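/- **Setting.** Fix a mass $m>0$, an integer $M>1$ and an ultraviolet cutoff $j_{\max}\in\mathbb N$; let $\mathcal S=\{0,\dots,j_{\max}\}$. For $x,y\in[0,1]^2$ put $$C_0(x,y)=\int_1^\infty e^{-\alpha m^2-\frac{(x-y)^2}{4\alpha}}\frac{d\alpha}{\alpha},\qquad C_j(x,y)=\int_{M^{-2j}}^{M^{-2(j-1)}}e^{-\alpha m^2-\frac{(x-y)^2}{4\alpha}}\frac{d\alpha}{\alpha}\quad(j\ge1),\qquad T_j=C_j(x,x),$$ and for $t=(t_j)_{j\in\mathcal S}\in[0,1]^{\mathcal S}$ put $C(t)=\sum_j t_jC_j$, $T(t)=\sum_j t_jT_j$. Let $\lambda\in\mathbb C$ not be a negative real number, let $\sqrt\lambda$ be the principal root, and let $\sigma$ be white noise on $[0,1]^2$ (the centred Gaussian field with covariance $\delta(x-y)$, law $d\nu$). With $\mathrm{Tr}=\int_{[0,1]^2}d^2x$ of the diagonal of a kernel and $\log_2(1+X)=\log(1+X)-X$, let $$R(t)=[1+2i\sqrt\lambda\,C(t)\sigma]^{-1},\qquad V(t)=\mathrm{Tr}\Bigl(3\lambda T(t)^2+2i\sqrt\lambda\,T(t)\sigma-\tfrac12\log_2[1+2i\sqrt\lambda\,C(t)\sigma]\Bigr);$$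 these are defined for $\sigma\in L^2$ and extended to white noise as almost sure limits along the $L^2$-projections of $\sigma$ on the functions constant on dyadic squares of side $2^{-n}$, $n\to\infty$. The partition function is $Z^{j_{\max}}(\lambda)=\int d\nu(\sigma)\,e^{V(t)}|_{t\equiv1}$, and for $\mathrm{Re}\,\lambda\ge0$ it is also $\int d\mu_C(\varphi)\,e^{-\frac\lambda2\int_{[0,1]^2}(\varphi^4-6T\varphi^2+3T^2)}$ with $C=\sum_jC_j$, $T=\sum_jT_j$. **Graphs.** Let $J=\{j_1<\dots<j_p\}\subset\mathcal S$. A $J$-resolvent graph $G$ of order $n$ is a combinatorial map: a set $V(G)$ of $n$ $\sigma$-propagators, each consisting of two half-propagators, and a permutation of the $2n$ half-propagators sending each to the next one around its loop vertex (the loop vertices are the cycles). Its $2n$ c-propagators $\ell\in CP(G)$ are the corners; $\ell$ goes from a half-propagator, lying on the $\sigma$-propagator at position $x_\ell$, to the next one, lying on the $\sigma$-propagator at position $x'_\ell$. Exactly $p$ distinct c-propagators bear the marks $j_1,\dots,j_p$. The c-propagator $\ell$ is a tadpole if its two ends lie on the same $\sigma$-propagator. $G$ is minimal if each of its connected components bears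 at least one mark and $n\le p$. Let $\mathcal G(J)$ be the finite set of minimal $J$-resolvent graphs (for $J=\emptyset$ only the empty graph). The renormalized amplitude is $$A^R_G(t,\sigma)=\prod_{v\in V(G)}\Bigl[(-\lambda)\int_{[0,1]^2}d^2x_v\Bigr]\prod_{\ell\text{ tadpole}}[(R(t)-1)C_{(\ell)}](x_\ell,x'_\ell)\prod_{\ell\text{ not tadpole}}[R(t)C_{(\ell)}](x_\ell,x'_\ell),$$ where $C_{(\ell)}=C_j$ if $\ell$ bears the mark $j$ and $C_{(\ell)}=C(t)$ if $\ell$ bears no mark. **Lemma.** There are combinatorial weights $c_G\in\mathbb N$, depending only on the marked graph $G$ (with the marks numbered $1,\dots,p$ in increasing order of the slices) and on none of $m,M,j_{\max},\lambda$, such that, for all data as above, $$Z^{j_{\max}}(\lambda)=\sum_{J\subset\mathcal S}\ \sum_{G\in\mathcal G(J)}c_G\int d\nu(\sigma)\prod_{j\in J}\int_0^1dt_j\,\bigl[e^{V(t)}A^R_G(t,\sigma)\bigr]_{t_j=0\text{ for }j\notin J}.$$ This holds term by term: for each $J\subset\mathcal S$ the general term $\int d\nu(\sigma)\prod_{j\in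 J}\int_0^1dt_j\frac{d}{dt_j}e^{V(t)}\big|_{t_j=0\text{ for }j\notin J}$ of the slice-testing expansion equals the inner sum over $G\in\mathcal G(J)$. The limits defining $V$ and the kernels $[R(t)C_j](x,y)$ exist almost surely, simultaneously for all $t$, $j\in\mathcal S$, $x$, $y$, and $e^{V}|_{t\equiv1}$ and all the integrands $e^{V}A^R_G$ are integrable. In particular every marked propagator which is a (potential) tadpole carries a factor $R-1$ and no counterterm $T$ is left: tadpoles cancel exactly against the Wick-ordering counterterms. -/

import Mathlib

open MeasureTheory ProbabilityTheory Filter Topology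

namespace Phi42

noncomputable section

/-! ### The sliced propagator on the unit square -/

/-- The unit square `[0,1]²` with its Lebesgue (probability) measure. -/
abbrev Sq : Type := unitInterval × unitInterval

/-- The squared Euclidean distance `(x - y)²` in the square. -/
def sqDist (x y : Sq) : ℝ :=
  ((x.1 : ℝ) - (y.1 : ℝ)) ^ 2 + ((x.2 : ℝ) - (y.2 : ℝ)) ^ 2

/-- The fixed data of the cutoff model: mass `m > 0`, integer slicing ratio `M > 1`, and the
ultraviolet cutoff `jmax`. -/
structure Model where
  mass : ℝ
  M : ℕ
  jmax : ℕ
  mass_pos : 0 < mass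
  one_lt_M : 1 < M

/-- The parametric integrand `e^{-α m² - (x-y)²/(4α)} / α`. -/
def heat (m α : ℝ) (x y : Sq) : ℝ :=
  Real.exp (-α * m ^ 2 - sqDist x y / (4 * α)) / α

/-- The slice `C_j(x,y)`: `α` runs over `(1,∞)` for `j = 0` and over
`(M^{-2j}, M^{-2(j-1)})` for `j ≥ 1`. -/
def sliceFun (Φ : Model) : ℕ → Sq → Sq → ℝ
  | 0, x, y => ∫ α in Set.Ioi (1 : ℝ), heat Φ.mass α x y
  | j + 1, x, y =>
      ∫ α in Set.Ioc (((Φ.M : ℝ) ^ (2 * (j + 1)))⁻¹) (((Φ.M : ℝ) ^ (2 * j))⁻¹),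
        heat Φ.mass α x y

theorem sqDist_nonneg (x y : Sq) : 0 ≤ sqDist x y := by
  unfold sqDist; positivity

theorem continuous_setIntegral_heat {m a : ℝ} (hm : 0 < m) (ha : 0 < a) {s : Set ℝ}
    (hs : MeasurableSet s) (hsa : s ⊆ Set.Ioi a) :
    Continuous (fun p : Sq × Sq => ∫ α in s, heat m α p.1 p.2) := by
  have hb : IntegrableOn (fun α : ℝ => Real.exp (-(m ^ 2) * α) * a⁻¹) s :=
    ((exp_neg_integrableOn_Ioi a (by positivity : 0 < m ^ 2)).mono_set hsa).mul_const _
  refine continuous_of_dominated (bound := fun α : ℝ => Real.exp (-(m ^ 2) * α) * a⁻¹)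
    ?_ ?_ hb ?_
  · intro p
    refine Measurable.aestronglyMeasurable ?_
    unfold heat
    fun_prop
  · intro p
    refine (ae_restrict_iff' hs).2 (Eventually.of_forall fun α hα => ?_)
    have h1 : a < α := hsa hα
    have h0 : 0 < α := ha.trans h1
    have hd := sqDist_nonneg p.1 p.2
    unfold heat
    rw [Real.norm_of_nonneg (by positivity), div_eq_mul_inv]
    gcongr
    have : 0 ≤ sqDist p.1 p.2 / (4 * α) := by positivity
    nlinarith
  · refine Eventually.of_forall fun α => ?_
    unfold heat sqDist
    fun_prop

theorem continuous_sliceFun (Φ : Model) (j : ℕ) :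
    Continuous (fun p : Sq × Sq => sliceFun Φ j p.1 p.2) := by
  cases j with
  | zero =>
    exact continuous_setIntegral_heat Φ.mass_pos one_pos measurableSet_Ioi subset_rfl
  | succ j =>
    have hM : (0 : ℝ) < (Φ.M : ℝ) := by exact_mod_cast (zero_lt_one.trans Φ.one_lt_M)
    exact continuous_setIntegral_heat Φ.mass_pos (a := ((Φ.M : ℝ) ^ (2 * (j + 1)))⁻¹)
      (by positivity) measurableSet_Ioc Set.Ioc_subset_Ioi_self

/-- The slice covariance `C_j` as a continuous kernel. -/
def sliceCov (Φ : Model) (j : ℕ) : C(Sq × Sq, ℝ) :=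
  ⟨fun p => sliceFun Φ j p.1 p.2, continuous_sliceFun Φ j⟩

/-- The tadpole `T_j = C_j(x,x)` (it does not depend on `x`, see `sliceCov_diag`). -/
def sliceTad (Φ : Model) (j : ℕ) : ℝ := sliceCov Φ j (0, 0)

theorem sliceCov_diag (Φ : Model) (j : ℕ) (x : Sq) : sliceCov Φ j (x, x) = sliceTad Φ j := by
  cases j <;> simp [sliceTad, sliceCov, sliceFun, heat, sqDist]

/-- The interpolated covariance `C(t) = ∑_{j ≤ jmax} t_j C_j`. -/
def cov (Φ : Model) (t : ℕ → ℝ) : C(Sq × Sq, ℝ) :=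
  ∑ j ∈ Finset.range (Φ.jmax + 1), t j • sliceCov Φ j

/-- The interpolated tadpole `T(t) = ∑_{j ≤ jmax} t_j T_j`. -/
def tad (Φ : Model) (t : ℕ → ℝ) : ℝ :=
  ∑ j ∈ Finset.range (Φ.jmax + 1), t j * sliceTad Φ j

/-! ### Operators, resolvents and the interaction for a square integrable field -/

/-- Real square integrable functions on the unit square. -/
abbrev L2 : Type := Lp ℝ 2 (volume : Measure Sq)

/-- The column `K(·, y)` of a kernel. -/
def column (K : C(Sq × Sq, ℝ)) (y : Sq) : C(Sq, ℂ) :=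
  ⟨fun x => ((K (x, y) : ℝ) : ℂ), by fun_prop⟩

theorem integrable_L2 (s : L2) : Integrable (fun y => s y) (volume : Measure Sq) :=
  (Lp.memLp s).integrable (by norm_num)

theorem integrable_kernel_mul (K : C(Sq × Sq, ℝ)) (s : L2) (f : C(Sq, ℂ)) (x : Sq) :
    Integrable (fun y => (K (x, y) : ℂ) * (s y : ℂ) * f y) (volume : Measure Sq) := by
  have h1 : Integrable (fun y => ((s y : ℝ) : ℂ)) (volume : Measure Sq) :=
    (integrable_L2 s).ofReal
  have h2 : Continuous (fun y => (K (x, y) : ℂ) * f y) := by fun_prop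
  have h3 := h1.bdd_mul (f := fun y => (K (x, y) : ℂ) * f y) (c := ‖K‖ * ‖f‖)
    h2.aestronglyMeasurable (Eventually.of_forall fun y => by
      rw [norm_mul, Complex.norm_real]
      exact mul_le_mul (K.norm_coe_le_norm _) (f.norm_coe_le_norm _) (norm_nonneg _)
        (norm_nonneg _))
  refine h3.congr (Eventually.of_forall fun y => ?_)
  simp only
  ring

theorem norm_kernel_mul_le (K : C(Sq × Sq, ℝ)) (s : L2) (f : C(Sq, ℂ)) (x y : Sq) :
    ‖(K (x, y) : ℂ) * (s y : ℂ) * f y‖ ≤ ‖K‖ * ‖f‖ * ‖s y‖ := by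
  rw [norm_mul, norm_mul, Complex.norm_real, Complex.norm_real]
  calc ‖K (x, y)‖ * ‖s y‖ * ‖f y‖ ≤ ‖K‖ * ‖s y‖ * ‖f‖ := by
        gcongr
        · exact K.norm_coe_le_norm _
        · exact f.norm_coe_le_norm _
    _ = ‖K‖ * ‖f‖ * ‖s y‖ := by ring

/-- The operator `Kσ` on `C([0,1]²)`: multiplication by `σ` followed by the integral operator
with kernel `K`, i.e. `(Kσ f)(x) = ∫ K(x,y) σ(y) f(y) dy`. -/
def mulOp (K : C(Sq × Sq, ℝ)) (s : L2) : C(Sq, ℂ) →L[ℂ] C(Sq, ℂ) :=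
  LinearMap.mkContinuous
    { toFun := fun f =>
        ⟨fun x => ∫ y, (K (x, y) : ℂ) * (s y : ℂ) * f y, by
          refine continuous_of_dominated (bound := fun y => ‖K‖ * ‖f‖ * ‖s y‖)
            (fun x => (integrable_kernel_mul K s f x).aestronglyMeasurable)
            (fun x => Eventually.of_forall fun y => norm_kernel_mul_le K s f x y)
            ((integrable_L2 s).norm.const_mul _)
            (Eventually.of_forall fun y => by fun_prop)⟩
      map_add' := by
        intro f g
        ext x
        simp only [ContinuousMap.coe_mk, ContinuousMap.add_apply, mul_add]
        exact integral_add (integrable_kernel_mul K s f x) (integrable_kernel_mul K s g x)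
      map_smul' := by
        intro c f
        ext x
        simp only [ContinuousMap.coe_mk, ContinuousMap.smul_apply, RingHom.id_apply,
          smul_eq_mul]
        rw [← integral_const_mul]
        congr 1
        ext y
        ring }
    (‖K‖ * ∫ y, ‖s y‖)
    (by
      intro f
      refine (ContinuousMap.norm_le _ (by positivity)).2 fun x => ?_
      simp only [LinearMap.coe_mk, AddHom.coe_mk, ContinuousMap.coe_mk]
      refine (norm_integral_le_of_norm_le ((integrable_L2 s).norm.const_mul _)
        (Eventually.of_forall fun y => norm_kernel_mul_le K s f x y)).trans ?_
      rw [integral_const_mul]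
      exact le_of_eq (by ring))

/-- The resolvent `R = (1 + z C σ)⁻¹`. -/
def resolvent (z : ℂ) (C : C(Sq × Sq, ℝ)) (s : L2) : C(Sq, ℂ) →L[ℂ] C(Sq, ℂ) :=
  Ring.inverse (1 + z • mulOp C s)

/-- The kernel `[R K](x,y)`. -/
def RK (z : ℂ) (C : C(Sq × Sq, ℝ)) (s : L2) (K : C(Sq × Sq, ℝ)) (x y : Sq) : ℂ :=
  resolvent z C s (column K y) x

/-- The kernel `[(R - 1) K](x,y)`. -/
def RsubK (z : ℂ) (C : C(Sq × Sq, ℝ)) (s : L2) (K : C(Sq × Sq, ℝ)) (x y : Sq) : ℂ :=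
  (resolvent z C s - 1) (column K y) x

/-- The kernel of `log₂ (1 + z C σ)`, where `log₂ (1 + X) = log (1 + X) - X` is the operator
function `∫₀¹ ((1 + u X)⁻¹ - 1) X du`. -/
def logTwoKernel (z : ℂ) (C : C(Sq × Sq, ℝ)) (s : L2) (x y : Sq) : ℂ :=
  (∫ u in (0 : ℝ)..1, RsubK (u * z) C s C x y) * z * (s y : ℂ)

/-- The factor `2 i √λ` in front of `C σ` (principal square root). -/
def zeta (lam : ℂ) : ℂ := 2 * Complex.I * lam ^ (1 / 2 : ℂ)

/-- The interaction `V(t) = Tr (3 λ T(t)² + 2 i √λ T(t) σ - ½ log₂ [1 + 2 i √λ C(t) σ])`, where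
`Tr` is the integral of the diagonal of a kernel over the unit square. -/
def action (Φ : Model) (lam : ℂ) (t : ℕ → ℝ) (s : L2) : ℂ :=
  ∫ x, (3 * lam * (tad Φ t : ℂ) ^ 2 + zeta lam * (tad Φ t : ℂ) * (s x : ℂ)
    - 1 / 2 * logTwoKernel (zeta lam) (cov Φ t) s x x)

/-! ### Gaussian fields, white noise -/

/-- `X` is a centred Gaussian family with covariance `K` on the probability space `(Ω, P)`. -/
structure IsCentredGaussian {T Ω : Type*} [MeasurableSpace Ω] (P : Measure Ω)
    (X : T → Ω → ℝ) (K : T → T → ℝ) : Prop where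
  gaussian : IsGaussianProcess X P
  mean_zero : ∀ a, ∫ ω, X a ω ∂P = 0
  covariance : ∀ a b, ∫ ω, X a ω * X b ω ∂P = K a b

/-- `W f = ⟨σ, f⟩` for a Gaussian field `σ` on the unit square with the ultralocal covariance
`δ(x - y)`: a centred Gaussian family indexed by `L²` with covariance the `L²` inner product. -/
def IsWhiteNoise {Ω : Type*} [MeasurableSpace Ω] (P : Measure Ω) (W : L2 → Ω → ℝ) : Prop :=
  IsCentredGaussian P W (fun f g => inner ℝ f g)

/-- The dyadic squares of side `2⁻ⁿ`. -/
def cell (n : ℕ) (k : Fin (2 ^ n) × Fin (2 ^ n)) : Set Sq :=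
  {x | ((k.1 : ℝ) ≤ 2 ^ n * (x.1 : ℝ) ∧ 2 ^ n * (x.1 : ℝ) < (k.1 : ℝ) + 1) ∧
    ((k.2 : ℝ) ≤ 2 ^ n * (x.2 : ℝ) ∧ 2 ^ n * (x.2 : ℝ) < (k.2 : ℝ) + 1)}

theorem measurableSet_cell (n : ℕ) (k : Fin (2 ^ n) × Fin (2 ^ n)) :
    MeasurableSet (cell n k) := by
  have h1 : Measurable (fun x : Sq => (2 : ℝ) ^ n * (x.1 : ℝ)) :=
    (measurable_subtype_coe.comp measurable_fst).const_mul _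
  have h2 : Measurable (fun x : Sq => (2 : ℝ) ^ n * (x.2 : ℝ)) :=
    (measurable_subtype_coe.comp measurable_snd).const_mul _
  exact ((measurableSet_le measurable_const h1).inter (measurableSet_lt h1 measurable_const)).inter
    ((measurableSet_le measurable_const h2).inter (measurableSet_lt h2 measurable_const))

/-- The indicator of a dyadic square in `L²`. -/
def cellInd (n : ℕ) (k : Fin (2 ^ n) × Fin (2 ^ n)) : L2 :=
  indicatorConstLp 2 (measurableSet_cell n k) (measure_ne_top _ _) (1 : ℝ)

/-- The `L²` orthogonal projection of the white noise on the functions constant on the dyadic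
squares of side `2⁻ⁿ` (of area `4⁻ⁿ`): `σ_n = ∑_Q 4ⁿ ⟨σ, 1_Q⟩ 1_Q`. -/
def noise {Ω : Type*} (W : L2 → Ω → ℝ) (n : ℕ) (ω : Ω) : L2 :=
  ∑ k : Fin (2 ^ n) × Fin (2 ^ n), ((4 : ℝ) ^ n * W (cellInd n k) ω) • cellInd n k

/-- Extension to white noise of a function `F` of square integrable fields:
`F(σ) = lim_n F(σ_n)`. -/
def onNoise {Ω : Type*} (W : L2 → Ω → ℝ) (F : L2 → ℂ) (ω : Ω) : ℂ :=
  limUnder atTop (fun n => F (noise W n ω))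

/-! ### Resolvent graphs -/

/-- A (vacuum) resolvent graph with `n` `σ`-propagators and marks `1, …, p`, as a combinatorial
map. The `σ`-propagators are `v : Fin n`, with two half-`σ`-propagators `(v, false)`, `(v, true)`
each. The loop vertices are the cycles of `next`, which sends a half-`σ`-propagator to the next
one around its loop vertex. The c-propagator at the corner between `ℓ` and `next ℓ` is labelled
by `ℓ`. The `p` marks sit on `p` distinct c-propagators. -/
structure ResolventGraph (p n : ℕ) where
  next : Equiv.Perm (Fin n × Bool)
  mark : Fin p ↪ Fin n × Bool

namespace ResolventGraph

instance (p n : ℕ) : Fintype (ResolventGraph p n) :=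
  Fintype.ofInjective
    (fun G : ResolventGraph p n => (G.next, G.mark))
    (by
      rintro ⟨a, b⟩ ⟨c, d⟩ h
      simp only [Prod.mk.injEq] at h
      rw [h.1, h.2])

variable {p n : ℕ}

/-- The position at which a c-propagator starts. -/
def src (_ : ResolventGraph p n) (l : Fin n × Bool) : Fin n := l.1

/-- The position at which a c-propagator ends. -/
def tgt (G : ResolventGraph p n) (l : Fin n × Bool) : Fin n := (G.next l).1

/-- A c-propagator is a tadpole if both its ends are at the same `σ`-propagator (a loop vertex
of length one, or a `σ`-propagator of length one). -/
def IsTadpole (G : ResolventGraph p n) (l : Fin n × Bool) : Prop := G.src l = G.tgt l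

/-- Two `σ`-propagators lie in the same connected component. -/
def Connected (G : ResolventGraph p n) : Fin n → Fin n → Prop :=
  Relation.EqvGen (fun v w => ∃ l, G.src l = v ∧ G.tgt l = w)

/-- Every connected component bears at least one mark, and the order is at most the number of
marks. -/
def IsMinimal (G : ResolventGraph p n) : Prop :=
  (∀ v, ∃ i, G.Connected v (G.src (G.mark i))) ∧ n ≤ p

open Classical in
/-- The bare covariance carried by a c-propagator: `D i` if it bears the mark `i`, and `C` if it
bears no mark. -/
def lineCov (G : ResolventGraph p n) (C : C(Sq × Sq, ℝ)) (D : Fin p → C(Sq × Sq, ℝ))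
    (l : Fin n × Bool) : C(Sq × Sq, ℝ) :=
  if h : ∃ i, G.mark i = l then D h.choose else C

/-- `∏_v [(-λ) ∫ d²x_v] ∏_ℓ A_ℓ(x_ℓ, x'_ℓ)`. -/
def integrate (G : ResolventGraph p n) (lam : ℂ) (A : Fin n × Bool → Sq → Sq → ℂ) : ℂ :=
  (-lam) ^ n * ∫ x : Fin n → Sq, ∏ l, A l (x (G.src l)) (x (G.tgt l))

end ResolventGraph

open Classical in
/-- The minimal resolvent graphs with marks `1, …, p`, of all orders `n ≤ p`. -/
def minimalGraphs (p : ℕ) : Finset (Σ n : ℕ, ResolventGraph p n) :=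
  (Finset.range (p + 1)).sigma fun _ => Finset.univ.filter fun G => G.IsMinimal

/-! ### The slice-testing expansion -/

section Expansion

variable (Φ : Model) (lam : ℂ) {Ω : Type*} (W : L2 → Ω → ℝ)

/-- The interaction `V(t, σ)` on white noise. -/
def V (t : ℕ → ℝ) (ω : Ω) : ℂ := onNoise W (action Φ lam t) ω

open Classical in
/-- The renormalized amplitude `A^R_G(t, σ)` on white noise, for the set of slices
`J = {j_1 < ⋯ < j_p}`: the mark `i` stands for the slice `j_i`, unmarked c-propagators are
`C(t)`; tadpoles carry `R(t) - 1`, other c-propagators carry `R(t)`. -/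
def renAmplitude (J : Finset ℕ) {n : ℕ} (G : ResolventGraph J.card n) (t : ℕ → ℝ) (ω : Ω) : ℂ :=
  G.integrate lam fun l x y =>
    let K := G.lineCov (cov Φ t) (fun i => sliceCov Φ (J.orderEmbOfFin rfl i)) l
    if G.IsTadpole l then onNoise W (fun s => RsubK (zeta lam) (cov Φ t) s K x y) ω
    else onNoise W (fun s => RK (zeta lam) (cov Φ t) s K x y) ω

/-- The parameters `(t_j)_{j ∈ J}` completed by `t_j = 0` for `j ∉ J`. -/
def onlyIn (J : Finset ℕ) (t : Fin J.card → ℝ) : ℕ → ℝ :=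
  Function.extend (J.orderEmbOfFin rfl) t 0

/-- The range `[0,1]^J` of the parameters `(t_j)_{j ∈ J}`. -/
def cube (J : Finset ℕ) : Set (Fin J.card → ℝ) := Set.Icc 0 1

/-- The mixed derivative `∏_{j ∈ J} d/dt_j`. -/
def mixedDeriv (J : Finset ℕ) (F : (ℕ → ℝ) → ℂ) : (ℕ → ℝ) → ℂ :=
  (J.sort (· ≤ ·)).foldr
    (fun j F t => deriv (fun u : ℝ => F (Function.update t j u)) (t j)) F

/-- The partition function in the intermediate field representation, `∫ dν(σ) e^{V}` with all
`t_j = 1`. -/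
def Zsigma [MeasurableSpace Ω] (P : Measure Ω) : ℂ :=
  ∫ ω, Complex.exp (V Φ lam W 1 ω) ∂P

/-- The partition function `∫ dμ_C(φ) e^{-(λ/2) Tr :φ⁴:}`, where
`:φ⁴: = φ⁴ - 6 T φ² + 3 T²` and `C`, `T` are the sums of all slices up to `jmax`. -/
def Zphi [MeasurableSpace Ω] (P : Measure Ω) (φ : Sq → Ω → ℝ) : ℂ :=
  ∫ ω, Complex.exp (-(lam / 2) *
    ((∫ x, (φ x ω ^ 4 - 6 * tad Φ 1 * φ x ω ^ 2 + 3 * tad Φ 1 ^ 2) : ℝ) : ℂ)) ∂P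

/-- The term of the slice set `J` before the contractions:
`∫ dν(σ) ∏_{j ∈ J} ∫₀¹ dt_j (d/dt_j) e^{V(t)}` at `t_j = 0` for `j ∉ J`. -/
def testingTerm [MeasurableSpace Ω] (P : Measure Ω) (J : Finset ℕ) : ℂ :=
  ∫ ω, (∫ t in cube J,
    mixedDeriv J (fun t' => Complex.exp (V Φ lam W t' ω)) (onlyIn J t)) ∂P

/-- The integrand `[e^{V(t)} A^R_G(t, σ)]` at `t_j = 0` for `j ∉ J`. -/
def graphIntegrand (J : Finset ℕ) (G : Σ n : ℕ, ResolventGraph J.card n) (ω : Ω)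
    (t : Fin J.card → ℝ) : ℂ :=
  Complex.exp (V Φ lam W (onlyIn J t) ω) * renAmplitude Φ lam W J G.2 (onlyIn J t) ω

/-- `∫ dν(σ) ∏_{j ∈ J} ∫₀¹ dt_j [e^{V(t)} A^R_G(t, σ)]` at `t_j = 0` for `j ∉ J`. -/
def graphTerm [MeasurableSpace Ω] (P : Measure Ω) (J : Finset ℕ)
    (G : Σ n : ℕ, ResolventGraph J.card n) : ℂ :=
  ∫ ω, (∫ t in cube J, graphIntegrand Φ lam W J G ω t) ∂P

/-- Almost surely the limits that define `V(t, σ)` and the kernels `[R(t) C_j](x,y)` exist, for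
all `t` with values in `[0,1]`, all slices and all points. -/
def LimitsExist [MeasurableSpace Ω] (P : Measure Ω) : Prop :=
  ∀ᵐ ω ∂P, ∀ t : ℕ → ℝ, (∀ j, t j ∈ Set.Icc (0 : ℝ) 1) →
    (∃ v, Tendsto (fun n => action Φ lam t (noise W n ω)) atTop (𝓝 v)) ∧
    ∀ j ≤ Φ.jmax, ∀ x y, ∃ r,
      Tendsto (fun n => RK (zeta lam) (cov Φ t) (noise W n ω) (sliceCov Φ j) x y) atTop (𝓝 r)

end Expansion

end

end Phi42

/-! The expansion itself is the fundamental theorem of calculus in each `t_j`. For a function f on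
the cube, f(1,…,1) is the sum over J of the alternating sums `testList` of f over the values 0 and 1
of the parameters in J, the other parameters being 0 (`sum_testList`). Each alternating sum is the
integral over [0,1]^J of a mixed derivative (`Tower.integral_eq`). Applied to f(t) = E e^{V(t)},
this decomposes Z. What remains is to recognise the mixed derivatives as sums of graphs.

Analytic setting. Each slice factors as C_j(x,y) = ⟨A_x, π_j A_y⟩, with orthogonal projections π_j
of a Hilbert space H and plane waves A_x (`features`). A field σ becomes X = ∫ σ(x) |A_x⟩⟨A_x| dx in
`TraceSpace H`, a real Banach space of self-adjoint operators that carry their trace pairing. As A_x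
is analytic in x, its monomial coefficients are summable, and the projected white noise converges
almost surely in this space (`ae_tendsto_state_noise`). The interaction becomes the continuous
function `pot` of X, so one almost sure event settles all limits at once. If 1 + zr stays at
distance δ from 0 for real r, and D = Q² with Q self-adjoint, then (1+zDX)⁻¹D = Q(1+zQXQ)⁻¹Q is
bounded uniformly in X. Hence `pot` grows at most linearly, and Gaussian exponential moments give
every integrability statement.

Graphs. The derivative d/dt_j of E[e^V A_G] either marks an unmarked line or leaves a term linear in
an explicit field. Gaussian integration by parts (`integral_field_pairing`) contracts that field
with the rest, through two Dirac masses at the same point y: a new σ-propagator, with factor z²/4 =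
-λ. All products involving T or T_j cancel, so that tadpoles keep R - 1, and the four ways of
attaching the new propagator have weights 3, 6, 6, 4 (`fderiv_explicitPart_dirac`,
`integral_explicit`). Iterating gives a multiset `graphs p` of minimal marked maps, defined without
reference to the model; its multiplicities are the c_G. For the general term of the expansion the
derivatives are pathwise, and they integrate to the same alternating sum (`testingTerm_eq`). So
higher derivatives are never exchanged with the expectation.

The field φ. For imaginary z and a finite combination of Dirac masses, e^{pot} is a Gaussian
integral over φ of an oscillating exponential of φ² (`integral_exp_quadratic`). Integrating the
masses as white noise on dyadic squares gives Riemann sums of the Wick ordered φ⁴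
(`integral_exp_wickFour_corners`). The limit is taken on both sides, and the identity theorem
extends the result to the cone |Re z| ≤ Im z, which contains 2i√λ when Re λ ≥ 0. -/

namespace Phi42

noncomputable section

/-! ### Resolvents of self-adjoint operators -/

section OperatorTheory

variable {H : Type*} [NormedAddCommGroup H] [InnerProductSpace ℂ H] [CompleteSpace H]

/-- As ⟨v, Sv⟩ is real, ⟨v, (1 + zS)v⟩ is ‖v‖² times some 1 + zr with r real; Cauchy–Schwarz
concludes. -/
theorem norm_one_add_smul_apply_ge {S : H →L[ℂ] H} (hS : IsSelfAdjoint S) {z : ℂ} {δ : ℝ}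
    (hz : ∀ r : ℝ, δ ≤ ‖1 + z * (r : ℂ)‖) (v : H) : δ * ‖v‖ ≤ ‖(1 + z • S) v‖ := by
  rcases eq_or_ne v 0 with rfl | hv
  · simp
  have hv' : 0 < ‖v‖ := norm_pos_iff.2 hv
  have him : (inner ℂ v (S v)).im = 0 := hS.isSymmetric.im_inner_self_apply v
  set a : ℝ := (inner ℂ v (S v)).re with ha
  have hin : inner ℂ v (S v) = (a : ℂ) := Complex.ext (by simp [ha]) (by simp [him])
  have h1 : inner ℂ v ((1 + z • S) v) = ((‖v‖ ^ 2 : ℝ) : ℂ) * (1 + z * ((a / ‖v‖ ^ 2 : ℝ) : ℂ)) := by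
    simp only [add_apply, one_apply_eq_self,
      smul_apply, inner_add_right, inner_smul_right, hin,
      inner_self_eq_norm_sq_to_K]
    have : ((‖v‖ : ℝ) : ℂ) ≠ 0 := by exact_mod_cast hv'.ne'
    push_cast
    simp only [Complex.coe_algebraMap]
    field_simp
  have h2 : δ * ‖v‖ ^ 2 ≤ ‖inner ℂ v ((1 + z • S) v)‖ := by
    rw [h1, norm_mul, Complex.norm_real, Real.norm_of_nonneg (by positivity), mul_comm]
    exact mul_le_mul_of_nonneg_left (hz _) (by positivity)
  have h3 := norm_inner_le_norm (𝕜 := ℂ) v ((1 + z • S) v)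
  nlinarith

/-- The spectrum of `S` is real, so if it contained `-z⁻¹` then 1 + zr would vanish for a real r. -/
theorem isUnit_one_add_smul {S : H →L[ℂ] H} (hS : IsSelfAdjoint S) {z : ℂ} {δ : ℝ} (hδ : 0 < δ)
    (hz : ∀ r : ℝ, δ ≤ ‖1 + z * (r : ℂ)‖) : IsUnit (1 + z • S) := by
  rcases eq_or_ne z 0 with rfl | hz0
  · simp
  have hmem : -z⁻¹ ∉ spectrum ℂ S := by
    intro hmem
    have h1 := hS.mem_spectrum_eq_re hmem
    have h2 := hz ((-z⁻¹).re)
    rw [← h1] at h2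
    simp [hz0] at h2
    linarith
  rw [spectrum.notMem_iff] at hmem
  have h : (1 + z • S) = (-z) • (algebraMap ℂ (H →L[ℂ] H) (-z⁻¹) - S) := by
    rw [Algebra.algebraMap_eq_smul_one, smul_sub, smul_smul]
    simp [hz0]
  rw [h]
  exact hmem.smul (Units.mk0 (-z) (neg_ne_zero.2 hz0))

theorem norm_inverse_one_add_smul_le {S : H →L[ℂ] H} (hS : IsSelfAdjoint S) {z : ℂ} {δ : ℝ}
    (hδ : 0 < δ) (hz : ∀ r : ℝ, δ ≤ ‖1 + z * (r : ℂ)‖) : ‖Ring.inverse (1 + z • S)‖ ≤ δ⁻¹ := by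
  have hu := isUnit_one_add_smul hS hδ hz
  refine ContinuousLinearMap.opNorm_le_bound _ (by positivity) fun w => ?_
  have h := norm_one_add_smul_apply_ge hS hz (Ring.inverse (1 + z • S) w)
  rw [← mul_apply_eq_comp, Ring.mul_inverse_cancel _ hu,
    one_apply_eq_self] at h
  rw [inv_mul_eq_div, le_div_iff₀ hδ]
  linarith

/-- `(1 + a b)⁻¹ = 1 - a (1 + b a)⁻¹ b`. -/
theorem one_add_mul_mul_eq_one {R : Type*} [Ring R] {a b c : R}
    (h1 : (1 + b * a) * c = 1) (h2 : c * (1 + b * a) = 1) :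
    (1 + a * b) * (1 - a * c * b) = 1 ∧ (1 - a * c * b) * (1 + a * b) = 1 := by
  constructor
  · have : (1 + a * b) * (1 - a * c * b) = 1 + a * b - a * ((1 + b * a) * c) * b := by noncomm_ring
    rw [this, h1]; noncomm_ring
  · have : (1 - a * c * b) * (1 + a * b) = 1 + a * b - a * (c * (1 + b * a)) * b := by noncomm_ring
    rw [this, h2]; noncomm_ring

theorem ringInverse_eq_of_mul_eq_one {R : Type*} [Ring R] {a b : R} (h1 : a * b = 1)
    (h2 : b * a = 1) : IsUnit a ∧ Ring.inverse a = b :=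
  ⟨⟨⟨a, b, h1, h2⟩, rfl⟩, Ring.inverse_unit ⟨a, b, h1, h2⟩⟩

/-! ### Resolvents of `Q² S`, with `Q` and `S` self-adjoint -/

section Sandwich

variable {S Q : H →L[ℂ] H} (hS : IsSelfAdjoint S) (hQ : IsSelfAdjoint Q) {z : ℂ} {δ : ℝ}
  (hδ : 0 < δ) (hz : ∀ r : ℝ, δ ≤ ‖1 + z * (r : ℂ)‖)

include hS hQ hδ hz

/-- `Q² S` is not self-adjoint but `Q S Q` is. The exchange of 1 + ab and 1 + ba, with a = zQ and b
= QS, transports invertibility from the second to the first. -/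
theorem inverse_one_add_sandwich :
    IsUnit (1 + z • (Q * Q) * S) ∧
      Ring.inverse (1 + z • (Q * Q) * S) =
        1 - z • (Q * Ring.inverse (1 + z • (Q * S * Q)) * (Q * S)) := by
  have hsa : IsSelfAdjoint (Q * S * Q) := by
    have := hS.conjugate Q
    rwa [hQ.star_eq] at this
  have hu := isUnit_one_add_smul hsa hδ hz
  have e : (1 + z • (Q * S * Q)) = 1 + (Q * S) * (z • Q) := by
    simp [mul_assoc]
  have h := one_add_mul_mul_eq_one (a := z • Q) (b := Q * S)
    (c := Ring.inverse (1 + z • (Q * S * Q)))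
    (by rw [← e, Ring.mul_inverse_cancel _ hu]) (by rw [← e, Ring.inverse_mul_cancel _ hu])
  have e2 : 1 + z • Q * (Q * S) = 1 + z • (Q * Q) * S := by simp [mul_assoc]
  rw [e2] at h
  have h' := ringInverse_eq_of_mul_eq_one h.1 h.2
  refine ⟨h'.1, h'.2.trans ?_⟩
  simp [mul_assoc]

theorem norm_inverse_one_add_sandwich_le :
    ‖Ring.inverse (1 + z • (Q * Q) * S)‖ ≤ 1 + ‖z‖ * (‖Q‖ ^ 2 * δ⁻¹) * ‖S‖ := by
  rw [(inverse_one_add_sandwich hS hQ hδ hz).2]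
  have hsa : IsSelfAdjoint (Q * S * Q) := by
    have := hS.conjugate Q
    rwa [hQ.star_eq] at this
  have hb := norm_inverse_one_add_smul_le hsa hδ hz
  calc _ ≤ ‖(1 : H →L[ℂ] H)‖ + ‖z • (Q * Ring.inverse (1 + z • (Q * S * Q)) * (Q * S))‖ :=
        norm_sub_le _ _
    _ ≤ 1 + ‖z‖ * (‖Q‖ * δ⁻¹ * (‖Q‖ * ‖S‖)) := by
        refine add_le_add ContinuousLinearMap.norm_id_le ?_
        rw [norm_smul]
        gcongr
        refine (norm_mul_le _ _).trans ?_
        gcongr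
        · refine (norm_mul_le _ _).trans ?_
          gcongr
        · exact norm_mul_le _ _
    _ = _ := by ring

/-- The identity (1 + zQ²S)⁻¹ Q² = Q (1 + zQSQ)⁻¹ Q gives a bound that no longer involves `S`. It is
the reason why the interaction grows linearly in the field, not quadratically. -/
theorem norm_inverse_one_add_sandwich_mul_le :
    ‖Ring.inverse (1 + z • (Q * Q) * S) * (Q * Q)‖ ≤ ‖Q‖ ^ 2 * δ⁻¹ := by
  have hsa : IsSelfAdjoint (Q * S * Q) := by
    have := hS.conjugate Q
    rwa [hQ.star_eq] at this
  have hu := isUnit_one_add_smul hsa hδ hz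
  have hu2 := (inverse_one_add_sandwich hS hQ hδ hz).1
  have hb := norm_inverse_one_add_smul_le hsa hδ hz
  have key : Ring.inverse (1 + z • (Q * Q) * S) * (Q * Q) =
      Q * Ring.inverse (1 + z • (Q * S * Q)) * Q := by
    have h1 : (1 + z • (Q * Q) * S) * (Q * Ring.inverse (1 + z • (Q * S * Q)) * Q) = Q * Q := by
      have : (1 + z • (Q * Q) * S) * Q = Q * (1 + z • (Q * S * Q)) := by
        simp [mul_add, add_mul, mul_assoc]
      rw [← mul_assoc, ← mul_assoc, this, mul_assoc Q, Ring.mul_inverse_cancel _ hu, mul_one]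
    calc _ = Ring.inverse (1 + z • (Q * Q) * S) * ((1 + z • (Q * Q) * S) *
          (Q * Ring.inverse (1 + z • (Q * S * Q)) * Q)) := by rw [h1]
      _ = _ := by rw [← mul_assoc, Ring.inverse_mul_cancel _ hu2, one_mul]
  rw [key]
  calc _ ≤ ‖Q‖ * δ⁻¹ * ‖Q‖ := by
        refine (norm_mul_le _ _).trans ?_
        gcongr
        refine (norm_mul_le _ _).trans ?_
        gcongr
    _ = _ := by ring

end Sandwich

/-! ### Self-adjoint trace class operators with their trace pairing -/

/-- The pair of the rank one operator `½ (|u⟩⟨v| + |v⟩⟨u|)` and of the trace against it. -/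
def symRankOne (u v : H) : (H →L[ℂ] H) × ((H →L[ℂ] H) →L[ℂ] ℂ) :=
  ((1 / 2 : ℂ) • (InnerProductSpace.rankOne ℂ u v + InnerProductSpace.rankOne ℂ v u),
    (1 / 2 : ℂ) • ((innerSL ℂ v).comp (ContinuousLinearMap.apply ℂ H u) +
      (innerSL ℂ u).comp (ContinuousLinearMap.apply ℂ H v)))

theorem norm_symRankOne_le (u v : H) : ‖symRankOne u v‖ ≤ ‖u‖ * ‖v‖ := by
  refine max_le ?_ ?_
  · simp only [symRankOne]
    rw [norm_smul]
    have h := norm_add_le (InnerProductSpace.rankOne ℂ u v) (InnerProductSpace.rankOne ℂ v u)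
    rw [InnerProductSpace.norm_rankOne, InnerProductSpace.norm_rankOne] at h
    norm_num
    nlinarith
  · refine ContinuousLinearMap.opNorm_le_bound _ (by positivity) fun B => ?_
    simp only [symRankOne, smul_apply, add_apply,
      ContinuousLinearMap.comp_apply, ContinuousLinearMap.apply_apply, innerSL_apply_apply]
    rw [norm_smul]
    have h (a b : H) : ‖inner ℂ a (B b)‖ ≤ ‖a‖ * (‖B‖ * ‖b‖) :=
      (norm_inner_le_norm _ _).trans (by gcongr; exact B.le_opNorm b)
    have h1 := h v u
    have h2 := h u v
    have h3 := norm_add_le (inner ℂ v (B u)) (inner ℂ u (B v))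
    norm_num
    nlinarith

variable (H) in
/-- The real Banach space spanned by the rank one operators `|u⟩⟨u|`. -/
def traceSubmodule : Submodule ℝ ((H →L[ℂ] H) × ((H →L[ℂ] H) →L[ℂ] ℂ)) :=
  (Submodule.span ℝ (Set.range fun u : H => symRankOne u u)).topologicalClosure

variable (H) in
/-- Self-adjoint trace class operators with their trace pairing. -/
def TraceSpace : Type _ := traceSubmodule H

instance : NormedAddCommGroup (TraceSpace H) := inferInstanceAs (NormedAddCommGroup (traceSubmodule H))

instance : NormedSpace ℝ (TraceSpace H) := inferInstanceAs (NormedSpace ℝ (traceSubmodule H))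

instance : CompleteSpace (TraceSpace H) :=
  (Submodule.isClosed_topologicalClosure
    (Submodule.span ℝ (Set.range fun u : H => symRankOne u u))).completeSpace_coe

namespace TraceSpace

variable (H) in
/-- The operator of an element of the trace space. -/
def op : TraceSpace H →L[ℝ] (H →L[ℂ] H) :=
  (ContinuousLinearMap.fst ℝ _ _).comp (traceSubmodule H).subtypeL

variable (H) in
/-- The trace pairing `X ↦ (B ↦ Tr (X B))`. -/
def tr : TraceSpace H →L[ℝ] ((H →L[ℂ] H) →L[ℂ] ℂ) :=
  (ContinuousLinearMap.snd ℝ _ _).comp (traceSubmodule H).subtypeL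

theorem norm_op_le (X : TraceSpace H) : ‖op H X‖ ≤ ‖X‖ := norm_fst_le X.1

theorem norm_tr_le (X : TraceSpace H) : ‖tr H X‖ ≤ ‖X‖ := norm_snd_le X.1

theorem norm_tr_apply_le (X : TraceSpace H) (B : H →L[ℂ] H) : ‖tr H X B‖ ≤ ‖X‖ * ‖B‖ :=
  ((tr H X).le_opNorm B).trans (by gcongr; exact norm_tr_le X)

/-- Polarisation: the diagonal elements |u⟩⟨u| already span the mixed ones. -/
theorem symRankOne_mem (u v : H) : symRankOne u v ∈ traceSubmodule H := by
  have h (w : H) : symRankOne w w ∈ traceSubmodule H :=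
    Submodule.le_topologicalClosure _ (Submodule.subset_span ⟨w, rfl⟩)
  have e : symRankOne u v = (1 / 2 : ℝ) • (symRankOne (u + v) (u + v) - symRankOne u u
      - symRankOne v v) := by
    refine Prod.ext ?_ ?_
    · ext w
      simp only [symRankOne, Prod.smul_fst, Prod.fst_sub, smul_apply,
        sub_apply, add_apply, map_add,
        InnerProductSpace.rankOne_apply]
      module
    · ext B
      simp only [symRankOne, Prod.smul_snd, Prod.snd_sub, smul_apply,
        sub_apply, add_apply, map_add,
        ContinuousLinearMap.comp_apply, ContinuousLinearMap.apply_apply, innerSL_apply_apply]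
      module
  rw [e]
  exact Submodule.smul_mem _ _ (Submodule.sub_mem _ (Submodule.sub_mem _ (h _) (h _)) (h _))

theorem symRankOne_comm (u v : H) : symRankOne u v = symRankOne v u := by
  simp only [symRankOne, add_comm]

theorem symRankOne_add_left (u u' v : H) :
    symRankOne (u + u') v = symRankOne u v + symRankOne u' v := by
  refine Prod.ext ?_ ?_
  · ext w
    simp only [symRankOne, Prod.fst_add, smul_apply, add_apply, InnerProductSpace.rankOne_apply,
      inner_add_left]
    module
  · ext B
    simp only [symRankOne, Prod.snd_add, smul_apply, add_apply, map_add,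
        ContinuousLinearMap.comp_apply, ContinuousLinearMap.apply_apply, innerSL_apply_apply,
        inner_add_left]
    module

theorem symRankOne_smul_left (c : ℝ) (u v : H) :
    symRankOne (c • u) v = c • symRankOne u v := by
  rw [← Complex.coe_smul c u]
  refine Prod.ext ?_ ?_
  · ext w
    simp only [symRankOne, Prod.smul_fst, smul_apply, add_apply, InnerProductSpace.rankOne_apply,
      inner_smul_left, Complex.conj_ofReal, ← Complex.coe_smul c (_ : H)]
    module
  · ext B
    simp only [symRankOne, Prod.smul_snd, smul_apply, add_apply, map_smul,
        ContinuousLinearMap.comp_apply, ContinuousLinearMap.apply_apply, innerSL_apply_apply,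
        inner_smul_left, inner_smul_right, Complex.conj_ofReal, Complex.real_smul, smul_eq_mul]
    ring

/-- The symmetrised rank one operator `½ (|u⟩⟨v| + |v⟩⟨u|)`, bilinear over the reals. -/
def rankTwo : H →L[ℝ] H →L[ℝ] TraceSpace H :=
  LinearMap.mkContinuous₂
    (LinearMap.mk₂ ℝ (fun u v => (⟨symRankOne u v, symRankOne_mem u v⟩ : TraceSpace H))
      (fun u u' v => Subtype.ext (symRankOne_add_left u u' v))
      (fun c u v => Subtype.ext (symRankOne_smul_left c u v))
      (fun u v v' => Subtype.ext (by
        change symRankOne u (v + v') = symRankOne u v + symRankOne u v'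
        rw [symRankOne_comm, symRankOne_add_left, symRankOne_comm v, symRankOne_comm v']))
      (fun c u v => Subtype.ext (by
        change symRankOne u (c • v) = c • symRankOne u v
        rw [symRankOne_comm, symRankOne_smul_left, symRankOne_comm v])))
    1 (fun u v => by rw [one_mul]; exact norm_symRankOne_le u v)

theorem norm_rankTwo_le (u v : H) : ‖rankTwo u v‖ ≤ ‖u‖ * ‖v‖ := norm_symRankOne_le u v

theorem op_rankTwo (u v : H) : op H (rankTwo u v) =
    (1 / 2 : ℂ) • (InnerProductSpace.rankOne ℂ u v + InnerProductSpace.rankOne ℂ v u) := rfl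

theorem op_rankTwo_self (u w : H) : op H (rankTwo u u) w = inner ℂ u w • u := by
  simp only [op_rankTwo, smul_apply, add_apply, InnerProductSpace.rankOne_apply]; module

theorem tr_rankTwo_self (u : H) (B : H →L[ℂ] H) : tr H (rankTwo u u) B = inner ℂ u (B u) := by
  change (1 / 2 : ℂ) • (inner ℂ u (B u) + inner ℂ u (B u)) = _
  rw [smul_eq_mul]; ring

/-- A closed real-linear property that holds for all `|u⟩⟨u|` holds on the trace space. -/
theorem induction_on {p : TraceSpace H → Prop} (hcl : IsClosed {X | p X})
    (hadd : ∀ X Y, p X → p Y → p (X + Y)) (hsmul : ∀ (c : ℝ) X, p X → p (c • X))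
    (hq : ∀ u, p (rankTwo u u)) (X : TraceSpace H) : p X := by
  have hspan : ∀ x (hx : x ∈ Submodule.span ℝ (Set.range fun u : H => symRankOne u u)),
      p ⟨x, Submodule.le_topologicalClosure _ hx⟩ := by
    intro x hx
    induction hx using Submodule.span_induction with
    | mem x h => obtain ⟨u, rfl⟩ := h; exact hq u
    | zero =>
      have h := hsmul 0 _ (hq 0)
      rw [zero_smul] at h
      exact h
    | add x y hx hy h1 h2 => exact hadd _ _ h1 h2
    | smul c x hx h => exact hsmul c _ h
  obtain ⟨x, hx⟩ := X
  have hx' : x ∈ closure (Submodule.span ℝ (Set.range fun u : H => symRankOne u u) : Set _) := hx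
  obtain ⟨y, hy, hlim⟩ := mem_closure_iff_seq_limit.1 hx'
  have : Tendsto (fun n => (⟨y n, Submodule.le_topologicalClosure _ (hy n)⟩ : TraceSpace H)) atTop
      (𝓝 ⟨x, hx⟩) := tendsto_subtype_rng.2 hlim
  exact hcl.mem_of_tendsto this (Eventually.of_forall fun n => hspan _ (hy n))

theorem isSelfAdjoint_op (X : TraceSpace H) : IsSelfAdjoint (op H X) := by
  induction X using induction_on with
  | hcl => exact isClosed_eq ((op H).continuous.star) (op H).continuous
  | hadd X Y hX hY => rw [map_add]; exact hX.add hY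
  | hsmul c X hX => rw [map_smul]; exact (IsSelfAdjoint.all c).smul hX
  | hq u =>
    rw [ContinuousLinearMap.isSelfAdjoint_iff_isSymmetric]
    intro v w
    simp only [ContinuousLinearMap.coe_coe, op_rankTwo_self, inner_smul_left, inner_smul_right,
      inner_conj_symm]
    ring

/-- Cyclicity of the trace. -/
theorem tr_mul_op_mul (X X' : TraceSpace H) (B D : H →L[ℂ] H) :
    tr H X (B * op H X' * D) = tr H X' (D * op H X * B) := by
  -- Both sides are continuous and real-linear in each of the two operators, so it is enough to
  -- treat |u⟩⟨u| and |v⟩⟨v|, where both sides are ⟨u, Bv⟩⟨v, Du⟩.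
  induction X using induction_on with
  | hcl =>
    refine isClosed_eq ?_ ?_
    · exact ((tr H).continuous).clm_apply continuous_const
    · exact (tr H X').continuous.comp
        ((continuous_const.mul (op H).continuous).mul continuous_const)
  | hadd X Y hX hY =>
    simp only [map_add, mul_add, add_mul, add_apply, hX, hY]
  | hsmul c X hX =>
    simp only [map_smul, mul_smul_comm, smul_mul_assoc, smul_apply, hX]
    rw [← Complex.coe_smul, ← Complex.coe_smul, map_smul]
  | hq u =>
    induction X' using induction_on with
    | hcl =>
      refine isClosed_eq ?_ ?_
      · exact (tr H _).continuous.comp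
          ((continuous_const.mul (op H).continuous).mul continuous_const)
      · exact ((tr H).continuous).clm_apply continuous_const
    | hadd X Y hX hY =>
      simp only [map_add, mul_add, add_mul, add_apply, hX, hY]
    | hsmul c X hX =>
      simp only [map_smul, mul_smul_comm, smul_mul_assoc, smul_apply, ← hX]
      rw [← Complex.coe_smul, ← Complex.coe_smul, map_smul]
    | hq v =>
      simp only [tr_rankTwo_self, mul_apply_eq_comp, op_rankTwo_self, map_smul,
        inner_smul_right]
      ring

end TraceSpace

end OperatorTheory

/-! ### The averaged resolvent and the logarithm of the determinant -/

section AveragedResolvent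

variable {A : Type*} [NormedRing A] [NormedAlgebra ℂ A] [CompleteSpace A]

/-- `(1 + Y S)⁻¹`. -/
def invOneAdd (Y S : A) : A := Ring.inverse (1 + Y * S)

/-- `∫₀¹ ((1 + u Y S)⁻¹ - 1) Y du`. -/
def avgRes (Y S : A) : A := ∫ u in (0 : ℝ)..1, (invOneAdd ((u : ℂ) • Y) S - 1) * Y

/-- All the operators `1 + u Y S`, `0 ≤ u ≤ 1`, are invertible. -/
def SegmentUnit (Y S : A) : Prop := ∀ u ∈ Set.Icc (0 : ℝ) 1, IsUnit (1 + ((u : ℂ) • Y) * S)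

omit [NormedAlgebra ℂ A] in
theorem continuousAt_invOneAdd {T : Type*} [TopologicalSpace T] {Y S : T → A} {p : T}
    (hY : ContinuousAt Y p) (hS : ContinuousAt S p) (hu : IsUnit (1 + Y p * S p)) :
    ContinuousAt (fun q => invOneAdd (Y q) (S q)) p := by
  obtain ⟨x, hx⟩ := hu
  have h := NormedRing.inverse_continuousAt x
  rw [hx] at h
  exact ContinuousAt.comp (f := fun q => 1 + Y q * S q) h (continuousAt_const.add (hY.mul hS))

theorem hasDerivAt_invOneAdd {𝕜 : Type*} [NontriviallyNormedField 𝕜] [NormedAlgebra 𝕜 A]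
    {Y S : 𝕜 → A} {Y' S' : A} {θ : 𝕜}
    (hY : HasDerivAt Y Y' θ) (hS : HasDerivAt S S' θ) (hu : IsUnit (1 + Y θ * S θ)) :
    HasDerivAt (fun θ => invOneAdd (Y θ) (S θ))
      (-(invOneAdd (Y θ) (S θ) * (Y' * S θ + Y θ * S') * invOneAdd (Y θ) (S θ))) θ := by
  obtain ⟨x, hx⟩ := hu
  have h := hasFDerivAt_ringInverse (𝕜 := 𝕜) x
  rw [hx] at h
  have h2 : HasDerivAt (fun θ => 1 + Y θ * S θ) (Y' * S θ + Y θ * S') θ :=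
    (hY.mul hS).const_add 1
  have h3 := h.comp_hasDerivAt (f := fun θ => 1 + Y θ * S θ) θ h2
  have e : invOneAdd (Y θ) (S θ) = ↑x⁻¹ := by
    rw [invOneAdd, ← hx, Ring.inverse_unit]
  rw [e]
  refine h3.congr_deriv ?_
  simp

theorem continuousOn_invOneAdd_segment {Y S : A} (h : SegmentUnit Y S) :
    ContinuousOn (fun u : ℝ => invOneAdd ((u : ℂ) • Y) S) (Set.Icc 0 1) := fun u hu =>
  (continuousAt_invOneAdd (Y := fun u : ℝ => (u : ℂ) • Y) (S := fun _ => S)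
    (by fun_prop) continuousAt_const (h u hu)).continuousWithinAt

/-- A tube lemma: compactness of [0,1] turns invertibility and continuity at each `u` into one
neighbourhood of `p` and one bound valid for all `u`. This supplies the domination for limits and
derivatives under the integral over `u`. -/
theorem eventually_segment {T : Type*} [TopologicalSpace T] {Y S : T → A} {p : T}
    (hY : ContinuousAt Y p) (hS : ContinuousAt S p) (h : SegmentUnit (Y p) (S p))
    {f : T → ℝ → A}
    (hf : ∀ u ∈ Set.Icc (0 : ℝ) 1, ContinuousAt (fun q : T × ℝ => f q.1 q.2) (p, u)) :
    ∃ K : ℝ, ∀ᶠ q in 𝓝 p, SegmentUnit (Y q) (S q) ∧ ∀ u ∈ Set.Icc (0 : ℝ) 1, ‖f q u‖ ≤ K := by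
  have hc : ContinuousOn (fun u => f p u) (Set.Icc 0 1) := fun u hu =>
    (ContinuousAt.comp (f := fun u : ℝ => (p, u)) (hf u hu) (by fun_prop)).continuousWithinAt
  obtain ⟨K, hK⟩ := (isCompact_Icc (a := (0 : ℝ)) (b := 1)).exists_bound_of_continuousOn hc
  refine ⟨K + 1, ?_⟩
  have := (isCompact_Icc (a := (0 : ℝ)) (b := 1)).eventually_forall_of_forall_eventually (x₀ := p)
    (P := fun q u => IsUnit (1 + ((u : ℂ) • Y q) * S q) ∧ ‖f q u‖ ≤ K + 1) ?_
  · filter_upwards [this] with q hq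
    exact ⟨fun u hu => (hq u hu).1, fun u hu => (hq u hu).2⟩
  · intro u hu
    refine Filter.Eventually.and ?_ ?_
    · have h1 : ContinuousAt (fun q : T × ℝ => 1 + ((q.2 : ℂ) • Y q.1) * S q.1) (p, u) := by
        have e1 : ContinuousAt (fun q : T × ℝ => Y q.1) (p, u) :=
          ContinuousAt.comp (f := Prod.fst) hY continuousAt_fst
        have e2 : ContinuousAt (fun q : T × ℝ => S q.1) (p, u) :=
          ContinuousAt.comp (f := Prod.fst) hS continuousAt_fst
        have e3 : ContinuousAt (fun q : T × ℝ => (q.2 : ℂ)) (p, u) := by fun_prop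
        exact continuousAt_const.add ((e3.smul e1).mul e2)
      exact h1.eventually (Units.isOpen.mem_nhds (h u hu))
    · have h2 := (hf u hu).norm
      have hlt : ‖f p u‖ < K + 1 := lt_of_le_of_lt (hK u hu) (lt_add_one K)
      exact (Tendsto.eventually_lt_const hlt h2).mono fun q hq => le_of_lt hq

theorem continuousAt_segment_integrand {T : Type*} [TopologicalSpace T] {Y S : T → A} {p : T}
    (hY : ContinuousAt Y p) (hS : ContinuousAt S p) (h : SegmentUnit (Y p) (S p)) {u : ℝ}
    (hu : u ∈ Set.Icc (0 : ℝ) 1) :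
    ContinuousAt (fun q : T × ℝ => invOneAdd ((q.2 : ℂ) • Y q.1) (S q.1)) (p, u) := by
  have e1 : ContinuousAt (fun q : T × ℝ => Y q.1) (p, u) :=
    ContinuousAt.comp (f := Prod.fst) hY continuousAt_fst
  have e2 : ContinuousAt (fun q : T × ℝ => S q.1) (p, u) :=
    ContinuousAt.comp (f := Prod.fst) hS continuousAt_fst
  have e3 : ContinuousAt (fun q : T × ℝ => (q.2 : ℂ)) (p, u) := by fun_prop
  exact continuousAt_invOneAdd (e3.smul e1) e2 (h u hu)

theorem continuousAt_avgRes {T : Type*} [TopologicalSpace T] [FirstCountableTopology T]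
    {Y S : T → A} {p : T} (hY : ContinuousAt Y p) (hS : ContinuousAt S p)
    (h : SegmentUnit (Y p) (S p)) : ContinuousAt (fun q => avgRes (Y q) (S q)) p := by
  have hc : ∀ u ∈ Set.Icc (0 : ℝ) 1, ContinuousAt
      (fun q : T × ℝ => (invOneAdd ((q.2 : ℂ) • Y q.1) (S q.1) - 1) * Y q.1) (p, u) := fun u hu =>
    ((continuousAt_segment_integrand hY hS h hu).sub continuousAt_const).mul
      (ContinuousAt.comp (f := Prod.fst) hY continuousAt_fst)
  obtain ⟨K, hK⟩ := eventually_segment hY hS h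
    (f := fun q u => (invOneAdd ((u : ℂ) • Y q) (S q) - 1) * Y q) hc
  have hsub : Set.uIoc (0 : ℝ) 1 ⊆ Set.Icc 0 1 := by
    rw [Set.uIoc_of_le zero_le_one]; exact Set.Ioc_subset_Icc_self
  refine intervalIntegral.continuousAt_of_dominated_interval (bound := fun _ => K) ?_ ?_
    (by simp) ?_
  · filter_upwards [hK] with q hq
    exact (((continuousOn_invOneAdd_segment hq.1).sub continuousOn_const).mul
      continuousOn_const).mono hsub |>.aestronglyMeasurable measurableSet_uIoc
  · filter_upwards [hK] with q hq
    exact Eventually.of_forall fun u hu => hq.2 u (hsub hu)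
  · refine Eventually.of_forall fun u hu => ?_
    exact ContinuousAt.comp (f := fun q : T => (q, u)) (hc u (hsub hu)) (by fun_prop)

/-- The derivative of `((1 + u Y S)⁻¹ - 1) Y` in the direction `(Y', S')`. -/
def segmentDeriv (Y S Y' S' : A) (u : ℝ) : A :=
  -(invOneAdd ((u : ℂ) • Y) S * (((u : ℂ) • Y') * S + ((u : ℂ) • Y) * S') *
    invOneAdd ((u : ℂ) • Y) S) * Y + (invOneAdd ((u : ℂ) • Y) S - 1) * Y'

theorem continuousOn_segmentDeriv {Y S : A} (h : SegmentUnit Y S) (Y' S' : A) :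
    ContinuousOn (segmentDeriv Y S Y' S') (Set.Icc 0 1) := by
  have h1 := continuousOn_invOneAdd_segment h
  have h2 : ContinuousOn (fun u : ℝ => ((u : ℂ) • Y') * S + ((u : ℂ) • Y) * S') (Set.Icc 0 1) := by
    fun_prop
  exact (((h1.mul h2).mul h1).neg.mul continuousOn_const).add
    ((h1.sub continuousOn_const).mul continuousOn_const)

theorem uIoc_zero_one_subset : Set.uIoc (0 : ℝ) 1 ⊆ Set.Icc 0 1 := by
  rw [Set.uIoc_of_le zero_le_one]; exact Set.Ioc_subset_Icc_self

/-- The scalar field is general because it is ℝ for derivatives in `t` or along the field, and ℂ for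
derivatives in the coupling. -/
theorem hasDerivAt_avgRes {𝕜 : Type*} [RCLike 𝕜] [NormedAlgebra 𝕜 A] [SMulCommClass ℂ 𝕜 A]
    {Y S : 𝕜 → A} {Y' S' : A} {θ : 𝕜}
    (hY : ∀ η, HasDerivAt Y Y' η) (hS : ∀ η, HasDerivAt S S' η) (h : SegmentUnit (Y θ) (S θ)) :
    HasDerivAt (fun η => avgRes (Y η) (S η))
      (∫ u in (0 : ℝ)..1, segmentDeriv (Y θ) (S θ) Y' S' u) θ := by
  have hYc : ContinuousAt Y θ := (hY θ).continuousAt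
  have hSc : ContinuousAt S θ := (hS θ).continuousAt
  have hc : ∀ u ∈ Set.Icc (0 : ℝ) 1, ContinuousAt
      (fun q : 𝕜 × ℝ => segmentDeriv (Y q.1) (S q.1) Y' S' q.2) (θ, u) := fun u hu => by
    have e1 : ContinuousAt (fun q : 𝕜 × ℝ => Y q.1) (θ, u) :=
      ContinuousAt.comp (f := Prod.fst) hYc continuousAt_fst
    have e2 : ContinuousAt (fun q : 𝕜 × ℝ => S q.1) (θ, u) :=
      ContinuousAt.comp (f := Prod.fst) hSc continuousAt_fst
    have e3 : ContinuousAt (fun q : 𝕜 × ℝ => (q.2 : ℂ)) (θ, u) := by fun_prop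
    have e4 := continuousAt_segment_integrand hYc hSc h hu
    exact (((e4.mul (((e3.smul continuousAt_const).mul e2).add
      ((e3.smul e1).mul continuousAt_const))).mul e4).neg.mul e1).add
      ((e4.sub continuousAt_const).mul continuousAt_const)
  obtain ⟨K, hK⟩ := eventually_segment hYc hSc h
    (f := fun q u => segmentDeriv (Y q) (S q) Y' S' u) hc
  have hInt : ∀ η, SegmentUnit (Y η) (S η) → ContinuousOn
      (fun u : ℝ => (invOneAdd ((u : ℂ) • Y η) (S η) - 1) * Y η) (Set.Icc 0 1) := fun η hη =>
    ((continuousOn_invOneAdd_segment hη).sub continuousOn_const).mul continuousOn_const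
  refine (intervalIntegral.hasDerivAt_integral_of_dominated_loc_of_deriv_le
    (F := fun η (u : ℝ) => (invOneAdd ((u : ℂ) • Y η) (S η) - 1) * Y η)
    (F' := fun η u => segmentDeriv (Y η) (S η) Y' S' u) (bound := fun _ => K)
    (s := {q | SegmentUnit (Y q) (S q) ∧ ∀ u ∈ Set.Icc (0 : ℝ) 1,
      ‖segmentDeriv (Y q) (S q) Y' S' u‖ ≤ K}) hK ?_ ?_ ?_ ?_ (by simp) ?_).2
  · filter_upwards [hK] with q hq
    exact ((hInt q hq.1).mono uIoc_zero_one_subset).aestronglyMeasurable measurableSet_uIoc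
  · refine ContinuousOn.intervalIntegrable ?_
    rw [Set.uIcc_of_le zero_le_one]
    exact hInt θ h
  · exact ((continuousOn_segmentDeriv h Y' S').mono uIoc_zero_one_subset).aestronglyMeasurable
      measurableSet_uIoc
  · exact Eventually.of_forall fun u hu q hq => hq.2 u (uIoc_zero_one_subset hu)
  · refine Eventually.of_forall fun u hu q hq => ?_
    have d1 : HasDerivAt (fun η => (u : ℂ) • Y η) ((u : ℂ) • Y') q := (hY q).const_smul (u : ℂ)
    exact ((hasDerivAt_invOneAdd d1 (hS q) (hq.1 u (uIoc_zero_one_subset hu))).sub_const 1).mul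
      (hY q)

/-- The total derivative of the paired average, computed by integrating in `u`. -/
theorem pairing_avgRes_add {Y S Y' S' : A} {τ τ' : A →L[ℂ] ℂ} (h : SegmentUnit Y S)
    (hcyc : ∀ B D, τ (B * S * D) = τ (D * S * B))
    (hcyc' : ∀ B D, τ (B * S' * D) = τ' (D * S * B)) :
    τ' (avgRes Y S) + τ (∫ u in (0 : ℝ)..1, segmentDeriv Y S Y' S' u) =
      τ ((invOneAdd Y S - 1) * Y') + τ' ((invOneAdd Y S - 1) * Y) := by
  have hc0 : ContinuousOn (fun u : ℝ => (invOneAdd ((u : ℂ) • Y) S - 1) * Y) (Set.uIcc 0 1) := by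
    rw [Set.uIcc_of_le zero_le_one]
    exact ((continuousOn_invOneAdd_segment h).sub continuousOn_const).mul continuousOn_const
  have hc1 : ContinuousOn (segmentDeriv Y S Y' S') (Set.uIcc 0 1) := by
    rw [Set.uIcc_of_le zero_le_one]
    exact continuousOn_segmentDeriv h Y' S'
  have hi0 : IntervalIntegrable (fun u : ℝ => τ' ((invOneAdd ((u : ℂ) • Y) S - 1) * Y)) volume 0 1 :=
    (τ'.continuous.comp_continuousOn hc0).intervalIntegrable
  have hi1 : IntervalIntegrable (fun u : ℝ => τ (segmentDeriv Y S Y' S' u)) volume 0 1 :=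
    (τ.continuous.comp_continuousOn hc1).intervalIntegrable
  rw [avgRes, ← ContinuousLinearMap.intervalIntegral_comp_comm _ hc0.intervalIntegrable,
    ← ContinuousLinearMap.intervalIntegral_comp_comm _ hc1.intervalIntegrable,
    ← intervalIntegral.integral_add hi0 hi1]
  -- By cyclicity the integrand is the derivative of `u` times the right-hand side taken with `u Y`
  -- in place of `Y` in the resolvent. The value at `u = 0` vanishes because of the factor `u`.
  have hderiv : ∀ u ∈ Set.uIcc (0 : ℝ) 1, HasDerivAt
      (fun u : ℝ => (u : ℂ) * (τ ((invOneAdd ((u : ℂ) • Y) S - 1) * Y') +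
        τ' ((invOneAdd ((u : ℂ) • Y) S - 1) * Y)))
      (τ' ((invOneAdd ((u : ℂ) • Y) S - 1) * Y) + τ (segmentDeriv Y S Y' S' u)) u := by
    intro u hu
    rw [Set.uIcc_of_le zero_le_one] at hu
    set R := invOneAdd ((u : ℂ) • Y) S with hR
    have d0 : HasDerivAt (fun u : ℝ => (u : ℂ)) 1 u := Complex.ofRealCLM.hasDerivAt
    have d1 : HasDerivAt (fun u : ℝ => (u : ℂ) • Y) Y u := by
      simpa using d0.smul_const Y
    have d2 := hasDerivAt_invOneAdd d1 (hasDerivAt_const u S) (h u hu)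
    rw [← hR] at d2
    have d3 := ((τ.restrictScalars ℝ).hasFDerivAt).comp_hasDerivAt u ((d2.sub_const 1).mul_const Y')
    have d4 := ((τ'.restrictScalars ℝ).hasFDerivAt).comp_hasDerivAt u ((d2.sub_const 1).mul_const Y)
    have d5 := d0.mul (d3.add d4)
    refine d5.congr_deriv ?_
    simp only [segmentDeriv, ← hR, ContinuousLinearMap.coe_restrictScalars', Function.comp_apply,
      mul_zero, add_zero, one_mul, Pi.add_apply]
    have c1 : τ (R * Y' * S * (R * Y)) = τ (R * Y * S * (R * Y')) := hcyc _ _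
    have c2 : τ (R * Y * S' * (R * Y)) = τ' (R * Y * S * (R * Y)) := hcyc' _ _
    have e1 : -(R * ((u : ℂ) • Y' * S + (u : ℂ) • Y * S') * R) * Y =
        -((u : ℂ) • (R * Y' * S * (R * Y)) + (u : ℂ) • (R * Y * S' * (R * Y))) := by
      simp only [smul_mul_assoc, mul_add, mul_smul_comm, add_mul, neg_mul, mul_assoc]
    have e2 : -(R * (Y * S) * R) * Y' = -(R * Y * S * (R * Y')) := by noncomm_ring
    have e3 : -(R * (Y * S) * R) * Y = -(R * Y * S * (R * Y)) := by noncomm_ring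
    simp only [e1, e2, e3, map_add, map_neg, map_smul, smul_eq_mul, c1, c2]
    ring
  rw [intervalIntegral.integral_eq_sub_of_hasDerivAt hderiv]
  · simp
  · exact hi0.add hi1

end AveragedResolvent

/-! ### Feature maps of the slice covariances -/

/-- Weighted monomials on the square. -/
def mono (k : ℕ × ℕ) (x : Sq) : ℝ := (1 / 4) ^ (k.1 + k.2) * ((x.1 : ℝ) ^ k.1 * (x.2 : ℝ) ^ k.2)

/-- The weights `2^{-|k|}`. -/
def wt (k : ℕ × ℕ) : ℝ := (1 / 2) ^ k.1 * (1 / 2) ^ k.2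

theorem wt_pos (k : ℕ × ℕ) : 0 < wt k := by unfold wt; positivity

theorem summable_wt : Summable wt :=
  (summable_geometric_two).mul_of_nonneg summable_geometric_two
    (fun _ => by positivity) (fun _ => by positivity)

theorem continuous_mono (k : ℕ × ℕ) : Continuous (mono k) := by unfold mono; fun_prop

theorem abs_mono_le (k : ℕ × ℕ) (x : Sq) : |mono k x| ≤ wt k := by
  have h1 : (x.1 : ℝ) ^ k.1 ≤ 1 := pow_le_one₀ x.1.2.1 x.1.2.2
  have h2 : (x.2 : ℝ) ^ k.2 ≤ 1 := pow_le_one₀ x.2.2.1 x.2.2.2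
  have h3 : 0 ≤ (x.1 : ℝ) ^ k.1 := pow_nonneg x.1.2.1 _
  have h4 : 0 ≤ (x.2 : ℝ) ^ k.2 := pow_nonneg x.2.2.1 _
  have h5 : (1 / 4 : ℝ) ^ (k.1 + k.2) ≤ (1 / 2) ^ (k.1 + k.2) :=
    pow_le_pow_left₀ (by norm_num) (by norm_num) _
  rw [mono, wt, abs_of_nonneg (by positivity), ← pow_add]
  calc _ ≤ (1 / 2 : ℝ) ^ (k.1 + k.2) * (1 * 1) := by gcongr
    _ = _ := by ring

/-- The factor `2 ^ n`, cruder than `n`, is harmless: against the weights `4⁻ⁿ` of `mono` it leaves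
`2⁻ⁿ`, which is `wt`. -/
theorem abs_pow_sub_pow_le {a b : ℝ} (ha : 0 ≤ a) (ha' : a ≤ 1) (hb : 0 ≤ b) (hb' : b ≤ 1) (n : ℕ) :
    |a ^ n - b ^ n| ≤ 2 ^ n * |a - b| := by
  induction n with
  | zero => simp
  | succ n ih =>
    have e : a ^ (n + 1) - b ^ (n + 1) = a * (a ^ n - b ^ n) + (a - b) * b ^ n := by ring
    have h1 : b ^ n ≤ 1 := pow_le_one₀ hb hb'
    rw [e]
    calc _ ≤ |a| * |a ^ n - b ^ n| + |a - b| * |b ^ n| := by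
          rw [← abs_mul, ← abs_mul]; exact abs_add_le _ _
      _ ≤ 1 * (2 ^ n * |a - b|) + |a - b| * 1 := by
          rw [abs_of_nonneg ha, abs_of_nonneg (pow_nonneg hb n)]
          gcongr
      _ ≤ 2 ^ (n + 1) * |a - b| := by
          have : (1 : ℝ) ≤ 2 ^ n := one_le_pow₀ (by norm_num)
          rw [pow_succ]
          nlinarith [abs_nonneg (a - b)]

/-- The `ℓ¹` distance in the square. -/
def l1dist (x y : Sq) : ℝ := |(x.1 : ℝ) - y.1| + |(x.2 : ℝ) - y.2|

theorem l1dist_nonneg (x y : Sq) : 0 ≤ l1dist x y := by unfold l1dist; positivity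

theorem abs_mono_sub_le (k : ℕ × ℕ) (x y : Sq) : |mono k x - mono k y| ≤ wt k * l1dist x y := by
  have h1 : (x.1 : ℝ) ^ k.1 ≤ 1 := pow_le_one₀ x.1.2.1 x.1.2.2
  have h2 : (y.2 : ℝ) ^ k.2 ≤ 1 := pow_le_one₀ y.2.2.1 y.2.2.2
  have h3 : 0 ≤ (x.1 : ℝ) ^ k.1 := pow_nonneg x.1.2.1 _
  have h4 : 0 ≤ (y.2 : ℝ) ^ k.2 := pow_nonneg y.2.2.1 _
  have e : mono k x - mono k y = (1 / 4) ^ (k.1 + k.2) *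
      ((x.1 : ℝ) ^ k.1 * ((x.2 : ℝ) ^ k.2 - (y.2 : ℝ) ^ k.2) +
        ((x.1 : ℝ) ^ k.1 - (y.1 : ℝ) ^ k.1) * (y.2 : ℝ) ^ k.2) := by unfold mono; ring
  have b1 := abs_pow_sub_pow_le x.1.2.1 x.1.2.2 y.1.2.1 y.1.2.2 k.1
  have b2 := abs_pow_sub_pow_le x.2.2.1 x.2.2.2 y.2.2.1 y.2.2.2 k.2
  have p1 : (2 : ℝ) ^ k.1 ≤ 2 ^ (k.1 + k.2) := pow_le_pow_right₀ (by norm_num) (by omega)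
  have p2 : (2 : ℝ) ^ k.2 ≤ 2 ^ (k.1 + k.2) := pow_le_pow_right₀ (by norm_num) (by omega)
  rw [e, abs_mul, abs_of_nonneg (by positivity : (0 : ℝ) ≤ (1 / 4) ^ (k.1 + k.2))]
  calc _ ≤ (1 / 4 : ℝ) ^ (k.1 + k.2) * (1 * (2 ^ (k.1 + k.2) * |(x.2 : ℝ) - y.2|) +
        (2 ^ (k.1 + k.2) * |(x.1 : ℝ) - y.1|) * 1) := by
        gcongr
        refine (abs_add_le _ _).trans ?_
        rw [abs_mul, abs_mul, abs_of_nonneg h3, abs_of_nonneg h4]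
        gcongr
        · exact b2.trans (by gcongr)
        · exact b1.trans (by gcongr)
    _ = ((1 / 4 : ℝ) ^ (k.1 + k.2) * 2 ^ (k.1 + k.2)) * l1dist x y := by unfold l1dist; ring
    _ = wt k * l1dist x y := by
        rw [← mul_pow, wt, ← pow_add]; norm_num

/-- A Hilbert space with orthogonal slice projections and an analytic map `x ↦ A_x` such that
`C_j(x,y) = ⟨A_x, π_j A_y⟩`. -/
structure Features (Φ : Model) (H : Type*) [NormedAddCommGroup H] [InnerProductSpace ℂ H]
    [CompleteSpace H] where
  proj : ℕ → H →L[ℂ] H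
  proj_sa : ∀ j, IsSelfAdjoint (proj j)
  proj_mul : ∀ i j, proj i * proj j = if i = j then proj i else 0
  vec : ℕ × ℕ → H
  bound : ℝ
  norm_vec_le : ∀ k, ‖vec k‖ ≤ bound
  inner_proj : ∀ j ≤ Φ.jmax, ∀ x y : Sq, inner ℂ (∑' k, mono k x • vec k)
    (proj j (∑' k, mono k y • vec k)) = ((sliceCov Φ j (x, y) : ℝ) : ℂ)

namespace Features

variable {Φ : Model} {H : Type*} [NormedAddCommGroup H] [InnerProductSpace ℂ H] [CompleteSpace H]
  (F : Features Φ H)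

/-- The feature vector `A_x`. -/
def feat (x : Sq) : H := ∑' k, mono k x • F.vec k

theorem bound_nonneg : 0 ≤ F.bound := (norm_nonneg _).trans (F.norm_vec_le (0, 0))

theorem norm_mono_smul_le (k : ℕ × ℕ) (x : Sq) : ‖mono k x • F.vec k‖ ≤ wt k * F.bound := by
  rw [norm_smul]
  exact mul_le_mul (abs_mono_le k x) (F.norm_vec_le k) (norm_nonneg _) (wt_pos k).le

theorem hasSum_feat (x : Sq) : HasSum (fun k => mono k x • F.vec k) (F.feat x) :=
  (Summable.of_norm_bounded (summable_wt.mul_right F.bound)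
    fun k => F.norm_mono_smul_le k x).hasSum

theorem continuous_feat : Continuous F.feat :=
  continuous_tsum (fun k => (continuous_mono k).smul continuous_const)
    (summable_wt.mul_right F.bound) fun k x => F.norm_mono_smul_le k x

/-- A bound for the feature vectors. -/
def featBound : ℝ := (∑' k, wt k) * F.bound

theorem norm_feat_le (x : Sq) : ‖F.feat x‖ ≤ F.featBound := by
  have h := tsum_of_norm_bounded (summable_wt.mul_right F.bound).hasSum
    fun k => F.norm_mono_smul_le k x
  rwa [tsum_mul_right] at h

theorem featBound_nonneg : 0 ≤ F.featBound := (norm_nonneg _).trans (F.norm_feat_le (0, 0))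

theorem inner_feat_proj {j : ℕ} (hj : j ≤ Φ.jmax) (x y : Sq) :
    inner ℂ (F.feat x) (F.proj j (F.feat y)) = ((sliceCov Φ j (x, y) : ℝ) : ℂ) :=
  F.inner_proj j hj x y

/-- The Dirac mass at `x` in the trace space: `|A_x⟩⟨A_x|`. -/
def dirac (x : Sq) : TraceSpace H := TraceSpace.rankTwo (F.feat x) (F.feat x)

theorem norm_dirac_le (x : Sq) : ‖F.dirac x‖ ≤ F.featBound ^ 2 := by
  refine (TraceSpace.norm_rankTwo_le _ _).trans ?_
  rw [sq]
  exact mul_le_mul (F.norm_feat_le x) (F.norm_feat_le x) (norm_nonneg _) F.featBound_nonneg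

theorem continuous_dirac : Continuous F.dirac :=
  (TraceSpace.rankTwo.continuous.comp F.continuous_feat).clm_apply F.continuous_feat

theorem tr_dirac (x : Sq) (B : H →L[ℂ] H) :
    TraceSpace.tr H (F.dirac x) B = inner ℂ (F.feat x) (B (F.feat x)) :=
  TraceSpace.tr_rankTwo_self _ _

theorem op_dirac (x : Sq) (v : H) :
    TraceSpace.op H (F.dirac x) v = inner ℂ (F.feat x) v • F.feat x :=
  TraceSpace.op_rankTwo_self _ _

/-- The coordinates of the trace space: products of two monomials. -/
def mono₂ (i : (ℕ × ℕ) × (ℕ × ℕ)) (x : Sq) : ℝ := mono i.1 x * mono i.2 x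

/-- The weights of the coordinates. -/
def wt₂ (i : (ℕ × ℕ) × (ℕ × ℕ)) : ℝ := wt i.1 * wt i.2

theorem wt₂_pos (i : (ℕ × ℕ) × (ℕ × ℕ)) : 0 < wt₂ i := mul_pos (wt_pos _) (wt_pos _)

theorem summable_wt₂ : Summable wt₂ :=
  summable_wt.mul_of_nonneg summable_wt (fun k => (wt_pos k).le) (fun k => (wt_pos k).le)

theorem continuous_mono₂ (i : (ℕ × ℕ) × (ℕ × ℕ)) : Continuous (mono₂ i) :=
  (continuous_mono _).mul (continuous_mono _)

theorem abs_mono₂_le (i : (ℕ × ℕ) × (ℕ × ℕ)) (x : Sq) : |mono₂ i x| ≤ wt₂ i := by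
  rw [mono₂, abs_mul]
  exact mul_le_mul (abs_mono_le _ _) (abs_mono_le _ _) (abs_nonneg _) (wt_pos _).le

theorem abs_mono_le_one (k : ℕ × ℕ) (x : Sq) : |mono k x| ≤ 1 :=
  (abs_mono_le k x).trans
    (mul_le_one₀ (pow_le_one₀ (by norm_num) (by norm_num)) (by positivity)
      (pow_le_one₀ (by norm_num) (by norm_num)))

theorem abs_mono₂_sub_le (i : (ℕ × ℕ) × (ℕ × ℕ)) (x y : Sq) :
    |mono₂ i x - mono₂ i y| ≤ 2 * wt₂ i * l1dist x y := by
  have e : mono₂ i x - mono₂ i y = mono i.1 x * (mono i.2 x - mono i.2 y) +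
      (mono i.1 x - mono i.1 y) * mono i.2 y := by unfold mono₂; ring
  rw [e]
  refine (abs_add_le _ _).trans ?_
  rw [abs_mul, abs_mul]
  have h0 := l1dist_nonneg x y
  have w1 := (wt_pos i.1).le
  have w2 := (wt_pos i.2).le
  calc _ ≤ wt i.1 * (wt i.2 * l1dist x y) + (wt i.1 * l1dist x y) * wt i.2 := by
        gcongr
        · exact abs_mono_le _ _
        · exact abs_mono_sub_le _ _ _
        · exact abs_mono_sub_le _ _ _
        · exact abs_mono_le _ _
    _ = _ := by unfold wt₂; ring

/-- The basis elements of the trace space. -/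
def basis (i : (ℕ × ℕ) × (ℕ × ℕ)) : TraceSpace H := TraceSpace.rankTwo (F.vec i.1) (F.vec i.2)

theorem norm_basis_le (i : (ℕ × ℕ) × (ℕ × ℕ)) : ‖F.basis i‖ ≤ F.bound ^ 2 := by
  refine (TraceSpace.norm_rankTwo_le _ _).trans ?_
  rw [sq]
  exact mul_le_mul (F.norm_vec_le _) (F.norm_vec_le _) (norm_nonneg _) F.bound_nonneg

/-- Both factors of |A_x⟩⟨A_x| are expanded, so that the point `x` enters only through scalar
coefficients. A field then acts through countably many numbers ∫ s `mono₂`, and these still make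
sense for white noise. -/
theorem hasSum_dirac (x : Sq) : HasSum (fun i => mono₂ i x • F.basis i) (F.dirac x) := by
  have hs : Summable (fun i => mono₂ i x • F.basis i) := by
    refine Summable.of_norm_bounded (summable_wt₂.mul_right (F.bound ^ 2)) fun i => ?_
    rw [norm_smul]
    exact mul_le_mul (abs_mono₂_le i x) (F.norm_basis_le i) (norm_nonneg _) (wt₂_pos i).le
  have h1 : ∀ k, HasSum (fun l => mono₂ (k, l) x • F.basis (k, l))
      (TraceSpace.rankTwo (mono k x • F.vec k) (F.feat x)) := by
    intro k
    refine ((TraceSpace.rankTwo (mono k x • F.vec k)).hasSum (F.hasSum_feat x)).congr_fun ?_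
    intro l
    simp [mono₂, basis, smul_smul, mul_comm]
  have h2 : HasSum (fun k => TraceSpace.rankTwo (mono k x • F.vec k) (F.feat x)) (F.dirac x) :=
    (TraceSpace.rankTwo.flip (F.feat x)).hasSum (F.hasSum_feat x)
  have h3 := hs.hasSum.prod_fiberwise h1
  rw [← h3.unique h2]
  exact hs.hasSum

end Features

/-! ### The interaction on the trace space -/

/-- Interpolation parameters with values in `[0,1]`. -/
def unitCube : Set (ℕ → ℝ) := {t | ∀ j, t j ∈ Set.Icc (0 : ℝ) 1}

theorem update_mem_unitCube {t : ℕ → ℝ} (ht : t ∈ unitCube) (j : ℕ) {u : ℝ}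
    (hu : u ∈ Set.Icc (0 : ℝ) 1) : Function.update t j u ∈ unitCube := by
  intro i
  rcases eq_or_ne i j with rfl | h
  · simpa using hu
  · simpa [h] using ht i

namespace Features

open TraceSpace

variable {Φ : Model} {H : Type*} [NormedAddCommGroup H] [InnerProductSpace ℂ H] [CompleteSpace H]
  (F : Features Φ H)

/-- The operator `∑ t_j π_j` on the feature space. -/
def interp (t : ℕ → ℝ) : H →L[ℂ] H := ∑ j ∈ Finset.range (Φ.jmax + 1), (t j : ℂ) • F.proj j

/-- Orthogonality of the projections makes `interp` multiplicative; hence the square root of `interp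
t` is `interp` of the square roots. -/
theorem interp_mul (s t : ℕ → ℝ) : F.interp s * F.interp t = F.interp (s * t) := by
  simp only [interp, Finset.sum_mul_sum, smul_mul_smul_comm, F.proj_mul, smul_ite, smul_zero,
    Finset.sum_ite_eq]
  refine Finset.sum_congr rfl fun i hi => ?_
  rw [if_pos hi]
  simp

theorem interp_smul (c : ℝ) (t : ℕ → ℝ) : F.interp (c • t) = (c : ℂ) • F.interp t := by
  simp [interp, Finset.smul_sum, mul_smul]

theorem interp_sa (t : ℕ → ℝ) : IsSelfAdjoint (F.interp t) := by
  unfold interp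
  rw [IsSelfAdjoint, star_sum]
  refine Finset.sum_congr rfl fun i _ => ?_
  rw [star_smul, (F.proj_sa i).star_eq]
  simp

/-- A bound for `interp` on the unit cube. -/
def projBound : ℝ := ∑ j ∈ Finset.range (Φ.jmax + 1), ‖F.proj j‖

theorem projBound_nonneg : 0 ≤ F.projBound := Finset.sum_nonneg fun _ _ => norm_nonneg _

theorem norm_interp_le {t : ℕ → ℝ} (ht : t ∈ unitCube) : ‖F.interp t‖ ≤ F.projBound := by
  refine (norm_sum_le _ _).trans (Finset.sum_le_sum fun j _ => ?_)
  rw [norm_smul, Complex.norm_real, Real.norm_of_nonneg (ht j).1]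
  exact mul_le_of_le_one_left (norm_nonneg _) (ht j).2

theorem continuous_interp : Continuous F.interp := by
  unfold interp
  fun_prop

theorem interp_update {j : ℕ} (hj : j ≤ Φ.jmax) (t : ℕ → ℝ) (u : ℝ) :
    F.interp (Function.update t j u) = F.interp t + ((u - t j : ℝ) : ℂ) • F.proj j := by
  have hmem : j ∈ Finset.range (Φ.jmax + 1) := Finset.mem_range.2 (Nat.lt_succ_of_le hj)
  unfold interp
  rw [← Finset.add_sum_erase _ _ hmem, ← Finset.add_sum_erase _ _ hmem]
  have : ∑ x ∈ (Finset.range (Φ.jmax + 1)).erase j, ((Function.update t j u x : ℝ) : ℂ) • F.proj x =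
      ∑ x ∈ (Finset.range (Φ.jmax + 1)).erase j, ((t x : ℝ) : ℂ) • F.proj x :=
    Finset.sum_congr rfl fun i hi => by rw [Function.update_of_ne (Finset.ne_of_mem_erase hi)]
  rw [this, Function.update_self]
  push_cast
  module

theorem inner_feat_interp (t : ℕ → ℝ) (x y : Sq) :
    inner ℂ (F.feat x) (F.interp t (F.feat y)) = ((cov Φ t (x, y) : ℝ) : ℂ) := by
  simp only [interp, cov, ContinuousLinearMap.sum_apply, smul_apply, inner_sum, inner_smul_right,
    ContinuousMap.sum_apply, ContinuousMap.smul_apply, smul_eq_mul, Complex.ofReal_sum,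
    Complex.ofReal_mul]
  refine Finset.sum_congr rfl fun j hj => ?_
  rw [F.inner_feat_proj (Nat.lt_succ_iff.1 (Finset.mem_range.1 hj))]

theorem cov_diag (Φ : Model) (t : ℕ → ℝ) (x : Sq) : cov Φ t (x, x) = tad Φ t := by
  simp [cov, tad, ContinuousMap.sum_apply, sliceCov_diag]

theorem inner_feat_interp_self (t : ℕ → ℝ) (x : Sq) :
    inner ℂ (F.feat x) (F.interp t (F.feat x)) = (tad Φ t : ℂ) := by
  rw [inner_feat_interp, cov_diag]

theorem inner_feat_proj_self {j : ℕ} (hj : j ≤ Φ.jmax) (x : Sq) :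
    inner ℂ (F.feat x) (F.proj j (F.feat x)) = (sliceTad Φ j : ℂ) := by
  rw [F.inner_feat_proj hj, sliceCov_diag]

/-- The resolvent `(1 + z D_t X)⁻¹` on the feature space. -/
def res (z : ℂ) (t : ℕ → ℝ) (X : TraceSpace H) : H →L[ℂ] H :=
  invOneAdd (z • F.interp t) (op H X)

/-- The interaction as a function on the trace space, with `λ = -z²/4`. -/
def pot (z : ℂ) (t : ℕ → ℝ) (X : TraceSpace H) : ℂ :=
  -(3 / 4) * z ^ 2 * (tad Φ t : ℂ) ^ 2 + z * tr H X (F.interp t)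
    - 1 / 2 * tr H X (avgRes (z • F.interp t) (op H X))

/-! ### Resolvent bounds and linear growth of the interaction -/

section Bounds

variable {z : ℂ} {δ : ℝ} (hδ : 0 < δ) (hz : ∀ r : ℝ, δ ≤ ‖1 + z * (r : ℂ)‖) {t : ℕ → ℝ}
  (ht : t ∈ unitCube)

theorem interp_sqrt_mul_self (ht : t ∈ unitCube) :
    F.interp (fun j => √(t j)) * F.interp (fun j => √(t j)) = F.interp t := by
  rw [interp_mul]
  congr 1
  ext j
  exact Real.mul_self_sqrt (ht j).1

theorem sqrt_mem_unitCube (ht : t ∈ unitCube) : (fun j => √(t j)) ∈ unitCube := fun j =>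
  ⟨Real.sqrt_nonneg _, Real.sqrt_le_one.2 (ht j).2⟩

theorem smul_mem_unitCube (ht : t ∈ unitCube) {u : ℝ} (hu : u ∈ Set.Icc (0 : ℝ) 1) :
    u • t ∈ unitCube := fun j =>
  ⟨mul_nonneg hu.1 (ht j).1, mul_le_one₀ hu.2 (ht j).1 (ht j).2⟩

include hδ hz ht

/-- The sandwich lemma with `S = op H X` and `Q` equal to `interp` of the square roots of the
parameters. -/
theorem isUnit_res (X : TraceSpace H) : IsUnit (1 + (z • F.interp t) * op H X) := by
  have h := (inverse_one_add_sandwich (isSelfAdjoint_op X)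
    (F.interp_sa (fun j => √(t j))) hδ hz).1
  rwa [F.interp_sqrt_mul_self ht] at h

theorem norm_res_le (X : TraceSpace H) :
    ‖F.res z t X‖ ≤ 1 + ‖z‖ * (F.projBound ^ 2 * δ⁻¹) * ‖X‖ := by
  have h := norm_inverse_one_add_sandwich_le (isSelfAdjoint_op X)
    (F.interp_sa (fun j => √(t j))) hδ hz
  rw [F.interp_sqrt_mul_self ht] at h
  refine h.trans ?_
  have h1 := F.norm_interp_le (sqrt_mem_unitCube ht)
  have h2 := norm_op_le X
  gcongr

theorem norm_res_mul_interp_le (X : TraceSpace H) :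
    ‖F.res z t X * F.interp t‖ ≤ F.projBound ^ 2 * δ⁻¹ := by
  have h := norm_inverse_one_add_sandwich_mul_le (isSelfAdjoint_op X)
    (F.interp_sa (fun j => √(t j))) hδ hz
  rw [F.interp_sqrt_mul_self ht] at h
  refine h.trans ?_
  have h1 := F.norm_interp_le (sqrt_mem_unitCube ht)
  gcongr

/-- Multiplying by `u` in [0,1] only replaces `t` by `u • t`, which stays in the unit cube. -/
theorem segmentUnit (X : TraceSpace H) : SegmentUnit (z • F.interp t) (op H X) := by
  intro u hu
  have h := F.isUnit_res hδ hz (smul_mem_unitCube ht hu) X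
  rwa [interp_smul, smul_comm] at h

theorem norm_avgRes_le (X : TraceSpace H) :
    ‖avgRes (z • F.interp t) (op H X)‖ ≤ ‖z‖ * (F.projBound ^ 2 * δ⁻¹ + F.projBound) := by
  have hb : ∀ u ∈ Set.uIoc (0 : ℝ) 1, ‖(invOneAdd ((u : ℂ) • z • F.interp t) (op H X) - 1) *
      (z • F.interp t)‖ ≤ ‖z‖ * (F.projBound ^ 2 * δ⁻¹ + F.projBound) := by
    intro u hu
    rw [Set.uIoc_of_le zero_le_one] at hu
    have hu' : u ∈ Set.Icc (0 : ℝ) 1 := Set.Ioc_subset_Icc_self hu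
    -- Replacing `z` by `u z` amounts to replacing `r` by `u r`, so the same `δ` works.
    have hzu : ∀ r : ℝ, δ ≤ ‖1 + ((u : ℂ) * z) * (r : ℂ)‖ := by
      intro r
      have := hz (u * r)
      push_cast at this
      rwa [show (u : ℂ) * z * r = z * (u * r) by ring]
    have h1 := F.norm_res_mul_interp_le hδ hzu ht X
    have h2 := F.norm_interp_le ht
    rw [mul_smul_comm, norm_smul, sub_mul, one_mul, smul_smul]
    gcongr
    exact (norm_sub_le _ _).trans (add_le_add h1 h2)
  have h := intervalIntegral.norm_integral_le_of_norm_le_const hb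
  rw [sub_zero, abs_one, mul_one] at h
  exact h

/-- The interaction grows at most linearly. -/
theorem norm_pot_le (X : TraceSpace H) :
    ‖F.pot z t X‖ ≤ ‖z‖ ^ 2 * |tad Φ t| ^ 2 +
      ‖z‖ * (F.projBound ^ 2 * δ⁻¹ + 2 * F.projBound) * ‖X‖ := by
  have h1 := norm_tr_apply_le X (F.interp t)
  have h2 := norm_tr_apply_le X (avgRes (z • F.interp t) (op H X))
  have h3 := F.norm_interp_le ht
  have h4 := F.norm_avgRes_le hδ hz ht X
  have h5 := F.projBound_nonneg
  calc ‖F.pot z t X‖ ≤ ‖-(3 / 4) * z ^ 2 * (tad Φ t : ℂ) ^ 2‖ + ‖z * tr H X (F.interp t)‖ +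
        ‖1 / 2 * tr H X (avgRes (z • F.interp t) (op H X))‖ := by
        refine (norm_sub_le _ _).trans ?_
        gcongr
        exact norm_add_le _ _
    _ ≤ 3 / 4 * ‖z‖ ^ 2 * |tad Φ t| ^ 2 + ‖z‖ * (‖X‖ * F.projBound) +
        1 / 2 * (‖X‖ * (‖z‖ * (F.projBound ^ 2 * δ⁻¹ + F.projBound))) := by
        gcongr
        · rw [norm_mul, norm_mul, norm_pow, norm_pow, Complex.norm_real]
          norm_num
        · rw [norm_mul]
          gcongr
          exact h1.trans (by gcongr)
        · rw [norm_mul]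
          norm_num
          exact h2.trans (by gcongr)
    _ ≤ _ := by
        have h6 : 0 ≤ ‖z‖ ^ 2 * |tad Φ t| ^ 2 := by positivity
        have h7 : 0 ≤ ‖z‖ * ‖X‖ * (F.projBound ^ 2 * δ⁻¹) := by positivity
        have h8 : 0 ≤ ‖z‖ * ‖X‖ * F.projBound := by positivity
        nlinarith

end Bounds

/-! #### Continuity -/

section Continuity

variable {T : Type*} [TopologicalSpace T] {δ : ℝ} (hδ : 0 < δ) {z : T → ℂ} {t : T → ℕ → ℝ}
  {X : T → TraceSpace H} {p : T} (hz : ∀ r : ℝ, δ ≤ ‖1 + z p * (r : ℂ)‖) (ht : t p ∈ unitCube)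
  (hzc : ContinuousAt z p) (htc : ContinuousAt t p) (hXc : ContinuousAt X p)

theorem continuous_tad (Φ : Model) : Continuous (tad Φ) := by unfold tad; fun_prop

include hδ hz ht hzc htc hXc

theorem continuousAt_res : ContinuousAt (fun q => F.res (z q) (t q) (X q)) p := by
  refine continuousAt_invOneAdd (Y := fun q => z q • F.interp (t q)) (S := fun q => op H (X q))
    (hzc.smul (F.continuous_interp.continuousAt.comp htc))
    ((op H).continuous.continuousAt.comp hXc) (F.isUnit_res hδ hz ht (X p))

theorem continuousAt_pot [FirstCountableTopology T] :
    ContinuousAt (fun q => F.pot (z q) (t q) (X q)) p := by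
  have hD : ContinuousAt (fun q => F.interp (t q)) p := F.continuous_interp.continuousAt.comp htc
  have hS : ContinuousAt (fun q => op H (X q)) p := (op H).continuous.continuousAt.comp hXc
  have hτ : ContinuousAt (fun q => tr H (X q)) p := (tr H).continuous.continuousAt.comp hXc
  have h1 := continuousAt_avgRes (Y := fun q => z q • F.interp (t q))
    (S := fun q => op H (X q)) (hzc.smul hD) hS (F.segmentUnit hδ hz ht (X p))
  have hT : ContinuousAt (fun q => ((tad Φ (t q) : ℝ) : ℂ)) p :=
    Complex.continuous_ofReal.continuousAt.comp ((continuous_tad Φ).continuousAt.comp htc)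
  exact (((continuousAt_const.mul (hzc.pow 2)).mul (hT.pow 2)).add
    (hzc.mul (hτ.clm_apply hD))).sub (continuousAt_const.mul (hτ.clm_apply h1))

end Continuity

/-! #### Derivatives -/

section Derivatives

variable {z : ℂ} {δ : ℝ} (hδ : 0 < δ) (hz : ∀ r : ℝ, δ ≤ ‖1 + z * (r : ℂ)‖) {t : ℕ → ℝ}
  (ht : t ∈ unitCube)

theorem hasDerivAt_interp_update {j : ℕ} (hj : j ≤ Φ.jmax) (t : ℕ → ℝ) (u : ℝ) :
    HasDerivAt (fun u : ℝ => F.interp (Function.update t j u)) (F.proj j) u := by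
  simp only [F.interp_update hj]
  have h0 : HasDerivAt (fun u : ℝ => ((u - t j : ℝ) : ℂ)) 1 u := by
    simpa using ((hasDerivAt_id u).sub_const (t j)).ofReal_comp
  simpa using (h0.smul_const (F.proj j)).const_add (F.interp t)

theorem hasDerivAt_tad_update {j : ℕ} (hj : j ≤ Φ.jmax) (t : ℕ → ℝ) (u : ℝ) :
    HasDerivAt (fun u : ℝ => tad Φ (Function.update t j u)) (sliceTad Φ j) u := by
  have hmem : j ∈ Finset.range (Φ.jmax + 1) := Finset.mem_range.2 (Nat.lt_succ_of_le hj)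
  have e : ∀ u, tad Φ (Function.update t j u) = u * sliceTad Φ j +
      ∑ x ∈ (Finset.range (Φ.jmax + 1)).erase j, t x * sliceTad Φ x := by
    intro u
    unfold tad
    rw [← Finset.add_sum_erase _ _ hmem, Function.update_self]
    congr 1
    exact Finset.sum_congr rfl fun i hi => by
      rw [Function.update_of_ne (Finset.ne_of_mem_erase hi)]
  simp only [e]
  refine (((hasDerivAt_id u).mul_const (sliceTad Φ j)).add_const _).congr_deriv ?_
  rw [one_mul]

variable (H) in
/-- The trace pairing over the reals. -/
def trReal : TraceSpace H →L[ℝ] ((H →L[ℂ] H) →L[ℝ] ℂ) :=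
  (ContinuousLinearMap.restrictScalarsL ℂ (H →L[ℂ] H) ℂ ℝ ℝ).comp (tr H)

theorem trReal_apply (X : TraceSpace H) (B : H →L[ℂ] H) : trReal H X B = tr H X B := rfl

include hδ hz ht

theorem hasDerivAt_res_update {j : ℕ} (hj : j ≤ Φ.jmax) (X : TraceSpace H) :
    HasDerivAt (fun u => F.res z (Function.update t j u) X)
      (-(z • (F.res z t X * F.proj j * op H X * F.res z t X))) (t j) := by
  have h1 : HasDerivAt (fun u : ℝ => z • F.interp (Function.update t j u)) (z • F.proj j) (t j) :=
    (F.hasDerivAt_interp_update hj t (t j)).const_smul z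
  have h := hasDerivAt_invOneAdd h1 (hasDerivAt_const (t j) (op H X))
    (by simpa using F.isUnit_res hδ hz ht X)
  refine h.congr_deriv ?_
  simp [res, mul_assoc]

theorem hasDerivAt_res_line (X X' : TraceSpace H) :
    HasDerivAt (fun r : ℝ => F.res z t (X + r • X'))
      (-(z • (F.res z t X * F.interp t * op H X' * F.res z t X))) 0 := by
  have h1 : HasDerivAt (fun r : ℝ => op H (X + r • X')) (op H X') 0 := by
    have h : HasDerivAt (fun r : ℝ => X + r • X') X' 0 := by
      simpa using ((hasDerivAt_id (0 : ℝ)).smul_const X').const_add X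
    exact (op H).hasFDerivAt.comp_hasDerivAt 0 h
  have h := hasDerivAt_invOneAdd (hasDerivAt_const (0 : ℝ) (z • F.interp t)) h1
    (by simpa using F.isUnit_res hδ hz ht X)
  refine h.congr_deriv ?_
  simp [res, mul_assoc]

/-- With `S` fixed, `pairing_avgRes_add` for `τ' = 0` is the rule d Tr log₂(1 + YS) = Tr((R - 1) dY
S), although the logarithm is only present through its integral over `u`. -/
theorem hasDerivAt_pot_update {j : ℕ} (hj : j ≤ Φ.jmax) (X : TraceSpace H) :
    HasDerivAt (fun u => F.pot z (Function.update t j u) X)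
      (-(3 / 2) * z ^ 2 * (tad Φ t : ℂ) * (sliceTad Φ j : ℂ) + z * tr H X (F.proj j)
        - 1 / 2 * (z * tr H X ((F.res z t X - 1) * F.proj j))) (t j) := by
  have h1 : ∀ u : ℝ, HasDerivAt (fun u : ℝ => z • F.interp (Function.update t j u))
      (z • F.proj j) u := fun u => (F.hasDerivAt_interp_update hj t u).const_smul z
  have hseg : SegmentUnit (z • F.interp (Function.update t j (t j))) (op H X) := by
    rw [Function.update_eq_self]; exact F.segmentUnit hδ hz ht X
  have h2 := hasDerivAt_avgRes h1 (fun u => hasDerivAt_const u (op H X)) hseg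
  have h3 := (trReal H X).hasFDerivAt.comp_hasDerivAt (t j) h2
  have h4 := (trReal H X).hasFDerivAt.comp_hasDerivAt (t j)
    (F.hasDerivAt_interp_update hj t (t j))
  have h5 := (hasDerivAt_tad_update hj t (t j)).ofReal_comp
  have h6 := pairing_avgRes_add (Y' := z • F.proj j) (S' := 0) (τ := tr H X) (τ' := 0)
    (F.segmentUnit hδ hz ht X) (fun B D => tr_mul_op_mul X X B D) (by simp)
  simp only [ContinuousLinearMap.zero_apply, zero_add, add_zero] at h6
  have h := (((h5.pow 2).const_mul (-(3 / 4) * z ^ 2)).add (h4.const_mul z)).sub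
    (h3.const_mul (1 / 2))
  refine h.congr_deriv ?_
  simp only [trReal_apply, Function.update_eq_self, h6]
  simp only [mul_smul_comm, map_smul, smul_eq_mul, res]
  push_cast
  ring

theorem hasDerivAt_pot_line (X X' : TraceSpace H) :
    HasDerivAt (fun r : ℝ => F.pot z t (X + r • X'))
      (z * tr H X' (F.interp t) - 1 / 2 * (z * tr H X' ((F.res z t X - 1) * F.interp t))) 0 := by
  have hline : ∀ r : ℝ, HasDerivAt (fun r : ℝ => X + r • X') X' r := fun r => by
    simpa using ((hasDerivAt_id r).smul_const X').const_add X
  have hS : ∀ r : ℝ, HasDerivAt (fun r : ℝ => op H (X + r • X')) (op H X') r := fun r =>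
    (op H).hasFDerivAt.comp_hasDerivAt r (hline r)
  have hτ : HasDerivAt (fun r : ℝ => trReal H (X + r • X')) (trReal H X') 0 :=
    (trReal H).hasFDerivAt.comp_hasDerivAt 0 (hline 0)
  have hseg : SegmentUnit (z • F.interp t) (op H (X + (0 : ℝ) • X')) :=
    F.segmentUnit hδ hz ht _
  have h2 := hasDerivAt_avgRes (fun r => hasDerivAt_const r (z • F.interp t)) hS hseg
  have h3 := hτ.clm_apply h2
  have h4 := hτ.clm_apply (hasDerivAt_const (0 : ℝ) (F.interp t))
  have h6 := pairing_avgRes_add (Y' := 0) (S' := op H X') (τ := tr H X) (τ' := tr H X')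
    (F.segmentUnit hδ hz ht X) (fun B D => tr_mul_op_mul X X B D)
    (fun B D => tr_mul_op_mul X X' B D)
  simp only [mul_zero, map_zero, zero_add] at h6
  have h := ((h4.const_mul z).const_add (-(3 / 4) * z ^ 2 * (tad Φ t : ℂ) ^ 2)).sub
    (h3.const_mul (1 / 2))
  refine h.congr_deriv ?_
  simp only [trReal_apply, zero_smul, add_zero, map_zero, h6]
  simp only [mul_smul_comm, map_smul, smul_eq_mul, res]

theorem hasDerivAt_pot_coupling (X : TraceSpace H) :
    HasDerivAt (fun w : ℂ => F.pot w t X)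
      (-(3 / 2) * z * (tad Φ t : ℂ) ^ 2 + tr H X (F.interp t)
        - 1 / 2 * (tr H X ((F.res z t X - 1) * F.interp t))) z := by
  have h1 : ∀ w : ℂ, HasDerivAt (fun w : ℂ => w • F.interp t) (F.interp t) w := fun w => by
    simpa using (hasDerivAt_id w).smul_const (F.interp t)
  have h2 := hasDerivAt_avgRes h1 (fun w => hasDerivAt_const w (op H X))
    (F.segmentUnit hδ hz ht X)
  have h3 := (tr H X).hasFDerivAt.comp_hasDerivAt z h2
  have h6 := pairing_avgRes_add (Y' := F.interp t) (S' := 0) (τ := tr H X) (τ' := 0)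
    (F.segmentUnit hδ hz ht X) (fun B D => tr_mul_op_mul X X B D) (by simp)
  simp only [ContinuousLinearMap.zero_apply, zero_add, add_zero] at h6
  have h := ((((hasDerivAt_id z).pow 2).const_mul (-(3 / 4))).mul_const ((tad Φ t : ℂ) ^ 2)).add
    ((hasDerivAt_id z).mul_const (tr H X (F.interp t))) |>.sub (h3.const_mul (1 / 2))
  refine h.congr_deriv ?_
  simp only [h6, res, id]
  push_cast
  ring

end Derivatives

end Features

/-! ### Square integrable fields on the feature space -/

theorem zeta_sq (lam : ℂ) : zeta lam ^ 2 = -4 * lam := by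
  have h : (lam ^ (1 / 2 : ℂ)) ^ 2 = lam := by
    rw [one_div]
    exact Complex.cpow_nat_inv_pow lam two_ne_zero
  rw [zeta, mul_pow, mul_pow, h, Complex.I_sq]
  ring

namespace Features

open TraceSpace

variable {Φ : Model} {H : Type*} [NormedAddCommGroup H] [InnerProductSpace ℂ H] [CompleteSpace H]
  (F : Features Φ H)

/-- The element `∫ s(x) |A_x⟩⟨A_x| dx` of the trace space. -/
def state (s : Sq → ℝ) : TraceSpace H := ∫ x, s x • F.dirac x

theorem integrable_smul_dirac {s : Sq → ℝ} (hs : Integrable s) :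
    Integrable (fun x => s x • F.dirac x) :=
  hs.smul_bdd (F.featBound ^ 2) F.continuous_dirac.aestronglyMeasurable
    (Eventually.of_forall F.norm_dirac_le)

theorem tr_state {s : Sq → ℝ} (hs : Integrable s) (B : H →L[ℂ] H) :
    tr H (F.state s) B = ∫ x, (s x : ℂ) * inner ℂ (F.feat x) (B (F.feat x)) := by
  have h := ((trReal H).flip B).integral_comp_comm (F.integrable_smul_dirac hs)
  simp only [map_smul, ContinuousLinearMap.flip_apply, trReal_apply, tr_dirac] at h
  rw [state, ← h]
  rfl

theorem op_state_apply {s : Sq → ℝ} (hs : Integrable s) (v : H) :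
    op H (F.state s) v = ∫ x, ((s x : ℂ) * inner ℂ (F.feat x) v) • F.feat x := by
  have h := ((ContinuousLinearMap.apply ℝ H v).comp
    ((ContinuousLinearMap.restrictScalarsL ℂ H H ℝ ℝ).comp (op H))).integral_comp_comm
      (F.integrable_smul_dirac hs)
  have e : ∀ X : TraceSpace H, ((ContinuousLinearMap.apply ℝ H v).comp
    ((ContinuousLinearMap.restrictScalarsL ℂ H H ℝ ℝ).comp (op H))) X = op H X v := fun _ => rfl
  simp only [e, map_smul, smul_apply, op_dirac] at h
  rw [state, ← h]
  congr 1
  ext x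
  rw [mul_smul, Complex.coe_smul]

/-- The evaluation `v ↦ ⟨A_x, v⟩`. -/
def evalMap : H →L[ℂ] C(Sq, ℂ) :=
  LinearMap.mkContinuous
    { toFun := fun v => ⟨fun x => inner ℂ (F.feat x) v, by
        have := F.continuous_feat
        fun_prop⟩
      map_add' := fun v w => by ext x; simp [inner_add_right]
      map_smul' := fun c v => by ext x; simp [inner_smul_right] }
    F.featBound
    (fun v => (ContinuousMap.norm_le _ (mul_nonneg F.featBound_nonneg (norm_nonneg v))).2 fun x =>
      (norm_inner_le_norm _ _).trans (mul_le_mul_of_nonneg_right (F.norm_feat_le x) (norm_nonneg v)))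

theorem evalMap_apply (v : H) (x : Sq) : F.evalMap v x = inner ℂ (F.feat x) v := rfl

theorem norm_smear_le (s : L2) (f : C(Sq, ℂ)) (y : Sq) :
    ‖((s y : ℂ) * f y) • F.feat y‖ ≤ ‖f‖ * F.featBound * ‖s y‖ := by
  rw [norm_smul, norm_mul, Complex.norm_real]
  calc ‖s y‖ * ‖f y‖ * ‖F.feat y‖ ≤ ‖s y‖ * ‖f‖ * F.featBound := by
        gcongr
        · exact f.norm_coe_le_norm y
        · exact F.norm_feat_le y
    _ = _ := by ring

theorem integrable_smear (s : L2) (f : C(Sq, ℂ)) :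
    Integrable (fun y => ((s y : ℂ) * f y) • F.feat y) := by
  refine ((integrable_L2 s).norm.const_mul (‖f‖ * F.featBound)).mono' ?_
    (Eventually.of_forall fun y => F.norm_smear_le s f y)
  have h1 : AEStronglyMeasurable (fun y => ((s y : ℝ) : ℂ)) (volume : Measure Sq) :=
    (integrable_L2 s).ofReal.aestronglyMeasurable
  exact (h1.mul f.continuous.aestronglyMeasurable).smul F.continuous_feat.aestronglyMeasurable

/-- The smearing `f ↦ ∫ s(y) f(y) A_y dy`. -/
def smear (s : L2) : C(Sq, ℂ) →L[ℂ] H :=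
  LinearMap.mkContinuous
    { toFun := fun f => ∫ y, ((s y : ℂ) * f y) • F.feat y
      map_add' := fun f g => by
        rw [← integral_add (F.integrable_smear s f) (F.integrable_smear s g)]
        congr 1
        ext y
        simp [mul_add, add_smul]
      map_smul' := fun c f => by
        rw [RingHom.id_apply, ← integral_smul]
        congr 1
        ext y
        simp only [ContinuousMap.smul_apply, smul_eq_mul, smul_smul]
        congr 1
        ring }
    (F.featBound * ∫ y, ‖s y‖)
    (fun f => by
      refine (norm_integral_le_of_norm_le
        ((integrable_L2 s).norm.const_mul (‖f‖ * F.featBound))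
        (Eventually.of_forall fun y => F.norm_smear_le s f y)).trans ?_
      rw [integral_const_mul]
      exact le_of_eq (by ring))

theorem smear_evalMap (s : L2) (v : H) : F.smear s (F.evalMap v) = op H (F.state s) v := by
  rw [F.op_state_apply (integrable_L2 s)]
  rfl

/-- The operator Cσ factors through the feature space. Together with `smear_evalMap` this presents
Cσ as a product ab and `interp t * op H (F.state s)` as ba, so the resolvent on continuous functions
can be read on `H`. -/
theorem mulOp_apply (s : L2) (t : ℕ → ℝ) (f : C(Sq, ℂ)) :
    mulOp (cov Φ t) s f = F.evalMap (F.interp t (F.smear s f)) := by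
  ext x
  change ∫ y, ((cov Φ t (x, y) : ℝ) : ℂ) * (s y : ℂ) * f y =
    inner ℂ (F.feat x) (F.interp t (∫ y, ((s y : ℂ) * f y) • F.feat y))
  rw [← ContinuousLinearMap.integral_comp_comm _ (F.integrable_smear s f),
    ← integral_inner ((F.interp t).integrable_comp (F.integrable_smear s f))]
  congr 1
  ext y
  rw [map_smul, inner_smul_right, inner_feat_interp]
  ring

theorem column_eq_evalMap {K : C(Sq × Sq, ℝ)} {B : H →L[ℂ] H}
    (hK : ∀ x y, inner ℂ (F.feat x) (B (F.feat y)) = ((K (x, y) : ℝ) : ℂ)) (y : Sq) :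
    column K y = F.evalMap (B (F.feat y)) := by
  ext x
  rw [evalMap_apply, hK]
  rfl

section Resolvent

variable {z : ℂ} {t : ℕ → ℝ} {s : L2}
  (hu : IsUnit (1 + (z • F.interp t) * op H (F.state s)))

include hu

theorem resolvent_evalMap (v : H) :
    resolvent z (cov Φ t) s (F.evalMap v) = F.evalMap (F.res z t (F.state s) v) := by
  set R := F.res z t (F.state s) with hR
  have h1 : ∀ w, R w + z • F.interp t (op H (F.state s) (R w)) = w := fun w => by
    have := congrArg (fun B : H →L[ℂ] H => B w) (Ring.mul_inverse_cancel _ hu)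
    simpa [hR, res, invOneAdd] using this
  have h2 : ∀ w, R w + R (z • F.interp t (op H (F.state s) w)) = w := fun w => by
    have := congrArg (fun B : H →L[ℂ] H => B w) (Ring.inverse_mul_cancel _ hu)
    simpa [hR, res, invOneAdd] using this
  -- The inverse predicted by (1 + ab)⁻¹ = 1 - a(1 + ba)⁻¹b, with a = `evalMap` and b = z `interp t`
  -- after `smear`.
  let G : C(Sq, ℂ) →L[ℂ] C(Sq, ℂ) := 1 - (F.evalMap ∘L (R ∘L (z • F.interp t)) ∘L F.smear s)
  have hG : ∀ f, G f = f - F.evalMap (R (z • F.interp t (F.smear s f))) := fun f => rfl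
  have hM : ∀ f, (1 + z • mulOp (cov Φ t) s) f =
      f + F.evalMap (z • F.interp t (F.smear s f)) := fun f => by
    rw [map_smul, ← F.mulOp_apply]
    rfl
  have e1 : (1 + z • mulOp (cov Φ t) s) * G = 1 := by
    refine ContinuousLinearMap.ext fun f => ?_
    rw [mul_apply_eq_comp, hM, hG, map_sub, smear_evalMap]
    have h3 := h1 (z • F.interp t (F.smear s f))
    set w := z • F.interp t (F.smear s f) with hw
    rw [map_sub, smul_sub, ← hw, sub_add_eq_add_sub, add_sub_assoc, one_apply_eq_self,
      ← map_sub, ← sub_eq_zero, add_sub_cancel_left, sub_sub, add_comm (z • _), h3, sub_self, map_zero]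
  have e2 : G * (1 + z • mulOp (cov Φ t) s) = 1 := by
    refine ContinuousLinearMap.ext fun f => ?_
    rw [mul_apply_eq_comp, hM, hG, map_add, smear_evalMap]
    set w := z • F.interp t (F.smear s f) with hw
    have h3 := h2 w
    rw [map_add, smul_add, ← hw, map_add, h3, one_apply_eq_self, add_sub_cancel_right]
  have e3 : resolvent z (cov Φ t) s = G :=
    (ringInverse_eq_of_mul_eq_one (R := C(Sq, ℂ) →L[ℂ] C(Sq, ℂ))
      (a := 1 + z • mulOp (cov Φ t) s) (b := G) e1 e2).2
  rw [e3, hG, smear_evalMap, ← map_sub]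
  congr 1
  exact sub_eq_of_eq_add (h2 v).symm

theorem RK_eq {K : C(Sq × Sq, ℝ)} {B : H →L[ℂ] H}
    (hK : ∀ x y, inner ℂ (F.feat x) (B (F.feat y)) = ((K (x, y) : ℝ) : ℂ)) (x y : Sq) :
    RK z (cov Φ t) s K x y = inner ℂ (F.feat x) ((F.res z t (F.state s) * B) (F.feat y)) := by
  rw [RK, F.column_eq_evalMap hK, F.resolvent_evalMap hu]
  rfl

theorem RsubK_eq {K : C(Sq × Sq, ℝ)} {B : H →L[ℂ] H}
    (hK : ∀ x y, inner ℂ (F.feat x) (B (F.feat y)) = ((K (x, y) : ℝ) : ℂ)) (x y : Sq) :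
    RsubK z (cov Φ t) s K x y =
      inner ℂ (F.feat x) (((F.res z t (F.state s) - 1) * B) (F.feat y)) := by
  rw [RsubK, sub_apply, F.column_eq_evalMap hK, F.resolvent_evalMap hu,
    one_apply_eq_self, ← map_sub]
  rfl

end Resolvent

/-- Each term of the interaction is the integral of s(x)⟨A_x, B A_x⟩ for some operator B, that is,
the trace pairing of `state s` with B. For the counterterm linear in the field, B is `interp t`,
since ⟨A_x, C(t)-operator A_x⟩ = T(t); for the logarithm, B is the averaged resolvent. -/
theorem action_eq {lam : ℂ} {δ : ℝ} (hδ : 0 < δ)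
    (hz : ∀ r : ℝ, δ ≤ ‖1 + zeta lam * (r : ℂ)‖) {t : ℕ → ℝ} (ht : t ∈ unitCube) (s : L2) :
    action Φ lam t s = F.pot (zeta lam) t (F.state s) := by
  set z := zeta lam with hzdef
  set X := F.state s with hX
  have hseg := F.segmentUnit hδ hz ht X
  have hlog : ∀ x, logTwoKernel z (cov Φ t) s x x =
      (s x : ℂ) * inner ℂ (F.feat x) (avgRes (z • F.interp t) (op H X) (F.feat x)) := by
    intro x
    have hc0 : ContinuousOn (fun u : ℝ => (invOneAdd ((u : ℂ) • z • F.interp t) (op H X) - 1) *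
        (z • F.interp t)) (Set.uIcc 0 1) := by
      rw [Set.uIcc_of_le zero_le_one]
      exact ((continuousOn_invOneAdd_segment hseg).sub continuousOn_const).mul continuousOn_const
    have h := ((innerSL ℂ (F.feat x)).comp
      (ContinuousLinearMap.apply ℂ H (F.feat x))).intervalIntegral_comp_comm
        (μ := volume) hc0.intervalIntegrable
    simp only [ContinuousLinearMap.comp_apply, ContinuousLinearMap.apply_apply,
      innerSL_apply_apply] at h
    have h' : ∫ u in (0 : ℝ)..1, inner ℂ (F.feat x)
        (((invOneAdd ((u : ℂ) • z • F.interp t) (op H X) - 1) * (z • F.interp t)) (F.feat x)) =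
        inner ℂ (F.feat x) (avgRes (z • F.interp t) (op H X) (F.feat x)) := h
    rw [← h', logTwoKernel]
    have e : ∀ u ∈ Set.uIcc (0 : ℝ) 1, inner ℂ (F.feat x)
        (((invOneAdd ((u : ℂ) • z • F.interp t) (op H X) - 1) * (z • F.interp t)) (F.feat x)) =
        RsubK (u * z) (cov Φ t) s (cov Φ t) x x * z := by
      intro u hu
      rw [Set.uIcc_of_le zero_le_one] at hu
      have hu' : IsUnit (1 + ((u * z) • F.interp t) * op H (F.state s)) := by
        have := hseg u hu
        rwa [smul_smul] at this
      rw [F.RsubK_eq hu' (F.inner_feat_interp t), mul_smul_comm, smul_apply, inner_smul_right,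
        smul_smul, mul_comm]
      rfl
    rw [intervalIntegral.integral_congr e, intervalIntegral.integral_mul_const]
    ring
  have hs := integrable_L2 s
  have hi : Integrable (fun x => ((s x : ℝ) : ℂ)) (volume : Measure Sq) := hs.ofReal
  have hB : ∀ B : H →L[ℂ] H, Integrable (fun x => (s x : ℂ) * inner ℂ (F.feat x) (B (F.feat x)))
      (volume : Measure Sq) := fun B => by
    have hc : Continuous fun x => inner ℂ (F.feat x) (B (F.feat x)) := by
      have := F.continuous_feat
      fun_prop
    exact hi.mul_bdd (c := F.featBound * (‖B‖ * F.featBound)) hc.aestronglyMeasurable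
      (Eventually.of_forall fun x => (norm_inner_le_norm _ _).trans
        (mul_le_mul (F.norm_feat_le x)
          ((B.le_opNorm _).trans (mul_le_mul_of_nonneg_left (F.norm_feat_le x) (norm_nonneg _)))
          (norm_nonneg _) F.featBound_nonneg))
  have hT : ∀ x, (tad Φ t : ℂ) * (s x : ℂ) =
      (s x : ℂ) * inner ℂ (F.feat x) (F.interp t (F.feat x)) := fun x => by
    rw [inner_feat_interp_self, mul_comm]
  rw [action]
  simp only [← hzdef, hlog, mul_assoc z, hT]
  rw [integral_sub, integral_add, integral_const, integral_const_mul, integral_const_mul,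
    ← F.tr_state hs, ← F.tr_state hs, pot, ← hX]
  · have : 3 * lam = -(3 / 4) * z ^ 2 := by rw [hzdef, zeta_sq]; ring
    simp [this]
  · exact integrable_const _
  · exact (hB _).const_mul z
  · exact (integrable_const _).add ((hB _).const_mul z)
  · exact (hB _).const_mul _

end Features

/-! ### Construction of the feature space -/

section FeatureSpace

/-- The range of the parameter `α` in the slice `j`. -/
def sliceRange (Φ : Model) : ℕ → Set ℝ
  | 0 => Set.Ioi 1
  | j + 1 => Set.Ioc (((Φ.M : ℝ) ^ (2 * (j + 1)))⁻¹) (((Φ.M : ℝ) ^ (2 * j))⁻¹)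

theorem measurableSet_sliceRange (Φ : Model) (j : ℕ) : MeasurableSet (sliceRange Φ j) := by
  cases j with
  | zero => exact measurableSet_Ioi
  | succ j => exact measurableSet_Ioc

/-- A positive lower bound of the slice. -/
def sliceMin (Φ : Model) (j : ℕ) : ℝ := ((Φ.M : ℝ) ^ (2 * j))⁻¹

theorem sliceMin_pos (Φ : Model) (j : ℕ) : 0 < sliceMin Φ j := by
  have hM : (0 : ℝ) < (Φ.M : ℝ) := by exact_mod_cast (zero_lt_one.trans Φ.one_lt_M)
  unfold sliceMin
  positivity

theorem sliceRange_subset (Φ : Model) (j : ℕ) : sliceRange Φ j ⊆ Set.Ioi (sliceMin Φ j) := by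
  cases j with
  | zero => simp [sliceRange, sliceMin]
  | succ j => exact Set.Ioc_subset_Ioi_self

theorem sliceFun_eq (Φ : Model) (j : ℕ) (x y : Sq) :
    sliceFun Φ j x y = ∫ α in sliceRange Φ j, heat Φ.mass α x y := by
  cases j <;> rfl

/-- The measure `e^{-α m²} dα / α` on the slice. -/
def alphaMeasure (Φ : Model) (j : ℕ) : Measure ℝ :=
  (volume.restrict (sliceRange Φ j)).withDensity
    fun α => ENNReal.ofReal (Real.exp (-α * Φ.mass ^ 2) / α)

theorem integrableOn_density (Φ : Model) (j : ℕ) :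
    IntegrableOn (fun α => Real.exp (-α * Φ.mass ^ 2) / α) (sliceRange Φ j) := by
  have ha := sliceMin_pos Φ j
  have hm := Φ.mass_pos
  have hb : IntegrableOn (fun α : ℝ => Real.exp (-(Φ.mass ^ 2) * α) * (sliceMin Φ j)⁻¹)
      (sliceRange Φ j) :=
    ((exp_neg_integrableOn_Ioi _ (by positivity : 0 < Φ.mass ^ 2)).mono_set
      (sliceRange_subset Φ j)).mul_const _
  refine hb.mono' (Measurable.aestronglyMeasurable (by fun_prop)) ?_
  refine (ae_restrict_iff' (measurableSet_sliceRange Φ j)).2 (Eventually.of_forall fun α hα => ?_)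
  have h1 : sliceMin Φ j < α := sliceRange_subset Φ j hα
  have h0 : 0 < α := ha.trans h1
  rw [Real.norm_of_nonneg (by positivity), div_eq_mul_inv,
    show -α * Φ.mass ^ 2 = -(Φ.mass ^ 2) * α by ring]
  exact mul_le_mul_of_nonneg_left (inv_anti₀ ha h1.le) (Real.exp_pos _).le

instance (Φ : Model) (j : ℕ) : IsFiniteMeasure (alphaMeasure Φ j) :=
  isFiniteMeasure_withDensity_ofReal (integrableOn_density Φ j).2

theorem ae_alphaMeasure (Φ : Model) (j : ℕ) : ∀ᵐ α ∂alphaMeasure Φ j, sliceMin Φ j < α := by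
  refine (withDensity_absolutelyContinuous _ _).ae_le ?_
  exact (ae_restrict_iff' (measurableSet_sliceRange Φ j)).2
    (Eventually.of_forall fun α hα => sliceRange_subset Φ j hα)

/-- The measure of the slice on the feature variables `(α, g₁, g₂)`. -/
def sliceMeasure (Φ : Model) (j : ℕ) : Measure (ℝ × (ℝ × ℝ)) :=
  (alphaMeasure Φ j).prod ((gaussianReal 0 1).prod (gaussianReal 0 1))

theorem ae_sliceMeasure (Φ : Model) (j : ℕ) : ∀ᵐ q ∂sliceMeasure Φ j, sliceMin Φ j < q.1 :=
  Measure.quasiMeasurePreserving_fst.ae (ae_alphaMeasure Φ j)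

/-- The Taylor coefficient vectors, as functions. -/
def vecFun (k : ℕ × ℕ) (q : ℝ × (ℝ × ℝ)) : ℂ :=
  (4 * (Complex.I * (q.2.1 / √(2 * q.1) : ℝ))) ^ k.1 / (k.1.factorial : ℂ) *
    ((4 * (Complex.I * (q.2.2 / √(2 * q.1) : ℝ))) ^ k.2 / (k.2.factorial : ℂ))

/-- The feature vectors, as functions: plane waves. -/
def waveFun (x : Sq) (q : ℝ × (ℝ × ℝ)) : ℂ :=
  Complex.exp (Complex.I * (q.2.1 / √(2 * q.1) : ℝ) * ((x.1 : ℝ) : ℂ)) *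
    Complex.exp (Complex.I * (q.2.2 / √(2 * q.1) : ℝ) * ((x.2 : ℝ) : ℂ))

theorem measurable_vecFun (k : ℕ × ℕ) : Measurable (vecFun k) := by
  unfold vecFun; fun_prop

/-- The terms of the exponential series. -/
def expTerm (a : ℂ) (k : ℕ) : ℂ := a ^ k / (k.factorial : ℂ)

theorem summable_norm_expTerm (a : ℂ) : Summable fun k => ‖expTerm a k‖ :=
  NormedSpace.norm_expSeries_div_summable (𝔸 := ℂ) a

theorem hasSum_expTerm (a : ℂ) : HasSum (expTerm a) (Complex.exp a) := by
  rw [Complex.exp_eq_exp_ℂ]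
  exact NormedSpace.expSeries_div_hasSum_exp (𝔸 := ℂ) a

theorem hasSum_mul_of_summable_norm {ι κ : Type*} {u : ι → ℂ} {v : κ → ℂ} {a b : ℂ}
    (hu : HasSum u a) (hv : HasSum v b) (hun : Summable fun k => ‖u k‖)
    (hvn : Summable fun k => ‖v k‖) : HasSum (fun i : ι × κ => u i.1 * v i.2) (a * b) :=
  hu.mul hv (summable_mul_of_summable_norm hun hvn)

theorem mono_mul_vecFun (x : Sq) (q : ℝ × (ℝ × ℝ)) (k : ℕ × ℕ) :
    (mono k x : ℂ) * vecFun k q =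
      expTerm (Complex.I * (q.2.1 / √(2 * q.1) : ℝ) * ((x.1 : ℝ) : ℂ)) k.1 *
      expTerm (Complex.I * (q.2.2 / √(2 * q.1) : ℝ) * ((x.2 : ℝ) : ℂ)) k.2 := by
  obtain ⟨k, l⟩ := k
  have h4 : (1 / 4 : ℂ) ^ k * 4 ^ k = 1 := by rw [← mul_pow]; norm_num
  have h5 : (1 / 4 : ℂ) ^ l * 4 ^ l = 1 := by rw [← mul_pow]; norm_num
  simp only [mono, vecFun, expTerm]
  generalize (q.2.1 / √(2 * q.1) : ℝ) = a
  generalize (q.2.2 / √(2 * q.1) : ℝ) = b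
  push_cast
  rw [pow_add, mul_pow 4, mul_pow 4, mul_pow (Complex.I * (a : ℂ)), mul_pow (Complex.I * (b : ℂ))]
  calc _ = ((1 / 4 : ℂ) ^ k * 4 ^ k) * ((1 / 4 : ℂ) ^ l * 4 ^ l) *
        ((Complex.I * (a : ℂ)) ^ k * ((x.1 : ℝ) : ℂ) ^ k / (k.factorial : ℂ) *
        ((Complex.I * (b : ℂ)) ^ l * ((x.2 : ℝ) : ℂ) ^ l / (l.factorial : ℂ))) := by ring
    _ = _ := by rw [h4, h5, one_mul, one_mul]

theorem hasSum_waveFun (x : Sq) (q : ℝ × (ℝ × ℝ)) :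
    HasSum (fun k => (mono k x : ℂ) * vecFun k q) (waveFun x q) ∧
      Summable fun k => ‖(mono k x : ℂ) * vecFun k q‖ := by
  simp only [mono_mul_vecFun]
  exact ⟨hasSum_mul_of_summable_norm (hasSum_expTerm _) (hasSum_expTerm _)
    (summable_norm_expTerm _) (summable_norm_expTerm _),
    (summable_norm_expTerm _).mul_norm (summable_norm_expTerm _)⟩

/-- A constant controlling the growth of the features in the slice. -/
def growth (Φ : Model) (j : ℕ) : ℝ := 4 / √(2 * sliceMin Φ j)

/-- A square integrable function dominating the features. -/
def domFun (Φ : Model) (j : ℕ) (q : ℝ × (ℝ × ℝ)) : ℝ :=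
  Real.exp (growth Φ j * |q.2.1|) * Real.exp (growth Φ j * |q.2.2|)

/-- The lower bound on α in the slice, i.e. the ultraviolet cutoff, bounds the factor 1/√(2α) of the
frequencies; then aⁿ/n! ≤ eᵃ. -/
theorem norm_vecFun_le (Φ : Model) (j : ℕ) (k : ℕ × ℕ) {q : ℝ × (ℝ × ℝ)}
    (hq : sliceMin Φ j < q.1) : ‖vecFun k q‖ ≤ domFun Φ j q := by
  have ha := sliceMin_pos Φ j
  have hs : √(2 * sliceMin Φ j) ≤ √(2 * q.1) := Real.sqrt_le_sqrt (by linarith)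
  have hs0 : 0 < √(2 * sliceMin Φ j) := Real.sqrt_pos.2 (by linarith)
  have key : ∀ (g : ℝ) (n : ℕ), ‖(4 * (Complex.I * (g / √(2 * q.1) : ℝ))) ^ n / (n.factorial : ℂ)‖ ≤
      Real.exp (growth Φ j * |g|) := by
    intro g n
    have h1 : ‖(4 : ℂ) * (Complex.I * (g / √(2 * q.1) : ℝ))‖ ≤ growth Φ j * |g| := by
      rw [norm_mul, norm_mul, Complex.norm_I, Complex.norm_real, norm_div, Real.norm_eq_abs,
        Real.norm_of_nonneg (Real.sqrt_nonneg _), growth]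
      norm_num
      rw [div_mul_eq_mul_div, mul_div_assoc]
      gcongr
    rw [norm_div, norm_pow, Complex.norm_natCast]
    calc _ ≤ (growth Φ j * |g|) ^ n / n.factorial := by gcongr
      _ ≤ _ := Real.pow_div_factorial_le_exp _ ((norm_nonneg _).trans h1) n
  rw [vecFun, norm_mul, domFun]
  exact mul_le_mul (key _ _) (key _ _) (norm_nonneg _) (Real.exp_pos _).le

theorem integrable_exp_mul_abs_gaussianReal (v : NNReal) (c : ℝ) :
    Integrable (fun g : ℝ => Real.exp (c * |g|)) (gaussianReal 0 v) := by
  have h1 := integrable_exp_mul_gaussianReal (μ := 0) (v := v) c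
  have h2 := integrable_exp_mul_gaussianReal (μ := 0) (v := v) (-c)
  refine (h1.add h2).mono' (by fun_prop) (Eventually.of_forall fun g => ?_)
  rw [Real.norm_of_nonneg (Real.exp_pos _).le]
  simp only [Pi.add_apply]
  rcases abs_cases g with h | h <;> rw [h.1]
  · linarith [Real.exp_pos (-c * g)]
  · rw [mul_neg, neg_mul]; linarith [Real.exp_pos (c * g)]

theorem memLp_domFun (Φ : Model) (j : ℕ) : MemLp (domFun Φ j) 2 (sliceMeasure Φ j) := by
  have hm : Measurable (domFun Φ j) := by unfold domFun; fun_prop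
  refine (memLp_two_iff_integrable_sq hm.aestronglyMeasurable).2 ?_
  have h := integrable_exp_mul_abs_gaussianReal 1 (2 * growth Φ j)
  have h2 := (integrable_const (μ := alphaMeasure Φ j) (1 : ℝ)).mul_prod (h.mul_prod h)
  refine h2.congr (Eventually.of_forall fun q => ?_)
  simp only [domFun, one_mul, mul_pow, ← Real.exp_nat_mul]
  push_cast
  ring_nf

theorem memLp_vecFun (Φ : Model) (j : ℕ) (k : ℕ × ℕ) : MemLp (vecFun k) 2 (sliceMeasure Φ j) :=
  (memLp_domFun Φ j).of_le (measurable_vecFun k).aestronglyMeasurable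
    ((ae_sliceMeasure Φ j).mono fun q hq => (norm_vecFun_le Φ j k hq).trans (le_abs_self _))

/-- The Taylor coefficient vectors of the slice `j`. -/
def sliceVec (Φ : Model) (j : ℕ) (k : ℕ × ℕ) : Lp ℂ 2 (sliceMeasure Φ j) :=
  (memLp_vecFun Φ j k).toLp _

/-- A bound for the Taylor coefficient vectors. -/
def sliceBound (Φ : Model) (j : ℕ) : ℝ := ‖(memLp_domFun Φ j).toLp _‖

theorem norm_sliceVec_le (Φ : Model) (j : ℕ) (k : ℕ × ℕ) : ‖sliceVec Φ j k‖ ≤ sliceBound Φ j := by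
  refine Lp.norm_le_norm_of_ae_le ?_
  filter_upwards [(memLp_vecFun Φ j k).coeFn_toLp, (memLp_domFun Φ j).coeFn_toLp,
    ae_sliceMeasure Φ j] with q h1 h2 h3
  rw [sliceVec, h1, h2]
  exact (norm_vecFun_le Φ j k h3).trans (le_abs_self _)

theorem hasSum_sliceVec (Φ : Model) (j : ℕ) (x : Sq) :
    Summable fun k => (mono k x : ℂ) • sliceVec Φ j k := by
  refine Summable.of_norm_bounded (summable_wt.mul_right (sliceBound Φ j)) fun k => ?_
  rw [norm_smul, Complex.norm_real]
  exact mul_le_mul (abs_mono_le k x) (norm_sliceVec_le Φ j k) (norm_nonneg _) (wt_pos k).le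

theorem inner_sliceVec (Φ : Model) (j : ℕ) (k l : ℕ × ℕ) :
    inner ℂ (sliceVec Φ j k) (sliceVec Φ j l) =
      ∫ q, (starRingEnd ℂ) (vecFun k q) * vecFun l q ∂sliceMeasure Φ j := by
  rw [L2.inner_def]
  refine integral_congr_ae ?_
  filter_upwards [(memLp_vecFun Φ j k).coeFn_toLp, (memLp_vecFun Φ j l).coeFn_toLp] with q h1 h2
  rw [sliceVec, sliceVec, h1, h2, RCLike.inner_apply, mul_comm]

theorem conj_waveFun_mul (x y : Sq) (q : ℝ × (ℝ × ℝ)) :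
    (starRingEnd ℂ) (waveFun x q) * waveFun y q =
      Complex.exp (((((y.1 : ℝ) - x.1) / √(2 * q.1) : ℝ) : ℂ) * q.2.1 * Complex.I) *
        Complex.exp (((((y.2 : ℝ) - x.2) / √(2 * q.1) : ℝ) : ℂ) * q.2.2 * Complex.I) := by
  simp only [waveFun, map_mul, ← Complex.exp_conj, Complex.conj_I, Complex.conj_ofReal,
    ← Complex.exp_add, map_add]
  congr 1
  push_cast
  ring

/-- In each coordinate the characteristic function of a standard Gaussian at (y - x)/√(2α) is
exp(-(y - x)²/(4α)). The remaining factor exp(-αm²)/α is the density of `alphaMeasure`. -/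
theorem integral_wave (Φ : Model) (j : ℕ) (x y : Sq) :
    ∫ q, (starRingEnd ℂ) (waveFun x q) * waveFun y q ∂sliceMeasure Φ j =
      ((sliceFun Φ j x y : ℝ) : ℂ) := by
  simp only [conj_waveFun_mul]
  have hmeas : Measurable fun q : ℝ × (ℝ × ℝ) =>
      Complex.exp (((((y.1 : ℝ) - x.1) / √(2 * q.1) : ℝ) : ℂ) * q.2.1 * Complex.I) *
        Complex.exp (((((y.2 : ℝ) - x.2) / √(2 * q.1) : ℝ) : ℂ) * q.2.2 * Complex.I) := by
    fun_prop
  rw [sliceMeasure, integral_prod]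
  · have h1 : ∀ α : ℝ, ∫ g : ℝ × ℝ,
        Complex.exp (((((y.1 : ℝ) - x.1) / √(2 * α) : ℝ) : ℂ) * g.1 * Complex.I) *
        Complex.exp (((((y.2 : ℝ) - x.2) / √(2 * α) : ℝ) : ℂ) * g.2 * Complex.I)
          ∂(gaussianReal 0 1).prod (gaussianReal 0 1) =
        charFun (gaussianReal 0 1) (((y.1 : ℝ) - x.1) / √(2 * α)) *
          charFun (gaussianReal 0 1) (((y.2 : ℝ) - x.2) / √(2 * α)) := by
      intro α
      rw [integral_prod_mul (μ := gaussianReal 0 1) (ν := gaussianReal 0 1)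
        (f := fun g : ℝ => Complex.exp (((((y.1 : ℝ) - x.1) / √(2 * α) : ℝ) : ℂ) * g * Complex.I))
        (g := fun g : ℝ => Complex.exp (((((y.2 : ℝ) - x.2) / √(2 * α) : ℝ) : ℂ) * g * Complex.I)),
        charFun_apply_real, charFun_apply_real]
    simp only [h1, charFun_gaussianReal]
    rw [alphaMeasure, integral_withDensity_eq_integral_toReal_smul (by fun_prop) (by simp),
      sliceFun_eq, ← integral_complex_ofReal]
    refine setIntegral_congr_fun (measurableSet_sliceRange Φ j) fun α hα => ?_
    have hα0 : 0 < α := (sliceMin_pos Φ j).trans (sliceRange_subset Φ j hα)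
    rw [ENNReal.toReal_ofReal (by positivity), heat, sqDist, ← Complex.exp_add, Complex.real_smul]
    have hsq : (((√(2 * α) : ℝ)) : ℂ) ^ 2 = 2 * α := by
      rw [← Complex.ofReal_pow, Real.sq_sqrt (by positivity)]; push_cast; ring
    have hαc : (α : ℂ) ≠ 0 := by exact_mod_cast hα0.ne'
    push_cast
    rw [div_mul_eq_mul_div, ← Complex.exp_add]
    congr 2
    rw [div_pow, div_pow, hsq]
    field_simp
    ring
  · refine (integrable_const (1 : ℝ)).mono' hmeas.aestronglyMeasurable
      (Eventually.of_forall fun q => ?_)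
    rw [norm_mul, ← Complex.ofReal_mul, ← Complex.ofReal_mul, Complex.norm_exp_ofReal_mul_I,
      Complex.norm_exp_ofReal_mul_I, mul_one]

-- The two Taylor series are multiplied pointwise and integrated term by term; the products are
-- dominated by summable weights times `domFun` squared, which is integrable.
set_option maxHeartbeats 1000000 in
theorem inner_sliceFeature (Φ : Model) (j : ℕ) (x y : Sq) :
    inner ℂ (∑' k, (mono k x : ℂ) • sliceVec Φ j k) (∑' k, (mono k y : ℂ) • sliceVec Φ j k) =
      ((sliceFun Φ j x y : ℝ) : ℂ) := by
  set G : (ℕ × ℕ) × (ℕ × ℕ) → ℝ × (ℝ × ℝ) → ℂ := fun i q =>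
    (starRingEnd ℂ) ((mono i.1 x : ℂ) * vecFun i.1 q) * ((mono i.2 y : ℂ) * vecFun i.2 q) with hG
  have hGm : ∀ i, Measurable (G i) := fun i => by
    have h1 := measurable_vecFun i.1
    have h2 := measurable_vecFun i.2
    exact (Complex.continuous_conj.measurable.comp (h1.const_mul _)).mul (h2.const_mul _)
  have hbound : ∀ i, ∀ᵐ q ∂sliceMeasure Φ j, ‖G i q‖ ≤
      wt i.1 * wt i.2 * (domFun Φ j q ^ 2) := fun i => by
    filter_upwards [ae_sliceMeasure Φ j] with q hq
    have h1 := norm_vecFun_le Φ j i.1 hq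
    have h2 := norm_vecFun_le Φ j i.2 hq
    have m1 := abs_mono_le i.1 x
    have m2 := abs_mono_le i.2 y
    have w1 := (wt_pos i.1).le
    have w2 := (wt_pos i.2).le
    have hd : 0 ≤ domFun Φ j q := (norm_nonneg _).trans h1
    rw [hG]
    simp only [norm_mul, RCLike.norm_conj, Complex.norm_real, Real.norm_eq_abs]
    calc _ ≤ (wt i.1 * domFun Φ j q) * (wt i.2 * domFun Φ j q) := by gcongr
      _ = _ := by ring
  have hdom : Integrable (fun q => domFun Φ j q ^ 2) (sliceMeasure Φ j) :=
    (memLp_domFun Φ j).integrable_sq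
  have hGi : ∀ i, Integrable (G i) (sliceMeasure Φ j) := fun i =>
    (hdom.const_mul _).mono' (hGm i).aestronglyMeasurable (hbound i)
  have hsumw : Summable fun i : (ℕ × ℕ) × (ℕ × ℕ) => wt i.1 * wt i.2 :=
    summable_wt.mul_of_nonneg summable_wt (fun k => (wt_pos k).le) (fun k => (wt_pos k).le)
  have hnorm : ∀ i, ∫ q, ‖G i q‖ ∂sliceMeasure Φ j ≤
      wt i.1 * wt i.2 * ∫ q, domFun Φ j q ^ 2 ∂sliceMeasure Φ j := fun i => by
    rw [← integral_const_mul]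
    exact integral_mono_ae (hGi i).norm (hdom.const_mul _) (hbound i)
  have hsn : Summable fun i => ∫ q, ‖G i q‖ ∂sliceMeasure Φ j :=
    Summable.of_nonneg_of_le (fun i => integral_nonneg fun q => norm_nonneg _) hnorm
      (hsumw.mul_right _)
  have h1 := hasSum_integral_of_summable_integral_norm hGi hsn
  have h2 : ∀ q, ∑' i, G i q = (starRingEnd ℂ) (waveFun x q) * waveFun y q := fun q => by
    have hx := hasSum_waveFun x q
    have hy := hasSum_waveFun y q
    have hxc : HasSum (fun k => (starRingEnd ℂ) ((mono k x : ℂ) * vecFun k q))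
        ((starRingEnd ℂ) (waveFun x q)) := hx.1.map (starRingEnd ℂ) Complex.continuous_conj
    refine (hasSum_mul_of_summable_norm hxc hy.1 ?_ hy.2).tsum_eq
    simpa [RCLike.norm_conj] using hx.2
  simp only [h2, integral_wave] at h1
  have h3 : ∀ i, ∫ q, G i q ∂sliceMeasure Φ j =
      inner ℂ ((mono i.1 x : ℂ) • sliceVec Φ j i.1) ((mono i.2 y : ℂ) • sliceVec Φ j i.2) := fun i => by
    rw [inner_smul_left, inner_smul_right, inner_sliceVec, ← integral_const_mul, ← integral_const_mul]
    congr 1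
    ext q
    simp only [hG, map_mul]
    ring
  simp only [h3] at h1
  have hx := (hasSum_sliceVec Φ j x).hasSum
  have hy := (hasSum_sliceVec Φ j y).hasSum
  have h4 := h1.prod_fiberwise fun k =>
    (innerSL ℂ ((mono k x : ℂ) • sliceVec Φ j k)).hasSum hy
  have h5 := ((innerSLFlip ℂ (∑' k, (mono k y : ℂ) • sliceVec Φ j k))).hasSum hx
  exact h5.unique h4

/-- The Hilbert space of the features: the direct sum of the slices. -/
abbrev FeatureSpace (Φ : Model) : Type :=
  PiLp 2 fun j : Fin (Φ.jmax + 1) => Lp ℂ 2 (sliceMeasure Φ j)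

/-- The orthogonal projection on the slice `j`. -/
def featureProj (Φ : Model) (j : ℕ) : FeatureSpace Φ →L[ℂ] FeatureSpace Φ :=
  (PiLp.continuousLinearEquiv 2 ℂ
      fun j : Fin (Φ.jmax + 1) => Lp ℂ 2 (sliceMeasure Φ j)).symm.toContinuousLinearMap.comp
    (ContinuousLinearMap.pi fun i : Fin (Φ.jmax + 1) =>
      if (i : ℕ) = j then PiLp.proj 2 (fun j : Fin (Φ.jmax + 1) => Lp ℂ 2 (sliceMeasure Φ j)) i
      else 0)

theorem featureProj_apply (Φ : Model) (j : ℕ) (v : FeatureSpace Φ) (i : Fin (Φ.jmax + 1)) :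
    featureProj Φ j v i = if (i : ℕ) = j then v i else 0 := by
  by_cases h : (i : ℕ) = j <;> simp [featureProj, h]

/-- The Taylor coefficient vectors in the feature space. -/
def featureVec (Φ : Model) (k : ℕ × ℕ) : FeatureSpace Φ :=
  WithLp.toLp 2 fun j => sliceVec Φ j k

/-- The features of the model. -/
def features (Φ : Model) : Features Φ (FeatureSpace Φ) where
  proj := featureProj Φ
  proj_sa j := by
    rw [ContinuousLinearMap.isSelfAdjoint_iff_isSymmetric]
    intro v w
    simp only [ContinuousLinearMap.coe_coe, PiLp.inner_apply, featureProj_apply]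
    refine Finset.sum_congr rfl fun i _ => ?_
    split_ifs <;> simp
  proj_mul i j := by
    refine ContinuousLinearMap.ext fun v => PiLp.ext fun l => ?_
    rw [mul_apply_eq_comp, featureProj_apply, featureProj_apply]
    by_cases hij : i = j
    · subst hij
      by_cases hl : (l : ℕ) = i <;> simp [hl, featureProj_apply]
    · by_cases hl : (l : ℕ) = i
      · simp [hij, hl]
      · simp [hij, hl]
  vec := featureVec Φ
  bound := √(∑ j : Fin (Φ.jmax + 1), sliceBound Φ j ^ 2)
  norm_vec_le k := by
    rw [PiLp.norm_eq_of_L2]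
    refine Real.sqrt_le_sqrt (Finset.sum_le_sum fun j _ => ?_)
    exact pow_le_pow_left₀ (norm_nonneg _) (norm_sliceVec_le Φ j k) 2
  inner_proj j hj x y := by
    simp only [← Complex.coe_smul]
    have hs : ∀ x : Sq, Summable fun k => (mono k x : ℂ) • featureVec Φ k := fun x => by
      refine Summable.of_norm_bounded
        (summable_wt.mul_right (√(∑ j : Fin (Φ.jmax + 1), sliceBound Φ j ^ 2))) fun k => ?_
      rw [norm_smul, Complex.norm_real]
      refine mul_le_mul (abs_mono_le k x) ?_ (norm_nonneg _) (wt_pos k).le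
      rw [PiLp.norm_eq_of_L2]
      refine Real.sqrt_le_sqrt (Finset.sum_le_sum fun j _ => ?_)
      exact pow_le_pow_left₀ (norm_nonneg _) (norm_sliceVec_le Φ j k) 2
    have hcomp : ∀ (x : Sq) (i : Fin (Φ.jmax + 1)), (∑' k, (mono k x : ℂ) • featureVec Φ k) i =
        ∑' k, (mono k x : ℂ) • sliceVec Φ i k := fun x i => by
      have h := (PiLp.proj (𝕜 := ℂ) 2 (fun j : Fin (Φ.jmax + 1) =>
        Lp ℂ 2 (sliceMeasure Φ j)) i).map_tsum (hs x)
      simp only [PiLp.proj_apply] at h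
      rw [h]
      rfl
    rw [PiLp.inner_apply, Finset.sum_eq_single ⟨j, Nat.lt_succ_of_le hj⟩]
    · rw [featureProj_apply, if_pos rfl, hcomp, hcomp]
      exact inner_sliceFeature Φ j x y
    · intro i _ hi
      rw [featureProj_apply, if_neg, inner_zero_right]
      intro h
      exact hi (Fin.ext h)
    · simp

end FeatureSpace

/-! ### Gaussian families -/

namespace IsCentredGaussian

variable {T Ω : Type*} [MeasurableSpace Ω] {P : Measure Ω} {X : T → Ω → ℝ} {K : T → T → ℝ}
  (hX : IsCentredGaussian P X K)

include hX

theorem memLp_two (a : T) : MemLp (X a) 2 P := (hX.gaussian.hasGaussianLaw_eval a).memLp_two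

theorem integrable_mul (a b : T) : Integrable (fun ω => X a ω * X b ω) P :=
  (hX.memLp_two a).integrable_mul (hX.memLp_two b)

theorem covariance_eq (a b : T) : cov[X a, X b; P] = K a b := by
  have := hX.gaussian.isProbabilityMeasure
  rw [covariance_eq_sub (hX.memLp_two a) (hX.memLp_two b), hX.mean_zero, hX.mean_zero]
  simpa using hX.covariance a b

theorem cov_self_nonneg (a : T) : 0 ≤ K a a := by
  rw [← hX.covariance]
  exact integral_nonneg fun ω => mul_self_nonneg _

theorem map_eq (a : T) : P.map (X a) = gaussianReal 0 (K a a).toNNReal := by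
  have hm := (hX.gaussian.aemeasurable a)
  rw [(hX.gaussian.hasGaussianLaw_eval a).map_eq_gaussianReal, hX.mean_zero a,
    ← covariance_self hm, hX.covariance_eq]

/-- A finite family of finite linear combinations of a centred Gaussian family. -/
theorem linear_comb {S : Type*} (I : S → Finset T) (c : S → T → ℝ) :
    IsCentredGaussian P (fun s ω => ∑ i ∈ I s, c s i * X i ω)
      (fun s s' => ∑ i ∈ I s, ∑ j ∈ I s', c s i * c s' j * K i j) where
  gaussian := hX.gaussian.of_isGaussianProcess fun s => ⟨I s,
    { toFun := fun x => ∑ i : I s, c s i * x i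
      map_add' := fun x y => by simp [mul_add, Finset.sum_add_distrib]
      map_smul' := fun r x => by
        simp only [Pi.smul_apply, smul_eq_mul, RingHom.id_apply, Finset.mul_sum]
        exact Finset.sum_congr rfl fun _ _ => by ring
      cont := by fun_prop }, fun ω => by
        simpa using (Finset.sum_coe_sort (I s) fun i => c s i * X i ω).symm⟩
  mean_zero s := by
    rw [integral_finset_sum]
    · simp [integral_const_mul, hX.mean_zero]
    · exact fun i _ => (hX.gaussian.hasGaussianLaw_eval i).integrable.const_mul _
  covariance s s' := by
    simp only [Finset.sum_mul_sum]
    rw [integral_finset_sum]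
    · refine Finset.sum_congr rfl fun i _ => ?_
      rw [integral_finset_sum]
      · refine Finset.sum_congr rfl fun j _ => ?_
        rw [← hX.covariance, ← integral_const_mul]
        congr 1
        ext ω
        ring
      · exact fun j _ => ((hX.integrable_mul i j).const_mul (c s i * c s' j)).congr
          (Eventually.of_forall fun ω => by simp only; ring)
    · exact fun i _ => integrable_finset_sum _ fun j _ =>
        ((hX.integrable_mul i j).const_mul (c s i * c s' j)).congr
          (Eventually.of_forall fun ω => by simp only; ring)

theorem comp {S : Type*} (f : S → T) :
    IsCentredGaussian P (fun s => X (f s)) (fun s s' => K (f s) (f s')) where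
  gaussian := hX.gaussian.comp_right f
  mean_zero s := hX.mean_zero (f s)
  covariance s s' := hX.covariance (f s) (f s')

theorem integrable_exp_mul (a : T) (c : ℝ) : Integrable (fun ω => Real.exp (c * X a ω)) P := by
  have h := integrable_exp_mul_gaussianReal (μ := 0) (v := (K a a).toNNReal) c
  rw [← hX.map_eq a] at h
  exact h.comp_aemeasurable (hX.gaussian.aemeasurable a)

theorem integral_exp_mul (a : T) (c : ℝ) :
    ∫ ω, Real.exp (c * X a ω) ∂P = Real.exp (c ^ 2 * K a a / 2) := by
  have h := mgf_gaussianReal (hX.map_eq a) c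
  rw [mgf] at h
  rw [h, Real.coe_toNNReal _ (hX.cov_self_nonneg a), zero_mul, zero_add, mul_comm (K a a)]

theorem lintegral_exp_mul_abs_le (a : T) {c : ℝ} (hc : 0 ≤ c) :
    ∫⁻ ω, ENNReal.ofReal (Real.exp (c * |X a ω|)) ∂P ≤
      ENNReal.ofReal (2 * Real.exp (c ^ 2 * K a a / 2)) := by
  have h1 := hX.integrable_exp_mul a c
  have h2 := hX.integrable_exp_mul a (-c)
  calc _ ≤ ∫⁻ ω, ENNReal.ofReal (Real.exp (c * X a ω) + Real.exp (-c * X a ω)) ∂P := by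
        refine lintegral_mono fun ω => ENNReal.ofReal_le_ofReal ?_
        rcases abs_cases (X a ω) with h | h <;> rw [h.1]
        · linarith [Real.exp_pos (-c * X a ω)]
        · rw [mul_neg, neg_mul]; linarith [Real.exp_pos (c * X a ω)]
    _ = ENNReal.ofReal (∫ ω, (Real.exp (c * X a ω) + Real.exp (-c * X a ω)) ∂P) :=
        (ofReal_integral_eq_lintegral_ofReal (h1.add h2)
          (Eventually.of_forall fun ω => (add_pos (Real.exp_pos _) (Real.exp_pos _)).le)).symm
    _ = _ := by
        rw [integral_add h1 h2, hX.integral_exp_mul, hX.integral_exp_mul]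
        congr 1
        rw [neg_sq]
        ring

/-- The characteristic function of a finite linear combination. -/
theorem integral_exp_I_mul_sum (I : Finset T) (c : T → ℝ) :
    ∫ ω, Complex.exp (Complex.I * ((∑ i ∈ I, c i * X i ω : ℝ) : ℂ)) ∂P =
      Complex.exp (-((∑ i ∈ I, ∑ j ∈ I, c i * c j * K i j : ℝ) : ℂ) / 2) := by
  have hY := hX.linear_comb (fun _ : Unit => I) (fun _ => c)
  have hm := hY.gaussian.aemeasurable ()
  have h := charFun_gaussianReal (μ := 0)
    (v := (∑ i ∈ I, ∑ j ∈ I, c i * c j * K i j).toNNReal) 1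
  rw [← hY.map_eq (), charFun_apply_real, integral_map hm (by fun_prop)] at h
  rw [Real.coe_toNNReal _ (hY.cov_self_nonneg ())] at h
  simp only [Complex.ofReal_one, one_mul, Complex.ofReal_zero, mul_zero, zero_mul, one_pow,
    mul_one, zero_sub] at h
  rw [neg_div, ← h]
  congr 1
  ext ω
  rw [mul_comm]

end IsCentredGaussian

/-! ### Gaussian integration by parts -/

theorem integrable_exp_abs_mul_gaussian {v : ℝ} (hv : 0 < v) (c : ℝ) :
    Integrable (fun r : ℝ => Real.exp (c * |r|) * Real.exp (-(r ^ 2) / (2 * v))) := by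
  have hb : (0 : ℝ) < 1 / (2 * v) := by positivity
  have key : ∀ c : ℝ, Integrable (fun r : ℝ => Real.exp (c * r) * Real.exp (-(r ^ 2) / (2 * v))) := by
    intro c
    have h := ((integrable_exp_neg_mul_sq hb).comp_sub_right (c * v)).const_mul
      (Real.exp (c ^ 2 * v / 2))
    refine h.congr (Eventually.of_forall fun r => ?_)
    simp only
    rw [← Real.exp_add, ← Real.exp_add]
    congr 1
    field_simp
    ring
  refine ((key c).add (key (-c))).mono' (by fun_prop) (Eventually.of_forall fun r => ?_)
  rw [Real.norm_of_nonneg (by positivity)]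
  simp only [Pi.add_apply]
  rcases abs_cases r with h | h <;> rw [h.1]
  · linarith [mul_pos (Real.exp_pos (-c * r)) (Real.exp_pos (-(r ^ 2) / (2 * v)))]
  · rw [mul_neg, neg_mul]
    linarith [mul_pos (Real.exp_pos (c * r)) (Real.exp_pos (-(r ^ 2) / (2 * v)))]

/-- Stein's identity for functions of exponential growth. -/
theorem integral_mul_gaussianReal_eq {v : NNReal} (hv : v ≠ 0) {h h' : ℝ → ℂ} {C c : ℝ}
    (hd : ∀ r, HasDerivAt h (h' r) r) (hm : Continuous h')
    (hb : ∀ r, ‖h r‖ ≤ C * Real.exp (c * |r|)) (hb' : ∀ r, ‖h' r‖ ≤ C * Real.exp (c * |r|)) :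
    ∫ r, (r : ℂ) * h r ∂gaussianReal 0 v = (v : ℂ) * ∫ r, h' r ∂gaussianReal 0 v := by
  have hv0 : (0 : ℝ) < v := by positivity
  have hvc : ((v : ℝ) : ℂ) ≠ 0 := by exact_mod_cast hv0.ne'
  set ρ : ℝ → ℝ := gaussianPDFReal 0 v with hρ
  have hρe : ∀ r, ρ r = (√(2 * Real.pi * v))⁻¹ * Real.exp (-(r ^ 2) / (2 * v)) := fun r => by
    simp [hρ, gaussianPDFReal]
  have hρd : ∀ r, HasDerivAt ρ (-(r / v) * ρ r) r := by
    intro r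
    have h1 : HasDerivAt (fun r : ℝ => -(r ^ 2) / (2 * (v : ℝ))) (-(r / v)) r := by
      refine (((hasDerivAt_pow 2 r).neg).div_const (2 * (v : ℝ))).congr_deriv ?_
      field_simp
      norm_num
    have h2 := (h1.exp).const_mul (√(2 * Real.pi * v))⁻¹
    rw [show ρ = fun r => (√(2 * Real.pi * v))⁻¹ * Real.exp (-(r ^ 2) / (2 * v)) from funext hρe]
    refine h2.congr_deriv ?_
    ring
  have hρc : Continuous ρ := continuous_iff_continuousAt.2 fun r => (hρd r).continuousAt
  have hρ0 : ∀ r, 0 ≤ ρ r := gaussianPDFReal_nonneg 0 v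
  have hhc : Continuous h := continuous_iff_continuousAt.2 fun r => (hd r).continuousAt
  have hC : 0 ≤ C := by
    have := (norm_nonneg _).trans (hb 0)
    simpa using this
  have hI : ∀ c : ℝ, Integrable (fun r => Real.exp (c * |r|) * ρ r) := fun c => by
    refine ((integrable_exp_abs_mul_gaussian hv0 c).const_mul (√(2 * Real.pi * v))⁻¹).congr
      (Eventually.of_forall fun r => ?_)
    simp only [hρe]
    ring
  have i1 : Integrable (fun r => (ρ r : ℂ) * h' r) := by
    refine ((hI c).const_mul C).mono' (by fun_prop) (Eventually.of_forall fun r => ?_)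
    rw [norm_mul, Complex.norm_real, Real.norm_of_nonneg (hρ0 r)]
    nlinarith [hb' r, hρ0 r]
  have i0 : Integrable (fun r => (ρ r : ℂ) * h r) := by
    refine ((hI c).const_mul C).mono' (by fun_prop) (Eventually.of_forall fun r => ?_)
    rw [norm_mul, Complex.norm_real, Real.norm_of_nonneg (hρ0 r)]
    nlinarith [hb r, hρ0 r]
  have i2 : Integrable (fun r => (ρ r : ℂ) * ((r : ℂ) * h r)) := by
    refine ((hI (c + 1)).const_mul C).mono' (by fun_prop) (Eventually.of_forall fun r => ?_)
    rw [norm_mul, norm_mul, Complex.norm_real, Complex.norm_real, Real.norm_of_nonneg (hρ0 r),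
      Real.norm_eq_abs]
    have h1 : |r| ≤ Real.exp |r| := (le_add_of_nonneg_right zero_le_one).trans (Real.add_one_le_exp _)
    have h2 : |r| * ‖h r‖ ≤ Real.exp |r| * (C * Real.exp (c * |r|)) :=
      mul_le_mul h1 (hb r) (norm_nonneg _) (Real.exp_pos _).le
    have h3 : Real.exp ((c + 1) * |r|) = Real.exp (c * |r|) * Real.exp |r| := by
      rw [← Real.exp_add]; ring_nf
    rw [h3]
    nlinarith [hρ0 r]
  have hz := integral_eq_zero_of_hasDerivAt_of_integrable
    (f := fun r => (ρ r : ℂ) * h r)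
    (f' := fun r => (ρ r : ℂ) * h' r - (v : ℂ)⁻¹ * ((ρ r : ℂ) * ((r : ℂ) * h r)))
    (fun r => by
      refine (((hρd r).ofReal_comp).mul (hd r)).congr_deriv ?_
      push_cast
      field_simp
      ring) (i1.sub (i2.const_mul _)) i0
  rw [integral_sub i1 (i2.const_mul _), integral_const_mul, sub_eq_zero] at hz
  rw [integral_gaussianReal_eq_integral_smul hv, integral_gaussianReal_eq_integral_smul hv]
  simp only [Complex.real_smul]
  rw [← hρ, hz, ← mul_assoc, mul_inv_cancel₀ hvc, one_mul]

/-- A `C¹` function which, with its derivative, grows at most exponentially. -/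
structure TameC1 {E G : Type*} [NormedAddCommGroup E] [NormedSpace ℝ E] [NormedAddCommGroup G]
    [NormedSpace ℝ G] (f : E → G) : Prop where
  contDiff : ContDiff ℝ 1 f
  growth : ∃ C, 0 ≤ C ∧ ∀ x, ‖f x‖ ≤ C * Real.exp (C * ‖x‖) ∧
    ‖fderiv ℝ f x‖ ≤ C * Real.exp (C * ‖x‖)

theorem exp_sum_le {ι : Type*} (F : Finset ι) (hF : F.Nonempty) (a : ι → ℝ) :
    Real.exp (∑ i ∈ F, a i) ≤ ∑ i ∈ F, Real.exp (F.card * a i) := by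
  obtain ⟨j, hj, hm⟩ := F.exists_max_image a hF
  calc Real.exp (∑ i ∈ F, a i) ≤ Real.exp (F.card * a j) := by
        refine Real.exp_le_exp.2 ((Finset.sum_le_card_nsmul F a (a j) hm).trans_eq ?_)
        rw [nsmul_eq_mul]
    _ ≤ _ := Finset.single_le_sum (f := fun i => Real.exp (F.card * a i))
        (fun i _ => (Real.exp_pos _).le) hj

namespace IsCentredGaussian

variable {T Ω : Type*} [MeasurableSpace Ω] {P : Measure Ω} {X : T → Ω → ℝ} {K : T → T → ℝ}
  (hX : IsCentredGaussian P X K)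

include hX

theorem integrable_exp_mul_abs (a : T) (c : ℝ) :
    Integrable (fun ω => Real.exp (c * |X a ω|)) P := by
  have hm := hX.gaussian.aemeasurable a
  refine ((hX.integrable_exp_mul a c).add (hX.integrable_exp_mul a (-c))).mono'
    (by fun_prop) (Eventually.of_forall fun ω => ?_)
  rw [Real.norm_of_nonneg (Real.exp_pos _).le]
  simp only [Pi.add_apply]
  rcases abs_cases (X a ω) with h | h <;> rw [h.1]
  · linarith [Real.exp_pos (-c * X a ω)]
  · rw [mul_neg, neg_mul]; linarith [Real.exp_pos (c * X a ω)]

theorem integrable_exp_sum_abs (F : Finset T) (c : T → ℝ) :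
    Integrable (fun ω => Real.exp (∑ i ∈ F, c i * |X i ω|)) P := by
  have := hX.gaussian.isProbabilityMeasure
  rcases F.eq_empty_or_nonempty with rfl | hF
  · simp
  have hm : ∀ i, AEMeasurable (X i) P := hX.gaussian.aemeasurable
  refine (integrable_finset_sum F fun i _ =>
    hX.integrable_exp_mul_abs i (F.card * c i)).mono' (by fun_prop)
    (Eventually.of_forall fun ω => ?_)
  rw [Real.norm_of_nonneg (Real.exp_pos _).le]
  refine (exp_sum_le F hF _).trans (le_of_eq (Finset.sum_congr rfl fun i _ => ?_))
  rw [mul_assoc]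

/-- Gaussian integration by parts, for a function of a finite combination of the field. -/
theorem integral_mul_finset {E : Type*} [NormedAddCommGroup E] [NormedSpace ℝ E]
    {f : E → ℂ} (hf : TameC1 f) (a : T) (F : Finset T) (b : T → E) :
    ∫ ω, (X a ω : ℂ) * f (∑ i ∈ F, X i ω • b i) ∂P =
      ∫ ω, fderiv ℝ f (∑ i ∈ F, X i ω • b i) (∑ i ∈ F, K a i • b i) ∂P := by
  classical
  have := hX.gaussian.isProbabilityMeasure
  obtain ⟨hf1, C, hC, hg⟩ := hf
  have hm : ∀ i, AEMeasurable (X i) P := hX.gaussian.aemeasurable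
  have hfc : Continuous f := hf1.continuous
  have hfd : Continuous (fderiv ℝ f) := hf1.continuous_fderiv one_ne_zero
  -- A variable of variance 0 vanishes almost surely, and so do all its covariances; both sides are
  -- then 0.
  rcases (hX.cov_self_nonneg a).eq_or_lt with h0 | hv
  · have hXa : X a =ᵐ[P] 0 := by
      have h1 := hX.covariance a a
      rw [← h0, integral_eq_zero_iff_of_nonneg (fun ω => mul_self_nonneg _)
        (hX.integrable_mul a a)] at h1
      filter_upwards [h1] with ω hω
      simpa using hω
    have hK : ∀ i, K a i = 0 := fun i => by
      rw [← hX.covariance, ← integral_zero Ω ℝ]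
      refine integral_congr_ae ?_
      filter_upwards [hXa] with ω hω
      simp [hω]
    simp only [hK, zero_smul, Finset.sum_const_zero, map_zero, integral_zero]
    rw [← integral_zero Ω ℂ]
    refine integral_congr_ae ?_
    filter_upwards [hXa] with ω hω
    simp [hω]
  set v := K a a with hvdef
  set c : E := ∑ i ∈ F, K a i • b i with hc
  -- Regression on `X a`: the residuals are uncorrelated with `X a`, hence independent of it by
  -- joint Gaussianity. For fixed residuals the claim is Stein's identity in one variable.
  set Z : F → Ω → ℝ := fun i ω => X i ω - K a i / v * X a ω with hZ
  have hZm : AEMeasurable (fun ω i => Z i ω) P :=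
    aemeasurable_pi_lambda _ fun i => (hm i).sub ((hm a).const_mul _)
  have hgauss : IsGaussianProcess (Sum.elim Z (fun _ : Unit => X a)) P := by
    refine hX.gaussian.of_isGaussianProcess fun s => ?_
    rcases s with i | u
    · exact ⟨{i.1, a},
        { toFun := fun x => x ⟨i, by simp⟩ - K a i / v * x ⟨a, by simp⟩
          map_add' := fun x y => by simp only [Pi.add_apply]; ring
          map_smul' := fun r x => by
            simp only [Pi.smul_apply, smul_eq_mul, RingHom.id_apply]; ring
          cont := by fun_prop }, fun ω => rfl⟩
    · exact ⟨{a},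
        { toFun := fun x => x ⟨a, by simp⟩
          map_add' := fun x y => rfl
          map_smul' := fun r x => rfl
          cont := by fun_prop }, fun ω => rfl⟩
  have hind := hgauss.indepFun_of_covariance_eq_zero
    (fun i => (hm i).sub ((hm a).const_mul _)) (fun _ => hm a) fun i _ => by
    simp only [hZ]
    rw [covariance_fun_sub_left (hX.memLp_two i) ((hX.memLp_two a).const_mul _) (hX.memLp_two a),
      covariance_const_mul_left, hX.covariance_eq, hX.covariance_eq, ← hvdef,
      div_mul_cancel₀ _ hv.ne', sub_eq_zero, ← hX.covariance, ← hX.covariance]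
    simp_rw [mul_comm]
  have hind' : IndepFun (fun ω i => Z i ω) (X a) P :=
    hind.comp measurable_id (measurable_pi_apply ())
  have hmap : P.map (fun ω => ((fun i => Z i ω : F → ℝ), X a ω)) =
      (P.map fun ω i => Z i ω).prod (gaussianReal 0 v.toNNReal) := by
    rw [(indepFun_iff_map_prod_eq_prod_map_map hZm (hm a)).1 hind', hX.map_eq]
  have hpm : AEMeasurable (fun ω => ((fun i => Z i ω : F → ℝ), X a ω)) P := hZm.prodMk (hm a)
  set pt : (F → ℝ) × ℝ → E := fun q => (∑ i : F, q.1 i • b i) + (q.2 / v) • c with hpt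
  have hptc : Continuous pt := by
    simp only [hpt]
    fun_prop
  have hsum : ∀ ω, pt ((fun i => Z i ω : F → ℝ), X a ω) = ∑ i ∈ F, X i ω • b i := fun ω => by
    simp only [hpt, hZ, hc]
    rw [Finset.sum_coe_sort F (fun i => (X i ω - K a i / v * X a ω) • b i), Finset.smul_sum,
      ← Finset.sum_add_distrib]
    refine Finset.sum_congr rfl fun i _ => ?_
    rw [smul_smul, ← add_smul]
    congr 1
    ring
  set S : Ω → ℝ := fun ω => Real.exp (∑ i ∈ F, C * ‖b i‖ * |X i ω|) with hS
  have hSi : Integrable S P := hX.integrable_exp_sum_abs F _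
  have hSn : ∀ ω, Real.exp (C * ‖∑ i ∈ F, X i ω • b i‖) ≤ S ω := fun ω => by
    refine Real.exp_le_exp.2 ?_
    simp_rw [mul_assoc]
    rw [← Finset.mul_sum]
    refine mul_le_mul_of_nonneg_left ((norm_sum_le _ _).trans_eq ?_) hC
    exact Finset.sum_congr rfl fun i _ => by rw [norm_smul, Real.norm_eq_abs, mul_comm]
  have hXs : Integrable (fun ω => Real.exp |X a ω| * S ω) P := by
    -- Since `a` may or may not belong to `F`, the exponent of `|X a|` is 1 plus its exponent in the
    -- sum over `F`, if it has one.
    have := hX.integrable_exp_sum_abs (insert a F)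
      (fun i => (if i = a then 1 else 0) + if i ∈ F then C * ‖b i‖ else 0)
    refine this.congr (Eventually.of_forall fun ω => ?_)
    simp only [hS]
    rw [← Real.exp_add]
    congr 1
    simp_rw [add_mul, ite_mul, zero_mul, one_mul]
    rw [Finset.sum_add_distrib, Finset.sum_ite_eq']
    simp only [Finset.mem_insert, true_or, if_true]
    congr 1
    rw [← Finset.sum_filter]
    congr 1
    ext i
    simp only [Finset.mem_filter, Finset.mem_insert]
    tauto
  have hle : ∀ r : ℝ, |r| ≤ Real.exp |r| := fun r =>
    (le_add_of_nonneg_right zero_le_one).trans (Real.add_one_le_exp _)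
  have hsm : AEStronglyMeasurable (fun ω => ∑ i ∈ F, X i ω • b i) P := by
    have : ∀ i, AEStronglyMeasurable (X i) P := fun i => (hm i).aestronglyMeasurable
    fun_prop
  have i1 : Integrable (fun ω => (X a ω : ℂ) * f (∑ i ∈ F, X i ω • b i)) P := by
    refine (hXs.const_mul C).mono' (AEStronglyMeasurable.mul (by fun_prop)
      (hfc.comp_aestronglyMeasurable hsm)) (Eventually.of_forall fun ω => ?_)
    rw [norm_mul, Complex.norm_real, Real.norm_eq_abs]
    calc _ ≤ Real.exp |X a ω| * (C * S ω) := by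
          refine mul_le_mul (hle _) ((hg _).1.trans ?_) (norm_nonneg _) (Real.exp_pos _).le
          exact mul_le_mul_of_nonneg_left (hSn ω) hC
      _ = _ := by ring
  have i2 : Integrable (fun ω => fderiv ℝ f (∑ i ∈ F, X i ω • b i) c) P := by
    refine ((hSi.const_mul C).mul_const ‖c‖).mono'
      ((hfd.clm_apply continuous_const).comp_aestronglyMeasurable hsm)
      (Eventually.of_forall fun ω => ?_)
    refine (ContinuousLinearMap.le_opNorm _ _).trans ?_
    refine mul_le_mul_of_nonneg_right ((hg _).2.trans ?_) (norm_nonneg _)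
    exact mul_le_mul_of_nonneg_left (hSn ω) hC
  have e1 : Continuous fun q : (F → ℝ) × ℝ => (q.2 : ℂ) * f (pt q) := by fun_prop
  have e2 : Continuous fun q : (F → ℝ) × ℝ => fderiv ℝ f (pt q) c :=
    (hfd.comp hptc).clm_apply continuous_const
  simp_rw [← hsum] at i1 i2 ⊢
  have j1 := (integrable_map_measure (f := fun ω => ((fun i => Z i ω : F → ℝ), X a ω))
    (g := fun q => (q.2 : ℂ) * f (pt q)) e1.aestronglyMeasurable hpm).2 i1
  have j2 := (integrable_map_measure (f := fun ω => ((fun i => Z i ω : F → ℝ), X a ω))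
    (g := fun q => fderiv ℝ f (pt q) c) e2.aestronglyMeasurable hpm).2 i2
  have k1 := integral_map (φ := fun ω => ((fun i => Z i ω : F → ℝ), X a ω))
    (f := fun q => (q.2 : ℂ) * f (pt q)) hpm e1.aestronglyMeasurable
  have k2 := integral_map (φ := fun ω => ((fun i => Z i ω : F → ℝ), X a ω))
    (f := fun q => fderiv ℝ f (pt q) c) hpm e2.aestronglyMeasurable
  rw [← k1, ← k2]
  rw [hmap] at j1 j2 ⊢
  rw [integral_prod _ j1, integral_prod _ j2]
  refine integral_congr_ae (Eventually.of_forall fun z => ?_)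
  simp only
  have hvn : v.toNNReal ≠ 0 := by simpa using hv
  have hder : ∀ r, HasDerivAt (fun r => f (pt (z, r))) (fderiv ℝ f (pt (z, r)) (v⁻¹ • c)) r := by
    intro r
    have h1 : HasDerivAt (fun r => pt (z, r)) (v⁻¹ • c) r := by
      have := (((hasDerivAt_id r).div_const v).smul_const c).const_add (∑ i : F, z i • b i)
      simpa [hpt] using this
    exact ((hf1.differentiable one_ne_zero) _).hasFDerivAt.comp_hasDerivAt r h1
  set z0 : E := ∑ i : F, z i • b i with hz0
  have hgrow : ∀ r, Real.exp (C * ‖pt (z, r)‖) ≤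
      Real.exp (C * ‖z0‖) * Real.exp (C * (‖c‖ / v) * |r|) := fun r => by
    rw [← Real.exp_add]
    refine Real.exp_le_exp.2 ?_
    have : ‖pt (z, r)‖ ≤ ‖z0‖ + |r| / v * ‖c‖ := by
      refine (norm_add_le _ _).trans_eq ?_
      rw [norm_smul, Real.norm_eq_abs, abs_div, abs_of_pos hv]
    calc C * ‖pt (z, r)‖ ≤ C * (‖z0‖ + |r| / v * ‖c‖) := mul_le_mul_of_nonneg_left this hC
      _ = _ := by ring
  have hst := integral_mul_gaussianReal_eq (v := v.toNNReal) hvn hder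
    (C := C * Real.exp (C * ‖z0‖) * (1 + ‖v⁻¹ • c‖)) (c := C * (‖c‖ / v))
    ((hfd.comp (hptc.comp (by fun_prop))).clm_apply continuous_const)
    (fun r => (hg _).1.trans (by
      calc _ ≤ C * (Real.exp (C * ‖z0‖) * Real.exp (C * (‖c‖ / v) * |r|)) * 1 := by
            rw [mul_one]; exact mul_le_mul_of_nonneg_left (hgrow r) hC
        _ ≤ C * (Real.exp (C * ‖z0‖) * Real.exp (C * (‖c‖ / v) * |r|)) * (1 + ‖v⁻¹ • c‖) := by
            gcongr
            exact le_add_of_nonneg_right (norm_nonneg _)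
        _ = _ := by ring))
    (fun r => (ContinuousLinearMap.le_opNorm _ _).trans (by
      calc _ ≤ C * (Real.exp (C * ‖z0‖) * Real.exp (C * (‖c‖ / v) * |r|)) * ‖v⁻¹ • c‖ := by
            gcongr
            exact (hg _).2.trans (mul_le_mul_of_nonneg_left (hgrow r) hC)
        _ ≤ C * (Real.exp (C * ‖z0‖) * Real.exp (C * (‖c‖ / v) * |r|)) * (1 + ‖v⁻¹ • c‖) := by
            gcongr
            exact le_add_of_nonneg_left zero_le_one
        _ = _ := by ring))
  rw [hst, ← integral_const_mul]
  refine integral_congr_ae (Eventually.of_forall fun r => ?_)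
  simp only [map_smul, Complex.real_smul]
  have : ((v.toNNReal : ℝ) : ℂ) * ((v⁻¹ : ℝ) : ℂ) = 1 := by
    rw [Real.coe_toNNReal _ hv.le, ← Complex.ofReal_mul, mul_inv_cancel₀ hv.ne',
      Complex.ofReal_one]
  rw [← mul_assoc]
  erw [this]
  rw [one_mul]

end IsCentredGaussian

/-- Jensen's inequality for the weights w_i/S. Their mass on `F` is at most 1; the missing mass is
placed at the point 0, where the exponential is 1, whence the leading term. -/
theorem exp_sum_le_weighted {ι : Type*} {w : ι → ℝ} (hw : ∀ i, 0 < w i) (hs : Summable w)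
    (hS : 0 < ∑' i, w i) {a : ι → ℝ} (F : Finset ι) :
    Real.exp (∑ i ∈ F, a i) ≤
      1 + ∑ i ∈ F, w i / (∑' i, w i) * Real.exp ((∑' i, w i) * (a i / w i)) := by
  set S := ∑' i, w i with hSdef
  have hle : ∑ i ∈ F, w i / S ≤ 1 := by
    rw [← Finset.sum_div, div_le_one hS]
    exact hs.sum_le_tsum F fun i _ => (hw i).le
  have h := convexOn_exp.map_add_sum_le (t := F) (w := fun i => w i / S)
    (p := fun i => S * (a i / w i)) (v := 1 - ∑ i ∈ F, w i / S) (q := 0)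
    (fun i _ => (div_pos (hw i) hS).le) (by ring) (fun _ _ => Set.mem_univ _)
    (by linarith) (Set.mem_univ _)
  simp only [smul_eq_mul, mul_zero, zero_add, Real.exp_zero, mul_one] at h
  have e : ∑ i ∈ F, a i = ∑ i ∈ F, w i / S * (S * (a i / w i)) := by
    refine Finset.sum_congr rfl fun i _ => ?_
    have := (hw i).ne'
    field_simp
  rw [e]
  refine h.trans ?_
  have : 0 ≤ ∑ i ∈ F, w i / S := Finset.sum_nonneg fun i _ => (div_pos (hw i) hS).le
  linarith

/-! ### Exponential moments of summable Gaussian families -/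

namespace IsCentredGaussian

variable {ι Ω : Type*} [Countable ι] [MeasurableSpace Ω] {P : Measure Ω} {X : ι → Ω → ℝ}
  {K : ι → ι → ℝ} (hX : IsCentredGaussian P X K) {w : ι → ℝ} (hw : ∀ i, 0 < w i)
  (hs : Summable w) (hK : ∀ i, K i i ≤ w i ^ 2)

include hX hw hs hK

/-- `X i / w i` has variance at most 1, so its exponential moments are bounded uniformly in `i`, and
the weights in front are summable. -/
theorem lintegral_tsum_exp_lt_top {c : ℝ} (hc : 0 ≤ c) :
    ∫⁻ ω, ∑' i, ENNReal.ofReal (w i * Real.exp (c * (|X i ω| / w i))) ∂P < ⊤ := by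
  have hm : ∀ i, AEMeasurable (X i) P := hX.gaussian.aemeasurable
  rw [lintegral_tsum (fun i => by fun_prop)]
  have hb : ∀ i, ∫⁻ ω, ENNReal.ofReal (w i * Real.exp (c * (|X i ω| / w i))) ∂P ≤
      ENNReal.ofReal (w i * (2 * Real.exp (c ^ 2 / 2))) := fun i => by
    simp_rw [ENNReal.ofReal_mul (hw i).le]
    rw [lintegral_const_mul' _ _ ENNReal.ofReal_ne_top]
    gcongr
    have h := hX.lintegral_exp_mul_abs_le i (c := c / w i) (div_nonneg hc (hw i).le)
    simp_rw [div_mul_eq_mul_div, ← mul_div_assoc] at h ⊢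
    refine h.trans (ENNReal.ofReal_le_ofReal ?_)
    gcongr
    rw [div_pow, div_mul_eq_mul_div, div_le_iff₀ (pow_pos (hw i) 2)]
    exact mul_le_mul_of_nonneg_left (hK i) (sq_nonneg c)
  refine (ENNReal.tsum_le_tsum hb).trans_lt ?_
  rw [← ENNReal.ofReal_tsum_of_nonneg (fun i => by have := hw i; positivity) (hs.mul_right _)]
  exact ENNReal.ofReal_lt_top

theorem ae_summable_exp {c : ℝ} (hc : 0 ≤ c) :
    ∀ᵐ ω ∂P, Summable fun i => w i * Real.exp (c * (|X i ω| / w i)) := by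
  have hm : ∀ i, AEMeasurable (X i) P := hX.gaussian.aemeasurable
  have h := ae_lt_top' (AEMeasurable.ennreal_tsum fun i => by fun_prop)
    (hX.lintegral_tsum_exp_lt_top hw hs hK hc).ne
  filter_upwards [h] with ω hω
  have h2 := ENNReal.summable_toReal hω.ne
  refine h2.congr fun i => ?_
  rw [ENNReal.toReal_ofReal]
  have := hw i
  positivity

theorem ae_summable_abs : ∀ᵐ ω ∂P, Summable fun i => |X i ω| := by
  filter_upwards [hX.ae_summable_exp hw hs hK zero_le_one] with ω h
  refine h.of_nonneg_of_le (fun i => abs_nonneg _) fun i => ?_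
  have h1 : |X i ω| / w i ≤ Real.exp (1 * (|X i ω| / w i)) := by
    rw [one_mul]
    exact (le_add_of_nonneg_right zero_le_one).trans (Real.add_one_le_exp _)
  calc |X i ω| = w i * (|X i ω| / w i) := by rw [mul_div_cancel₀ _ (hw i).ne']
    _ ≤ _ := mul_le_mul_of_nonneg_left h1 (hw i).le

theorem aestronglyMeasurable_tsum_abs :
    AEStronglyMeasurable (fun ω => ∑' i, |X i ω|) P := by
  have hm : ∀ i, AEMeasurable (X i) P := hX.gaussian.aemeasurable
  refine aestronglyMeasurable_of_tendsto_ae (u := (atTop : Filter (Finset ι)))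
    (f := fun F ω => ∑ i ∈ F, |X i ω|) (fun F => ?_) ?_
  · have hXm : ∀ i, AEStronglyMeasurable (X i) P := fun i => (hm i).aestronglyMeasurable
    simp only [← Real.norm_eq_abs]
    exact Finset.aestronglyMeasurable_fun_sum F fun i _ => (hXm i).norm
  · filter_upwards [hX.ae_summable_abs hw hs hK] with ω h
    exact h.hasSum

/-- The weighted Jensen inequality is passed to the limit over finite sets; the dominating series is
integrable by the preceding lemmas. -/
theorem integrable_exp_tsum_abs (c : ℝ) :
    Integrable (fun ω => Real.exp (c * ∑' i, |X i ω|)) P := by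
  have := hX.gaussian.isProbabilityMeasure
  have hm : ∀ i, AEMeasurable (X i) P := hX.gaussian.aemeasurable
  have hN := hX.aestronglyMeasurable_tsum_abs hw hs hK
  -- For negative `c` the integrand is at most 1, its value for `c = 0`.
  wlog hc : 0 ≤ c generalizing c
  · refine (this 0 le_rfl).mono' (by fun_prop) ?_
    filter_upwards [hX.ae_summable_abs hw hs hK] with ω h
    rw [Real.norm_of_nonneg (Real.exp_pos _).le, zero_mul]
    exact Real.exp_le_exp.2 (mul_nonpos_of_nonpos_of_nonneg (not_le.1 hc).le
      (tsum_nonneg fun i => abs_nonneg _))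
  rcases isEmpty_or_nonempty ι with he | ⟨⟨i0⟩⟩
  · simp
  set S := ∑' i, w i with hS
  have hSpos : 0 < S := hs.tsum_pos (fun i => (hw i).le) i0 (hw i0)
  have hA := hX.ae_summable_exp hw hs hK (c := S * c) (by positivity)
  have hI : Integrable (fun ω => ∑' i, w i * Real.exp (S * c * (|X i ω| / w i))) P := by
    refine ⟨aestronglyMeasurable_of_tendsto_ae (u := (atTop : Filter (Finset ι)))
      (f := fun F ω => ∑ i ∈ F, w i * Real.exp (S * c * (|X i ω| / w i)))
      (fun F => by fun_prop) ?_, ?_⟩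
    · filter_upwards [hA] with ω h using h.hasSum
    · refine (lintegral_mono_ae ?_).trans_lt (hX.lintegral_tsum_exp_lt_top hw hs hK
        (c := S * c) (by positivity))
      filter_upwards [hA] with ω h
      have h0 : ∀ i, 0 ≤ w i * Real.exp (S * c * (|X i ω| / w i)) := fun i => by
        have := hw i; positivity
      rw [← ENNReal.ofReal_tsum_of_nonneg h0 h, Real.enorm_eq_ofReal (tsum_nonneg h0)]
  refine ((integrable_const (1 : ℝ)).add (hI.const_mul S⁻¹)).mono' (by fun_prop) ?_
  filter_upwards [hA, hX.ae_summable_abs hw hs hK] with ω h h'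
  rw [Real.norm_of_nonneg (Real.exp_pos _).le]
  have hl : Tendsto (fun F : Finset ι => Real.exp (∑ i ∈ F, c * |X i ω|)) atTop
      (𝓝 (Real.exp (c * ∑' i, |X i ω|))) :=
    (Real.continuous_exp.tendsto _).comp (h'.hasSum.mul_left c)
  refine le_of_tendsto hl (Eventually.of_forall fun F => ?_)
  refine (exp_sum_le_weighted hw hs hSpos F).trans (add_le_add_right ?_ 1)
  have h0 : ∀ i, 0 ≤ w i * Real.exp (S * c * (|X i ω| / w i)) := fun i => by
    have := hw i; positivity
  refine le_trans (le_of_eq ?_) (mul_le_mul_of_nonneg_left (h.sum_le_tsum F fun i _ => h0 i)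
    (inv_nonneg.2 hSpos.le))
  rw [Finset.mul_sum]
  refine Finset.sum_congr rfl fun i _ => ?_
  rw [← hS]
  rw [show S * (c * |X i ω| / w i) = S * c * (|X i ω| / w i) by ring]
  ring

end IsCentredGaussian

/-- Gaussian integration by parts for a function of a convergent random series. -/
theorem IsCentredGaussian.integral_mul_tsum {ι T Ω : Type*} [Countable ι] [MeasurableSpace Ω]
    {P : Measure Ω} {X : T → Ω → ℝ} {K : T → T → ℝ} (hX : IsCentredGaussian P X K)
    {w : ι → ℝ} (hw : ∀ i, 0 < w i) (hs : Summable w) (g : ι → T)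
    (hK : ∀ i, K (g i) (g i) ≤ w i ^ 2)
    {E : Type*} [NormedAddCommGroup E] [NormedSpace ℝ E] [CompleteSpace E]
    {f : E → ℂ} (hf : TameC1 f) (a : T) {b : ι → E} {B : ℝ} (hB : ∀ i, ‖b i‖ ≤ B) {c : E}
    (hc : HasSum (fun i => K a (g i) • b i) c) :
    ∫ ω, (X a ω : ℂ) * f (∑' i, X (g i) ω • b i) ∂P =
      ∫ ω, fderiv ℝ f (∑' i, X (g i) ω • b i) c ∂P := by
  have := hX.gaussian.isProbabilityMeasure
  have hm : ∀ i, AEMeasurable (X i) P := hX.gaussian.aemeasurable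
  have hY := hX.comp g
  have hsum := hY.ae_summable_abs hw hs hK
  have hexp := hY.integrable_exp_tsum_abs hw hs hK
  obtain ⟨hf1, C, hC, hg⟩ := id hf
  have hfc : Continuous f := hf1.continuous
  have hfd : Continuous (fderiv ℝ f) := hf1.continuous_fderiv one_ne_zero
  set N : Ω → ℝ := fun ω => ∑' i, |X (g i) ω| with hN
  have hlim : ∀ᵐ ω ∂P, Tendsto (fun F : Finset ι => ∑ i ∈ F, X (g i) ω • b i) atTop
      (𝓝 (∑' i, X (g i) ω • b i)) := by
    filter_upwards [hsum] with ω h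
    refine (Summable.of_norm_bounded (h.mul_right B) fun i => ?_).hasSum
    rw [norm_smul, Real.norm_eq_abs]
    exact mul_le_mul_of_nonneg_left (hB i) (abs_nonneg _)
  have hbd : ∀ᵐ ω ∂P, ∀ F : Finset ι, Real.exp (C * ‖∑ i ∈ F, X (g i) ω • b i‖) ≤
      Real.exp (C * |B| * N ω) := by
    filter_upwards [hsum] with ω h F
    refine Real.exp_le_exp.2 ?_
    rw [mul_assoc]
    refine mul_le_mul_of_nonneg_left ((norm_sum_le _ _).trans ?_) hC
    calc ∑ i ∈ F, ‖X (g i) ω • b i‖ ≤ ∑ i ∈ F, |B| * |X (g i) ω| := by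
          refine Finset.sum_le_sum fun i _ => ?_
          rw [norm_smul, Real.norm_eq_abs, mul_comm]
          exact mul_le_mul_of_nonneg_right ((hB i).trans (le_abs_self B)) (abs_nonneg _)
      _ = |B| * ∑ i ∈ F, |X (g i) ω| := by rw [Finset.mul_sum]
      _ ≤ |B| * N ω := mul_le_mul_of_nonneg_left
          (h.sum_le_tsum F fun i _ => abs_nonneg _) (abs_nonneg B)
  have hXm : ∀ i, AEStronglyMeasurable (X i) P := fun i => (hm i).aestronglyMeasurable
  have hsm : ∀ F : Finset ι, AEStronglyMeasurable (fun ω => ∑ i ∈ F, X (g i) ω • b i) P :=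
    fun F => by fun_prop
  have hfin : ∀ F : Finset ι, ∫ ω, (X a ω : ℂ) * f (∑ i ∈ F, X (g i) ω • b i) ∂P =
      ∫ ω, fderiv ℝ f (∑ i ∈ F, X (g i) ω • b i) (∑ i ∈ F, K a (g i) • b i) ∂P := fun F => by
    -- The map `g` need not be injective and may take the value `a`. Reindexing by `Option ι`, with
    -- `none` for `a`, avoids both difficulties.
    have h := (hX.comp (fun o : Option ι => o.elim a g)).integral_mul_finset hf none
      (F.map Function.Embedding.some) (fun o => o.elim 0 b)
    simpa using h
  have l1 : Tendsto (fun F : Finset ι => ∫ ω, (X a ω : ℂ) * f (∑ i ∈ F, X (g i) ω • b i) ∂P) atTop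
      (𝓝 (∫ ω, (X a ω : ℂ) * f (∑' i, X (g i) ω • b i) ∂P)) := by
    -- The domination comes from |x| eʸ ≤ x² + e²ʸ, whose two terms are separately integrable.
    refine tendsto_integral_filter_of_dominated_convergence
      (fun ω => C * (X a ω * X a ω + Real.exp (2 * (C * |B|) * N ω)))
      (Eventually.of_forall fun F => AEStronglyMeasurable.mul (by fun_prop)
        (hfc.comp_aestronglyMeasurable (hsm F))) (Eventually.of_forall fun F => ?_)
      (((hX.integrable_mul a a).add (hexp _)).const_mul C) ?_
    · filter_upwards [hbd] with ω h
      rw [norm_mul, Complex.norm_real, Real.norm_eq_abs]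
      have h1 := (hg (∑ i ∈ F, X (g i) ω • b i)).1.trans (mul_le_mul_of_nonneg_left (h F) hC)
      calc _ ≤ |X a ω| * (C * Real.exp (C * |B| * N ω)) :=
            mul_le_mul_of_nonneg_left h1 (abs_nonneg _)
        _ = C * (|X a ω| * Real.exp (C * |B| * N ω)) := by ring
        _ ≤ _ := by
            refine mul_le_mul_of_nonneg_left ?_ hC
            rw [mul_assoc 2, two_mul, Real.exp_add, ← abs_mul_abs_self (X a ω)]
            nlinarith [sq_nonneg (|X a ω| - Real.exp (C * |B| * N ω)),
              sq_nonneg (|X a ω|), sq_nonneg (Real.exp (C * |B| * N ω))]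
    · filter_upwards [hlim] with ω h
      exact ((hfc.tendsto _).comp h).const_mul _
  have l2 : Tendsto (fun F : Finset ι => ∫ ω, fderiv ℝ f (∑ i ∈ F, X (g i) ω • b i)
      (∑ i ∈ F, K a (g i) • b i) ∂P) atTop
      (𝓝 (∫ ω, fderiv ℝ f (∑' i, X (g i) ω • b i) c ∂P)) := by
    have hcn : ∀ᶠ F : Finset ι in atTop, ‖∑ i ∈ F, K a (g i) • b i‖ ≤ ‖c‖ + 1 :=
      (Tendsto.norm hc).eventually (ge_mem_nhds (lt_add_one _)) |>.mono fun _ h => h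
    refine tendsto_integral_filter_of_dominated_convergence
      (fun ω => C * Real.exp (C * |B| * N ω) * (‖c‖ + 1))
      (Eventually.of_forall fun F => (hfd.clm_apply continuous_const).comp_aestronglyMeasurable
        (hsm F)) ?_ (((hexp _).const_mul C).mul_const _) ?_
    · filter_upwards [hcn] with F hF
      filter_upwards [hbd] with ω h
      refine (ContinuousLinearMap.le_opNorm _ _).trans ?_
      gcongr
      exact (hg _).2.trans (mul_le_mul_of_nonneg_left (h F) hC)
    · filter_upwards [hlim] with ω h
      have h1 := (hfd.tendsto _).comp h
      exact (isBoundedBilinearMap_apply.continuous.tendsto (_, c)).comp (h1.prodMk_nhds hc)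
  simp_rw [hfin] at l1
  exact tendsto_nhds_unique l1 l2

/-! ### Dyadic squares -/

theorem cell_eq_prod (n : ℕ) (k : Fin (2 ^ n) × Fin (2 ^ n)) :
    ∃ a b a' b' : unitInterval, cell n k = Set.Ico a b ×ˢ Set.Ico a' b' ∧
      (b : ℝ) - a = (1 / 2) ^ n ∧ (b' : ℝ) - a' = (1 / 2) ^ n := by
  have h2 : (0 : ℝ) < 2 ^ n := by positivity
  have hk : ∀ j : Fin (2 ^ n), ((j : ℕ) : ℝ) + 1 ≤ 2 ^ n := fun j => by
    exact_mod_cast j.2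
  have hd : ∀ j : Fin (2 ^ n), ((j : ℕ) : ℝ) / 2 ^ n ∈ unitInterval := fun j =>
    ⟨by positivity, by rw [div_le_one h2]; linarith [hk j]⟩
  have hu : ∀ j : Fin (2 ^ n), (((j : ℕ) : ℝ) + 1) / 2 ^ n ∈ unitInterval := fun j =>
    ⟨by positivity, by rw [div_le_one h2]; exact hk j⟩
  refine ⟨⟨_, hd k.1⟩, ⟨_, hu k.1⟩, ⟨_, hd k.2⟩, ⟨_, hu k.2⟩, ?_, ?_, ?_⟩
  · ext x
    simp only [cell, Set.mem_setOf_eq, Set.mem_prod, Set.mem_Ico, ← Subtype.coe_le_coe,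
      ← Subtype.coe_lt_coe]
    rw [div_le_iff₀ h2, lt_div_iff₀ h2, div_le_iff₀ h2, lt_div_iff₀ h2, mul_comm (x.1 : ℝ),
      mul_comm (x.2 : ℝ)]
  · simp only [one_div, inv_pow]
    field_simp
    ring
  · simp only [one_div, inv_pow]
    field_simp
    ring

theorem volume_real_cell (n : ℕ) (k : Fin (2 ^ n) × Fin (2 ^ n)) :
    (volume : Measure Sq).real (cell n k) = (1 / 4) ^ n := by
  obtain ⟨a, b, a', b', h, e, e'⟩ := cell_eq_prod n k
  have hp : (0 : ℝ) ≤ (1 / 2) ^ n := by positivity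
  rw [measureReal_def, h, Measure.volume_eq_prod, Measure.prod_prod, unitInterval.volume_Ico,
    unitInterval.volume_Ico, e, e', ENNReal.toReal_mul, ENNReal.toReal_ofReal hp, ← mul_pow]
  norm_num

theorem l1dist_le_of_mem_cell {n : ℕ} {k : Fin (2 ^ n) × Fin (2 ^ n)} {x y : Sq}
    (hx : x ∈ cell n k) (hy : y ∈ cell n k) : l1dist x y ≤ 2 * (1 / 2) ^ n := by
  obtain ⟨a, b, a', b', h, e, e'⟩ := cell_eq_prod n k
  rw [h] at hx hy
  obtain ⟨⟨h1, h2⟩, h3, h4⟩ := hx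
  obtain ⟨⟨h5, h6⟩, h7, h8⟩ := hy
  simp only [← Subtype.coe_le_coe, ← Subtype.coe_lt_coe] at *
  have d1 : |(x.1 : ℝ) - y.1| ≤ (1 / 2) ^ n := by rw [abs_le]; constructor <;> linarith
  have d2 : |(x.2 : ℝ) - y.2| ≤ (1 / 2) ^ n := by rw [abs_le]; constructor <;> linarith
  unfold l1dist
  linarith

theorem cell_unique {n : ℕ} {k l : Fin (2 ^ n) × Fin (2 ^ n)} {x : Sq}
    (hk : x ∈ cell n k) (hl : x ∈ cell n l) : k = l := by
  obtain ⟨⟨h1, h2⟩, h3, h4⟩ := hk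
  obtain ⟨⟨h5, h6⟩, h7, h8⟩ := hl
  have aux : ∀ {i j : Fin (2 ^ n)} {r : ℝ}, (i : ℝ) ≤ r → r < (i : ℝ) + 1 → (j : ℝ) ≤ r →
      r < (j : ℝ) + 1 → i = j := by
    intro i j r a b c d
    have e1 : ((i : ℕ) : ℝ) < (j : ℕ) + 1 := by linarith
    have e2 : ((j : ℕ) : ℝ) < (i : ℕ) + 1 := by linarith
    have e3 : (i : ℕ) < (j : ℕ) + 1 := by exact_mod_cast e1
    have e4 : (j : ℕ) < (i : ℕ) + 1 := by exact_mod_cast e2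
    exact Fin.ext (by omega)
  exact Prod.ext (aux h1 h2 h5 h6) (aux h3 h4 h7 h8)

/-- The half-open squares miss exactly the points with a coordinate equal to 1, a null set. -/
theorem ae_mem_cell (n : ℕ) : ∀ᵐ x : Sq, ∃ k, x ∈ cell n k := by
  have h1 : ∀ᵐ x : unitInterval, x ≠ 1 := by
    simp [ae_iff]
  have hf := (Measure.quasiMeasurePreserving_fst (μ := (volume : Measure unitInterval))
    (ν := (volume : Measure unitInterval))).ae h1
  have hs := (Measure.quasiMeasurePreserving_snd (μ := (volume : Measure unitInterval))
    (ν := (volume : Measure unitInterval))).ae h1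
  have aux : ∀ r : unitInterval, r ≠ 1 → ∃ i : Fin (2 ^ n), ((i : ℕ) : ℝ) ≤ 2 ^ n * (r : ℝ) ∧
      2 ^ n * (r : ℝ) < ((i : ℕ) : ℝ) + 1 := by
    intro r hr
    have h0 : 0 ≤ 2 ^ n * (r : ℝ) := mul_nonneg (by positivity) r.2.1
    have hr1 : (r : ℝ) < 1 := lt_of_le_of_ne r.2.2 fun h => hr (Subtype.ext h)
    have hlt : ⌊2 ^ n * (r : ℝ)⌋₊ < 2 ^ n := by
      rw [Nat.floor_lt h0]
      push_cast
      have : (0 : ℝ) < 2 ^ n := by positivity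
      nlinarith
    exact ⟨⟨_, hlt⟩, Nat.floor_le h0, Nat.lt_floor_add_one _⟩
  rw [Measure.volume_eq_prod]
  filter_upwards [hf, hs] with x hx1 hx2
  obtain ⟨i, hi⟩ := aux x.1 hx1
  obtain ⟨j, hj⟩ := aux x.2 hx2
  exact ⟨(i, j), hi, hj⟩

/-- The lower left corner of a dyadic square. -/
def corner (n : ℕ) (k : Fin (2 ^ n) × Fin (2 ^ n)) : Sq :=
  (⟨((k.1 : ℕ) : ℝ) / 2 ^ n, by positivity, by
      rw [div_le_one (by positivity)]; exact_mod_cast k.1.2.le⟩,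
    ⟨((k.2 : ℕ) : ℝ) / 2 ^ n, by positivity, by
      rw [div_le_one (by positivity)]; exact_mod_cast k.2.2.le⟩)

theorem corner_mem_cell (n : ℕ) (k : Fin (2 ^ n) × Fin (2 ^ n)) : corner n k ∈ cell n k := by
  have h2 : (2 : ℝ) ^ n ≠ 0 := by positivity
  simp only [cell, corner, Set.mem_setOf_eq, mul_div_cancel₀ _ h2]
  simp

/-! ### White noise -/

/-- A continuous function as an element of `L²`. -/
def toL2 (f : Sq → ℝ) (hf : Continuous f) : L2 :=
  MemLp.toLp f (by
    obtain ⟨C, hC⟩ := isCompact_univ.exists_bound_of_continuousOn hf.continuousOn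
    exact MemLp.of_bound hf.aestronglyMeasurable C
      (Eventually.of_forall fun x => hC x (Set.mem_univ x)))

theorem coeFn_toL2 (f : Sq → ℝ) (hf : Continuous f) : toL2 f hf =ᵐ[volume] f :=
  MemLp.coeFn_toLp _

theorem inner_toL2 (f g : Sq → ℝ) (hf : Continuous f) (hg : Continuous g) :
    inner ℝ (toL2 f hf) (toL2 g hg) = ∫ x, f x * g x := by
  rw [L2.inner_def]
  refine integral_congr_ae ?_
  filter_upwards [coeFn_toL2 f hf, coeFn_toL2 g hg] with x h1 h2
  rw [h1, h2]
  simp [mul_comm]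

theorem norm_L2_le {s : L2} {C : ℝ} (hC : 0 ≤ C) (h : ∀ᵐ x, ‖s x‖ ≤ C) : ‖s‖ ≤ C := by
  have := Lp.norm_le_of_ae_bound hC h
  simpa [measureUnivNNReal] using this

/-- The coordinates of white noise. -/
def monoL2 (i : (ℕ × ℕ) × (ℕ × ℕ)) : L2 := toL2 (Features.mono₂ i) (Features.continuous_mono₂ i)

theorem inner_monoL2_self_le (i : (ℕ × ℕ) × (ℕ × ℕ)) :
    inner ℝ (monoL2 i) (monoL2 i) ≤ Features.wt₂ i ^ 2 := by
  rw [real_inner_self_eq_norm_sq]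
  refine pow_le_pow_left₀ (norm_nonneg _) (norm_L2_le (Features.wt₂_pos i).le ?_) 2
  filter_upwards [coeFn_toL2 _ (Features.continuous_mono₂ i)] with x hx
  rw [monoL2, hx]
  exact Features.abs_mono₂_le i x

namespace IsWhiteNoise

variable {Ω : Type*} [MeasurableSpace Ω] {P : Measure Ω} {W : L2 → Ω → ℝ}
  (hW : IsWhiteNoise P W)

include hW

theorem aemeasurable (f : L2) : AEMeasurable (W f) P :=
  IsGaussianProcess.aemeasurable (IsCentredGaussian.gaussian hW) f

theorem integral_sq_sum {κ : Type*} (F : Finset κ) (c : κ → ℝ) (g : κ → L2) :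
    ∫ ω, (∑ k ∈ F, c k * W (g k) ω) ^ 2 ∂P = ‖∑ k ∈ F, c k • g k‖ ^ 2 := by
  have h := ((IsCentredGaussian.comp hW g).linear_comb (fun _ : Unit => F)
    (fun _ => c)).covariance () ()
  simp_rw [sq]
  rw [h, ← real_inner_self_eq_norm_mul_norm, sum_inner]
  refine Finset.sum_congr rfl fun k _ => ?_
  rw [inner_sum]
  refine Finset.sum_congr rfl fun l _ => ?_
  rw [real_inner_smul_left, real_inner_smul_right]
  ring

/-- The inequality |r| ≤ r²/(2ε) + ε/2 turns a variance of at most ε² into a first moment of at most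
ε. -/
theorem lintegral_abs_sum_le {κ : Type*} (F : Finset κ) (c : κ → ℝ) (g : κ → L2) {ε : ℝ}
    (hε : 0 < ε) (h : ‖∑ k ∈ F, c k • g k‖ ≤ ε) :
    ∫⁻ ω, ENNReal.ofReal |∑ k ∈ F, c k * W (g k) ω| ∂P ≤ ENNReal.ofReal ε := by
  have := (IsCentredGaussian.gaussian hW).isProbabilityMeasure
  have hi : Integrable (fun ω => (∑ k ∈ F, c k * W (g k) ω) ^ 2) P := by
    have := ((IsCentredGaussian.comp hW g).linear_comb (fun _ : Unit => F)
      (fun _ => c)).integrable_mul () ()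
    refine this.congr (Eventually.of_forall fun ω => ?_)
    simp only
    ring
  calc _ ≤ ∫⁻ ω, ENNReal.ofReal ((∑ k ∈ F, c k * W (g k) ω) ^ 2 * (2 * ε)⁻¹ + ε / 2) ∂P := by
        refine lintegral_mono fun ω => ENNReal.ofReal_le_ofReal ?_
        set r := ∑ k ∈ F, c k * W (g k) ω
        rw [← sub_nonneg]
        have : r ^ 2 * (2 * ε)⁻¹ + ε / 2 - |r| = (|r| - ε) ^ 2 * (2 * ε)⁻¹ := by
          rw [← sq_abs r]
          field_simp
          ring
        rw [this]
        positivity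
    _ = ENNReal.ofReal (∫ ω, ((∑ k ∈ F, c k * W (g k) ω) ^ 2 * (2 * ε)⁻¹ + ε / 2) ∂P) :=
        (ofReal_integral_eq_lintegral_ofReal ((hi.mul_const _).add (integrable_const _))
          (Eventually.of_forall fun ω => add_nonneg (mul_nonneg (sq_nonneg _)
            (inv_nonneg.2 (by positivity))) (by positivity))).symm
    _ ≤ _ := by
        refine ENNReal.ofReal_le_ofReal ?_
        rw [integral_add (hi.mul_const _) (integrable_const _), integral_mul_const,
          integral_sq_sum hW, integral_const, probReal_univ, one_smul]
        have h2 : ‖∑ k ∈ F, c k • g k‖ ^ 2 ≤ ε ^ 2 := pow_le_pow_left₀ (norm_nonneg _) h 2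
        calc _ ≤ ε ^ 2 * (2 * ε)⁻¹ + ε / 2 := by gcongr
          _ = ε := by field_simp; ring

/-- Sums of point-like contributions over the dyadic squares converge to the white noise
series. -/
theorem ae_tendsto_cells {E : Type*} [NormedAddCommGroup E] [NormedSpace ℝ E] [CompleteSpace E]
    {a : ∀ n : ℕ, Fin (2 ^ n) × Fin (2 ^ n) → (ℕ × ℕ) × (ℕ × ℕ) → ℝ} {C : ℝ} (hC : 0 < C)
    (ha : ∀ n k i x, x ∈ cell n k → |a n k i - Features.mono₂ i x| ≤ C * Features.wt₂ i * (1 / 2) ^ n)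
    {b : (ℕ × ℕ) × (ℕ × ℕ) → E} {B : ℝ} (hB : ∀ i, ‖b i‖ ≤ B)
    {e : ∀ n : ℕ, Fin (2 ^ n) × Fin (2 ^ n) → E}
    (he : ∀ n k, HasSum (fun i => a n k i • b i) (e n k)) :
    ∀ᵐ ω ∂P, Tendsto (fun n => ∑ k, W (cellInd n k) ω • e n k) atTop
      (𝓝 (∑' i, W (monoL2 i) ω • b i)) := by
  have hB0 : 0 ≤ B := (norm_nonneg _).trans (hB ((0, 0), (0, 0)))
  -- The error of the coordinate `i` at scale `n`. Its first moment is at most C 2⁻ⁿ `wt₂ i`,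
  -- summable over `n` and `i` together. Hence, almost surely, the total error at scale `n` tends to
  -- 0 along the full sequence.
  set D : ℕ × ((ℕ × ℕ) × (ℕ × ℕ)) → Ω → ℝ := fun q ω =>
    ∑ k, a q.1 k q.2 * W (cellInd q.1 k) ω - W (monoL2 q.2) ω with hD
  have hDe : ∀ q, ∫⁻ ω, ENNReal.ofReal |D q ω| ∂P ≤
      ENNReal.ofReal ((1 / 2) ^ q.1 * (C * Features.wt₂ q.2)) := by
    rintro ⟨n, i⟩
    have hw := Features.wt₂_pos i
    -- The index `none` carries the subtracted coordinate `monoL2 i`, the other indices the dyadic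
    -- squares.
    have h := hW.lintegral_abs_sum_le (Finset.univ : Finset (Option (Fin (2 ^ n) × Fin (2 ^ n))))
      (fun o => o.elim (-1) fun k => a n k i) (fun o => o.elim (monoL2 i) (cellInd n))
      (ε := (1 / 2) ^ n * (C * Features.wt₂ i)) (by positivity) ?_
    · refine le_trans (le_of_eq ?_) h
      congr 1
      ext ω
      simp only [hD, Fintype.sum_option, Option.elim]
      congr 2
      ring
    · refine norm_L2_le (by positivity) ?_
      simp only [Fintype.sum_option, Option.elim]
      have hs := Lp.coeFn_finsetSum Finset.univ (fun k => a n k i • cellInd n k)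
      have hk : ∀ᵐ x, ∀ k, (a n k i • cellInd n k : L2) x =
          a n k i * (cell n k).indicator (fun _ => (1 : ℝ)) x := by
        rw [ae_all_iff]
        intro k
        filter_upwards [Lp.coeFn_smul (a n k i) (cellInd n k), indicatorConstLp_coeFn
          (p := 2) (hs := measurableSet_cell n k) (hμs := measure_ne_top volume (cell n k))
          (c := (1 : ℝ))] with x h1 h2
        rw [h1, Pi.smul_apply, smul_eq_mul, cellInd, h2]
      filter_upwards [hs, hk, Lp.coeFn_add ((-1 : ℝ) • monoL2 i) (∑ k, a n k i • cellInd n k),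
        Lp.coeFn_smul (-1 : ℝ) (monoL2 i), coeFn_toL2 _ (Features.continuous_mono₂ i),
        ae_mem_cell n] with x h1 h2 h3 h4 h5 ⟨k, h6⟩
      rw [h3, Pi.add_apply, h1, h4, Pi.smul_apply, monoL2, h5, Finset.sum_apply,
        Finset.sum_eq_single k]
      · rw [h2, Set.indicator_of_mem h6]
        have := ha n k i x h6
        rw [Real.norm_eq_abs]
        refine le_trans (le_of_eq ?_) (this.trans_eq (by ring))
        congr 1
        simp only [smul_eq_mul]
        ring
      · intro l _ hl
        rw [h2, Set.indicator_of_notMem fun hm => hl (cell_unique hm h6), mul_zero]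
      · simp
  have hDm : ∀ q, AEMeasurable (D q) P := fun q => by
    have : ∀ f, AEStronglyMeasurable (W f) P := fun f => (hW.aemeasurable f).aestronglyMeasurable
    have h : AEStronglyMeasurable (D q) P := by simp only [hD]; fun_prop
    exact h.aemeasurable
  have hDs : ∀ᵐ ω ∂P, Summable fun q => |D q ω| := by
    have hfin : ∫⁻ ω, ∑' q, ENNReal.ofReal |D q ω| ∂P < ⊤ := by
      rw [lintegral_tsum fun q => (hDm q).abs.ennreal_ofReal]
      refine (ENNReal.tsum_le_tsum hDe).trans_lt ?_
      rw [← ENNReal.ofReal_tsum_of_nonneg]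
      · exact ENNReal.ofReal_lt_top
      · intro q
        have := Features.wt₂_pos q.2
        positivity
      · exact summable_geometric_two.mul_of_nonneg (Features.summable_wt₂.mul_left C)
          (fun _ => by positivity) (fun i => (mul_pos hC (Features.wt₂_pos i)).le)
    filter_upwards [ae_lt_top' (AEMeasurable.ennreal_tsum fun q => (hDm q).abs.ennreal_ofReal)
      hfin.ne] with ω hω
    refine (ENNReal.summable_toReal hω.ne).congr fun q => ?_
    rw [ENNReal.toReal_ofReal (abs_nonneg _)]
  have hsum := (IsCentredGaussian.comp hW monoL2).ae_summable_abs Features.wt₂_pos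
    Features.summable_wt₂ inner_monoL2_self_le
  filter_upwards [hDs, hsum] with ω h1 h2
  have h3 : Tendsto (fun n => ∑' i, |D (n, i) ω|) atTop (𝓝 0) := h1.prod.tendsto_atTop_zero
  have hbs : Summable fun i => W (monoL2 i) ω • b i := by
    refine Summable.of_norm_bounded (h2.mul_right B) fun i => ?_
    rw [norm_smul]
    exact mul_le_mul_of_nonneg_left (hB i) (abs_nonneg _)
  rw [tendsto_iff_norm_sub_tendsto_zero]
  refine squeeze_zero (fun _ => norm_nonneg _) (fun n => ?_) (by simpa using h3.mul_const B)
  have h4 : HasSum (fun i => D (n, i) ω • b i)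
      (∑ k, W (cellInd n k) ω • e n k - ∑' i, W (monoL2 i) ω • b i) := by
    refine ((hasSum_sum fun k _ => (he n k).const_smul (W (cellInd n k) ω)).sub hbs.hasSum).congr_fun
      fun i => ?_
    simp only [hD]
    rw [sub_smul, Finset.sum_smul]
    congr 1
    refine Finset.sum_congr rfl fun k _ => ?_
    rw [smul_smul, mul_comm]
  rw [← h4.tsum_eq, ← tsum_mul_right]
  refine tsum_of_norm_bounded ((h1.prod_factor n).mul_right B).hasSum fun i => ?_
  rw [norm_smul]
  exact mul_le_mul_of_nonneg_left (hB i) (abs_nonneg _)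

end IsWhiteNoise

/-! ### White noise as a random element of the trace space -/

namespace Features

open TraceSpace

variable {Φ : Model} {H : Type*} [NormedAddCommGroup H] [InnerProductSpace ℂ H] [CompleteSpace H]
  (F : Features Φ H)

theorem hasSum_state {s : Sq → ℝ} (hs : Integrable s) :
    HasSum (fun i => (∫ x, s x * mono₂ i x) • F.basis i) (F.state s) := by
  have h := hasSum_integral_of_dominated_convergence (μ := (volume : Measure Sq))
    (F := fun i x => (s x * mono₂ i x) • F.basis i)
    (f := fun x => s x • F.dirac x) (fun i x => |s x| * (wt₂ i * F.bound ^ 2)) ?_ ?_ ?_ ?_ ?_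
  · simp_rw [integral_smul_const] at h
    exact h
  · intro i
    exact (hs.aestronglyMeasurable.mul (continuous_mono₂ i).aestronglyMeasurable).smul_const _
  · intro i
    refine Eventually.of_forall fun x => ?_
    rw [norm_smul, Real.norm_eq_abs, abs_mul, mul_assoc]
    refine mul_le_mul_of_nonneg_left ?_ (abs_nonneg _)
    exact mul_le_mul (abs_mono₂_le i x) (F.norm_basis_le i) (norm_nonneg _) (wt₂_pos i).le
  · exact Eventually.of_forall fun x => (summable_wt₂.mul_right _).mul_left _
  · simp_rw [tsum_mul_left]
    exact hs.norm.mul_const _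
  · refine Eventually.of_forall fun x => ?_
    refine ((F.hasSum_dirac x).const_smul (s x)).congr_fun fun i => ?_
    rw [smul_smul]

/-- White noise as a random element of the trace space. -/
def field {Ω : Type*} (W : L2 → Ω → ℝ) (ω : Ω) : TraceSpace H := ∑' i, W (monoL2 i) ω • F.basis i

/-- The dominating variable of the white noise. -/
def envelope {Ω : Type*} (W : L2 → Ω → ℝ) (ω : Ω) : ℝ := ∑' i, |W (monoL2 i) ω|

theorem state_noise {Ω : Type*} (W : L2 → Ω → ℝ) (n : ℕ) (ω : Ω) :
    F.state (noise W n ω) =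
      ∑ k, W (cellInd n k) ω • F.state ((cell n k).indicator fun _ => (4 : ℝ) ^ n) := by
  have hi : ∀ k, Integrable ((cell n k).indicator fun _ : Sq => (4 : ℝ) ^ n) := fun k =>
    (integrable_const _).indicator (measurableSet_cell n k)
  simp only [state]
  simp_rw [← integral_smul]
  rw [← integral_finset_sum]
  · refine integral_congr_ae ?_
    have hk : ∀ᵐ x, ∀ k, (((4 : ℝ) ^ n * W (cellInd n k) ω) • cellInd n k : L2) x =
        W (cellInd n k) ω * (cell n k).indicator (fun _ => (4 : ℝ) ^ n) x := by
      rw [ae_all_iff]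
      intro k
      filter_upwards [Lp.coeFn_smul ((4 : ℝ) ^ n * W (cellInd n k) ω) (cellInd n k),
        indicatorConstLp_coeFn (p := 2) (hs := measurableSet_cell n k)
        (hμs := measure_ne_top volume (cell n k)) (c := (1 : ℝ))] with x h1 h2
      rw [h1, Pi.smul_apply, smul_eq_mul, cellInd, h2]
      by_cases hx : x ∈ cell n k
      · rw [Set.indicator_of_mem hx, Set.indicator_of_mem hx]; ring
      · rw [Set.indicator_of_notMem hx, Set.indicator_of_notMem hx]; ring
    filter_upwards [hk, Lp.coeFn_finsetSum Finset.univ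
      (fun k => ((4 : ℝ) ^ n * W (cellInd n k) ω) • cellInd n k)] with x h1 h2
    rw [noise, h2, Finset.sum_apply, Finset.sum_smul]
    refine Finset.sum_congr rfl fun k _ => ?_
    rw [h1, smul_smul]
  · intro k _
    exact Integrable.smul (W (cellInd n k) ω) (F.integrable_smul_dirac (hi k))

variable {Ω : Type*} [MeasurableSpace Ω] {P : Measure Ω} {W : L2 → Ω → ℝ}
  (hW : IsWhiteNoise P W)

include hW

/-- The coefficient of a square is the average of `mono₂` over it. It differs from any value in the
square by at most 4 `wt₂ i` 2⁻ⁿ: a Lipschitz constant 2 `wt₂ i` times a diameter 2 · 2⁻ⁿ. -/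
theorem ae_tendsto_state_noise :
    ∀ᵐ ω ∂P, Tendsto (fun n => F.state (noise W n ω)) atTop (𝓝 (F.field W ω)) := by
  simp_rw [F.state_noise]
  refine hW.ae_tendsto_cells (C := 4)
    (a := fun n k i => ∫ x, (cell n k).indicator (fun _ => (4 : ℝ) ^ n) x * mono₂ i x)
    (by norm_num) ?_ F.norm_basis_le
    fun n k => F.hasSum_state ((integrable_const _).indicator (measurableSet_cell n k))
  intro n k i x hx
  have e : ∫ y, (cell n k).indicator (fun _ => (4 : ℝ) ^ n) y * mono₂ i y =
      ∫ y in cell n k, (4 : ℝ) ^ n * mono₂ i y := by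
    rw [← integral_indicator (measurableSet_cell n k)]
    congr 1
    ext y
    by_cases hy : y ∈ cell n k <;> simp [hy]
  have e2 : mono₂ i x = ∫ y in cell n k, (4 : ℝ) ^ n * mono₂ i x := by
    rw [setIntegral_const, volume_real_cell, smul_eq_mul, ← mul_assoc, ← mul_pow]
    norm_num
  have hint : ∀ g : Sq → ℝ, Continuous g → IntegrableOn g (cell n k) := fun g hg =>
    hg.integrable_of_hasCompactSupport
      (HasCompactSupport.of_compactSpace g) |>.integrableOn
  rw [e, e2, ← integral_sub (hint _ (by have := continuous_mono₂ i; fun_prop))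
    (hint _ continuous_const), ← Real.norm_eq_abs]
  have hb : ∀ y ∈ cell n k, ‖(4 : ℝ) ^ n * mono₂ i y - 4 ^ n * mono₂ i x‖ ≤
      4 ^ n * (4 * wt₂ i * (1 / 2) ^ n) := fun y hy => by
    rw [← mul_sub, norm_mul, Real.norm_of_nonneg (by positivity), Real.norm_eq_abs]
    refine mul_le_mul_of_nonneg_left ((abs_mono₂_sub_le i y x).trans ?_) (by positivity)
    have := l1dist_le_of_mem_cell hy hx
    nlinarith [wt₂_pos i]
  refine (norm_setIntegral_le_of_norm_le_const (measure_lt_top _ _) hb).trans (le_of_eq ?_)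
  rw [volume_real_cell, mul_right_comm, ← mul_pow]
  norm_num

/-- A second discretisation, by point masses at corners, has the same limit. It is the one that fits
the φ representation, where φ is evaluated at finitely many points. -/
theorem ae_tendsto_corners :
    ∀ᵐ ω ∂P, Tendsto (fun n => ∑ k, W (cellInd n k) ω • F.dirac (corner n k)) atTop
      (𝓝 (F.field W ω)) := by
  refine hW.ae_tendsto_cells (C := 4) (a := fun n k i => mono₂ i (corner n k))
    (by norm_num) ?_ F.norm_basis_le fun n k => F.hasSum_dirac _
  intro n k i x hx
  refine (abs_mono₂_sub_le i _ x).trans ?_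
  have := l1dist_le_of_mem_cell (corner_mem_cell n k) hx
  nlinarith [wt₂_pos i]

theorem ae_summable_coordinates : ∀ᵐ ω ∂P, Summable fun i => |W (monoL2 i) ω| :=
  (IsCentredGaussian.comp hW monoL2).ae_summable_abs wt₂_pos summable_wt₂ inner_monoL2_self_le

theorem ae_hasSum_field : ∀ᵐ ω ∂P, HasSum (fun i => W (monoL2 i) ω • F.basis i) (F.field W ω) := by
  filter_upwards [ae_summable_coordinates hW] with ω h
  refine (Summable.of_norm_bounded (h.mul_right (F.bound ^ 2)) fun i => ?_).hasSum
  rw [norm_smul]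
  exact mul_le_mul_of_nonneg_left (F.norm_basis_le i) (abs_nonneg _)

theorem ae_norm_field_le : ∀ᵐ ω ∂P, ‖F.field W ω‖ ≤ F.bound ^ 2 * envelope W ω := by
  filter_upwards [ae_summable_coordinates hW] with ω h
  rw [envelope, ← tsum_mul_left]
  refine tsum_of_norm_bounded (h.mul_left _).hasSum fun i => ?_
  rw [norm_smul, mul_comm]
  exact mul_le_mul_of_nonneg_right (F.norm_basis_le i) (abs_nonneg _)

theorem integrable_exp_envelope (c : ℝ) : Integrable (fun ω => Real.exp (c * envelope W ω)) P :=
  (IsCentredGaussian.comp hW monoL2).integrable_exp_tsum_abs wt₂_pos summable_wt₂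
    inner_monoL2_self_le c

theorem aestronglyMeasurable_field : AEStronglyMeasurable (F.field W) P := by
  have hXm : ∀ f, AEStronglyMeasurable (W f) P := fun f => (hW.aemeasurable f).aestronglyMeasurable
  refine aestronglyMeasurable_of_tendsto_ae (u := (atTop : Filter (Finset ((ℕ × ℕ) × (ℕ × ℕ)))))
    (f := fun I ω => ∑ i ∈ I, W (monoL2 i) ω • F.basis i) (fun I => by fun_prop) ?_
  filter_upwards [F.ae_hasSum_field hW] with ω h using h

/-- Combined with the linear growth of the interaction, these exponential moments yield all the
integrability in the expansion. -/
theorem integrable_exp_norm_field (c : ℝ) :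
    Integrable (fun ω => Real.exp (c * ‖F.field W ω‖)) P := by
  have hm := F.aestronglyMeasurable_field hW
  refine (integrable_exp_envelope hW (|c| * F.bound ^ 2)).mono' (by fun_prop) ?_
  filter_upwards [F.ae_norm_field_le hW] with ω h
  rw [Real.norm_of_nonneg (Real.exp_pos _).le, mul_assoc]
  refine Real.exp_le_exp.2 ?_
  exact mul_le_mul (le_abs_self c) h (norm_nonneg _) (abs_nonneg c)

end Features

/-! ### Calculus of tame functions -/

namespace TameC1

variable {E F G K : Type*} [NormedAddCommGroup E] [NormedSpace ℝ E] [NormedAddCommGroup F]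
  [NormedSpace ℝ F] [NormedAddCommGroup G] [NormedSpace ℝ G] [NormedAddCommGroup K]
  [NormedSpace ℝ K]

theorem of_bounds {f : E → G} (hf : ContDiff ℝ 1 f) {A a B b : ℝ}
    (h1 : ∀ x, ‖f x‖ ≤ A * Real.exp (a * ‖x‖))
    (h2 : ∀ x, ‖fderiv ℝ f x‖ ≤ B * Real.exp (b * ‖x‖)) : TameC1 f := by
  refine ⟨hf, |A| + |B| + |a| + |b|, by positivity, fun x => ⟨(h1 x).trans ?_, (h2 x).trans ?_⟩⟩
  · gcongr
    · linarith [le_abs_self A, abs_nonneg B, abs_nonneg a, abs_nonneg b]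
    · linarith [le_abs_self a, abs_nonneg B, abs_nonneg A, abs_nonneg b]
  · gcongr
    · linarith [le_abs_self B, abs_nonneg A, abs_nonneg a, abs_nonneg b]
    · linarith [le_abs_self b, abs_nonneg B, abs_nonneg A, abs_nonneg a]

theorem const (c : G) : TameC1 (fun _ : E => c) :=
  of_bounds contDiff_const (A := ‖c‖) (a := 0) (B := 0) (b := 0) (fun x => by simp)
    (fun x => by simp)

theorem bilin (L : F →L[ℝ] G →L[ℝ] K) {f : E → F} {g : E → G} (hf : TameC1 f) (hg : TameC1 g) :
    TameC1 (fun x => L (f x) (g x)) := by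
  obtain ⟨f1, C, hC, hfb⟩ := hf
  obtain ⟨g1, D, hD, hgb⟩ := hg
  have hmul : ∀ x : E, C * Real.exp (C * ‖x‖) * (D * Real.exp (D * ‖x‖)) =
      C * D * Real.exp ((C + D) * ‖x‖) := fun x => by
    rw [add_mul, Real.exp_add]; ring
  refine of_bounds (A := ‖L‖ * (C * D)) (a := C + D) (B := 2 * (‖L‖ * (C * D))) (b := C + D)
    ((L.contDiff.comp f1).clm_apply g1) (fun x => ?_) (fun x => ?_)
  · refine (L.le_opNorm₂ _ _).trans ?_
    rw [mul_assoc, mul_assoc, ← hmul]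
    gcongr
    · exact (hfb x).1
    · exact (hgb x).1
  · have h := L.isBoundedBilinearMap.hasFDerivAt (f x, g x)
    have h2 := h.comp x ((f1.differentiable one_ne_zero x).hasFDerivAt.prodMk
      (g1.differentiable one_ne_zero x).hasFDerivAt)
    have e : (fun x => L (f x) (g x)) = (fun p : F × G => L p.1 p.2) ∘ fun x => (f x, g x) := rfl
    rw [e, h2.fderiv]
    refine ContinuousLinearMap.opNorm_le_bound _ (by positivity) fun v => ?_
    have a1 := (L.le_opNorm₂ (f x) (fderiv ℝ g x v))
    have a2 := (L.le_opNorm₂ (fderiv ℝ f x v) (g x))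
    have b1 := (fderiv ℝ g x).le_opNorm v
    have b2 := (fderiv ℝ f x).le_opNorm v
    have hv := norm_nonneg v
    refine (norm_add_le _ _).trans ?_
    calc _ ≤ ‖L‖ * ‖f x‖ * ‖fderiv ℝ g x v‖ + ‖L‖ * ‖fderiv ℝ f x v‖ * ‖g x‖ := add_le_add a1 a2
      _ ≤ ‖L‖ * (C * Real.exp (C * ‖x‖)) * (D * Real.exp (D * ‖x‖) * ‖v‖) +
          ‖L‖ * (C * Real.exp (C * ‖x‖) * ‖v‖) * (D * Real.exp (D * ‖x‖)) := by
          gcongr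
          · exact (hfb x).1
          · exact b1.trans (mul_le_mul_of_nonneg_right (hgb x).2 hv)
          · exact b2.trans (mul_le_mul_of_nonneg_right (hfb x).2 hv)
          · exact (hgb x).1
      _ = 2 * (‖L‖ * (C * Real.exp (C * ‖x‖) * (D * Real.exp (D * ‖x‖)))) * ‖v‖ := by ring
      _ = _ := by rw [hmul]; ring

theorem clm_comp (L : F →L[ℝ] G) {f : E → F} (hf : TameC1 f) : TameC1 (fun x => L (f x)) := by
  simpa using bilin (ContinuousLinearMap.apply ℝ G).flip (const L) hf

theorem add {f g : E → G} (hf : TameC1 f) (hg : TameC1 g) : TameC1 (fun x => f x + g x) := by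
  obtain ⟨f1, C, hC, hfb⟩ := hf
  obtain ⟨g1, D, hD, hgb⟩ := hg
  have hle : ∀ x : E, C * Real.exp (C * ‖x‖) + D * Real.exp (D * ‖x‖) ≤
      (C + D) * Real.exp ((C + D) * ‖x‖) := fun x => by
    rw [add_mul C D (Real.exp _)]
    gcongr <;> linarith
  refine of_bounds (A := C + D) (a := C + D) (B := C + D) (b := C + D) (f1.add g1)
    (fun x => ?_) fun x => ?_
  · exact (norm_add_le _ _).trans ((add_le_add (hfb x).1 (hgb x).1).trans (hle x))
  · rw [fderiv_fun_add (f1.differentiable one_ne_zero x) (g1.differentiable one_ne_zero x)]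
    exact (norm_add_le _ _).trans ((add_le_add (hfb x).2 (hgb x).2).trans (hle x))

theorem sum {ι : Type*} (I : Finset ι) {f : ι → E → G} (hf : ∀ i, TameC1 (f i)) :
    TameC1 (fun x => ∑ i ∈ I, f i x) := by
  classical
  induction I using Finset.induction_on with
  | empty => simpa using const (E := E) (0 : G)
  | insert i I hi ih =>
    simp_rw [Finset.sum_insert hi]
    exact (hf i).add ih

theorem mul {f g : E → ℂ} (hf : TameC1 f) (hg : TameC1 g) : TameC1 (fun x => f x * g x) :=
  bilin (ContinuousLinearMap.mul ℝ ℂ) hf hg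

theorem prod {ι : Type*} (I : Finset ι) {f : ι → E → ℂ} (hf : ∀ i, TameC1 (f i)) :
    TameC1 (fun x => ∏ i ∈ I, f i x) := by
  classical
  induction I using Finset.induction_on with
  | empty => simpa using const (E := E) (1 : ℂ)
  | insert i I hi ih =>
    simp_rw [Finset.prod_insert hi]
    exact (hf i).mul ih

theorem smul_clm {f : E → ℂ} {g : E → F →L[ℝ] ℂ} (hf : TameC1 f) (hg : TameC1 g) :
    TameC1 (fun x => f x • g x) :=
  bilin (ContinuousLinearMap.lsmul ℝ ℂ) hf hg

/-- Linear growth of the exponent is required here: exponential growth would not survive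
exponentiation. -/
theorem cexp {f : E → ℂ} (hf : TameC1 f) {A : ℝ} (hA : ∀ x, ‖f x‖ ≤ A * (1 + ‖x‖)) :
    TameC1 (fun x => Complex.exp (f x)) := by
  obtain ⟨f1, C, hC, hfb⟩ := hf
  have hexp : ∀ x, ‖Complex.exp (f x)‖ ≤ Real.exp A * Real.exp (A * ‖x‖) := fun x => by
    rw [Complex.norm_exp, ← Real.exp_add]
    refine Real.exp_le_exp.2 ((Complex.re_le_norm _).trans ((hA x).trans_eq (by ring)))
  refine of_bounds (A := Real.exp A) (a := A) (B := Real.exp A * C) (b := A + C) f1.cexp hexp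
    fun x => ?_
  rw [((f1.differentiable one_ne_zero x).hasFDerivAt.cexp).fderiv, norm_smul, add_mul,
    Real.exp_add]
  calc _ ≤ Real.exp A * Real.exp (A * ‖x‖) * (C * Real.exp (C * ‖x‖)) :=
        mul_le_mul (hexp x) (hfb x).2 (norm_nonneg _) (by positivity)
    _ = _ := by ring

end TameC1

/-! ### Integration by parts for white noise -/

namespace Features

open TraceSpace

variable {Φ : Model} {H : Type*} [NormedAddCommGroup H] [InnerProductSpace ℂ H] [CompleteSpace H]
  (F : Features Φ H) {Ω : Type*} [MeasurableSpace Ω] {P : Measure Ω} {W : L2 → Ω → ℝ}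
  (hW : IsWhiteNoise P W)

theorem norm_second_le {Λ : TraceSpace H → TraceSpace H →L[ℝ] ℂ} {C : ℝ} (hC : 0 ≤ C)
    (hb : ∀ X, ‖fderiv ℝ Λ X‖ ≤ C * Real.exp (C * ‖X‖)) (X : TraceSpace H) {Y Z : TraceSpace H}
    {a b : ℝ} (ha : 0 ≤ a) (hY : ‖Y‖ ≤ a) (hZ : ‖Z‖ ≤ b) :
    ‖fderiv ℝ Λ X Y Z‖ ≤ C * a * b * Real.exp (C * ‖X‖) := by
  have h := ContinuousLinearMap.le_opNorm₂ (fderiv ℝ Λ X) Y Z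
  refine h.trans ?_
  calc _ ≤ C * Real.exp (C * ‖X‖) * a * b := by
        gcongr
        exact hb X
    _ = _ := by ring

include hW

/-- The covariances of one coordinate with all the others are the coefficients of `state (mono₂ i)`,
which is therefore the direction of differentiation. -/
theorem integral_coordinate_mul {f : TraceSpace H → ℂ} (hf : TameC1 f)
    (i : (ℕ × ℕ) × (ℕ × ℕ)) :
    ∫ ω, (W (monoL2 i) ω : ℂ) * f (F.field W ω) ∂P =
      ∫ ω, fderiv ℝ f (F.field W ω) (F.state (mono₂ i)) ∂P := by
  refine IsCentredGaussian.integral_mul_tsum hW wt₂_pos summable_wt₂ monoL2 inner_monoL2_self_le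
    hf (monoL2 i) F.norm_basis_le ?_
  have hi : Integrable (mono₂ i) := (continuous_mono₂ i).integrable_of_hasCompactSupport
    (HasCompactSupport.of_compactSpace _)
  refine (F.hasSum_state hi).congr_fun fun j => ?_
  rw [monoL2, monoL2, inner_toL2]

attribute [local irreducible] mono₂ wt₂ field dirac

/-- The explicit field is expanded in its coordinates, each of which can then be integrated by
parts. -/
theorem hasSum_coordinate_pairing {Λ : TraceSpace H → TraceSpace H →L[ℝ] ℂ} (hΛ : TameC1 Λ) :
    HasSum (fun i => ∫ ω, (W (monoL2 i) ω : ℂ) * Λ (F.field W ω) (F.basis i) ∂P)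
      (∫ ω, Λ (F.field W ω) (F.field W ω) ∂P) := by
  have := (IsCentredGaussian.gaussian hW).isProbabilityMeasure
  obtain ⟨h1, C, hC, hb⟩ := id hΛ
  have hc : Continuous Λ := h1.continuous
  have hd : Continuous (fderiv ℝ Λ) := h1.continuous_fderiv one_ne_zero
  have hfm := F.aestronglyMeasurable_field hW
  have hWm : ∀ f, AEStronglyMeasurable (W f) P := fun f => (hW.aemeasurable f).aestronglyMeasurable
  set B := F.bound ^ 2 with hB
  have hB0 : 0 ≤ B := by positivity
  set N : Ω → ℝ := envelope W with hN
  have hNle : ∀ᵐ ω ∂P, Real.exp (C * ‖F.field W ω‖) ≤ Real.exp (C * B * N ω) := by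
    filter_upwards [F.ae_norm_field_le hW] with ω h
    rw [mul_assoc]
    exact Real.exp_le_exp.2 (mul_le_mul_of_nonneg_left h hC)
  refine hasSum_integral_of_dominated_convergence
    (fun i ω => |W (monoL2 i) ω| * (C * Real.exp (C * B * N ω) * B)) (fun i => ?_) (fun i => ?_)
    ?_ ?_ ?_
  · have e : Continuous fun X => Λ X (F.basis i) := hc.clm_apply continuous_const
    exact AEStronglyMeasurable.mul (by have := hWm (monoL2 i); fun_prop)
      (e.comp_aestronglyMeasurable hfm)
  · filter_upwards [hNle] with ω h
    rw [norm_mul, Complex.norm_real, Real.norm_eq_abs]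
    refine mul_le_mul_of_nonneg_left ?_ (abs_nonneg _)
    refine ((Λ (F.field W ω)).le_opNorm _).trans ?_
    gcongr
    · exact (hb _).1.trans (mul_le_mul_of_nonneg_left h hC)
    · exact F.norm_basis_le i
  · filter_upwards [ae_summable_coordinates hW] with ω h using h.mul_right _
  · simp_rw [tsum_mul_right]
    have hNm : AEStronglyMeasurable N P := (IsCentredGaussian.comp hW
      monoL2).aestronglyMeasurable_tsum_abs wt₂_pos summable_wt₂ inner_monoL2_self_le
    refine ((integrable_exp_envelope hW (1 + C * B)).const_mul (C * B)).mono'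
      (by simp only [hN, envelope] at hNm ⊢; fun_prop) (Eventually.of_forall fun ω => ?_)
    have h0 : 0 ≤ N ω := tsum_nonneg fun i => abs_nonneg _
    have h2 : N ω ≤ Real.exp (N ω) :=
      (le_add_of_nonneg_right zero_le_one).trans (Real.add_one_le_exp _)
    change ‖N ω * (C * Real.exp (C * B * N ω) * B)‖ ≤ C * B * Real.exp ((1 + C * B) * N ω)
    rw [Real.norm_of_nonneg (by positivity), add_mul, one_mul, Real.exp_add]
    calc _ ≤ Real.exp (N ω) * (C * Real.exp (C * B * N ω) * B) := by gcongr
      _ = _ := by ring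
  · filter_upwards [F.ae_hasSum_field hW] with ω h
    refine ((Λ (F.field W ω)).hasSum h).congr_fun fun i => ?_
    simp

/-- The direction `state (mono₂ i)` is written as a superposition of Dirac masses with density
`mono₂ i`. Summing over `i` afterwards rebuilds a second Dirac mass at the same point, by
`hasSum_dirac`. -/
theorem integral_coordinate_pairing {Λ : TraceSpace H → TraceSpace H →L[ℝ] ℂ} (hΛ : TameC1 Λ)
    (i : (ℕ × ℕ) × (ℕ × ℕ)) :
    ∫ ω, (W (monoL2 i) ω : ℂ) * Λ (F.field W ω) (F.basis i) ∂P =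
      ∫ q : Ω × Sq, (mono₂ i q.2 : ℂ) *
        fderiv ℝ Λ (F.field W q.1) (F.dirac q.2) (F.basis i) ∂(P.prod volume) := by
  have := (IsCentredGaussian.gaussian hW).isProbabilityMeasure
  obtain ⟨h1, C, hC, hb⟩ := id hΛ
  have hd : Continuous (fderiv ℝ Λ) := h1.continuous_fderiv one_ne_zero
  have hfm := F.aestronglyMeasurable_field hW
  have hn2 : ∀ (ω : Ω) (y : Sq) (Z : TraceSpace H) (b : ℝ), ‖Z‖ ≤ b →
      ‖fderiv ℝ Λ (F.field W ω) (F.dirac y) Z‖ ≤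
        C * F.featBound ^ 2 * b * Real.exp (C * ‖F.field W ω‖) := fun ω y Z b hZ =>
    norm_second_le (Y := F.dirac y) hC (fun X => (hb X).2) _ (sq_nonneg _) (F.norm_dirac_le y) hZ
  have ht : TameC1 fun X => Λ X (F.basis i) :=
    hΛ.clm_comp (ContinuousLinearMap.apply ℝ ℂ (F.basis i))
  have hi : Integrable (mono₂ i) := (continuous_mono₂ i).integrable_of_hasCompactSupport
    (HasCompactSupport.of_compactSpace _)
  have hfd : ∀ X Y, fderiv ℝ (fun X => Λ X (F.basis i)) X Y = fderiv ℝ Λ X Y (F.basis i) := by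
    intro X Y
    have h := ((ContinuousLinearMap.apply ℝ ℂ (F.basis i)).hasFDerivAt).comp X
      (h1.differentiable one_ne_zero X).hasFDerivAt
    have h' : HasFDerivAt (fun X => Λ X (F.basis i)) _ X := h
    rw [h'.fderiv]
    rfl
  rw [F.integral_coordinate_mul hW ht i, integral_prod]
  · refine integral_congr_ae (Eventually.of_forall fun ω => ?_)
    simp only
    rw [hfd, state]
    have h := ((ContinuousLinearMap.apply ℝ ℂ (F.basis i)).comp
      (fderiv ℝ Λ (F.field W ω))).integral_comp_comm (F.integrable_smul_dirac hi)
    refine h.symm.trans (integral_congr_ae (Eventually.of_forall fun y => ?_))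
    simp
  · have e : Continuous fun q : TraceSpace H × Sq => (mono₂ i q.2 : ℂ) *
        fderiv ℝ Λ q.1 (F.dirac q.2) (F.basis i) := by
      have := continuous_mono₂ i
      have := F.continuous_dirac
      refine Continuous.mul (by fun_prop) ?_
      exact ((hd.comp continuous_fst).clm_apply (by fun_prop)).clm_apply continuous_const
    have hi := ((F.integrable_exp_norm_field hW C).const_mul
      (C * F.featBound ^ 2 * F.bound ^ 2)).mul_prod (integrable_const (μ := (volume : Measure Sq)) (1 : ℝ))
    refine hi.mono' (e.comp_aestronglyMeasurable (hfm.comp_fst.prodMk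
      measurable_snd.aestronglyMeasurable)) (Eventually.of_forall fun q => ?_)
    rw [norm_mul, Complex.norm_real, mul_one]
    have a1 : ‖mono₂ i q.2‖ ≤ 1 := by
      rw [Real.norm_eq_abs, mono₂, abs_mul]
      exact mul_le_one₀ (abs_mono_le_one _ _) (abs_nonneg _) (abs_mono_le_one _ _)
    refine (mul_le_of_le_one_left (norm_nonneg _) a1).trans ?_
    exact hn2 q.1 q.2 _ _ (F.norm_basis_le i)

theorem integrable_fderiv_dirac {Λ : TraceSpace H → TraceSpace H →L[ℝ] ℂ} (hΛ : TameC1 Λ) :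
    Integrable (fun q : Ω × Sq => fderiv ℝ Λ (F.field W q.1) (F.dirac q.2) (F.dirac q.2))
      (P.prod volume) := by
  have := (IsCentredGaussian.gaussian hW).isProbabilityMeasure
  obtain ⟨h1, C, hC, hb⟩ := id hΛ
  have hd : Continuous (fderiv ℝ Λ) := h1.continuous_fderiv one_ne_zero
  have hfm := F.aestronglyMeasurable_field hW
  have hn2 : ∀ (ω : Ω) (y : Sq) (Z : TraceSpace H) (b : ℝ), ‖Z‖ ≤ b →
      ‖fderiv ℝ Λ (F.field W ω) (F.dirac y) Z‖ ≤
        C * F.featBound ^ 2 * b * Real.exp (C * ‖F.field W ω‖) := fun ω y Z b hZ =>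
    norm_second_le (Y := F.dirac y) hC (fun X => (hb X).2) _ (sq_nonneg _) (F.norm_dirac_le y) hZ
  have e0 : Continuous fun q : TraceSpace H × Sq => fderiv ℝ Λ q.1 (F.dirac q.2) := by
    have := F.continuous_dirac
    exact (hd.comp continuous_fst).clm_apply (by fun_prop)
  have e : Continuous fun q : TraceSpace H × Sq =>
      fderiv ℝ Λ q.1 (F.dirac q.2) (F.dirac q.2) :=
    e0.clm_apply (F.continuous_dirac.comp continuous_snd)
  have hexpi : Integrable (fun q : Ω × Sq => Real.exp (C * ‖F.field W q.1‖)) (P.prod volume) := by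
    simpa using (F.integrable_exp_norm_field hW C).mul_prod
      (integrable_const (μ := (volume : Measure Sq)) (1 : ℝ))
  have hpm : AEStronglyMeasurable (fun q : Ω × Sq => (F.field W q.1, q.2)) (P.prod volume) :=
    hfm.comp_fst.prodMk measurable_snd.aestronglyMeasurable
  refine (hexpi.const_mul (C * F.featBound ^ 2 * F.featBound ^ 2)).mono'
    (e.comp_aestronglyMeasurable hpm) (Eventually.of_forall fun q => ?_)
  exact hn2 q.1 q.2 _ _ (F.norm_dirac_le q.2)

/-- `E[Λ(σ)(σ)] = ∫ dy E[(DΛ(σ) δ_y)(δ_y)]`. -/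
theorem integral_field_pairing {Λ : TraceSpace H → TraceSpace H →L[ℝ] ℂ} (hΛ : TameC1 Λ) :
    ∫ ω, Λ (F.field W ω) (F.field W ω) ∂P =
      ∫ y, ∫ ω, fderiv ℝ Λ (F.field W ω) (F.dirac y) (F.dirac y) ∂P := by
  have := (IsCentredGaussian.gaussian hW).isProbabilityMeasure
  obtain ⟨h1, C, hC, hb⟩ := id hΛ
  have hd : Continuous (fderiv ℝ Λ) := h1.continuous_fderiv one_ne_zero
  have hfm := F.aestronglyMeasurable_field hW
  have hn2 : ∀ (ω : Ω) (y : Sq) (Z : TraceSpace H) (b : ℝ), ‖Z‖ ≤ b →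
      ‖fderiv ℝ Λ (F.field W ω) (F.dirac y) Z‖ ≤
        C * F.featBound ^ 2 * b * Real.exp (C * ‖F.field W ω‖) := fun ω y Z b hZ =>
    norm_second_le (Y := F.dirac y) hC (fun X => (hb X).2) _ (sq_nonneg _) (F.norm_dirac_le y) hZ
  have hs1 := F.hasSum_coordinate_pairing hW hΛ
  simp_rw [F.integral_coordinate_pairing hW hΛ] at hs1
  have e0 : Continuous fun q : TraceSpace H × Sq => fderiv ℝ Λ q.1 (F.dirac q.2) := by
    have := F.continuous_dirac
    exact (hd.comp continuous_fst).clm_apply (by fun_prop)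
  have hexpi : Integrable (fun q : Ω × Sq => Real.exp (C * ‖F.field W q.1‖)) (P.prod volume) := by
    simpa using (F.integrable_exp_norm_field hW C).mul_prod
      (integrable_const (μ := (volume : Measure Sq)) (1 : ℝ))
  have hpm : AEStronglyMeasurable (fun q : Ω × Sq => (F.field W q.1, q.2)) (P.prod volume) :=
    hfm.comp_fst.prodMk measurable_snd.aestronglyMeasurable
  have hs2 : HasSum (fun i => ∫ q : Ω × Sq, (mono₂ i q.2 : ℂ) *
        fderiv ℝ Λ (F.field W q.1) (F.dirac q.2) (F.basis i) ∂(P.prod volume))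
      (∫ q : Ω × Sq, fderiv ℝ Λ (F.field W q.1) (F.dirac q.2) (F.dirac q.2)
        ∂(P.prod volume)) := by
    refine hasSum_integral_of_dominated_convergence
      (fun i q => wt₂ i * (C * F.featBound ^ 2 * F.bound ^ 2 * Real.exp (C * ‖F.field W q.1‖)))
      (fun i => ?_) (fun i => Eventually.of_forall fun q => ?_)
      (Eventually.of_forall fun q => summable_wt₂.mul_right _) ?_
      (Eventually.of_forall fun q => ?_)
    · have e' : Continuous fun q : TraceSpace H × Sq => (mono₂ i q.2 : ℂ) *
          fderiv ℝ Λ q.1 (F.dirac q.2) (F.basis i) := by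
        have := continuous_mono₂ i
        exact Continuous.mul (by fun_prop) (e0.clm_apply continuous_const)
      exact e'.comp_aestronglyMeasurable hpm
    · rw [norm_mul, Complex.norm_real]
      refine mul_le_mul (abs_mono₂_le i q.2) ?_ (norm_nonneg _) (wt₂_pos i).le
      exact hn2 q.1 q.2 _ _ (F.norm_basis_le i)
    · simp_rw [tsum_mul_right]
      exact (hexpi.const_mul _).const_mul _
    · refine ((fderiv ℝ Λ (F.field W q.1) (F.dirac q.2)).hasSum
        (F.hasSum_dirac q.2)).congr_fun fun i => ?_
      simp
  rw [hs1.unique hs2, integral_prod_symm]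
  exact F.integrable_fderiv_dirac hW hΛ

end Features

/-- A function with a continuous directional derivative is differentiable. -/
theorem hasFDerivAt_of_hasDerivAt_line {E : Type*} [NormedAddCommGroup E] [NormedSpace ℝ E]
    {f : E → ℂ} {f' : E → E →L[ℝ] ℂ} (hc : Continuous f')
    (hf : ∀ X Y, HasDerivAt (fun r : ℝ => f (X + r • Y)) (f' X Y) 0) (X : E) :
    HasFDerivAt f (f' X) X := by
  have hline : ∀ X Y (r₀ : ℝ), HasDerivAt (fun r : ℝ => f (X + r • Y)) (f' (X + r₀ • Y) Y) r₀ := by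
    intro X Y r₀
    have h : HasDerivAt (fun r : ℝ => f (X + r₀ • Y + r • Y)) (f' (X + r₀ • Y) Y) (r₀ - r₀) := by
      rw [sub_self]; exact hf _ _
    have h2 := h.comp_sub_const r₀ r₀
    refine h2.congr_of_eventuallyEq (Eventually.of_forall fun r => ?_)
    simp only
    congr 1
    rw [add_assoc, ← add_smul]
    congr 2
    ring
  rw [hasFDerivAt_iff_isLittleO_nhds_zero, Asymptotics.isLittleO_iff]
  intro ε hε
  have hev : ∀ᶠ Y in 𝓝 (0 : E), ‖f' (X + Y) - f' X‖ ≤ ε := by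
    have h1 : Tendsto (fun Y => ‖f' (X + Y) - f' X‖) (𝓝 0) (𝓝 0) := by
      have h2 : Continuous fun Y => ‖f' (X + Y) - f' X‖ := by fun_prop
      have := h2.tendsto 0
      simpa using this
    exact h1.eventually (ge_mem_nhds hε)
  obtain ⟨ρ, hρ, hball⟩ := Metric.eventually_nhds_iff_ball.1 hev
  filter_upwards [Metric.ball_mem_nhds (0 : E) hρ] with Y hY
  have hmv := (convex_Icc (0 : ℝ) 1).norm_image_sub_le_of_norm_hasDerivWithin_le
    (f := fun r : ℝ => f (X + r • Y) - (r : ℂ) * f' X Y)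
    (f' := fun r => f' (X + r • Y) Y - f' X Y) (C := ε * ‖Y‖) (x := 0) (y := 1)
    (fun r _ => by
      have h1 : HasDerivAt (fun r : ℝ => (r : ℂ) * f' X Y) (f' X Y) r := by
        simpa using (HasDerivAt.ofReal_comp (hasDerivAt_id r)).mul_const (f' X Y)
      exact ((hline X Y r).sub h1).hasDerivWithinAt)
    (fun r hr => by
      rw [← sub_apply]
      refine (ContinuousLinearMap.le_opNorm _ _).trans ?_
      refine mul_le_mul_of_nonneg_right (hball _ ?_) (norm_nonneg _)
      rw [mem_ball_zero_iff] at hY ⊢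
      rw [norm_smul, Real.norm_of_nonneg hr.1]
      exact (mul_le_of_le_one_left (norm_nonneg _) hr.2).trans_lt hY)
    (by simp) (by simp)
  simp only [one_smul, Complex.ofReal_one, one_mul, zero_smul, add_zero, Complex.ofReal_zero,
    zero_mul, sub_zero, norm_one, mul_one] at hmv
  calc _ = ‖f (X + Y) - f' X Y - f X‖ := by congr 1; ring
    _ ≤ _ := hmv

/-! ### Resolvent kernels and their derivatives in the field -/

namespace Features

open TraceSpace

variable {Φ : Model} {H : Type*} [NormedAddCommGroup H] [InnerProductSpace ℂ H] [CompleteSpace H]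
  (F : Features Φ H)

/-- The kernel `⟨A_a, (R - τ) B A_b⟩`. -/
def ker (z : ℂ) (t : ℕ → ℝ) (X : TraceSpace H) (τ : ℂ) (B : H →L[ℂ] H) (a b : Sq) : ℂ :=
  inner ℂ (F.feat a) (((F.res z t X - τ • 1) * B) (F.feat b))

theorem ker_zero (z : ℂ) (t : ℕ → ℝ) (X : TraceSpace H) (B : H →L[ℂ] H) (a b : Sq) :
    F.ker z t X 0 B a b = inner ℂ (F.feat a) ((F.res z t X * B) (F.feat b)) := by
  simp [ker]

theorem ker_one (z : ℂ) (t : ℕ → ℝ) (X : TraceSpace H) (B : H →L[ℂ] H) (a b : Sq) :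
    F.ker z t X 1 B a b = inner ℂ (F.feat a) (((F.res z t X - 1) * B) (F.feat b)) := by
  simp [ker]

/-- On the diagonal the first summand is T(t) or T_j. This splitting is what exposes the tadpoles to
the cancellation. -/
theorem ker_zero_eq_add (z : ℂ) (t : ℕ → ℝ) (X : TraceSpace H) (B : H →L[ℂ] H) (a b : Sq) :
    F.ker z t X 0 B a b = inner ℂ (F.feat a) (B (F.feat b)) + F.ker z t X 1 B a b := by
  rw [ker_zero, ker_one, ← inner_add_right]
  congr 1
  simp [sub_mul]

/-- The matrix element `T ↦ ⟨A_a, T A_b⟩`. -/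
def elt (a b : Sq) : (H →L[ℂ] H) →L[ℝ] ℂ :=
  ((innerSL ℂ (F.feat a)).comp (ContinuousLinearMap.apply ℂ H (F.feat b))).restrictScalars ℝ

theorem elt_apply (a b : Sq) (T : H →L[ℂ] H) : F.elt a b T = inner ℂ (F.feat a) (T (F.feat b)) :=
  rfl

/-- The functional `Y ↦ ⟨A_a, R B Y R B' A_b⟩`. -/
def insertion (z : ℂ) (t : ℕ → ℝ) (B B' : H →L[ℂ] H) (a b : Sq) (X : TraceSpace H) :
    TraceSpace H →L[ℝ] ℂ :=
  (F.elt a b).comp ((ContinuousLinearMap.mulLeftRight ℝ (H →L[ℂ] H) (F.res z t X * B)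
    (F.res z t X * B')).comp (op H))

theorem insertion_apply (z : ℂ) (t : ℕ → ℝ) (B B' : H →L[ℂ] H) (a b : Sq) (X Y : TraceSpace H) :
    F.insertion z t B B' a b X Y =
      inner ℂ (F.feat a) ((F.res z t X * B * op H Y * (F.res z t X * B')) (F.feat b)) := rfl

/-- A Dirac mass has a rank one operator, so inserting it cuts the line at `y` into two kernels. -/
theorem insertion_dirac (z : ℂ) (t : ℕ → ℝ) (B B' : H →L[ℂ] H) (a b y : Sq) (X : TraceSpace H) :
    F.insertion z t B B' a b X (F.dirac y) = F.ker z t X 0 B a y * F.ker z t X 0 B' y b := by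
  rw [insertion_apply, ker_zero, ker_zero]
  simp only [mul_apply_eq_comp]
  simp only [ContinuousLinearMap.comp_apply, op_dirac, map_smul, inner_smul_right]
  rw [mul_comm]

section Tame

variable {z : ℂ} {δ : ℝ} (hδ : 0 < δ) (hz : ∀ r : ℝ, δ ≤ ‖1 + z * (r : ℂ)‖) {t : ℕ → ℝ}
  (ht : t ∈ unitCube)

include hδ hz ht

theorem contDiff_res : ContDiff ℝ 1 (F.res z t) := by
  rw [contDiff_iff_contDiffAt]
  intro X
  obtain ⟨u, hu⟩ := F.isUnit_res hδ hz ht X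
  have h := contDiffAt_ringInverse (n := 1) ℝ u
  rw [hu] at h
  have h2 : ContDiffAt ℝ 1 (fun X => 1 + (z • F.interp t) * op H X) X := by
    have : ContDiff ℝ 1 (fun X => op H X) := (op H).contDiff
    exact (contDiff_const.add (contDiff_const.mul this)).contDiffAt
  exact ContDiffAt.comp (g := Ring.inverse) X h h2

theorem fderiv_res_apply (X Y : TraceSpace H) : fderiv ℝ (F.res z t) X Y =
    -(z • (F.res z t X * F.interp t * op H Y * F.res z t X)) := by
  have h1 := ((F.contDiff_res hδ hz ht).differentiable one_ne_zero X).hasFDerivAt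
  have h2 : HasDerivAt (fun r : ℝ => X + r • Y) Y 0 := by
    simpa using ((hasDerivAt_id (0 : ℝ)).smul_const Y).const_add X
  have h3 : HasFDerivAt (F.res z t) (fderiv ℝ (F.res z t) X) (X + (0 : ℝ) • Y) := by simpa using h1
  have h4 : HasDerivAt (fun r : ℝ => F.res z t (X + r • Y)) _ 0 :=
    HasFDerivAt.comp_hasDerivAt (l := F.res z t) (f := fun r : ℝ => X + r • Y) (0 : ℝ) h3 h2
  exact h4.unique (F.hasDerivAt_res_line hδ hz ht X Y)

theorem tameC1_res : TameC1 (F.res z t) := by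
  set K := ‖z‖ * (F.projBound ^ 2 * δ⁻¹) with hK
  have hK0 : 0 ≤ K := by positivity
  have hR : ∀ X, ‖F.res z t X‖ ≤ Real.exp (K * ‖X‖) := fun X =>
    (F.norm_res_le hδ hz ht X).trans (by rw [add_comm]; exact Real.add_one_le_exp _)
  refine TameC1.of_bounds (F.contDiff_res hδ hz ht) (A := 1) (a := K) (B := K) (b := K)
    (fun X => by rw [one_mul]; exact hR X) fun X => ?_
  refine ContinuousLinearMap.opNorm_le_bound _ (by positivity) fun Y => ?_
  rw [F.fderiv_res_apply hδ hz ht, norm_neg, norm_smul]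
  have h1 := F.norm_res_mul_interp_le hδ hz ht X
  have h2 := norm_op_le Y
  calc _ ≤ ‖z‖ * (‖F.res z t X * F.interp t‖ * ‖op H Y‖ * ‖F.res z t X‖) := by
        gcongr
        exact (norm_mul_le _ _).trans (by gcongr; exact norm_mul_le _ _)
    _ ≤ ‖z‖ * (F.projBound ^ 2 * δ⁻¹ * ‖Y‖ * Real.exp (K * ‖X‖)) := by
        gcongr
        exact hR X
    _ = _ := by rw [hK]; ring

omit hδ hz ht in
/-- The differential of the interaction. -/
def potDeriv (z : ℂ) (t : ℕ → ℝ) (X : TraceSpace H) : TraceSpace H →L[ℝ] ℂ :=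
  z • (trReal H).flip (F.interp t) -
    (1 / 2 * z) • (trReal H).flip ((F.res z t X - 1) * F.interp t)

omit hδ hz ht in
theorem potDeriv_apply (z : ℂ) (t : ℕ → ℝ) (X Y : TraceSpace H) :
    F.potDeriv z t X Y = z * tr H Y (F.interp t) -
      1 / 2 * (z * tr H Y ((F.res z t X - 1) * F.interp t)) := by
  rw [← mul_assoc]
  rfl

theorem hasFDerivAt_pot (X : TraceSpace H) : HasFDerivAt (F.pot z t) (F.potDeriv z t X) X := by
  refine hasFDerivAt_of_hasDerivAt_line ?_ (fun X Y => ?_) X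
  · have h := (F.contDiff_res hδ hz ht).continuous
    unfold potDeriv
    have h2 : Continuous fun X => (trReal H).flip ((F.res z t X - 1) * F.interp t) :=
      (trReal H).flip.continuous.comp (by fun_prop)
    exact continuous_const.sub ((continuous_const_smul (1 / 2 * z)).comp h2)
  · rw [potDeriv_apply]
    exact F.hasDerivAt_pot_line hδ hz ht X Y

theorem norm_pot_le_mul : ∃ A, 0 ≤ A ∧ ∀ X, ‖F.pot z t X‖ ≤ A * (1 + ‖X‖) := by
  set a := ‖z‖ ^ 2 * |tad Φ t| ^ 2
  set b := ‖z‖ * (F.projBound ^ 2 * δ⁻¹ + 2 * F.projBound)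
  have ha : 0 ≤ a := by positivity
  have hb : 0 ≤ b := by have := F.projBound_nonneg; positivity
  refine ⟨a + b, by positivity, fun X => (F.norm_pot_le hδ hz ht X).trans ?_⟩
  nlinarith [norm_nonneg X, mul_nonneg ha (norm_nonneg X)]

theorem tameC1_pot : TameC1 (F.pot z t) := by
  obtain ⟨A, hA0, hA⟩ := F.norm_pot_le_mul hδ hz ht
  have hc : Continuous (F.potDeriv z t) := by
    have h := (F.contDiff_res hδ hz ht).continuous
    unfold potDeriv
    have h2 : Continuous fun X => (trReal H).flip ((F.res z t X - 1) * F.interp t) :=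
      (trReal H).flip.continuous.comp (by fun_prop)
    exact continuous_const.sub ((continuous_const_smul (1 / 2 * z)).comp h2)
  set K := ‖z‖ * (F.projBound ^ 2 * δ⁻¹ + 2 * F.projBound)
  have hp := F.projBound_nonneg
  have hK0 : 0 ≤ K := by positivity
  refine TameC1.of_bounds (A := A) (a := 1) (B := K) (b := 0) ?_ (fun X => (hA X).trans ?_)
    fun X => ?_
  · exact contDiff_one_iff_hasFDerivAt.2 ⟨_, hc, F.hasFDerivAt_pot hδ hz ht⟩
  · gcongr
    rw [one_mul, add_comm]
    exact Real.add_one_le_exp _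
  · rw [(F.hasFDerivAt_pot hδ hz ht X).fderiv, zero_mul, Real.exp_zero, mul_one]
    refine ContinuousLinearMap.opNorm_le_bound _ hK0 fun Y => ?_
    rw [potDeriv_apply]
    have h1 := norm_tr_apply_le Y (F.interp t)
    have h2 := norm_tr_apply_le Y ((F.res z t X - 1) * F.interp t)
    have h3 := F.norm_interp_le ht
    have h4 := F.norm_res_mul_interp_le hδ hz ht X
    have h5 : ‖(F.res z t X - 1) * F.interp t‖ ≤ F.projBound ^ 2 * δ⁻¹ + F.projBound := by
      rw [sub_mul, one_mul]
      exact (norm_sub_le _ _).trans (add_le_add h4 h3)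
    have hY := norm_nonneg Y
    refine (norm_sub_le _ _).trans ?_
    rw [norm_mul, norm_mul, norm_mul]
    have h6 : ‖(1 / 2 : ℂ)‖ = 1 / 2 := by norm_num
    rw [h6]
    calc _ ≤ ‖z‖ * (‖Y‖ * F.projBound) + 1 / 2 * (‖z‖ * (‖Y‖ *
          (F.projBound ^ 2 * δ⁻¹ + F.projBound))) := by
          gcongr
          · exact h1.trans (by gcongr)
          · exact h2.trans (by gcongr)
      _ ≤ ‖z‖ * (‖Y‖ * F.projBound) + 1 * (‖z‖ * (‖Y‖ *
          (F.projBound ^ 2 * δ⁻¹ + F.projBound))) := by gcongr; norm_num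
      _ = _ := by ring

theorem tameC1_exp_pot : TameC1 (fun X => Complex.exp (F.pot z t X)) := by
  obtain ⟨A, _, hA⟩ := F.norm_pot_le_mul hδ hz ht
  exact (F.tameC1_pot hδ hz ht).cexp hA

theorem tameC1_ker (τ : ℂ) (B : H →L[ℂ] H) (a b : Sq) :
    TameC1 (fun X => F.ker z t X τ B a b) := by
  have h1 : TameC1 fun X => F.res z t X + -(τ • (1 : H →L[ℂ] H)) :=
    (F.tameC1_res hδ hz ht).add (TameC1.const _)
  have h2 := TameC1.bilin (ContinuousLinearMap.mul ℝ (H →L[ℂ] H)) h1 (TameC1.const B)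
  have h3 := h2.clm_comp (F.elt a b)
  simp only [← sub_eq_add_neg] at h3
  exact h3

theorem tameC1_insertion (B B' : H →L[ℂ] H) (a b : Sq) :
    TameC1 (F.insertion z t B B' a b) := by
  have h1 := TameC1.bilin (ContinuousLinearMap.mul ℝ (H →L[ℂ] H)) (F.tameC1_res hδ hz ht)
    (TameC1.const B)
  have h2 := TameC1.bilin (ContinuousLinearMap.mul ℝ (H →L[ℂ] H)) (F.tameC1_res hδ hz ht)
    (TameC1.const B')
  have h3 := TameC1.bilin (ContinuousLinearMap.mulLeftRight ℝ (H →L[ℂ] H)) h1 h2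
  have h4 := h3.clm_comp ((ContinuousLinearMap.compL ℝ (TraceSpace H) (H →L[ℂ] H)
    (H →L[ℂ] H)).flip (op H))
  exact h4.clm_comp (ContinuousLinearMap.compL ℝ (TraceSpace H) (H →L[ℂ] H) ℂ (F.elt a b))

theorem tameC1_tr_res (B : H →L[ℂ] H) :
    TameC1 (fun X => (trReal H).flip ((F.res z t X - 1) * B)) := by
  have h1 : TameC1 fun X => F.res z t X + -(1 : H →L[ℂ] H) :=
    (F.tameC1_res hδ hz ht).add (TameC1.const _)
  have h2 := TameC1.bilin (ContinuousLinearMap.mul ℝ (H →L[ℂ] H)) h1 (TameC1.const B)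
  have h3 := h2.clm_comp (trReal H).flip
  simp only [← sub_eq_add_neg] at h3
  exact h3

theorem hasDerivAt_ker_dirac (X : TraceSpace H) (τ : ℂ) (B : H →L[ℂ] H) (a b y : Sq) :
    HasDerivAt (fun r : ℝ => F.ker z t (X + r • F.dirac y) τ B a b)
      (-z * (F.ker z t X 0 (F.interp t) a y * F.ker z t X 0 B y b)) 0 := by
  have h1 := (((F.hasDerivAt_res_line hδ hz ht X (F.dirac y)).sub_const
    (τ • (1 : H →L[ℂ] H))).mul_const B)
  have h2 := (F.elt a b).hasFDerivAt.comp_hasDerivAt (0 : ℝ) h1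
  refine h2.congr_deriv ?_
  have h3 := F.insertion_dirac z t (F.interp t) B a b y X
  rw [insertion_apply] at h3
  rw [← h3, elt_apply, neg_mul, neg_apply, inner_neg_right, neg_mul, smul_mul_assoc, smul_apply,
    inner_smul_right, mul_assoc _ (F.res z t X) B]

/-- The trace pairing with a Dirac mass evaluates the diagonal at `y`: the linear counterterm
contributes T(t), and the logarithm half of the kernel of R - 1. -/
theorem hasDerivAt_pot_dirac (X : TraceSpace H) (y : Sq) :
    HasDerivAt (fun r : ℝ => F.pot z t (X + r • F.dirac y))
      (z * ((tad Φ t : ℂ) - 1 / 2 * F.ker z t X 1 (F.interp t) y y)) 0 := by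
  refine (F.hasDerivAt_pot_line hδ hz ht X (F.dirac y)).congr_deriv ?_
  rw [tr_dirac, tr_dirac, inner_feat_interp_self, ker_one]
  ring

end Tame

end Features

/-! ### Contraction of the explicit field -/

namespace Features

open TraceSpace

variable {Φ : Model} {H : Type*} [NormedAddCommGroup H] [InnerProductSpace ℂ H] [CompleteSpace H]
  (F : Features Φ H)

theorem integrable_comp_field {Ω : Type*} [MeasurableSpace Ω] {P : Measure Ω} {W : L2 → Ω → ℝ}
    (hW : IsWhiteNoise P W) {f : TraceSpace H → ℂ} (hf : Continuous f) {A a : ℝ}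
    (hb : ∀ X, ‖f X‖ ≤ A * Real.exp (a * ‖X‖)) : Integrable (fun ω => f (F.field W ω)) P :=
  ((F.integrable_exp_norm_field hW a).const_mul A).mono'
    (hf.comp_aestronglyMeasurable (F.aestronglyMeasurable_field hW))
    (Eventually.of_forall fun ω => hb _)

theorem integrable_tame {Ω : Type*} [MeasurableSpace Ω] {P : Measure Ω} {W : L2 → Ω → ℝ}
    (hW : IsWhiteNoise P W) {f : TraceSpace H → ℂ} (hf : TameC1 f) :
    Integrable (fun ω => f (F.field W ω)) P := by
  obtain ⟨h1, C, _, hb⟩ := hf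
  exact F.integrable_comp_field hW h1.continuous fun X => (hb X).1

theorem integrable_pairing {Ω : Type*} [MeasurableSpace Ω] {P : Measure Ω} {W : L2 → Ω → ℝ}
    (hW : IsWhiteNoise P W) {Λ : TraceSpace H → TraceSpace H →L[ℝ] ℂ} (hΛ : TameC1 Λ) :
    Integrable (fun ω => Λ (F.field W ω) (F.field W ω)) P := by
  obtain ⟨h1, C, hC, hb⟩ := hΛ
  refine F.integrable_comp_field hW (f := fun X => Λ X X) (A := C) (a := C + 1)
    (h1.continuous.clm_apply continuous_id) fun X => ?_
  have h2 : ‖X‖ ≤ Real.exp (1 * ‖X‖) := by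
    rw [one_mul]; exact (le_add_of_nonneg_right zero_le_one).trans (Real.add_one_le_exp _)
  rw [add_mul, Real.exp_add, ← mul_assoc]
  exact (ContinuousLinearMap.le_opNorm _ _).trans
    (mul_le_mul (hb X).1 h2 (norm_nonneg _) (by positivity))

section Contraction

variable (z : ℂ) (t : ℕ → ℝ) {L : Type*} [Fintype L] [DecidableEq L] (a b : L → Sq) (τ : L → ℂ)
  (B : L → H →L[ℂ] H) (j : ℕ)

/-- The product of all line kernels. -/
def lineProd (X : TraceSpace H) : ℂ := ∏ l, F.ker z t X (τ l) (B l) (a l) (b l)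

/-- The product of the line kernels except one. -/
def lineProdErase (l : L) (X : TraceSpace H) : ℂ :=
  ∏ k ∈ Finset.univ.erase l, F.ker z t X (τ k) (B k) (a k) (b k)

/-- The product of the line kernels except two. -/
def lineProdErase₂ (l l' : L) (X : TraceSpace H) : ℂ :=
  ∏ k ∈ (Finset.univ.erase l).erase l', F.ker z t X (τ k) (B k) (a k) (b k)

/-- The derivative of the interaction with respect to `t_j`. -/
def potSlope (X : TraceSpace H) : ℂ :=
  -(3 / 2) * z ^ 2 * (tad Φ t : ℂ) * (sliceTad Φ j : ℂ) + z * tr H X (F.proj j)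
    - 1 / 2 * (z * tr H X ((F.res z t X - 1) * F.proj j))

/-- The result of contracting the explicit field against the vertices, at the point `y`. -/
def contracted (y : Sq) (X : TraceSpace H) : ℂ :=
  3 * F.ker z t X 1 (F.interp t) y y * F.ker z t X 1 (F.proj j) y y * F.lineProd z t a b τ B X
  + 6 * F.ker z t X 1 (F.proj j) y y * ∑ l, F.lineProdErase z t a b τ B l X *
      (F.ker z t X 0 (F.interp t) (a l) y * F.ker z t X 0 (B l) y (b l))
  + 6 * F.ker z t X 1 (F.interp t) y y * ∑ l, F.lineProdErase z t a b τ B l X *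
      (F.ker z t X 0 (F.proj j) (a l) y * F.ker z t X 0 (B l) y (b l))
  + 4 * ∑ l, (∑ l' ∈ Finset.univ.erase l, F.lineProdErase₂ z t a b τ B l l' X *
      (F.ker z t X 0 (F.interp t) (a l') y * F.ker z t X 0 (B l') y (b l'))) *
      (F.ker z t X 0 (F.proj j) (a l) y * F.ker z t X 0 (B l) y (b l))

/-- The part of the `t_j`-derivative which is linear in an explicit field. -/
def explicitPart (X : TraceSpace H) : TraceSpace H →L[ℝ] ℂ :=
  Complex.exp (F.pot z t X) •
    (F.lineProd z t a b τ B X • (z • (trReal H).flip (F.proj j) +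
        (-(1 / 2 * z)) • (trReal H).flip ((F.res z t X - 1) * F.proj j)) +
      (-z) • ∑ l, F.lineProdErase z t a b τ B l X • F.insertion z t (F.proj j) (B l) (a l) (b l) X)

theorem explicitPart_apply (X Y : TraceSpace H) : F.explicitPart z t a b τ B j X Y =
    Complex.exp (F.pot z t X) * (F.lineProd z t a b τ B X * (z * tr H Y (F.proj j)
      - 1 / 2 * (z * tr H Y ((F.res z t X - 1) * F.proj j)))
      - z * ∑ l, F.lineProdErase z t a b τ B l X *
        F.insertion z t (F.proj j) (B l) (a l) (b l) X Y) := by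
  simp only [explicitPart, add_apply, smul_apply, ContinuousLinearMap.sum_apply, smul_eq_mul,
    ContinuousLinearMap.flip_apply, trReal_apply]
  ring

variable {z t} {δ : ℝ} (hδ : 0 < δ) (hz : ∀ r : ℝ, δ ≤ ‖1 + z * (r : ℂ)‖)
  (ht : t ∈ unitCube)

include hδ hz ht

theorem tameC1_lineProd : TameC1 (F.lineProd z t a b τ B) :=
  TameC1.prod _ fun _ => F.tameC1_ker hδ hz ht _ _ _ _

theorem tameC1_lineProdErase (l : L) : TameC1 (F.lineProdErase z t a b τ B l) :=
  TameC1.prod _ fun _ => F.tameC1_ker hδ hz ht _ _ _ _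

theorem tameC1_explicitPart : TameC1 (F.explicitPart z t a b τ B j) := by
  refine (F.tameC1_exp_pot hδ hz ht).smul_clm (((F.tameC1_lineProd a b τ B hδ hz ht).smul_clm
    ((TameC1.const _).add ((TameC1.const _).smul_clm (F.tameC1_tr_res hδ hz ht _)))).add
    ((TameC1.const (-z)).smul_clm (TameC1.sum _ fun l =>
      (F.tameC1_lineProdErase a b τ B hδ hz ht l).smul_clm (F.tameC1_insertion hδ hz ht _ _ _ _))))

theorem hasDerivAt_prod_ker_dirac (X : TraceSpace H) (y : Sq) (I : Finset L) :
    HasDerivAt (fun r : ℝ => ∏ k ∈ I, F.ker z t (X + r • F.dirac y) (τ k) (B k) (a k) (b k))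
      (-z * ∑ l ∈ I, (∏ k ∈ I.erase l, F.ker z t X (τ k) (B k) (a k) (b k)) *
        (F.ker z t X 0 (F.interp t) (a l) y * F.ker z t X 0 (B l) y (b l))) 0 := by
  have h := HasDerivAt.fun_finsetProd (u := I) (fun k _ =>
    F.hasDerivAt_ker_dirac hδ hz ht X (τ k) (B k) (a k) (b k) y)
  refine h.congr_deriv ?_
  rw [Finset.mul_sum]
  refine Finset.sum_congr rfl fun l _ => ?_
  simp only [zero_smul, add_zero, smul_eq_mul]
  ring

/-- Let a and a_j be the diagonal kernels at `y` of (R - 1)C(t) and (R - 1)C_j. With no cut line the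
coefficient is z²[(T - a/2)(T_j - a_j/2) + (T + a)(T_j + a_j)/2] = z²(3TT_j/2 + 3aa_j/4): the mixed
products cancel. With one cut line that receives C(t), it is z²[-(T_j - a_j/2) + (T_j + a_j)] =
3z²a_j/2, and symmetrically 3z²a/2 when the line receives C_j. With two cut lines it is z².
Extracting z²/4 leaves the weights 3, 6, 6, 4. The remaining 3z²TT_j/2 is opposite to the
`t_j`-derivative of the counterterm quadratic in T. -/
theorem fderiv_explicitPart_dirac (hj : j ≤ Φ.jmax) (X : TraceSpace H) (y : Sq) :
    fderiv ℝ (F.explicitPart z t a b τ B j) X (F.dirac y) (F.dirac y) =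
      z ^ 2 / 4 * (Complex.exp (F.pot z t X) * F.contracted z t a b τ B j y X) +
      (3 / 2) * z ^ 2 * (tad Φ t : ℂ) * (sliceTad Φ j : ℂ) *
        (Complex.exp (F.pot z t X) * F.lineProd z t a b τ B X) := by
  have hline : HasDerivAt (fun r : ℝ => X + r • F.dirac y) (F.dirac y) 0 := by
    simpa using ((hasDerivAt_id (0 : ℝ)).smul_const (F.dirac y)).const_add X
  have h1 : HasFDerivAt (F.explicitPart z t a b τ B j)
      (fderiv ℝ (F.explicitPart z t a b τ B j) X) (X + (0 : ℝ) • F.dirac y) := by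
    simpa using ((F.tameC1_explicitPart a b τ B j hδ hz ht).contDiff.differentiable
      one_ne_zero X).hasFDerivAt
  have h2 : HasDerivAt (fun r : ℝ => F.explicitPart z t a b τ B j (X + r • F.dirac y) (F.dirac y))
      (fderiv ℝ (F.explicitPart z t a b τ B j) X (F.dirac y) (F.dirac y)) 0 :=
    HasFDerivAt.comp_hasDerivAt (l := ContinuousLinearMap.apply ℝ ℂ (F.dirac y)) (0 : ℝ)
      (ContinuousLinearMap.apply ℝ ℂ (F.dirac y)).hasFDerivAt
      (HasFDerivAt.comp_hasDerivAt (l := F.explicitPart z t a b τ B j) (0 : ℝ) h1 hline)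
  have hAt : tr H (F.dirac y) (F.proj j) = (sliceTad Φ j : ℂ) := by
    rw [tr_dirac, F.inner_feat_proj_self hj]
  have hA : ∀ X, tr H (F.dirac y) ((F.res z t X - 1) * F.proj j) =
      F.ker z t X 1 (F.proj j) y y := fun X => by rw [tr_dirac, ker_one]
  simp only [explicitPart_apply, hAt, hA, insertion_dirac] at h2
  have hE := (F.hasDerivAt_pot_dirac hδ hz ht X y).cexp
  have hP : HasDerivAt (fun r : ℝ => F.lineProd z t a b τ B (X + r • F.dirac y)) _ 0 :=
    F.hasDerivAt_prod_ker_dirac a b τ B hδ hz ht X y Finset.univ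
  have hPe : ∀ l, HasDerivAt (fun r : ℝ => F.lineProdErase z t a b τ B l (X + r • F.dirac y)) _ 0 :=
    fun l => F.hasDerivAt_prod_ker_dirac a b τ B hδ hz ht X y (Finset.univ.erase l)
  have hAj := F.hasDerivAt_ker_dirac hδ hz ht X 1 (F.proj j) y y y
  have hpj := fun l => F.hasDerivAt_ker_dirac hδ hz ht X 0 (F.proj j) (a l) y y
  have hq := fun l => F.hasDerivAt_ker_dirac hδ hz ht X 0 (B l) y (b l) y
  have h3 := hE.fun_mul ((hP.fun_mul ((hasDerivAt_const (0 : ℝ) (z * (sliceTad Φ j : ℂ))).fun_sub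
    ((hAj.const_mul z).const_mul (1 / 2)))).fun_sub
    ((HasDerivAt.fun_sum (u := Finset.univ) fun l _ => (hPe l).fun_mul ((hpj l).fun_mul (hq l))).const_mul z))
  rw [h2.unique h3]
  have hT : F.ker z t X 0 (F.interp t) y y = (tad Φ t : ℂ) + F.ker z t X 1 (F.interp t) y y := by
    rw [ker_zero_eq_add, inner_feat_interp_self]
  have hTj : F.ker z t X 0 (F.proj j) y y = (sliceTad Φ j : ℂ) + F.ker z t X 1 (F.proj j) y y := by
    rw [ker_zero_eq_add, inner_feat_proj_self _ hj]
  simp only [zero_smul, add_zero, Pi.mul_apply, Pi.sub_apply, hT, hTj, zero_sub]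
  have hsum : ∑ l, ((-z * ∑ k ∈ Finset.univ.erase l,
        (∏ i ∈ (Finset.univ.erase l).erase k, F.ker z t X (τ i) (B i) (a i) (b i)) *
          (F.ker z t X 0 (F.interp t) (a k) y * F.ker z t X 0 (B k) y (b k))) *
        (F.ker z t X 0 (F.proj j) (a l) y * F.ker z t X 0 (B l) y (b l)) +
      F.lineProdErase z t a b τ B l X *
        (-z * (F.ker z t X 0 (F.interp t) (a l) y *
          ((sliceTad Φ j : ℂ) + F.ker z t X 1 (F.proj j) y y)) * F.ker z t X 0 (B l) y (b l) +
        F.ker z t X 0 (F.proj j) (a l) y *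
          (-z * (((tad Φ t : ℂ) + F.ker z t X 1 (F.interp t) y y) *
            F.ker z t X 0 (B l) y (b l))))) =
      -z * ∑ l, (∑ l' ∈ Finset.univ.erase l, F.lineProdErase₂ z t a b τ B l l' X *
      (F.ker z t X 0 (F.interp t) (a l') y * F.ker z t X 0 (B l') y (b l'))) *
      (F.ker z t X 0 (F.proj j) (a l) y * F.ker z t X 0 (B l) y (b l)) -
      z * ((sliceTad Φ j : ℂ) + F.ker z t X 1 (F.proj j) y y) *
        (∑ l, F.lineProdErase z t a b τ B l X *
      (F.ker z t X 0 (F.interp t) (a l) y * F.ker z t X 0 (B l) y (b l))) -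
      z * ((tad Φ t : ℂ) + F.ker z t X 1 (F.interp t) y y) *
        (∑ l, F.lineProdErase z t a b τ B l X *
      (F.ker z t X 0 (F.proj j) (a l) y * F.ker z t X 0 (B l) y (b l))) := by
    rw [Finset.mul_sum, Finset.mul_sum, Finset.mul_sum, ← Finset.sum_sub_distrib,
      ← Finset.sum_sub_distrib]
    refine Finset.sum_congr rfl fun l _ => ?_
    simp only [lineProdErase₂]
    ring
  rw [hsum, contracted]
  have hS1 : ∑ l, (∏ k ∈ Finset.univ.erase l, F.ker z t X (τ k) (B k) (a k) (b k)) *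
        (F.ker z t X 0 (F.interp t) (a l) y * F.ker z t X 0 (B l) y (b l)) =
      ∑ l, F.lineProdErase z t a b τ B l X *
      (F.ker z t X 0 (F.interp t) (a l) y * F.ker z t X 0 (B l) y (b l)) := rfl
  rw [hS1]
  ring

variable {Ω : Type*} [MeasurableSpace Ω] {P : Measure Ω} {W : L2 → Ω → ℝ}
  (hW : IsWhiteNoise P W)

include hW

/-- Integration by parts cancels the counterterms against the tadpoles. -/
theorem integral_explicit (hj : j ≤ Φ.jmax) :
    ∫ ω, Complex.exp (F.pot z t (F.field W ω)) *
        (F.potSlope z t j (F.field W ω) * F.lineProd z t a b τ B (F.field W ω) -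
          z * ∑ l, F.lineProdErase z t a b τ B l (F.field W ω) *
            F.insertion z t (F.proj j) (B l) (a l) (b l) (F.field W ω) (F.field W ω)) ∂P =
      z ^ 2 / 4 * ∫ y, ∫ ω, Complex.exp (F.pot z t (F.field W ω)) *
        F.contracted z t a b τ B j y (F.field W ω) ∂P := by
  have hP := (IsCentredGaussian.gaussian hW).isProbabilityMeasure
  have hΛ := F.tameC1_explicitPart a b τ B j hδ hz ht
  have hE : TameC1 fun X => Complex.exp (F.pot z t X) * F.lineProd z t a b τ B X :=
    (F.tameC1_exp_pot hδ hz ht).mul (F.tameC1_lineProd a b τ B hδ hz ht)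
  set κ : ℂ := (3 / 2) * z ^ 2 * (tad Φ t : ℂ) * (sliceTad Φ j : ℂ) with hκ
  have i1 := F.integrable_pairing hW hΛ
  have i2 := (F.integrable_tame hW hE).const_mul κ
  have e1 : ∀ X, Complex.exp (F.pot z t X) *
        (F.potSlope z t j X * F.lineProd z t a b τ B X -
          z * ∑ l, F.lineProdErase z t a b τ B l X *
            F.insertion z t (F.proj j) (B l) (a l) (b l) X X) =
      F.explicitPart z t a b τ B j X X -
        κ * (Complex.exp (F.pot z t X) * F.lineProd z t a b τ B X) := fun X => by
    rw [explicitPart_apply, potSlope, hκ]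
    ring
  simp_rw [e1]
  rw [integral_sub i1 i2, F.integral_field_pairing hW hΛ]
  have i3 := F.integrable_fderiv_dirac hW hΛ
  have i4 := i3.integral_prod_right
  have e2 : ∀ y, ∫ ω, fderiv ℝ (F.explicitPart z t a b τ B j) (F.field W ω) (F.dirac y)
        (F.dirac y) ∂P - ∫ ω, κ * (Complex.exp (F.pot z t (F.field W ω)) *
          F.lineProd z t a b τ B (F.field W ω)) ∂P =
      z ^ 2 / 4 * ∫ ω, Complex.exp (F.pot z t (F.field W ω)) *
        F.contracted z t a b τ B j y (F.field W ω) ∂P := fun y => by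
    have hd : Continuous fun X => fderiv ℝ (F.explicitPart z t a b τ B j) X (F.dirac y)
        (F.dirac y) :=
      ((hΛ.contDiff.continuous_fderiv one_ne_zero).clm_apply continuous_const).clm_apply
        continuous_const
    obtain ⟨_, C, hC, hb⟩ := id hΛ
    have i5 := F.integrable_comp_field hW hd
      fun X => norm_second_le hC (fun X => (hb X).2) X (sq_nonneg _) (F.norm_dirac_le y)
        (F.norm_dirac_le y)
    rw [← integral_sub i5 i2, ← integral_const_mul]
    refine integral_congr_ae (Eventually.of_forall fun ω => ?_)
    simp only
    rw [F.fderiv_explicitPart_dirac a b τ B j hδ hz ht hj, hκ]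
    ring
  rw [← integral_const_mul]
  simp_rw [← e2]
  -- The subtracted term does not depend on `y`, and the square has area 1.
  rw [integral_sub i4 (integrable_const _)]
  simp

end Contraction

end Features

/-! ### Values of marked graphs for general line kernels -/

namespace ResolventGraph

variable {p n : ℕ} (G : ResolventGraph p n) {α S : Type*}

open Classical in
/-- The label of a c-propagator: `d i` if it bears the mark `i`, and `c` if it bears no mark. -/
def lineVal (c : α) (d : Fin p → α) (l : Fin n × Bool) : α :=
  if h : ∃ i, G.mark i = l then d h.choose else c

theorem lineVal_mark (c : α) (d : Fin p → α) (i : Fin p) : G.lineVal c d (G.mark i) = d i := by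
  have h : ∃ k, G.mark k = G.mark i := ⟨i, rfl⟩
  rw [lineVal, dif_pos h]
  congr 1
  exact G.mark.injective h.choose_spec

theorem lineVal_of_notMem (c : α) (d : Fin p → α) {l : Fin n × Bool} (h : ∀ i, G.mark i ≠ l) :
    G.lineVal c d l = c := by
  rw [lineVal, dif_neg]
  rintro ⟨i, hi⟩
  exact h i hi

theorem lineVal_congr {β : Type*} {q m : ℕ} (G' : ResolventGraph q m) (f : α → β) (c : α)
    (d : Fin p → α) (d' : Fin q → β) {l : Fin n × Bool} {l' : Fin m × Bool}
    (h1 : ∀ i, G.mark i = l → ∃ k, G'.mark k = l' ∧ d' k = f (d i))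
    (h2 : (∀ i, G.mark i ≠ l) → ∀ k, G'.mark k ≠ l') :
    G'.lineVal (f c) d' l' = f (G.lineVal c d l) := by
  by_cases h : ∃ i, G.mark i = l
  · obtain ⟨i, hi⟩ := h
    obtain ⟨k, hk, hd⟩ := h1 i hi
    rw [← hi, ← hk, lineVal_mark, lineVal_mark, hd]
  · push Not at h
    rw [G.lineVal_of_notMem c d h, G'.lineVal_of_notMem _ _ (h2 h)]

open Classical in
/-- The indicator of the tadpoles. -/
def tau (l : Fin n × Bool) : ℂ := if G.IsTadpole l then 1 else 0

/-- The value of a graph for line kernels `K τ B a b`. -/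
def value (K : ℂ → α → S → S → ℂ) (c : α) (d : Fin p → α) (x : Fin n → S) : ℂ :=
  ∏ l, K (G.tau l) (G.lineVal c d l) (x (G.src l)) (x (G.tgt l))

/-! ### Adding a mark -/

/-- The graph with one more mark on an unmarked c-propagator. -/
def addMark (h : {l : Fin n × Bool // ∀ i, G.mark i ≠ l}) : ResolventGraph (p + 1) n where
  next := G.next
  -- Slices are differentiated in decreasing order, so the newest mark stands for the smallest slice
  -- and receives the number 0.
  mark := ⟨Fin.cons h.1 G.mark, Fin.cons_injective_iff.2
    ⟨fun ⟨i, hi⟩ => h.2 i hi, G.mark.injective⟩⟩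

theorem addMark_value (h : {l : Fin n × Bool // ∀ i, G.mark i ≠ l}) (K : ℂ → α → S → S → ℂ)
    (c d₀ : α) (d : Fin p → α) (x : Fin n → S) :
    (G.addMark h).value K c (Fin.cons d₀ d : Fin (p + 1) → α) x =
      (∏ l ∈ Finset.univ.erase h.1, K (G.tau l) (G.lineVal c d l) (x (G.src l)) (x (G.tgt l))) *
        K (G.tau h.1) d₀ (x (G.src h.1)) (x (G.tgt h.1)) := by
  rw [value, ← Finset.prod_erase_mul _ _ (Finset.mem_univ h.1)]
  congr 1
  · refine Finset.prod_congr rfl fun l hl => ?_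
    have e : (G.addMark h).lineVal c (Fin.cons d₀ d : Fin (p + 1) → α) l = G.lineVal c d l := by
      refine G.lineVal_congr (G.addMark h) id c d _ (fun i hi => ⟨i.succ, ?_, ?_⟩) fun hn k => ?_
      · simp [addMark, hi]
      · simp
      · refine Fin.cases ?_ (fun i => ?_) k
        · simpa [addMark] using (Finset.ne_of_mem_erase hl).symm
        · simpa [addMark] using hn i
    rw [e]
    rfl
  · have e : (G.addMark h).lineVal c (Fin.cons d₀ d : Fin (p + 1) → α) h.1 = d₀ := by
      have := (G.addMark h).lineVal_mark c (Fin.cons d₀ d : Fin (p + 1) → α) 0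
      simpa [addMark] using this
    rw [e]
    rfl

theorem Connected.mono {q m : ℕ} {G : ResolventGraph p n} {G' : ResolventGraph q m}
    (f : Fin n → Fin m) (h : ∀ l, G'.Connected (f (G.src l)) (f (G.tgt l))) {v w : Fin n}
    (hvw : G.Connected v w) : G'.Connected (f v) (f w) := by
  induction hvw with
  | rel v w h' =>
    obtain ⟨l, rfl, rfl⟩ := h'
    exact h l
  | refl v => exact Relation.EqvGen.refl _
  | symm v w _ ih => exact Relation.EqvGen.symm _ _ ih
  | trans u v w _ _ ih1 ih2 => exact Relation.EqvGen.trans _ _ _ ih1 ih2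

theorem connected_src_tgt (l : Fin n × Bool) : G.Connected (G.src l) (G.tgt l) :=
  Relation.EqvGen.rel _ _ ⟨l, rfl, rfl⟩

theorem addMark_isMinimal (hG : G.IsMinimal) (h : {l : Fin n × Bool // ∀ i, G.mark i ≠ l}) :
    (G.addMark h).IsMinimal := by
  refine ⟨fun v => ?_, hG.2.trans (Nat.le_succ p)⟩
  obtain ⟨i, hi⟩ := hG.1 v
  refine ⟨i.succ, ?_⟩
  have := Connected.mono (G' := G.addMark h) id (fun l => (G.addMark h).connected_src_tgt l) hi
  simpa [addMark, src] using this

/-! ### Grafting a σ-propagator -/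

/-- The embedding of the half-propagators after adding the new σ-propagator `0`. -/
def shift (n : ℕ) : Fin n × Bool ↪ Fin (n + 1) × Bool :=
  (Fin.succEmb n).prodMap (Function.Embedding.refl Bool)

theorem shift_apply (l : Fin n × Bool) : shift n l = (l.1.succ, l.2) := rfl

theorem shift_ne (l : Fin n × Bool) (b : Bool) : shift n l ≠ (0, b) := by
  simp [shift_apply, Fin.succ_ne_zero]

/-- Insertion of a new σ-propagator into corners, as prescribed by the permutation `s` of the
half-propagators, with a new mark at `m`. -/
def graft (s : Equiv.Perm (Fin (n + 1) × Bool)) (m : Fin (n + 1) × Bool) (hm : (s m).1 = 0) :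
    ResolventGraph (p + 1) (n + 1) where
  -- The extended permutation fixes the two new half-propagators; precomposition with `s` reroutes
  -- the chosen corners through them.
  next := G.next.viaFintypeEmbedding (shift n) * s
  -- An old mark follows the end of its line. Indeed a cut of R K gives R C_j σ R K or R C(t) σ R K,
  -- in which K stays at the right end.
  mark := ⟨Fin.cons m fun i => s.symm (shift n (G.mark i)), Fin.cons_injective_iff.2
    ⟨by
      rintro ⟨i, hi⟩
      have : s m = shift n (G.mark i) := by rw [← hi]; simp
      rw [this] at hm
      exact Fin.succ_ne_zero _ hm,
    s.symm.injective.comp ((shift n).injective.comp G.mark.injective)⟩⟩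

section Graft

variable (s : Equiv.Perm (Fin (n + 1) × Bool)) (m : Fin (n + 1) × Bool) (hm : (s m).1 = 0)

theorem graft_next_shift (l : Fin n × Bool) :
    (G.graft s m hm).next (s.symm (shift n l)) = shift n (G.next l) := by
  simp [graft, Equiv.Perm.viaFintypeEmbedding_apply_image]

theorem graft_next_zero (b : Bool) :
    (G.graft s m hm).next (s.symm (0, b)) = (0, b) := by
  simp only [graft, Equiv.Perm.mul_apply, Equiv.apply_symm_apply]
  refine Equiv.Perm.viaFintypeEmbedding_apply_notMem_range _ _ ?_
  rintro ⟨l, hl⟩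
  exact shift_ne l b hl

theorem graft_lineVal_shift (c d₀ : α) (d : Fin p → α) (l : Fin n × Bool) :
    (G.graft s m hm).lineVal c (Fin.cons d₀ d : Fin (p + 1) → α) (s.symm (shift n l)) =
      G.lineVal c d l := by
  refine G.lineVal_congr (G.graft s m hm) id c d _ (fun i hi => ⟨i.succ, ?_, ?_⟩) fun hn k => ?_
  · simp [graft, hi]
  · simp
  · refine Fin.cases ?_ (fun i => ?_) k
    · intro h
      have h1 : m = s.symm (shift n l) := h
      rw [h1, Equiv.apply_symm_apply] at hm
      exact Fin.succ_ne_zero _ hm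
    · simpa [graft] using hn i

theorem graft_lineVal_zero (c d₀ : α) (d : Fin p → α) (b : Bool) :
    (G.graft s m hm).lineVal c (Fin.cons d₀ d : Fin (p + 1) → α) (s.symm (0, b)) =
      if s m = (0, b) then d₀ else c := by
  split_ifs with h
  · have := (G.graft s m hm).lineVal_mark c (Fin.cons d₀ d : Fin (p + 1) → α) 0
    rw [← h, Equiv.symm_apply_apply]
    simpa [graft] using this
  · refine lineVal_of_notMem _ _ _ fun k => ?_
    refine Fin.cases ?_ (fun i => ?_) k
    · intro h'
      have h1 : m = s.symm (0, b) := h'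
      exact h (by rw [h1, Equiv.apply_symm_apply])
    · simpa [graft] using shift_ne _ b

open Classical in
theorem graft_value (K : ℂ → α → S → S → ℂ) (c d₀ : α) (d : Fin p → α) (x : Fin n → S) (y : S) :
    (G.graft s m hm).value K c (Fin.cons d₀ d : Fin (p + 1) → α) (Fin.cons y x : Fin (n + 1) → S) =
      K (if (s.symm (0, false)).1 = 0 then 1 else 0) (if s m = (0, false) then d₀ else c)
          ((Fin.cons y x : Fin (n + 1) → S) (s.symm (0, false)).1) y *
        K (if (s.symm (0, true)).1 = 0 then 1 else 0) (if s m = (0, true) then d₀ else c)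
          ((Fin.cons y x : Fin (n + 1) → S) (s.symm (0, true)).1) y *
        ∏ l, K (if (s.symm (shift n l)).1 = (G.tgt l).succ then 1 else 0) (G.lineVal c d l)
          ((Fin.cons y x : Fin (n + 1) → S) (s.symm (shift n l)).1) (x (G.tgt l)) := by
  -- Lines are indexed by their images under `s`. This separates the two lines that end at the new
  -- σ-propagator from those that inherit the end of an old line.
  rw [value, ← Equiv.prod_comp s.symm, Fintype.prod_prod_type, Fin.prod_univ_succ,
    ← Fintype.prod_prod_type (f := fun q : Fin n × Bool =>
      K ((G.graft s m hm).tau (s.symm (q.1.succ, q.2)))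
        ((G.graft s m hm).lineVal c (Fin.cons d₀ d : Fin (p + 1) → α) (s.symm (q.1.succ, q.2)))
        ((Fin.cons y x : Fin (n + 1) → S) ((G.graft s m hm).src (s.symm (q.1.succ, q.2))))
        ((Fin.cons y x : Fin (n + 1) → S) ((G.graft s m hm).tgt (s.symm (q.1.succ, q.2)))))]
  have h0 : ∀ b, K ((G.graft s m hm).tau (s.symm (0, b)))
      ((G.graft s m hm).lineVal c (Fin.cons d₀ d : Fin (p + 1) → α) (s.symm (0, b)))
      ((Fin.cons y x : Fin (n + 1) → S) ((G.graft s m hm).src (s.symm (0, b))))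
      ((Fin.cons y x : Fin (n + 1) → S) ((G.graft s m hm).tgt (s.symm (0, b)))) =
      K (if (s.symm (0, b)).1 = 0 then 1 else 0) (if s m = (0, b) then d₀ else c)
          ((Fin.cons y x : Fin (n + 1) → S) (s.symm (0, b)).1) y := fun b => by
    rw [graft_lineVal_zero]
    simp only [tau, IsTadpole, src, tgt, graft_next_zero, Fin.cons_zero]
  rw [Fintype.prod_bool, h0, h0, mul_comm (K _ _ _ _)]
  congr 1
  refine Finset.prod_congr rfl fun l _ => ?_
  rw [← shift_apply, graft_lineVal_shift]
  simp only [tau, IsTadpole, src, tgt, graft_next_shift]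
  simp only [shift_apply, Fin.cons_succ]
  congr

/-- Grafting preserves minimality as soon as every broken corner is linked through the new
propagator and the new propagator is linked to the new mark. -/
theorem graft_isMinimal (hG : G.IsMinimal)
    (h1 : ∀ l, (G.graft s m hm).Connected l.1.succ (s.symm (shift n l)).1)
    (h2 : (G.graft s m hm).Connected 0 m.1) : (G.graft s m hm).IsMinimal := by
  have hcon : ∀ l, (G.graft s m hm).Connected l.1.succ (G.tgt l).succ := fun l => by
    refine Relation.EqvGen.trans _ _ _ (h1 l) ?_
    have := (G.graft s m hm).connected_src_tgt (s.symm (shift n l))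
    simp only [src, tgt, graft_next_shift] at this
    exact this
  refine ⟨fun v => ?_, Nat.succ_le_succ hG.2⟩
  refine Fin.cases ⟨0, h2⟩ (fun w => ?_) v
  obtain ⟨i, hi⟩ := hG.1 w
  refine ⟨i.succ, ?_⟩
  have h3 := Connected.mono (G' := G.graft s m hm) Fin.succ hcon hi
  exact Relation.EqvGen.trans _ _ _ h3 (h1 (G.mark i))

end Graft

end ResolventGraph

/-! ### The four ways of attaching a σ-propagator, and the recursion -/

namespace ResolventGraph

variable {p n : ℕ} (G : ResolventGraph p n) {α S : Type*}

/-- The permutation which inserts the half-propagator `(0, b)` into the corner `h`. -/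
def insertAt (h : Fin n × Bool) (b : Bool) : Equiv.Perm (Fin (n + 1) × Bool) :=
  Equiv.swap (shift n h) (0, b)

theorem insertAt_symm (h : Fin n × Bool) (b : Bool) : (insertAt h b).symm = insertAt h b :=
  Equiv.symm_swap _ _

@[simp] theorem insertAt_shift (h : Fin n × Bool) (b : Bool) : insertAt h b (shift n h) = (0, b) :=
  Equiv.swap_apply_left _ _

@[simp] theorem insertAt_zero (h : Fin n × Bool) (b : Bool) : insertAt h b (0, b) = shift n h :=
  Equiv.swap_apply_right _ _

theorem insertAt_shift_of_ne {h l : Fin n × Bool} (hl : l ≠ h) (b : Bool) :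
    insertAt h b (shift n l) = shift n l :=
  Equiv.swap_apply_of_ne_of_ne ((shift n).injective.ne hl) (shift_ne l b)

theorem insertAt_zero_of_ne (h : Fin n × Bool) {b b' : Bool} (hb : b' ≠ b) :
    insertAt h b (0, b') = (0, b') :=
  Equiv.swap_apply_of_ne_of_ne (shift_ne h b').symm (by simpa using hb)

theorem insertAt_insertAt (h : Fin n × Bool) (b : Bool) (a : Fin (n + 1) × Bool) :
    insertAt h b (insertAt h b a) = a := by
  nth_rw 1 [← insertAt_symm]
  exact Equiv.symm_apply_apply _ _

/-- A new component with one σ-propagator and two loop vertices. -/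
def graftIso : ResolventGraph (p + 1) (n + 1) := G.graft 1 (0, false) (by rw [Equiv.Perm.one_apply])

/-- A new σ-propagator from the corner `h` to a new loop vertex, which bears the new mark. -/
def graftLeaf (h : Fin n × Bool) : ResolventGraph (p + 1) (n + 1) :=
  G.graft (insertAt h false) (0, true) (by rw [insertAt_zero_of_ne h (by simp)])

/-- A new σ-propagator from the corner `h` to a new loop vertex, with the new mark in the
corner `h`. -/
def graftMarkedLeaf (h : Fin n × Bool) : ResolventGraph (p + 1) (n + 1) :=
  G.graft (insertAt h false) (shift n h) (by rw [insertAt_shift])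

/-- A new σ-propagator between two corners, with the new mark in the first of them. -/
def graftPair (q : {q : (Fin n × Bool) × (Fin n × Bool) // q.2 ≠ q.1}) :
    ResolventGraph (p + 1) (n + 1) :=
  G.graft (insertAt q.1.1 false * insertAt q.1.2 true) (shift n q.1.1) (by
    rw [Equiv.Perm.mul_apply, insertAt_shift_of_ne q.2.symm, insertAt_shift])

section Values

variable (K : ℂ → α → S → S → ℂ) (c d₀ : α) (d : Fin p → α) (x : Fin n → S) (y : S)

/-- The kernel of a line. -/
def lineKer (l : Fin n × Bool) : ℂ :=
  K (G.tau l) (G.lineVal c d l) (x (G.src l)) (x (G.tgt l))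

open Classical in
/-- The kernels of all lines except one. -/
def valueErase (l : Fin n × Bool) : ℂ := ∏ k ∈ Finset.univ.erase l, G.lineKer K c d x k

open Classical in
/-- The kernels of all lines except two. -/
def valueErase₂ (l l' : Fin n × Bool) : ℂ :=
  ∏ k ∈ (Finset.univ.erase l).erase l', G.lineKer K c d x k

/-- The kernel from the start of a line to `y`. -/
def kerIn (e : α) (l : Fin n × Bool) : ℂ := K 0 e (x (G.src l)) y

/-- The kernel from `y` to the end of a line. -/
def kerOut (l : Fin n × Bool) : ℂ := K 0 (G.lineVal c d l) y (x (G.tgt l))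

/-- The lines left untouched by the insertion keep their marks, their ends and hence their tadpole
status. -/
theorem prod_insertAt {s : Equiv.Perm (Fin (n + 1) × Bool)}
    {I : Finset (Fin n × Bool)} (hI : ∀ l ∈ I, s.symm (shift n l) = shift n l) :
    open Classical in
    ∏ l ∈ I, K (if (s.symm (shift n l)).1 = (G.tgt l).succ then 1 else 0) (G.lineVal c d l)
          ((Fin.cons y x : Fin (n + 1) → S) (s.symm (shift n l)).1) (x (G.tgt l)) =
      ∏ l ∈ I, G.lineKer K c d x l := by
  refine Finset.prod_congr rfl fun l hl => ?_
  rw [hI l hl]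
  simp only [shift_apply, Fin.cons_succ, Fin.succ_inj]
  unfold lineKer tau IsTadpole
  congr

theorem graftIso_value :
    (G.graftIso).value K c (Fin.cons d₀ d : Fin (p + 1) → α) (Fin.cons y x : Fin (n + 1) → S) =
      K 1 d₀ y y * K 1 c y y * G.value K c d x := by
  rw [graftIso, graft_value]
  rw [G.prod_insertAt K c d x y (s := 1) (I := Finset.univ) fun l _ => rfl]
  simp only [Equiv.Perm.one_symm, Equiv.Perm.one_apply, Fin.cons_zero, if_true]
  simp only [Prod.mk.injEq, Bool.false_eq_true, and_false, if_false]
  rfl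

/-- The two halves of a cut line join the new position to old ones, so they are never tadpoles, even
if the line was one: they carry index 0. The new loop vertex of length one is a tadpole and carries
index 1. -/
theorem graftLeaf_value (h : Fin n × Bool) :
    (G.graftLeaf h).value K c (Fin.cons d₀ d : Fin (p + 1) → α) (Fin.cons y x : Fin (n + 1) → S) =
      K 1 d₀ y y * (G.valueErase K c d x h * (G.kerIn K x y c h * G.kerOut K c d x y h)) := by
  classical
  rw [graftLeaf, graft_value, insertAt_symm, ← Finset.mul_prod_erase _ _ (Finset.mem_univ h),
    insertAt_shift, insertAt_zero, insertAt_zero_of_ne h (by simp : true ≠ false)]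
  have e := G.prod_insertAt K c d x y (s := insertAt h false) (I := Finset.univ.erase h)
    fun l hl => by rw [insertAt_symm, insertAt_shift_of_ne (Finset.ne_of_mem_erase hl)]
  rw [insertAt_symm] at e
  have e2 : ¬ (0 : Fin (n + 1)) = (G.tgt h).succ := (Fin.succ_ne_zero _).symm
  simp only [shift_apply, Fin.cons_succ, Fin.cons_zero, Fin.succ_ne_zero, e2, if_true, if_false,
    valueErase, kerIn, kerOut, src] at e ⊢
  simp only [Prod.mk.injEq, Bool.true_eq_false, and_false, if_false]
  rw [e]
  ring

theorem graftMarkedLeaf_value (h : Fin n × Bool) :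
    (G.graftMarkedLeaf h).value K c (Fin.cons d₀ d : Fin (p + 1) → α)
        (Fin.cons y x : Fin (n + 1) → S) =
      K 1 c y y * (G.valueErase K c d x h * (G.kerIn K x y d₀ h * G.kerOut K c d x y h)) := by
  classical
  rw [graftMarkedLeaf, graft_value, insertAt_symm,
    ← Finset.mul_prod_erase _ _ (Finset.mem_univ h),
    insertAt_shift, insertAt_zero, insertAt_zero_of_ne h (by simp : true ≠ false)]
  have e := G.prod_insertAt K c d x y (s := insertAt h false) (I := Finset.univ.erase h)
    fun l hl => by rw [insertAt_symm, insertAt_shift_of_ne (Finset.ne_of_mem_erase hl)]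
  rw [insertAt_symm] at e
  have e2 : ¬ (0 : Fin (n + 1)) = (G.tgt h).succ := (Fin.succ_ne_zero _).symm
  simp only [shift_apply, Fin.cons_succ, Fin.cons_zero, Fin.succ_ne_zero, e2, if_true, if_false,
    valueErase, kerIn, kerOut, src] at e ⊢
  simp only [Prod.mk.injEq, Bool.false_eq_true, and_false, if_false]
  rw [e]
  ring

theorem graftPair_value (q : {q : (Fin n × Bool) × (Fin n × Bool) // q.2 ≠ q.1}) :
    (G.graftPair q).value K c (Fin.cons d₀ d : Fin (p + 1) → α)
        (Fin.cons y x : Fin (n + 1) → S) =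
      G.valueErase₂ K c d x q.1.1 q.1.2 * (G.kerIn K x y c q.1.2 * G.kerOut K c d x y q.1.2) *
        (G.kerIn K x y d₀ q.1.1 * G.kerOut K c d x y q.1.1) := by
  classical
  obtain ⟨⟨h, h'⟩, hq⟩ := q
  simp only at hq ⊢
  set s : Equiv.Perm (Fin (n + 1) × Bool) := insertAt h false * insertAt h' true with hs
  have hsymm : ∀ a, s.symm a = insertAt h' true (insertAt h false a) := fun a => by
    rw [Equiv.symm_apply_eq, hs, Equiv.Perm.mul_apply, insertAt_insertAt, insertAt_insertAt]
  rw [graftPair, graft_value]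
  simp only [← hs]
  have s1 : s.symm (0, false) = shift n h := by
    rw [hsymm, insertAt_zero, insertAt_shift_of_ne hq.symm]
  have s2 : s.symm (0, true) = shift n h' := by
    rw [hsymm, insertAt_zero_of_ne h (by simp), insertAt_zero]
  have s3 : s.symm (shift n h) = (0, false) := by
    rw [hsymm, insertAt_shift, insertAt_zero_of_ne h' (by simp)]
  have s4 : s.symm (shift n h') = (0, true) := by
    rw [hsymm, insertAt_shift_of_ne hq, insertAt_shift]
  have s5 : s (shift n h) = (0, false) := by rw [← s1, Equiv.apply_symm_apply]
  rw [← Finset.mul_prod_erase _ _ (Finset.mem_univ h),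
    ← Finset.mul_prod_erase _ _ (Finset.mem_erase.2 ⟨hq, Finset.mem_univ h'⟩),
    s1, s2, s3, s4, s5]
  have e := G.prod_insertAt K c d x y (s := s) (I := (Finset.univ.erase h).erase h')
    fun l hl => by
      rw [hsymm, insertAt_shift_of_ne (Finset.ne_of_mem_erase (Finset.mem_of_mem_erase hl)),
        insertAt_shift_of_ne (Finset.ne_of_mem_erase hl)]
  have e2 : ∀ h, ¬ (0 : Fin (n + 1)) = (G.tgt h).succ := fun h => (Fin.succ_ne_zero _).symm
  rw [e]
  simp only [shift_apply, Fin.cons_succ, Fin.cons_zero, Fin.succ_ne_zero, e2, if_true, if_false,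
    valueErase₂, kerIn, kerOut, src]
  simp only [Prod.mk.injEq, Bool.false_eq_true, and_false, if_false]
  ring

end Values

/-! ### Minimality -/

theorem graftIso_isMinimal (hG : G.IsMinimal) : G.graftIso.IsMinimal :=
  G.graft_isMinimal _ _ _ hG (fun _ => Relation.EqvGen.refl _) (Relation.EqvGen.refl _)

section Linked

variable (s : Equiv.Perm (Fin (n + 1) × Bool)) (m : Fin (n + 1) × Bool) (hm : (s m).1 = 0)

theorem graft_connected_zero (b : Bool) :
    (G.graft s m hm).Connected (s.symm (0, b)).1 0 := by
  have := (G.graft s m hm).connected_src_tgt (s.symm (0, b))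
  simpa only [src, tgt, graft_next_zero] using this

end Linked

theorem graft_insertAt_connected (h : Fin n × Bool) (m : Fin (n + 1) × Bool)
    (hm : (insertAt h false m).1 = 0) (l : Fin n × Bool) :
    (G.graft (insertAt h false) m hm).Connected l.1.succ ((insertAt h false).symm (shift n l)).1 := by
  by_cases hl : l = h
  · subst hl
    have := G.graft_connected_zero (insertAt l false) m hm false
    rw [insertAt_symm, insertAt_zero] at this
    rw [insertAt_symm, insertAt_shift]
    exact this
  · rw [insertAt_symm, insertAt_shift_of_ne hl]
    exact Relation.EqvGen.refl _

theorem graftLeaf_isMinimal (hG : G.IsMinimal) (h : Fin n × Bool) : (G.graftLeaf h).IsMinimal :=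
  G.graft_isMinimal _ _ _ hG (G.graft_insertAt_connected h _ _) (Relation.EqvGen.refl _)

theorem graftMarkedLeaf_isMinimal (hG : G.IsMinimal) (h : Fin n × Bool) :
    (G.graftMarkedLeaf h).IsMinimal := by
  refine G.graft_isMinimal _ _ _ hG (G.graft_insertAt_connected h _ _) ?_
  have := G.graft_connected_zero (insertAt h false) (shift n h) (by rw [insertAt_shift]) false
  rw [insertAt_symm, insertAt_zero] at this
  exact Relation.EqvGen.symm _ _ this

theorem graftPair_isMinimal (hG : G.IsMinimal)
    (q : {q : (Fin n × Bool) × (Fin n × Bool) // q.2 ≠ q.1}) : (G.graftPair q).IsMinimal := by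
  obtain ⟨⟨h, h'⟩, hq⟩ := q
  simp only at hq
  have hm : ((insertAt h false * insertAt h' true : Equiv.Perm _) (shift n h)).1 = 0 := by
    rw [Equiv.Perm.mul_apply, insertAt_shift_of_ne hq.symm, insertAt_shift]
  have hsymm : ∀ a, (insertAt h false * insertAt h' true : Equiv.Perm _).symm a =
      insertAt h' true (insertAt h false a) := fun a => by
    rw [Equiv.symm_apply_eq, Equiv.Perm.mul_apply, insertAt_insertAt, insertAt_insertAt]
  have c1 := G.graft_connected_zero _ _ hm false
  have c2 := G.graft_connected_zero _ _ hm true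
  rw [hsymm, insertAt_zero, insertAt_shift_of_ne hq.symm] at c1
  rw [hsymm, insertAt_zero_of_ne h (by simp), insertAt_zero] at c2
  refine G.graft_isMinimal _ _ hm hG (fun l => ?_) (Relation.EqvGen.symm _ _ c1)
  rw [hsymm]
  by_cases hl : l = h
  · subst hl
    rw [insertAt_shift, insertAt_zero_of_ne h' (by simp)]
    exact c1
  · rw [insertAt_shift_of_ne hl]
    by_cases hl' : l = h'
    · subst hl'
      rw [insertAt_shift]
      exact c2
    · rw [insertAt_shift_of_ne hl']
      exact Relation.EqvGen.refl _

/-! ### The expansion as a multiset of graphs -/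

open Classical in
/-- All ways of adding a mark. -/
def stepMark : Multiset (ResolventGraph (p + 1) n) := Finset.univ.val.map G.addMark

/-- All ways of adding a σ-propagator and a mark, with their multiplicities. -/
def stepGraft : Multiset (ResolventGraph (p + 1) (n + 1)) :=
  3 • {G.graftIso} + 6 • Finset.univ.val.map G.graftLeaf +
    6 • Finset.univ.val.map G.graftMarkedLeaf + 4 • Finset.univ.val.map G.graftPair

theorem isMinimal_of_mem_stepMark (hG : G.IsMinimal) {G'} (h : G' ∈ G.stepMark) :
    G'.IsMinimal := by
  obtain ⟨l, -, rfl⟩ := Multiset.mem_map.1 h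
  exact G.addMark_isMinimal hG l

theorem isMinimal_of_mem_stepGraft (hG : G.IsMinimal) {G'} (h : G' ∈ G.stepGraft) :
    G'.IsMinimal := by
  simp only [stepGraft, Multiset.mem_add] at h
  rcases h with ((h | h) | h) | h <;> have h := Multiset.mem_of_mem_nsmul h
  · rw [Multiset.mem_singleton.1 h]
    exact G.graftIso_isMinimal hG
  · obtain ⟨l, -, rfl⟩ := Multiset.mem_map.1 h
    exact G.graftLeaf_isMinimal hG l
  · obtain ⟨l, -, rfl⟩ := Multiset.mem_map.1 h
    exact G.graftMarkedLeaf_isMinimal hG l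
  · obtain ⟨l, -, rfl⟩ := Multiset.mem_map.1 h
    exact G.graftPair_isMinimal hG l

theorem sum_stepMark (f : ResolventGraph (p + 1) n → ℂ) :
    (G.stepMark.map f).sum = ∑ h, f (G.addMark h) := by
  rw [stepMark, Multiset.map_map]
  rfl

theorem sum_stepGraft (f : ResolventGraph (p + 1) (n + 1) → ℂ) :
    (G.stepGraft.map f).sum = 3 * f G.graftIso + 6 * ∑ h, f (G.graftLeaf h) +
      6 * ∑ h, f (G.graftMarkedLeaf h) + 4 * ∑ q, f (G.graftPair q) := by
  rw [stepGraft, Multiset.map_add, Multiset.map_add, Multiset.map_add, Multiset.sum_add,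
    Multiset.sum_add, Multiset.sum_add, Multiset.map_nsmul, Multiset.map_nsmul, Multiset.map_nsmul,
    Multiset.map_nsmul, Multiset.sum_nsmul, Multiset.sum_nsmul, Multiset.sum_nsmul,
    Multiset.sum_nsmul, Multiset.map_singleton, Multiset.sum_singleton, Multiset.map_map,
    Multiset.map_map, Multiset.map_map]
  rw [nsmul_eq_mul, nsmul_eq_mul, nsmul_eq_mul, nsmul_eq_mul]
  rfl

/-- The empty graph. -/
def empty : ResolventGraph 0 0 := ⟨1, ⟨Fin.elim0, fun i => i.elim0⟩⟩

theorem empty_isMinimal : empty.IsMinimal := ⟨fun v => v.elim0, le_rfl⟩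

/-- The graphs produced by `p` steps of the expansion, with multiplicities. -/
def graphs : (p : ℕ) → Multiset (Σ n, ResolventGraph p n)
  | 0 => {⟨0, empty⟩}
  | p + 1 => (graphs p).bind fun g =>
      g.2.stepMark.map (Sigma.mk g.1) + g.2.stepGraft.map (Sigma.mk (g.1 + 1))

/-- Each step adds one mark and at most one σ-propagator, which gives n ≤ p; a grafted propagator is
always connected to the new mark. -/
theorem isMinimal_of_mem_graphs : ∀ (p : ℕ) (g : Σ n, ResolventGraph p n), g ∈ graphs p →
    g.2.IsMinimal
  | 0, g, h => by
    rw [graphs, Multiset.mem_singleton] at h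
    subst h
    exact empty_isMinimal
  | p + 1, g, h => by
    rw [graphs, Multiset.mem_bind] at h
    obtain ⟨g', h', h⟩ := h
    have hm := isMinimal_of_mem_graphs p g' h'
    rcases Multiset.mem_add.1 h with h | h <;> obtain ⟨G, hG, rfl⟩ := Multiset.mem_map.1 h
    · exact g'.2.isMinimal_of_mem_stepMark hm hG
    · exact g'.2.isMinimal_of_mem_stepGraft hm hG

theorem mem_minimalGraphs {p : ℕ} {g : Σ n, ResolventGraph p n} (h : g.2.IsMinimal) :
    g ∈ minimalGraphs p := by
  simp [minimalGraphs, h, Nat.lt_succ_of_le h.2]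

open Classical in
/-- The weight of a graph. -/
def weight (p : ℕ) (g : Σ n, ResolventGraph p n) : ℕ := (graphs p).count g

/-- All graphs of the recursion are minimal, and a minimal graph that never occurs has multiplicity
0, so the sum may run over all minimal graphs. -/
theorem sum_graphs (p : ℕ) (f : (Σ n, ResolventGraph p n) → ℂ) :
    ((graphs p).map f).sum = ∑ g ∈ minimalGraphs p, (weight p g : ℂ) * f g := by
  classical
  rw [Finset.sum_multiset_map_count]
  simp only [nsmul_eq_mul]
  refine (Finset.sum_subset (fun g hg => mem_minimalGraphs
    (isMinimal_of_mem_graphs p g (Multiset.mem_toFinset.1 hg))) fun g _ hg => ?_).trans ?_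
  · rw [Multiset.count_eq_zero_of_notMem fun h => hg (Multiset.mem_toFinset.2 h)]
    simp
  · refine Finset.sum_congr rfl fun g _ => ?_
    rw [weight]

theorem sum_graphs_succ (p : ℕ) (f : (Σ n, ResolventGraph (p + 1) n) → ℂ) :
    ((graphs (p + 1)).map f).sum = ((graphs p).map fun g =>
      (g.2.stepMark.map fun G => f ⟨g.1, G⟩).sum +
        (g.2.stepGraft.map fun G => f ⟨g.1 + 1, G⟩).sum).sum := by
  rw [graphs, Multiset.map_bind, Multiset.sum_bind]
  simp only [Multiset.map_add, Multiset.sum_add, Multiset.map_map, Function.comp_def]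

end ResolventGraph

/-! ### Families of functionals with exponential growth -/

/-- A continuous family of functionals with a common exponential bound. -/
structure Dominated {T E G : Type*} [TopologicalSpace T] [NormedAddCommGroup E]
    [NormedAddCommGroup G] (f : T × E → G) : Prop where
  continuous : Continuous f
  growth : ∃ C, 0 ≤ C ∧ ∀ q, ‖f q‖ ≤ C * Real.exp (C * ‖q.2‖)

namespace Dominated

variable {T E G : Type*} [TopologicalSpace T] [NormedAddCommGroup E] [NormedAddCommGroup G]

theorem of_bound {f : T × E → G} (hf : Continuous f) {A a : ℝ} (hA : 0 ≤ A) (ha : 0 ≤ a)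
    (hb : ∀ q, ‖f q‖ ≤ A * Real.exp (a * ‖q.2‖)) : Dominated f := by
  refine ⟨hf, A + a, by positivity, fun q => (hb q).trans ?_⟩
  have : a * ‖q.2‖ ≤ (A + a) * ‖q.2‖ := by nlinarith [norm_nonneg q.2]
  gcongr
  linarith

theorem of_norm_le {f : T × E → G} (hf : Continuous f) {A : ℝ} (hA : 0 ≤ A)
    (hb : ∀ q, ‖f q‖ ≤ A) : Dominated f :=
  of_bound hf hA le_rfl fun q => by simpa using hb q

theorem const (g : G) : Dominated (fun _ : T × E => g) :=
  of_norm_le continuous_const (norm_nonneg g) fun _ => le_rfl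

theorem snd : Dominated (fun q : T × E => q.2) :=
  of_bound continuous_snd zero_le_one zero_le_one fun q => by
    rw [one_mul, one_mul]
    exact (le_add_of_nonneg_right zero_le_one).trans (Real.add_one_le_exp _)

theorem add {f g : T × E → G} (hf : Dominated f) (hg : Dominated g) :
    Dominated (fun q => f q + g q) := by
  obtain ⟨hc, A, hA, hA'⟩ := hf
  obtain ⟨hd, B, hB, hB'⟩ := hg
  refine of_bound (hc.add hd) (A := A + B) (a := A + B) (by positivity) (by positivity) fun q => ?_
  have h1 : A * ‖q.2‖ ≤ (A + B) * ‖q.2‖ := by nlinarith [norm_nonneg q.2]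
  have h2 : B * ‖q.2‖ ≤ (A + B) * ‖q.2‖ := by nlinarith [norm_nonneg q.2]
  refine (norm_add_le _ _).trans ((add_le_add (hA' q) (hB' q)).trans ?_)
  rw [add_mul]
  gcongr

theorem sum {ι : Type*} (I : Finset ι) {f : ι → T × E → G} (hf : ∀ i ∈ I, Dominated (f i)) :
    Dominated (fun q => ∑ i ∈ I, f i q) := by
  classical
  induction I using Finset.induction_on with
  | empty => simpa using const (0 : G)
  | insert a I ha ih =>
    simp only [Finset.sum_insert ha]
    exact (hf a (by simp)).add (ih fun i hi => hf i (by simp [hi]))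

theorem of_norm_le_mul {G₁ G₂ : Type*} [NormedAddCommGroup G₁] [NormedAddCommGroup G₂]
    {f : T × E → G₁} {g : T × E → G₂} (hf : Dominated f) (hg : Dominated g) {h : T × E → G}
    (hh : Continuous h) (hb : ∀ q, ‖h q‖ ≤ ‖f q‖ * ‖g q‖) : Dominated h := by
  obtain ⟨hc, A, hA, hA'⟩ := hf
  obtain ⟨hd, B, hB, hB'⟩ := hg
  refine of_bound hh (A := A * B) (a := A + B) (by positivity) (by positivity) fun q => ?_
  refine (hb q).trans ?_
  rw [add_mul, Real.exp_add]
  calc _ ≤ (A * Real.exp (A * ‖q.2‖)) * (B * Real.exp (B * ‖q.2‖)) := by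
        gcongr
        · exact hA' q
        · exact hB' q
    _ = _ := by ring

theorem clm_apply {𝕜 G₁ : Type*} [NontriviallyNormedField 𝕜] [NormedAddCommGroup G₁]
    [NormedSpace 𝕜 G₁] [NormedSpace 𝕜 G] {f : T × E → G₁ →L[𝕜] G} {g : T × E → G₁}
    (hf : Dominated f) (hg : Dominated g) : Dominated (fun q => f q (g q)) :=
  of_norm_le_mul hf hg (hf.continuous.clm_apply hg.continuous) fun _ =>
    ContinuousLinearMap.le_opNorm _ _

theorem inner {G₁ : Type*} [NormedAddCommGroup G₁] [InnerProductSpace ℂ G₁] {f g : T × E → G₁}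
    (hf : Dominated f) (hg : Dominated g) : Dominated (fun q => Inner.inner ℂ (f q) (g q)) :=
  of_norm_le_mul hf hg (hf.continuous.inner hg.continuous) fun _ => norm_inner_le_norm _ _

theorem mul {R : Type*} [NormedRing R] {f g : T × E → R} (hf : Dominated f)
    (hg : Dominated g) : Dominated (fun q => f q * g q) :=
  of_norm_le_mul hf hg (hf.continuous.mul hg.continuous) fun _ => norm_mul_le _ _

theorem prod {ι : Type*} (I : Finset ι) {f : ι → T × E → ℂ} (hf : ∀ i ∈ I, Dominated (f i)) :
    Dominated (fun q => ∏ i ∈ I, f i q) := by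
  classical
  induction I using Finset.induction_on with
  | empty => simpa using const (1 : ℂ)
  | insert a I ha ih =>
    simp only [Finset.prod_insert ha]
    exact (hf a (by simp)).mul (ih fun i hi => hf i (by simp [hi]))

theorem cexp {f : T × E → ℂ} (hf : Continuous f) {A : ℝ} (hA : 0 ≤ A)
    (hb : ∀ q, ‖f q‖ ≤ A * (1 + ‖q.2‖)) : Dominated (fun q => Complex.exp (f q)) := by
  refine of_bound (Complex.continuous_exp.comp hf) (A := Real.exp A) (a := A) (by positivity) hA
    fun q => ?_
  rw [← Real.exp_add, Complex.norm_exp]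
  refine Real.exp_le_exp.2 ((Complex.re_le_norm _).trans ((hb q).trans (le_of_eq (by ring))))

end Dominated

/-! ### Uniform growth bounds over parameters and positions -/

namespace Features

open TraceSpace

variable {Φ : Model} {H : Type*} [NormedAddCommGroup H] [InnerProductSpace ℂ H] [CompleteSpace H]
  (F : Features Φ H)

section Members

variable {z : ℂ} {δ : ℝ} (hδ : 0 < δ) (hz : ∀ r : ℝ, δ ≤ ‖1 + z * (r : ℂ)‖)
  {T : Type*} [TopologicalSpace T] {t : T → ℕ → ℝ} (htc : Continuous t)
  (ht : ∀ q, t q ∈ unitCube)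

theorem dominated_feat {E : Type*} [NormedAddCommGroup E] {a : T → Sq} (ha : Continuous a) :
    Dominated (fun q : T × E => F.feat (a q.1)) :=
  Dominated.of_norm_le (F.continuous_feat.comp (ha.comp continuous_fst)) F.featBound_nonneg
    fun _ => F.norm_feat_le _

include htc ht in
theorem dominated_interp {E : Type*} [NormedAddCommGroup E] :
    Dominated (fun q : T × E => F.interp (t q.1)) :=
  Dominated.of_norm_le (F.continuous_interp.comp (htc.comp continuous_fst)) F.projBound_nonneg
    fun q => F.norm_interp_le (ht q.1)

include hδ hz htc ht

theorem dominated_res : Dominated (fun q : T × TraceSpace H => F.res z (t q.1) q.2) := by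
  have hp := F.projBound_nonneg
  refine Dominated.of_bound (A := 1) (a := ‖z‖ * (F.projBound ^ 2 * δ⁻¹)) ?_ zero_le_one
    (by positivity) fun q => ?_
  · rw [continuous_iff_continuousAt]
    exact fun q => F.continuousAt_res hδ (z := fun _ => z) (t := fun q : T × TraceSpace H => t q.1)
      (X := fun q => q.2) hz (ht q.1) continuousAt_const (htc.comp continuous_fst).continuousAt
      continuousAt_snd
  · rw [one_mul]
    refine (F.norm_res_le hδ hz (ht q.1) q.2).trans ?_
    rw [add_comm]
    exact Real.add_one_le_exp _

theorem dominated_exp_pot [FirstCountableTopology T] :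
    Dominated (fun q : T × TraceSpace H => Complex.exp (F.pot z (t q.1) q.2)) := by
  have hp := F.projBound_nonneg
  set τ : ℝ := ∑ j ∈ Finset.range (Φ.jmax + 1), |sliceTad Φ j| with hτ
  have htad : ∀ q, |tad Φ (t q)| ≤ τ := fun q => by
    refine (Finset.abs_sum_le_sum_abs _ _).trans (Finset.sum_le_sum fun j _ => ?_)
    rw [abs_mul, abs_of_nonneg (ht q j).1]
    exact mul_le_of_le_one_left (abs_nonneg _) (ht q j).2
  have hτ0 : 0 ≤ τ := Finset.sum_nonneg fun _ _ => abs_nonneg _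
  set A := ‖z‖ ^ 2 * τ ^ 2 + ‖z‖ * (F.projBound ^ 2 * δ⁻¹ + 2 * F.projBound) with hA
  refine Dominated.cexp (A := A) ?_ (by positivity) fun q => ?_
  · rw [continuous_iff_continuousAt]
    exact fun q => F.continuousAt_pot hδ (z := fun _ => z) (t := fun q : T × TraceSpace H => t q.1)
      (X := fun q => q.2) hz (ht q.1) continuousAt_const (htc.comp continuous_fst).continuousAt
      continuousAt_snd
  · refine (F.norm_pot_le hδ hz (ht q.1) q.2).trans ?_
    have h1 : |tad Φ (t q.1)| ^ 2 ≤ τ ^ 2 := pow_le_pow_left₀ (abs_nonneg _) (htad _) 2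
    have h2 : ‖z‖ ^ 2 * |tad Φ (t q.1)| ^ 2 ≤ ‖z‖ ^ 2 * τ ^ 2 := by gcongr
    have h3 : 0 ≤ ‖z‖ ^ 2 * τ ^ 2 * ‖q.2‖ := by positivity
    have h4 : 0 ≤ ‖z‖ * (F.projBound ^ 2 * δ⁻¹ + 2 * F.projBound) := by positivity
    rw [hA]
    nlinarith

theorem dominated_ker (τ : ℂ) {B : T × TraceSpace H → H →L[ℂ] H} (hB : Dominated B)
    {a b : T → Sq} (ha : Continuous a) (hb : Continuous b) :
    Dominated (fun q : T × TraceSpace H => F.ker z (t q.1) q.2 τ (B q) (a q.1) (b q.1)) := by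
  have h1 := ((F.dominated_res hδ hz htc ht).add
    (Dominated.const (-(τ • (1 : H →L[ℂ] H))))).mul hB
  simp only [← sub_eq_add_neg] at h1
  exact (F.dominated_feat ha).inner (h1.clm_apply (F.dominated_feat hb))

theorem dominated_insertion {B B' : T × TraceSpace H → H →L[ℂ] H} (hB : Dominated B)
    (hB' : Dominated B') {a b : T → Sq} (ha : Continuous a) (hb : Continuous b) :
    Dominated (fun q : T × TraceSpace H =>
      F.insertion z (t q.1) (B q) (B' q) (a q.1) (b q.1) q.2 q.2) := by
  have hR := F.dominated_res hδ hz htc ht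
  have hX : Dominated (fun q : T × TraceSpace H => op H q.2) :=
    (Dominated.const (op H)).clm_apply Dominated.snd
  exact (F.dominated_feat ha).inner ((((hR.mul hB).mul hX).mul (hR.mul hB')).clm_apply
    (F.dominated_feat hb))

theorem dominated_potSlope (j : ℕ) :
    Dominated (fun q : T × TraceSpace H => F.potSlope z (t q.1) j q.2) := by
  have hR := F.dominated_res hδ hz htc ht
  have hX : Dominated (fun q : T × TraceSpace H => tr H q.2) :=
    (Dominated.const (tr H)).clm_apply Dominated.snd
  have hT : Dominated (fun q : T × TraceSpace H => (tad Φ (t q.1) : ℂ)) := by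
    simp only [tad, Complex.ofReal_sum, Complex.ofReal_mul]
    refine Dominated.sum _ fun j _ => Dominated.mul ?_ (Dominated.const _)
    refine Dominated.of_norm_le (A := 1) ?_ zero_le_one fun q => ?_
    · have := (continuous_apply j).comp htc
      exact Complex.continuous_ofReal.comp (this.comp continuous_fst)
    · rw [Complex.norm_real, Real.norm_of_nonneg (ht q.1 j).1]
      exact (ht q.1 j).2
  have h1 := (hX.clm_apply ((hR.add (Dominated.const (-1))).mul (Dominated.const (F.proj j))))
  have h2 := ((((Dominated.const (-(3 / 2) * z ^ 2)).mul hT).mul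
    (Dominated.const (sliceTad Φ j : ℂ))).add ((Dominated.const z).mul
      (hX.clm_apply (Dominated.const (F.proj j))))).add
        ((Dominated.const (-(1 / 2) * z)).mul h1)
  refine (congrArg Dominated (funext fun q => ?_)).mp h2
  rw [potSlope, sub_eq_add_neg (F.res z (t q.1) q.2)]
  ring

end Members

section Integrals

variable {Ω : Type*} [MeasurableSpace Ω] {P : Measure Ω} {W : L2 → Ω → ℝ}
  (hW : IsWhiteNoise P W) {T S : Type*} [TopologicalSpace T] [TopologicalSpace S]
  [MeasurableSpace S] [BorelSpace S] [SecondCountableTopology S]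
  [TopologicalSpace.PseudoMetrizableSpace S] (μ : Measure S) [IsFiniteMeasure μ]
  {G : Type*} [NormedAddCommGroup G]

include hW

theorem aestronglyMeasurable_dominated {f : S × TraceSpace H → G} (hf : Continuous f) :
    AEStronglyMeasurable (fun q : Ω × S => f (q.2, F.field W q.1)) (P.prod μ) :=
  hf.comp_aestronglyMeasurable (measurable_snd.aestronglyMeasurable.prodMk
    ((F.aestronglyMeasurable_field hW).comp_fst))

theorem integrable_growth (A a : ℝ) :
    Integrable (fun q : Ω × S => A * Real.exp (a * ‖F.field W q.1‖)) (P.prod μ) := by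
  have hP := (IsCentredGaussian.gaussian hW).isProbabilityMeasure
  exact (F.integrable_exp_norm_field hW a).const_mul A |>.comp_fst μ

theorem integrable_dominated {f : S × TraceSpace H → G} (hf : Dominated f) :
    Integrable (fun q : Ω × S => f (q.2, F.field W q.1)) (P.prod μ) := by
  obtain ⟨hc, C, _, hb⟩ := hf
  exact (F.integrable_growth hW μ C C).mono' (F.aestronglyMeasurable_dominated hW μ hc)
    (Eventually.of_forall fun q => hb _)

theorem continuous_integral_dominated [NormedSpace ℝ G] [FirstCountableTopology T]
    {f : (T × S) × TraceSpace H → G} (hf : Dominated f) :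
    Continuous fun τ => ∫ q : Ω × S, f ((τ, q.2), F.field W q.1) ∂(P.prod μ) := by
  obtain ⟨hc, C, _, hb⟩ := hf
  refine continuous_of_dominated (bound := fun q => C * Real.exp (C * ‖F.field W q.1‖))
    (fun τ => ?_) (fun τ => Eventually.of_forall fun q => hb _) (F.integrable_growth hW μ C C)
    (Eventually.of_forall fun q => hc.comp (by fun_prop))
  exact F.aestronglyMeasurable_dominated hW μ (f := fun r => f ((τ, r.1), r.2))
    (hc.comp (by fun_prop))

end Integrals

end Features

/-! ### One step of the recursion, in terms of values -/

namespace ResolventGraph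

variable {p n : ℕ} (G : ResolventGraph p n) {α S : Type*} (K : ℂ → α → S → S → ℂ) (c d₀ : α)
  (d : Fin p → α) (x : Fin n → S) (y : S)

theorem sum_graftPair (f : Fin n × Bool → Fin n × Bool → ℂ) :
    ∑ q : {q : (Fin n × Bool) × (Fin n × Bool) // q.2 ≠ q.1}, f q.1.1 q.1.2 =
      ∑ l, ∑ l' ∈ Finset.univ.erase l, f l l' := by
  classical
  rw [← Finset.sum_subtype (Finset.univ.filter fun q : (Fin n × Bool) × (Fin n × Bool) => q.2 ≠ q.1)
    (by simp) (fun q => f q.1 q.2), Finset.sum_filter, Fintype.sum_prod_type]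
  refine Finset.sum_congr rfl fun l _ => ?_
  rw [← Finset.sum_filter]
  refine Finset.sum_congr ?_ fun _ _ => rfl
  ext l'
  simp

/-- The right-hand side is arranged so that, for the resolvent kernels, it coincides by definition
with `Features.contracted`. -/
theorem sum_stepGraft_value :
    (G.stepGraft.map fun G' => G'.value K c (Fin.cons d₀ d : Fin (p + 1) → α)
      (Fin.cons y x : Fin (n + 1) → S)).sum =
    3 * K 1 c y y * K 1 d₀ y y * G.value K c d x
    + 6 * K 1 d₀ y y * ∑ l, G.valueErase K c d x l * (G.kerIn K x y c l * G.kerOut K c d x y l)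
    + 6 * K 1 c y y * ∑ l, G.valueErase K c d x l * (G.kerIn K x y d₀ l * G.kerOut K c d x y l)
    + 4 * ∑ l, (∑ l' ∈ Finset.univ.erase l, G.valueErase₂ K c d x l l' *
      (G.kerIn K x y c l' * G.kerOut K c d x y l')) *
      (G.kerIn K x y d₀ l * G.kerOut K c d x y l) := by
  rw [sum_stepGraft]
  simp only [graftIso_value, graftLeaf_value, graftMarkedLeaf_value, graftPair_value]
  rw [sum_graftPair (fun l l' => G.valueErase₂ K c d x l l' *
      (G.kerIn K x y c l' * G.kerOut K c d x y l') *
      (G.kerIn K x y d₀ l * G.kerOut K c d x y l))]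
  simp only [← Finset.mul_sum, ← Finset.sum_mul]
  ring

theorem sum_stepMark_value :
    (G.stepMark.map fun G' => G'.value K c (Fin.cons d₀ d : Fin (p + 1) → α) x).sum =
    ∑ h : {l : Fin n × Bool // ∀ i, G.mark i ≠ l},
      G.valueErase K c d x h.1 * K (G.tau h.1) d₀ (x (G.src h.1)) (x (G.tgt h.1)) := by
  rw [sum_stepMark]
  refine Finset.sum_congr rfl fun h _ => ?_
  rw [addMark_value]
  rfl

end ResolventGraph

/-! ### The `t_j`-derivative of a graph in a fixed field -/

namespace Features

open TraceSpace

variable {Φ : Model} {H : Type*} [NormedAddCommGroup H] [InnerProductSpace ℂ H] [CompleteSpace H]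
  (F : Features Φ H)

section Graphs

variable (z : ℂ) {p n : ℕ} (G : ResolventGraph p n) (e : Fin p → ℕ) (t : ℕ → ℝ)

/-- The operators on the lines of a graph. -/
def lineOp (l : Fin n × Bool) : H →L[ℂ] H := G.lineVal (F.interp t) (fun i => F.proj (e i)) l

/-- The value of a graph in the field `X`, with vertices at `x`. -/
def graphVal (x : Fin n → Sq) (X : TraceSpace H) : ℂ :=
  G.value (F.ker z t X) (F.interp t) (fun i => F.proj (e i)) x

theorem graphVal_eq (x : Fin n → Sq) (X : TraceSpace H) : F.graphVal z G e t x X =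
    F.lineProd z t (fun l => x (G.src l)) (fun l => x (G.tgt l)) G.tau (F.lineOp G e t) X := rfl

theorem proj_cons (j : ℕ) : (fun i => F.proj ((Fin.cons j e : Fin (p + 1) → ℕ) i)) =
    (Fin.cons (F.proj j) (fun i => F.proj (e i)) : Fin (p + 1) → H →L[ℂ] H) := by
  funext i
  refine Fin.cases ?_ (fun i => ?_) i <;> simp

theorem sum_stepGraft_graphVal (j : ℕ) (x : Fin n → Sq) (y : Sq) (X : TraceSpace H) :
    (G.stepGraft.map fun G' => F.graphVal z G' (Fin.cons j e) t (Fin.cons y x) X).sum =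
      F.contracted z t (fun l => x (G.src l)) (fun l => x (G.tgt l)) G.tau (F.lineOp G e t) j y X := by
  simp only [graphVal, proj_cons]
  rw [G.sum_stepGraft_value]
  rfl

/-- The part of the `t_j`-derivative which marks a line. -/
def markPart (j : ℕ) (x : Fin n → Sq) (X : TraceSpace H) : ℂ :=
  (G.stepMark.map fun G' => F.graphVal z G' (Fin.cons j e) t x X).sum

/-- The part of the `t_j`-derivative with an explicit field. -/
def explicitVal (j : ℕ) (x : Fin n → Sq) (X : TraceSpace H) : ℂ :=
  Complex.exp (F.pot z t X) * (F.potSlope z t j X * F.lineProd z t (fun l => x (G.src l))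
      (fun l => x (G.tgt l)) G.tau (F.lineOp G e t) X -
    z * ∑ l, F.lineProdErase z t (fun l => x (G.src l)) (fun l => x (G.tgt l)) G.tau
      (F.lineOp G e t) l X * F.insertion z t (F.proj j) (F.lineOp G e t l) (x (G.src l))
        (x (G.tgt l)) X X)

/-- The derivative of a line operator with respect to `t_j`. -/
def lineOpDeriv (j : ℕ) (l : Fin n × Bool) : H →L[ℂ] H :=
  G.lineVal (F.proj j) (fun _ => 0) l

/-- The covariance of a marked line does not depend on `t_j`: `lineOpDeriv` vanishes there, and the
sum over unmarked lines extends to all lines. -/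
theorem markPart_eq (j : ℕ) (x : Fin n → Sq) (X : TraceSpace H) : F.markPart z G e t j x X =
    ∑ l, F.lineProdErase z t (fun l => x (G.src l)) (fun l => x (G.tgt l)) G.tau
      (F.lineOp G e t) l X * F.ker z t X (G.tau l) (F.lineOpDeriv G j l)
        (x (G.src l)) (x (G.tgt l)) := by
  classical
  simp only [markPart, graphVal, proj_cons]
  rw [G.sum_stepMark_value]
  rw [← Finset.sum_subtype (Finset.univ.filter fun l => ∀ i, G.mark i ≠ l)
    (by simp) (fun l => G.valueErase (F.ker z t X) (F.interp t) (fun i => F.proj (e i)) x l *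
      F.ker z t X (G.tau l) (F.proj j) (x (G.src l)) (x (G.tgt l))), Finset.sum_filter]
  refine Finset.sum_congr rfl fun l _ => ?_
  split_ifs with h
  · rw [lineOpDeriv, G.lineVal_of_notMem _ _ h]
    rfl
  · push Not at h
    obtain ⟨i, rfl⟩ := h
    rw [lineOpDeriv, G.lineVal_mark]
    simp [ker]

section Derivative

variable {z t} {δ : ℝ} (hδ : 0 < δ) (hz : ∀ r : ℝ, δ ≤ ‖1 + z * (r : ℂ)‖)
  (ht : t ∈ unitCube)

theorem hasDerivAt_lineOp {j : ℕ} (hj : j ≤ Φ.jmax) (l : Fin n × Bool) :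
    HasDerivAt (fun u : ℝ => F.lineOp G e (Function.update t j u) l) (F.lineOpDeriv G j l) (t j) := by
  by_cases h : ∃ i, G.mark i = l
  · obtain ⟨i, rfl⟩ := h
    simp only [lineOp, lineOpDeriv, G.lineVal_mark]
    exact hasDerivAt_const _ _
  · push Not at h
    simp only [lineOp, lineOpDeriv, G.lineVal_of_notMem _ _ h]
    exact F.hasDerivAt_interp_update hj t (t j)

include hδ hz ht

/-- In the term where the resolvent is differentiated the shift `τ` drops out, so a cut tadpole
yields full resolvents. The shift survives only where the line operator is differentiated, i.e.
where a mark is added. -/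
theorem hasDerivAt_ker_update {j : ℕ} (hj : j ≤ Φ.jmax) (X : TraceSpace H) (τ : ℂ)
    {B : ℝ → H →L[ℂ] H} {B' : H →L[ℂ] H} (hB : HasDerivAt B B' (t j)) (a b : Sq) :
    HasDerivAt (fun u => F.ker z (Function.update t j u) X τ (B u) a b)
      (-z * F.insertion z t (F.proj j) (B (t j)) a b X X + F.ker z t X τ B' a b) (t j) := by
  have h1 := ((F.hasDerivAt_res_update hδ hz ht hj X).sub_const (τ • (1 : H →L[ℂ] H))).mul hB
  have h2 := (F.elt a b).hasFDerivAt.comp_hasDerivAt (t j) h1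
  refine h2.congr_deriv ?_
  rw [map_add, Function.update_eq_self]
  simp only [elt_apply, insertion_apply, ker]
  congr 1
  rw [neg_mul, neg_apply, inner_neg_right, neg_mul, smul_mul_assoc, smul_apply, inner_smul_right,
    mul_assoc _ (F.res z t X) (B (t j))]

theorem hasDerivAt_graphVal {j : ℕ} (hj : j ≤ Φ.jmax) (x : Fin n → Sq) (X : TraceSpace H) :
    HasDerivAt (fun u => F.graphVal z G e (Function.update t j u) x X)
      (-z * ∑ l, F.lineProdErase z t (fun l => x (G.src l)) (fun l => x (G.tgt l)) G.tau
        (F.lineOp G e t) l X * F.insertion z t (F.proj j) (F.lineOp G e t l) (x (G.src l))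
          (x (G.tgt l)) X X + F.markPart z G e t j x X) (t j) := by
  have h := HasDerivAt.fun_finsetProd (u := Finset.univ) (fun l _ =>
    F.hasDerivAt_ker_update hδ hz ht hj X (G.tau l) (F.hasDerivAt_lineOp G e hj l)
      (x (G.src l)) (x (G.tgt l)))
  refine h.congr_deriv ?_
  rw [markPart_eq, Finset.mul_sum, ← Finset.sum_add_distrib]
  refine Finset.sum_congr rfl fun l _ => ?_
  simp only [Function.update_eq_self, smul_eq_mul, lineProdErase]
  ring

theorem hasDerivAt_exp_mul_graphVal {j : ℕ} (hj : j ≤ Φ.jmax) (x : Fin n → Sq)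
    (X : TraceSpace H) :
    HasDerivAt (fun u => Complex.exp (F.pot z (Function.update t j u) X) *
        F.graphVal z G e (Function.update t j u) x X)
      (F.explicitVal z G e t j x X + Complex.exp (F.pot z t X) * F.markPart z G e t j x X)
      (t j) := by
  have h := (F.hasDerivAt_pot_update hδ hz ht hj X).cexp.fun_mul
    (F.hasDerivAt_graphVal G e hδ hz ht hj x X)
  refine h.congr_deriv ?_
  simp only [Function.update_eq_self, potSlope, explicitVal, graphVal_eq]
  ring

end Derivative

section Dominated

variable {z} {δ : ℝ} (hδ : 0 < δ) (hz : ∀ r : ℝ, δ ≤ ‖1 + z * (r : ℂ)‖)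
  {T : Type*} [TopologicalSpace T] {s : T → ℕ → ℝ} (hs : Continuous s)
  (hs' : ∀ q, s q ∈ unitCube)

include hs hs' in
theorem dominated_lineOp {E : Type*} [NormedAddCommGroup E] (l : Fin n × Bool) :
    Dominated (fun q : T × E => F.lineOp G e (s q.1) l) := by
  by_cases h : ∃ i, G.mark i = l
  · obtain ⟨i, rfl⟩ := h
    simp only [lineOp, G.lineVal_mark]
    exact Dominated.const _
  · push Not at h
    simp only [lineOp, G.lineVal_of_notMem _ _ h]
    exact F.dominated_interp hs hs'

include hδ hz hs hs'

variable {x : T → Fin n → Sq} (hx : Continuous x)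

include hx

theorem dominated_lineKer (l : Fin n × Bool) : Dominated (fun q : T × TraceSpace H =>
    F.ker z (s q.1) q.2 (G.tau l) (F.lineOp G e (s q.1) l) (x q.1 (G.src l)) (x q.1 (G.tgt l))) :=
  F.dominated_ker hδ hz hs hs' (G.tau l) (B := fun q => F.lineOp G e (s q.1) l)
    (F.dominated_lineOp G e hs hs' l) (a := fun q => x q (G.src l)) (b := fun q => x q (G.tgt l))
    ((continuous_apply (G.src l)).comp hx) ((continuous_apply (G.tgt l)).comp hx)

theorem dominated_lineInsertion (j : ℕ) (l : Fin n × Bool) :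
    Dominated (fun q : T × TraceSpace H => F.insertion z (s q.1) (F.proj j)
          (F.lineOp G e (s q.1) l) (x q.1 (G.src l)) (x q.1 (G.tgt l)) q.2 q.2) :=
  F.dominated_insertion hδ hz hs hs' (B := fun _ => F.proj j) (B' := fun q => F.lineOp G e (s q.1) l)
    (Dominated.const _) (F.dominated_lineOp G e hs hs' l) (a := fun q => x q (G.src l))
    (b := fun q => x q (G.tgt l))
    ((continuous_apply (G.src l)).comp hx) ((continuous_apply (G.tgt l)).comp hx)

theorem dominated_graphVal : Dominated (fun q : T × TraceSpace H =>
    F.graphVal z G e (s q.1) (x q.1) q.2) :=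
  Dominated.prod _ fun l _ => F.dominated_lineKer G e hδ hz hs hs' hx l

theorem dominated_integrand [FirstCountableTopology T] : Dominated (fun q : T × TraceSpace H =>
    Complex.exp (F.pot z (s q.1) q.2) * F.graphVal z G e (s q.1) (x q.1) q.2) :=
  (F.dominated_exp_pot hδ hz hs hs').mul (F.dominated_graphVal G e hδ hz hs hs' hx)

theorem dominated_explicit [FirstCountableTopology T] (j : ℕ) :
    Dominated (fun q : T × TraceSpace H => F.explicitVal z G e (s q.1) j (x q.1) q.2) := by
  refine (F.dominated_exp_pot hδ hz hs hs').mul ?_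
  have h1 := (F.dominated_potSlope hδ hz hs hs' j).mul (F.dominated_graphVal G e hδ hz hs hs' hx)
  have h2 : Dominated (fun q : T × TraceSpace H => ∑ l,
      F.lineProdErase z (s q.1) (fun l => x q.1 (G.src l)) (fun l => x q.1 (G.tgt l))
          G.tau (F.lineOp G e (s q.1)) l q.2 * F.insertion z (s q.1) (F.proj j)
          (F.lineOp G e (s q.1) l) (x q.1 (G.src l)) (x q.1 (G.tgt l)) q.2 q.2) :=
    Dominated.sum _ fun l _ => (Dominated.prod _ fun k _ =>
      F.dominated_lineKer G e hδ hz hs hs' hx k).mul (F.dominated_lineInsertion G e hδ hz hs hs' hx j l)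
  have h3 := h1.add ((Dominated.const (-z)).mul h2)
  refine (congrArg Dominated (funext fun q => ?_)).mp h3
  rw [graphVal_eq]
  ring

theorem dominated_markPart [FirstCountableTopology T] (j : ℕ) :
    Dominated (fun q : T × TraceSpace H =>
      Complex.exp (F.pot z (s q.1) q.2) * F.markPart z G e (s q.1) j (x q.1) q.2) := by
  refine (F.dominated_exp_pot hδ hz hs hs').mul ?_
  simp only [markPart, ResolventGraph.sum_stepMark]
  exact Dominated.sum _ fun h _ => F.dominated_graphVal _ _ hδ hz hs hs' hx

end Dominated

end Graphs

end Features

theorem integral_multiset_sum_map {S A : Type*} [MeasurableSpace S] {μ : Measure S}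
    (m : Multiset A) {f : A → S → ℂ} (hf : ∀ a ∈ m, Integrable (f a) μ) :
    Integrable (fun q => (m.map fun a => f a q).sum) μ ∧
    ∫ q, (m.map fun a => f a q).sum ∂μ = (m.map fun a => ∫ q, f a q ∂μ).sum := by
  induction m using Multiset.induction_on with
  | empty => simp
  | cons a m ih =>
    obtain ⟨h1, h2⟩ := ih fun b hb => hf b (by simp [hb])
    simp only [Multiset.map_cons, Multiset.sum_cons]
    refine ⟨(hf a (by simp)).add h1, ?_⟩
    rw [integral_add (hf a (by simp)) h1, h2]

theorem integral_fin_cons {n : ℕ} {S : Type*} [MeasureSpace S] [SigmaFinite (volume : Measure S)]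
    {J : (Fin (n + 1) → S) → ℂ} (hJ : Integrable J) :
    ∫ x, J x = ∫ x : Fin n → S, ∫ y, J (Fin.cons y x) := by
  have hm := (volume_preserving_piFinSuccAbove (fun _ : Fin (n + 1) => S) 0).symm
  rw [← hm.integral_comp' J]
  have h2 : Integrable (fun q => J ((MeasurableEquiv.piFinSuccAbove (fun _ : Fin (n + 1) => S)
      0).symm q)) := (hm.integrable_comp_emb (MeasurableEquiv.measurableEmbedding _)).2 hJ
  rw [Measure.volume_eq_prod] at h2 ⊢
  rw [integral_prod_symm _ h2]
  refine integral_congr_ae (Eventually.of_forall fun x => integral_congr_ae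
    (Eventually.of_forall fun y => ?_))
  simp only [MeasurableEquiv.piFinSuccAbove_symm_apply]
  congr 1
  exact Fin.insertNth_zero' _ _

/-! ### The `t_j`-derivative of an averaged graph -/

namespace Features

open TraceSpace

variable {Φ : Model} {H : Type*} [NormedAddCommGroup H] [InnerProductSpace ℂ H] [CompleteSpace H]
  (F : Features Φ H)

section Derivative

variable {Ω : Type*} [MeasurableSpace Ω] (P : Measure Ω) (W : L2 → Ω → ℝ) (z : ℂ) {p n : ℕ}

/-- The contribution of a graph, before the integration over the interpolation parameters. -/
def graphInt (G : ResolventGraph p n) (e : Fin p → ℕ) (t : ℕ → ℝ) : ℂ :=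
  (z ^ 2 / 4) ^ n * ∫ q : Ω × (Fin n → Sq), Complex.exp (F.pot z t (F.field W q.1)) *
    F.graphVal z G e t q.2 (F.field W q.1) ∂(P.prod volume)

/-- The sum of the contributions of all graphs after `p` steps of the expansion. -/
def expSum (e : Fin p → ℕ) (t : ℕ → ℝ) : ℂ :=
  ((ResolventGraph.graphs p).map fun g => F.graphInt P W z g.2 e t).sum

variable {P W z} {δ : ℝ} (hδ : 0 < δ) (hz : ∀ r : ℝ, δ ≤ ‖1 + z * (r : ℂ)‖)
  (hW : IsWhiteNoise P W)

include hδ hz hW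

theorem integrable_graphInt {t : ℕ → ℝ} (ht : t ∈ unitCube) (G : ResolventGraph p n)
    (e : Fin p → ℕ) :
    Integrable (fun q : Ω × (Fin n → Sq) => Complex.exp (F.pot z t (F.field W q.1)) *
    F.graphVal z G e t q.2 (F.field W q.1)) (P.prod volume) := by
  have h : Dominated (fun q : (Fin n → Sq) × TraceSpace H =>
      Complex.exp (F.pot z t q.2) * F.graphVal z G e t q.1 q.2) :=
    F.dominated_integrand G e hδ hz (s := fun _ : Fin n → Sq => t) continuous_const (fun _ => ht)
      (x := fun x => x) continuous_id
  exact F.integrable_dominated hW volume h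

theorem integral_contracted {t : ℕ → ℝ} (ht : t ∈ unitCube) (G : ResolventGraph p n)
    (e : Fin p → ℕ) (j : ℕ) :
    ∫ x : Fin n → Sq, ∫ y, ∫ ω, Complex.exp (F.pot z t (F.field W ω)) *
        F.contracted z t (fun l => x (G.src l)) (fun l => x (G.tgt l)) G.tau (F.lineOp G e t) j y
          (F.field W ω) ∂P =
      (G.stepGraft.map fun G' => ∫ q : Ω × (Fin (n + 1) → Sq),
        Complex.exp (F.pot z t (F.field W q.1)) *
        F.graphVal z G' (Fin.cons j e) t q.2 (F.field W q.1) ∂(P.prod volume)).sum := by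
  have hP := (IsCentredGaussian.gaussian hW).isProbabilityMeasure
  obtain ⟨h1, h2⟩ := integral_multiset_sum_map G.stepGraft (fun G' _ =>
    F.integrable_graphInt hδ hz hW ht G' (Fin.cons j e : Fin (p + 1) → ℕ))
  rw [← h2, integral_prod_symm _ h1, integral_fin_cons h1.integral_prod_right]
  simp only [Multiset.sum_map_mul_left, sum_stepGraft_graphVal]

/-- The derivative is a sum of graphs only after averaging over the field, since integration by
parts is used. Keeping `t j` inside (0,1) keeps nearby parameters in the cube, where the uniform
bounds hold. -/
theorem hasDerivAt_graphInt {t : ℕ → ℝ} (ht : t ∈ unitCube) {j : ℕ} (hj : j ≤ Φ.jmax)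
    (htj : t j ∈ Set.Ioo (0 : ℝ) 1) (G : ResolventGraph p n) (e : Fin p → ℕ) :
    HasDerivAt (fun u => F.graphInt P W z G e (Function.update t j u))
      ((G.stepMark.map fun G' => F.graphInt P W z G' (Fin.cons j e) t).sum +
        (G.stepGraft.map fun G' => F.graphInt P W z G' (Fin.cons j e) t).sum) (t j) := by
  have hP := (IsCentredGaussian.gaussian hW).isProbabilityMeasure
  -- the family over the parameter `u` and the positions
  set s : Set.Icc (0 : ℝ) 1 × (Fin n → Sq) → ℕ → ℝ := fun q => Function.update t j (q.1 : ℝ) with hs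
  have hsc : Continuous s := by
    rw [hs]
    exact continuous_const.update j (continuous_subtype_val.comp continuous_fst)
  have hs' : ∀ q, s q ∈ unitCube := fun q => update_mem_unitCube ht j q.1.2
  have d1 := F.dominated_explicit G e hδ hz hsc hs' (x := Prod.snd) continuous_snd j
  have d2 := F.dominated_markPart G e hδ hz hsc hs' (x := Prod.snd) continuous_snd j
  obtain ⟨-, C, hC, hb⟩ := d1.add d2
  have f1 : Dominated (fun q : (Fin n → Sq) × TraceSpace H => F.explicitVal z G e t j q.1 q.2) :=
    F.dominated_explicit G e hδ hz (s := fun _ : Fin n → Sq => t) continuous_const (fun _ => ht)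
      (x := fun x => x) continuous_id j
  have f2 : Dominated (fun q : (Fin n → Sq) × TraceSpace H =>
      Complex.exp (F.pot z t q.2) * F.markPart z G e t j q.1 q.2) :=
    F.dominated_markPart G e hδ hz (s := fun _ : Fin n → Sq => t) continuous_const (fun _ => ht)
      (x := fun x => x) continuous_id j
  have i1 := F.integrable_dominated hW (volume : Measure (Fin n → Sq)) f1
  have i2 := F.integrable_dominated hW (volume : Measure (Fin n → Sq)) f2
  have key := hasDerivAt_integral_of_dominated_loc_of_deriv_le
    (μ := P.prod (volume : Measure (Fin n → Sq))) (x₀ := t j) (s := Set.Ioo (0 : ℝ) 1)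
    (F := fun u q => Complex.exp (F.pot z (Function.update t j u) (F.field W q.1)) *
      F.graphVal z G e (Function.update t j u) q.2 (F.field W q.1))
    (F' := fun u q => F.explicitVal z G e (Function.update t j u) j q.2 (F.field W q.1) +
      Complex.exp (F.pot z (Function.update t j u) (F.field W q.1)) *
        F.markPart z G e (Function.update t j u) j q.2 (F.field W q.1))
    (bound := fun q => C * Real.exp (C * ‖F.field W q.1‖)) (Ioo_mem_nhds htj.1 htj.2)
    (by
      filter_upwards [Ioo_mem_nhds htj.1 htj.2] with u hu
      exact (F.integrable_graphInt hδ hz hW (update_mem_unitCube ht j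
        (Set.Ioo_subset_Icc_self hu)) G e).aestronglyMeasurable)
    (by
      rw [Function.update_eq_self]
      exact F.integrable_graphInt hδ hz hW ht G e)
    (by
      simp only [Function.update_eq_self]
      exact (i1.add i2).aestronglyMeasurable)
    (Eventually.of_forall fun q u hu => hb ((⟨u, Set.Ioo_subset_Icc_self hu⟩, q.2), F.field W q.1))
    (F.integrable_growth hW _ C C)
    (Eventually.of_forall fun q u hu => by
      have := F.hasDerivAt_exp_mul_graphVal G e hδ hz (update_mem_unitCube ht j
        (Set.Ioo_subset_Icc_self hu)) hj q.2 (F.field W q.1)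
      simpa only [Function.update_idem, Function.update_self] using this)
  have key2 := key.2.const_mul ((z ^ 2 / 4) ^ n)
  refine key2.congr_deriv ?_
  simp only [Function.update_eq_self]
  have hA := integral_prod_symm _ i1
  obtain ⟨-, hB⟩ := integral_multiset_sum_map G.stepMark (fun G' _ =>
    F.integrable_graphInt hδ hz hW ht G' (Fin.cons j e : Fin (p + 1) → ℕ))
  -- At fixed positions the explicit field is integrated by parts. The factor z²/4 that appears is
  -- the weight of the new vertex and raises the power from `n` to `n + 1`.
  have hE := fun x : Fin n → Sq => F.integral_explicit (fun l => x (G.src l))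
    (fun l => x (G.tgt l)) G.tau (F.lineOp G e t) j hδ hz ht hW hj
  simp only [explicitVal, hE] at hA
  rw [integral_const_mul, F.integral_contracted hδ hz hW ht] at hA
  have hB' : ∫ q : Ω × (Fin n → Sq), Complex.exp (F.pot z t (F.field W q.1)) *
      F.markPart z G e t j q.2 (F.field W q.1) ∂(P.prod volume) =
      (G.stepMark.map fun G' => ∫ q : Ω × (Fin n → Sq), Complex.exp (F.pot z t (F.field W q.1)) *
        F.graphVal z G' (Fin.cons j e) t q.2 (F.field W q.1) ∂(P.prod volume)).sum := by
    rw [← hB]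
    simp only [markPart, Multiset.sum_map_mul_left]
  rw [integral_add i1 i2, hB']
  simp only [explicitVal]
  rw [hA]
  simp only [graphInt, Multiset.sum_map_mul_left]
  ring

/-- The recursion defining `graphs` was set up so that one derivative is one step of it. -/
theorem hasDerivAt_expSum {t : ℕ → ℝ} (ht : t ∈ unitCube) {j : ℕ} (hj : j ≤ Φ.jmax)
    (htj : t j ∈ Set.Ioo (0 : ℝ) 1) (e : Fin p → ℕ) :
    HasDerivAt (fun u => F.expSum P W z e (Function.update t j u))
      (F.expSum P W z (Fin.cons j e : Fin (p + 1) → ℕ) t) (t j) := by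
  rw [expSum, ResolventGraph.sum_graphs_succ]
  unfold expSum
  generalize ResolventGraph.graphs p = m
  induction m using Multiset.induction_on with
  | empty => simpa using hasDerivAt_const (t j) (0 : ℂ)
  | cons g m ih =>
    simp only [Multiset.map_cons, Multiset.sum_cons]
    exact (F.hasDerivAt_graphInt hδ hz hW ht hj htj g.2 e).fun_add ih

theorem continuous_graphInt (G : ResolventGraph p n) (e : Fin p → ℕ) :
    Continuous fun t : unitCube => F.graphInt P W z G e t := by
  have h : Dominated (fun q : (unitCube × (Fin n → Sq)) × TraceSpace H =>
      Complex.exp (F.pot z q.1.1 q.2) * F.graphVal z G e q.1.1 q.1.2 q.2) :=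
    F.dominated_integrand G e hδ hz (s := fun q : unitCube × (Fin n → Sq) => (q.1 : ℕ → ℝ))
      (by fun_prop) (fun q => q.1.2) (x := fun q => q.2) continuous_snd
  exact continuous_const.mul (F.continuous_integral_dominated hW volume h)

theorem continuous_expSum (e : Fin p → ℕ) : Continuous fun t : unitCube => F.expSum P W z e t := by
  unfold expSum
  generalize ResolventGraph.graphs p = m
  induction m using Multiset.induction_on with
  | empty => simpa using continuous_const
  | cons g m ih =>
    simp only [Multiset.map_cons, Multiset.sum_cons]
    exact (F.continuous_graphInt hδ hz hW g.2 e).add ih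

theorem expSum_zero (e : Fin 0 → ℕ) (t : ℕ → ℝ) :
    F.expSum P W z e t = ∫ ω, Complex.exp (F.pot z t (F.field W ω)) ∂P := by
  have hP := (IsCentredGaussian.gaussian hW).isProbabilityMeasure
  simp only [expSum, ResolventGraph.graphs, Multiset.map_singleton, Multiset.sum_singleton,
    graphInt, pow_zero, one_mul]
  have e1 : ∀ (x : Fin 0 → Sq) X, F.graphVal z ResolventGraph.empty e t x X = 1 := fun x X => by
    simp [graphVal, ResolventGraph.value]
  simp only [e1, mul_one]
  rw [integral_fun_fst (fun ω => Complex.exp (F.pot z t (F.field W ω)))]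
  simp

end Derivative

end Features

/-! ### Testing the slices -/

/-- The alternating sum over the values `0` and `1` of the listed parameters. -/
def testList : List ℕ → ((ℕ → ℝ) → ℂ) → (ℕ → ℝ) → ℂ
  | [], f, t => f t
  | j :: l, f, t => testList l f (Function.update t j 1) - testList l f (Function.update t j 0)

theorem integral_testList {Ω : Type*} [MeasurableSpace Ω] {P : Measure Ω}
    {f : Ω → (ℕ → ℝ) → ℂ} (hf : ∀ t ∈ unitCube, Integrable (fun ω => f ω t) P) (l : List ℕ)
    {t : ℕ → ℝ} (ht : t ∈ unitCube) : Integrable (fun ω => testList l (f ω) t) P ∧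
      ∫ ω, testList l (f ω) t ∂P = testList l (fun t => ∫ ω, f ω t ∂P) t := by
  induction l generalizing t with
  | nil => exact ⟨hf t ht, rfl⟩
  | cons j l ih =>
    obtain ⟨h1, e1⟩ := ih (update_mem_unitCube ht j (u := 1) (by simp))
    obtain ⟨h2, e2⟩ := ih (update_mem_unitCube ht j (u := 0) (by simp))
    simp only [testList]
    exact ⟨h1.sub h2, by rw [integral_sub h1 h2, e1, e2]⟩

/-- The terms with and without `a` telescope: f at `t_a = 0` plus the difference between 1 and 0 is
f at `t_a = 1`. Inserting a new minimum matches the increasing order in which the lists are sorted.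
-/
theorem sum_testList (f : (ℕ → ℝ) → ℂ) (S : Finset ℕ) (t : ℕ → ℝ) (ht : ∀ i ∈ S, t i = 0) :
    ∑ J ∈ S.powerset, testList (J.sort (· ≤ ·)) f t = f (fun i => if i ∈ S then 1 else t i) := by
  induction S using Finset.induction_on_min generalizing t with
  | empty => simp [testList]
  | insert a S ha ih =>
    have haS : a ∉ S := fun h => lt_irrefl _ (ha a h)
    rw [Finset.sum_powerset_insert haS]
    have e : ∀ J ∈ S.powerset, testList ((insert a J).sort (· ≤ ·)) f t =
        testList (J.sort (· ≤ ·)) f (Function.update t a 1) - testList (J.sort (· ≤ ·)) f t := by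
      intro J hJ
      have hJ' := Finset.mem_powerset.1 hJ
      rw [Finset.sort_insert (r := (· ≤ ·)) (fun b hb => (ha b (hJ' hb)).le) fun h => haS (hJ' h),
        testList]
      congr 2
      rw [Function.update_eq_self_iff, ht a (by simp)]
    rw [Finset.sum_congr rfl e, Finset.sum_sub_distrib, add_sub_cancel,
      ih _ fun i hi => by
        rw [Function.update_of_ne (ne_of_mem_of_not_mem hi haS), ht i (by simp [hi])]]
    congr 1
    funext i
    by_cases hi : i = a
    · subst hi; simp
    · simp [hi]

/-- `g` is the iterated derivative of `f` with respect to the parameters `e`, in the interior of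
the cube, and all intermediate derivatives are continuous up to the boundary. -/
inductive Tower (f : (ℕ → ℝ) → ℂ) : (p : ℕ) → (Fin p → ℕ) → ((ℕ → ℝ) → ℂ) → Prop
  | zero (e : Fin 0 → ℕ) : ContinuousOn f unitCube → Tower f 0 e f
  | succ {p : ℕ} {e : Fin p → ℕ} {g g' : (ℕ → ℝ) → ℂ} {j : ℕ} : Tower f p e g →
      (∀ t ∈ unitCube, t j ∈ Set.Ioo (0 : ℝ) 1 →
        HasDerivAt (fun u => g (Function.update t j u)) (g' t) (t j)) →
      ContinuousOn g' unitCube → Tower f (p + 1) (Fin.cons j e) g'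

theorem Tower.continuousOn {f g : (ℕ → ℝ) → ℂ} {p : ℕ} {e : Fin p → ℕ} (h : Tower f p e g) :
    ContinuousOn g unitCube := by
  cases h with
  | zero _ h => exact h
  | succ _ _ h => exact h

theorem extend_mem_unitCube {p : ℕ} {e : Fin p → ℕ} (he : Function.Injective e) {t : ℕ → ℝ}
    (ht : t ∈ unitCube) {b : Fin p → ℝ} (hb : b ∈ Set.Icc 0 1) :
    Function.extend e b t ∈ unitCube := by
  intro i
  by_cases h : ∃ k, e k = i
  · obtain ⟨k, rfl⟩ := h
    rw [he.extend_apply]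
    exact ⟨hb.1 k, hb.2 k⟩
  · rw [Function.extend_apply' _ _ _ h]
    exact ht i

theorem continuous_extend {p : ℕ} {e : Fin p → ℕ} (he : Function.Injective e) (t : ℕ → ℝ) :
    Continuous fun b : Fin p → ℝ => Function.extend e b t := by
  refine continuous_pi fun i => ?_
  by_cases h : ∃ k, e k = i
  · obtain ⟨k, rfl⟩ := h
    simp only [he.extend_apply]
    exact continuous_apply k
  · simp only [Function.extend_apply' _ _ _ h]
    exact continuous_const

theorem extend_cons {p : ℕ} {e : Fin p → ℕ} {j : ℕ}
    (he : Function.Injective (Fin.cons j e : Fin (p + 1) → ℕ)) (t : ℕ → ℝ) (u : ℝ)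
    (b : Fin p → ℝ) :
    Function.extend (Fin.cons j e : Fin (p + 1) → ℕ) (Fin.cons u b : Fin (p + 1) → ℝ) t =
      Function.update (Function.extend e b t) j u := by
  have he' := (Fin.cons_injective_iff.1 he).2
  funext i
  by_cases hj : i = j
  · subst hj
    rw [Function.update_self]
    exact he.extend_apply (Fin.cons u b : Fin (p + 1) → ℝ) t 0
  · rw [Function.update_of_ne hj]
    by_cases h : ∃ k, e k = i
    · obtain ⟨k, rfl⟩ := h
      rw [he'.extend_apply]
      exact he.extend_apply (Fin.cons u b : Fin (p + 1) → ℝ) t k.succ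
    · rw [Function.extend_apply' _ _ _ h, Function.extend_apply']
      rintro ⟨k, hk⟩
      revert hk
      refine Fin.cases (fun hk => hj hk.symm) (fun k hk => h ⟨k, hk⟩) k

theorem update_extend {p : ℕ} {e : Fin p → ℕ} (he : Function.Injective e) {j : ℕ}
    (hj : j ∉ Set.range e) (t : ℕ → ℝ) (u : ℝ)
    (b : Fin p → ℝ) : Function.update (Function.extend e b t) j u =
      Function.extend e b (Function.update t j u) := by
  funext i
  by_cases h : ∃ k, e k = i
  · obtain ⟨k, rfl⟩ := h
    rw [he.extend_apply, Function.update_of_ne (fun h => hj ⟨k, h⟩), he.extend_apply]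
  · rw [Function.extend_apply' _ _ _ h]
    by_cases hij : i = j
    · subst hij; simp
    · rw [Function.update_of_ne hij, Function.update_of_ne hij, Function.extend_apply' _ _ _ h]

theorem integrableOn_extend {p : ℕ} {e : Fin p → ℕ} (he : Function.Injective e) {t : ℕ → ℝ}
    (ht : t ∈ unitCube) {g : (ℕ → ℝ) → ℂ} (hg : ContinuousOn g unitCube) :
    IntegrableOn (fun b => g (Function.extend e b t)) (Set.Icc 0 1) :=
  (hg.comp (continuous_extend he t).continuousOn fun _ hb =>
    extend_mem_unitCube he ht hb).integrableOn_compact isCompact_Icc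

/-- Integration of an iterated derivative over the cube. -/
theorem Tower.integral_eq {f g : (ℕ → ℝ) → ℂ} {p : ℕ} {e : Fin p → ℕ} (h : Tower f p e g)
    (he : Function.Injective e) {t : ℕ → ℝ} (ht : t ∈ unitCube) :
    ∫ b in Set.Icc (0 : Fin p → ℝ) 1, g (Function.extend e b t) =
      testList (List.ofFn e) f t := by
  induction h generalizing t with
  | zero e hf =>
    have e1 : ∀ b : Fin 0 → ℝ, Function.extend e b t = t := fun b => by
      funext i
      rw [Function.extend_apply']
      rintro ⟨k, -⟩
      exact k.elim0
    have e2 : Set.Icc (0 : Fin 0 → ℝ) 1 = Set.univ := by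
      ext b
      simp [Set.mem_Icc, Pi.le_def]
    simp only [e1, e2, Measure.restrict_univ, List.ofFn_zero, testList]
    simp [Measure.real, volume_pi, Measure.pi_univ]
  -- The outermost parameter `j` is integrated first, for fixed values of the others. The
  -- fundamental theorem of calculus leaves the difference of `g` at 1 and at 0, and the induction
  -- hypothesis applies to each of the two.
  | @succ p e g g' j hT hD hc ih =>
    obtain ⟨hj, he'⟩ := Fin.cons_injective_iff.1 he
    have hint := integrableOn_extend he ht hc
    rw [← integral_indicator measurableSet_Icc,
      integral_fin_cons ((integrable_indicator_iff measurableSet_Icc).2 hint)]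
    have hmem : ∀ (b : Fin p → ℝ) (u : ℝ), (Fin.cons u b : Fin (p + 1) → ℝ) ∈ Set.Icc 0 1 ↔
        b ∈ Set.Icc 0 1 ∧ u ∈ Set.Icc (0 : ℝ) 1 := fun b u => by
      simp only [Set.mem_Icc, Pi.le_def, Fin.forall_fin_succ, Fin.cons_zero, Fin.cons_succ,
        Pi.zero_apply, Pi.one_apply]
      tauto
    have hin : ∀ b ∈ Set.Icc (0 : Fin p → ℝ) 1,
        ∫ u, (Set.Icc 0 1).indicator (fun b => g' (Function.extend (Fin.cons j e) b t))
          (Fin.cons u b : Fin (p + 1) → ℝ) =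
        g (Function.extend e b (Function.update t j 1)) -
          g (Function.extend e b (Function.update t j 0)) := by
      intro b hb
      set s := Function.extend e b t with hs
      have hsm : s ∈ unitCube := extend_mem_unitCube he' ht hb
      have e1 : ∀ u, (Set.Icc 0 1).indicator (fun b => g' (Function.extend (Fin.cons j e) b t))
          (Fin.cons u b : Fin (p + 1) → ℝ) =
          (Set.Icc (0 : ℝ) 1).indicator (fun u => g' (Function.update s j u)) u := fun u => by
        by_cases hu : u ∈ Set.Icc (0 : ℝ) 1
        · rw [Set.indicator_of_mem hu, Set.indicator_of_mem ((hmem b u).2 ⟨hb, hu⟩),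
            extend_cons he]
        · rw [Set.indicator_of_notMem hu, Set.indicator_of_notMem fun h => hu ((hmem b u).1 h).2]
      simp only [e1]
      have hup : ContinuousOn (fun u : ℝ => Function.update s j u) (Set.Icc (0 : ℝ) 1) :=
        ((continuous_const (y := s)).update j continuous_id).continuousOn
      have hmaps : Set.MapsTo (fun u => Function.update s j u) (Set.Icc (0 : ℝ) 1) unitCube :=
        fun u hu => update_mem_unitCube hsm j hu
      have hd : ∀ u ∈ Set.Ioo (0 : ℝ) 1, HasDerivAt (fun u => g (Function.update s j u))
          (g' (Function.update s j u)) u := fun u hu => by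
        have := hD (Function.update s j u) (hmaps (Set.Ioo_subset_Icc_self hu))
          (by rwa [Function.update_self])
        simpa only [Function.update_idem, Function.update_self] using this
      have hi : IntervalIntegrable (fun u => g' (Function.update s j u)) volume 0 1 := by
        refine ContinuousOn.intervalIntegrable ?_
        rw [Set.uIcc_of_le zero_le_one]
        exact hc.comp hup hmaps
      rw [integral_indicator measurableSet_Icc, integral_Icc_eq_integral_Ioc,
        ← intervalIntegral.integral_of_le zero_le_one,
        intervalIntegral.integral_eq_sub_of_hasDerivAt_of_le zero_le_one
          (f := fun u => g (Function.update s j u)) (hT.continuousOn.comp hup hmaps) hd hi, hs,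
        update_extend he' hj, update_extend he' hj]
    have hout : ∀ b, ∫ u, (Set.Icc 0 1).indicator (fun b => g' (Function.extend (Fin.cons j e) b t))
          (Fin.cons u b : Fin (p + 1) → ℝ) = (Set.Icc 0 1).indicator (fun b =>
        g (Function.extend e b (Function.update t j 1)) -
          g (Function.extend e b (Function.update t j 0))) b := fun b => by
      by_cases hb : b ∈ Set.Icc (0 : Fin p → ℝ) 1
      · rw [Set.indicator_of_mem hb, hin b hb]
      · rw [Set.indicator_of_notMem hb]
        have : ∀ u, (Set.Icc 0 1).indicator (fun b => g' (Function.extend (Fin.cons j e) b t))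
          (Fin.cons u b : Fin (p + 1) → ℝ) = 0 := fun u =>
          Set.indicator_of_notMem (fun h => hb ((hmem b u).1 h).1) _
        simp [this]
    simp only [hout]
    have h1 : Function.update t j 1 ∈ unitCube := update_mem_unitCube ht j (by simp)
    have h0 : Function.update t j 0 ∈ unitCube := update_mem_unitCube ht j (by simp)
    rw [integral_indicator measurableSet_Icc,
      integral_sub (integrableOn_extend he' h1 hT.continuousOn)
        (integrableOn_extend he' h0 hT.continuousOn), ih he' h1, ih he' h0, List.ofFn_succ]
    rfl

/-- Functions on the unit cube with `n` partial derivatives in the parameters `j ≤ N`. -/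
def CubeSmooth {A : Type*} [NormedAddCommGroup A] [NormedSpace ℝ A] (N : ℕ) :
    ℕ → ((ℕ → ℝ) → A) → Prop
  | 0, f => ContinuousOn f unitCube
  | n + 1, f => ContinuousOn f unitCube ∧ ∀ j ≤ N, ∃ f' : (ℕ → ℝ) → A, CubeSmooth N n f' ∧
      ∀ t ∈ unitCube, HasDerivAt (fun u => f (Function.update t j u)) (f' t) (t j)

/-! ### Stability of smoothness in the interpolation parameters -/

namespace CubeSmooth

variable {A B C : Type*} [NormedAddCommGroup A] [NormedSpace ℝ A] [NormedAddCommGroup B]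
  [NormedSpace ℝ B] [NormedAddCommGroup C] [NormedSpace ℝ C] {N n : ℕ}

theorem continuousOn {f : (ℕ → ℝ) → A} (h : CubeSmooth N n f) : ContinuousOn f unitCube := by
  cases n with
  | zero => exact h
  | succ n => exact h.1

theorem of_succ {f : (ℕ → ℝ) → A} (h : CubeSmooth N (n + 1) f) : CubeSmooth N n f := by
  induction n generalizing f with
  | zero => exact h.1
  | succ n ih =>
    refine ⟨h.1, fun j hj => ?_⟩
    obtain ⟨f', h1, h2⟩ := h.2 j hj
    exact ⟨f', ih h1, h2⟩

theorem const (a : A) : CubeSmooth N n (fun _ => a) := by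
  induction n generalizing a with
  | zero => exact continuousOn_const
  | succ n ih => exact ⟨continuousOn_const, fun j _ => ⟨fun _ => 0, ih 0, fun t _ =>
      hasDerivAt_const _ _⟩⟩

theorem add {f g : (ℕ → ℝ) → A} (hf : CubeSmooth N n f) (hg : CubeSmooth N n g) :
    CubeSmooth N n (fun t => f t + g t) := by
  induction n generalizing f g with
  | zero => exact ContinuousOn.add hf hg
  | succ n ih =>
    refine ⟨hf.1.add hg.1, fun j hj => ?_⟩
    obtain ⟨f', h1, h2⟩ := hf.2 j hj
    obtain ⟨g', h3, h4⟩ := hg.2 j hj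
    exact ⟨_, ih h1 h3, fun t ht => (h2 t ht).fun_add (h4 t ht)⟩

theorem bilin (L : A →L[ℝ] B →L[ℝ] C) {f : (ℕ → ℝ) → A} {g : (ℕ → ℝ) → B}
    (hf : CubeSmooth N n f) (hg : CubeSmooth N n g) : CubeSmooth N n (fun t => L (f t) (g t)) := by
  induction n generalizing f g with
  | zero => exact (L.continuous.comp_continuousOn hf).clm_apply hg
  | succ n ih =>
    refine ⟨(L.continuous.comp_continuousOn hf.1).clm_apply hg.1, fun j hj => ?_⟩
    obtain ⟨f', h1, h2⟩ := hf.2 j hj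
    obtain ⟨g', h3, h4⟩ := hg.2 j hj
    refine ⟨_, (ih h1 (of_succ hg)).add (ih (of_succ hf) h3), fun t ht => ?_⟩
    have := (L.hasFDerivAt.comp_hasDerivAt (t j) (h2 t ht)).clm_apply (h4 t ht)
    refine this.congr_deriv ?_
    simp

theorem cexp {f : (ℕ → ℝ) → ℂ} (hf : CubeSmooth N n f) :
    CubeSmooth N n (fun t => Complex.exp (f t)) := by
  induction n with
  | zero => exact Complex.continuous_exp.comp_continuousOn hf
  | succ n ih =>
    refine ⟨Complex.continuous_exp.comp_continuousOn hf.1, fun j hj => ?_⟩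
    obtain ⟨f', h1, h2⟩ := hf.2 j hj
    refine ⟨_, bilin (ContinuousLinearMap.mul ℝ ℂ) (ih (of_succ hf)) h1, fun t ht => ?_⟩
    refine (h2 t ht).cexp.congr_deriv ?_
    simp

/-- Iterated derivatives of a smooth function. -/
theorem exists_tower {f : (ℕ → ℝ) → ℂ} {p : ℕ} (e : Fin p → ℕ) (he : ∀ i, e i ≤ N)
    (hf : CubeSmooth N (n + p) f) : ∃ g, CubeSmooth N n g ∧ Tower f p e g ∧
      ∀ F : (ℕ → ℝ) → ℂ, (∀ t ∈ unitCube, F t = f t) → ∀ t ∈ unitCube,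
        (∀ i, t (e i) ∈ Set.Ioo (0 : ℝ) 1) →
        (List.ofFn e).foldr (fun j F t => deriv (fun u : ℝ => F (Function.update t j u)) (t j)) F t =
          g t := by
  induction p generalizing n with
  | zero => exact ⟨f, hf, Tower.zero _ hf.continuousOn, fun F hF t ht _ => by simpa using hF t ht⟩
  | succ p ih =>
    rw [← Fin.cons_self_tail e] at he ⊢
    generalize e 0 = j at he ⊢
    generalize Fin.tail e = e at he ⊢
    obtain ⟨g, hg, hT, hF⟩ := ih (n := n + 1) e (fun i => by simpa using he i.succ)
      (by rwa [add_assoc, add_comm 1 p])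
    obtain ⟨g', h1, h2⟩ := hg.2 j (by simpa using he 0)
    refine ⟨g', h1, hT.succ (fun t ht _ => h2 t ht) h1.continuousOn, fun F hFf t ht hte => ?_⟩
    have htj : t j ∈ Set.Ioo (0 : ℝ) 1 := by simpa using hte 0
    rw [List.ofFn_succ, List.foldr_cons]
    simp only [Fin.cons_zero, Fin.cons_succ]
    -- `F` is known only on the cube; as `t j` is interior, this covers all nearby values of the
    -- parameter, which determines the derivative.
    refine Filter.EventuallyEq.deriv_eq (f := fun u => g (Function.update t j u)) ?_ |>.trans
      (h2 t ht).deriv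
    filter_upwards [Ioo_mem_nhds htj.1 htj.2] with u hu
    refine hF F hFf _ (update_mem_unitCube ht j (Set.Ioo_subset_Icc_self hu)) fun i => ?_
    by_cases hi : e i = j
    · rw [hi, Function.update_self]; exact hu
    · rw [Function.update_of_ne hi]
      simpa using hte i.succ

end CubeSmooth

/-! ### Pathwise smoothness of the interaction in the parameters -/

namespace Features

open TraceSpace

variable {Φ : Model} {H : Type*} [NormedAddCommGroup H] [InnerProductSpace ℂ H] [CompleteSpace H]
  (F : Features Φ H) {z : ℂ} {δ : ℝ} (hδ : 0 < δ) (hz : ∀ r : ℝ, δ ≤ ‖1 + z * (r : ℂ)‖)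

include hδ hz

/-- The derivative is a product of resolvents and constant operators, so smoothness of one order
yields the next. -/
theorem cubeSmooth_res (X : TraceSpace H) (n : ℕ) :
    CubeSmooth Φ.jmax n (fun t => F.res z t X) := by
  have hc : ContinuousOn (fun t => F.res z t X) unitCube := fun t ht =>
    (F.continuousAt_res hδ (z := fun _ => z) (t := fun t => t) (X := fun _ => X) hz ht
      continuousAt_const continuousAt_id continuousAt_const).continuousWithinAt
  induction n with
  | zero => exact hc
  | succ n ih =>
    refine ⟨hc, fun j hj => ⟨_, ?_, fun t ht => F.hasDerivAt_res_update hδ hz ht hj X⟩⟩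
    have h1 := CubeSmooth.bilin (ContinuousLinearMap.mul ℝ (H →L[ℂ] H)) ih
      (CubeSmooth.const (-(z • (F.proj j * op H X))))
    have h2 := CubeSmooth.bilin (ContinuousLinearMap.mul ℝ (H →L[ℂ] H)) h1 ih
    refine (congrArg (CubeSmooth Φ.jmax n) (funext fun t => ?_)).mp h2
    simp only [ContinuousLinearMap.mul_apply']
    simp only [mul_neg, neg_mul, mul_smul_comm, smul_mul_assoc, mul_assoc]

omit hδ hz in
theorem cubeSmooth_tad (n : ℕ) : CubeSmooth Φ.jmax n (fun t => (tad Φ t : ℂ)) := by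
  have hc : ContinuousOn (fun t => (tad Φ t : ℂ)) unitCube :=
    (Complex.continuous_ofReal.comp (continuous_tad Φ)).continuousOn
  cases n with
  | zero => exact hc
  | succ n =>
    exact ⟨hc, fun j hj => ⟨fun _ => (sliceTad Φ j : ℂ), CubeSmooth.const _, fun t _ =>
      (hasDerivAt_tad_update hj t (t j)).ofReal_comp⟩⟩

theorem cubeSmooth_pot (X : TraceSpace H) (n : ℕ) :
    CubeSmooth Φ.jmax n (fun t => F.pot z t X) := by
  have hc : ContinuousOn (fun t => F.pot z t X) unitCube := fun t ht =>
    (F.continuousAt_pot hδ (z := fun _ => z) (t := fun t => t) (X := fun _ => X) hz ht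
      continuousAt_const continuousAt_id continuousAt_const).continuousWithinAt
  cases n with
  | zero => exact hc
  | succ n =>
    refine ⟨hc, fun j hj => ⟨_, ?_, fun t ht => F.hasDerivAt_pot_update hδ hz ht hj X⟩⟩
    have h1 := CubeSmooth.bilin (ContinuousLinearMap.mul ℝ ℂ) (CubeSmooth.const
      (-(3 / 2) * z ^ 2)) (CubeSmooth.bilin (ContinuousLinearMap.mul ℝ ℂ)
        (cubeSmooth_tad (Φ := Φ) n) (CubeSmooth.const (sliceTad Φ j : ℂ)))
    have h2 := CubeSmooth.bilin (ContinuousLinearMap.mul ℝ (H →L[ℂ] H))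
      ((F.cubeSmooth_res hδ hz X n).add (CubeSmooth.const (-1))) (CubeSmooth.const (F.proj j))
    have h3 := CubeSmooth.bilin (ContinuousLinearMap.apply ℝ ℂ).flip
      (CubeSmooth.const (trReal H X)) h2
    have h4 := (h1.add (CubeSmooth.const (z * tr H X (F.proj j)))).add
      (CubeSmooth.bilin (ContinuousLinearMap.mul ℝ ℂ) (CubeSmooth.const (-(1 / 2) * z)) h3)
    refine (congrArg (CubeSmooth Φ.jmax n) (funext fun t => ?_)).mp h4
    simp only [ContinuousLinearMap.mul_apply', ContinuousLinearMap.flip_apply,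
      ContinuousLinearMap.apply_apply, trReal_apply]
    rw [sub_eq_add_neg (F.res z t X)]
    ring

end Features

/-! ### White noise limits -/

/-- For real r, the conjugate of z times 1 + zr has imaginary part -Im z, independent of r; this
gives δ = |Im z|/|z|. -/
theorem exists_coercive_of_im_ne_zero {z : ℂ} (hz : z.im ≠ 0) :
    ∃ δ : ℝ, 0 < δ ∧ ∀ r : ℝ, δ ≤ ‖1 + z * (r : ℂ)‖ := by
  have hz0 : 0 < ‖z‖ := norm_pos_iff.2 fun h => hz (by simp [h])
  refine ⟨|z.im| / ‖z‖, by positivity, fun r => ?_⟩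
  rw [div_le_iff₀ hz0]
  have h := Complex.abs_im_le_norm ((starRingEnd ℂ) z * (1 + z * (r : ℂ)))
  rw [norm_mul, Complex.norm_conj] at h
  rw [mul_comm ‖1 + z * (r : ℂ)‖]
  refine le_trans (le_of_eq ?_) h
  rw [← abs_neg]
  congr 1
  simp [Complex.mul_im]
  ring

theorem zeta_im {lam : ℂ} (h0 : lam ≠ 0) : (zeta lam).im =
    2 * (Real.exp (Complex.log lam * (1 / 2)).re * Real.cos (lam.arg / 2)) := by
  have h1 : (zeta lam).im = 2 * (lam ^ (1 / 2 : ℂ)).re := by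
    simp [zeta, Complex.mul_im]
  have e : (Complex.log lam * (1 / 2)).im = lam.arg / 2 := by
    have : Complex.log lam * (1 / 2) = Complex.log lam / ((2 : ℝ) : ℂ) := by
      push_cast; ring
    rw [this, Complex.div_ofReal_im, Complex.log_im]
  rw [h1, Complex.cpow_def_of_ne_zero h0, Complex.exp_re, e]

/-- When arg λ ≠ π, half the argument lies strictly between -π/2 and π/2, so Im 2i√λ = 2|λ|^{1/2}
cos(arg λ/2) is positive for λ ≠ 0. As `arg 0 = 0`, the value λ = 0 is included; there the coupling
vanishes and δ = 1. -/
theorem exists_coercive {lam : ℂ} (h : lam.arg ≠ Real.pi) :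
    ∃ δ : ℝ, 0 < δ ∧ ∀ r : ℝ, δ ≤ ‖1 + zeta lam * (r : ℂ)‖ := by
  by_cases h0 : lam = 0
  · refine ⟨1, one_pos, fun r => ?_⟩
    have : zeta lam = 0 := by
      rw [← sq_eq_zero_iff, zeta_sq, h0, mul_zero]
    simp [this]
  · refine exists_coercive_of_im_ne_zero ?_
    rw [zeta_im h0]
    have h2 := Complex.neg_pi_lt_arg lam
    have h3 := lt_of_le_of_ne (Complex.arg_le_pi lam) h
    have h4 : 0 < Real.cos (lam.arg / 2) :=
      Real.cos_pos_of_mem_Ioo ⟨by linarith, by linarith⟩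
    positivity

namespace Features

open TraceSpace

variable {Φ : Model} {H : Type*} [NormedAddCommGroup H] [InnerProductSpace ℂ H] [CompleteSpace H]
  (F : Features Φ H)

section Limits

variable {lam : ℂ} {δ : ℝ} (hδ : 0 < δ) (hz : ∀ r : ℝ, δ ≤ ‖1 + zeta lam * (r : ℂ)‖)
  {Ω : Type*} {W : L2 → Ω → ℝ} {ω : Ω}
  (hω : Tendsto (fun n => F.state (noise W n ω)) atTop (𝓝 (F.field W ω))) {t : ℕ → ℝ}
  (ht : t ∈ unitCube)

include hδ hz hω ht

theorem tendsto_action : Tendsto (fun n => action Φ lam t (noise W n ω)) atTop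
    (𝓝 (F.pot (zeta lam) t (F.field W ω))) := by
  simp only [F.action_eq hδ hz ht]
  have h : ContinuousAt (fun X => F.pot (zeta lam) t X) (F.field W ω) :=
    F.continuousAt_pot hδ (z := fun _ => zeta lam) (t := fun _ => t) (X := fun X => X) hz ht
      continuousAt_const continuousAt_const continuousAt_id
  exact h.tendsto.comp hω

theorem V_eq : V Φ lam W t ω = F.pot (zeta lam) t (F.field W ω) :=
  (F.tendsto_action hδ hz hω ht).limUnder_eq

theorem tendsto_res : Tendsto (fun n => F.res (zeta lam) t (F.state (noise W n ω))) atTop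
    (𝓝 (F.res (zeta lam) t (F.field W ω))) := by
  have h : ContinuousAt (fun X => F.res (zeta lam) t X) (F.field W ω) :=
    F.continuousAt_res hδ (z := fun _ => zeta lam) (t := fun _ => t) (X := fun X => X) hz ht
      continuousAt_const continuousAt_const continuousAt_id
  exact h.tendsto.comp hω

theorem tendsto_RK {K : C(Sq × Sq, ℝ)} {B : H →L[ℂ] H}
    (hK : ∀ x y, inner ℂ (F.feat x) (B (F.feat y)) = ((K (x, y) : ℝ) : ℂ)) (x y : Sq) :
    Tendsto (fun n => RK (zeta lam) (cov Φ t) (noise W n ω) K x y) atTop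
      (𝓝 (F.ker (zeta lam) t (F.field W ω) 0 B x y)) := by
  simp only [F.RK_eq (F.isUnit_res hδ hz ht _) hK, ker_zero]
  exact ((F.elt x y).continuous.tendsto _).comp
    ((F.tendsto_res hδ hz hω ht).mul_const B)

theorem tendsto_RsubK {K : C(Sq × Sq, ℝ)} {B : H →L[ℂ] H}
    (hK : ∀ x y, inner ℂ (F.feat x) (B (F.feat y)) = ((K (x, y) : ℝ) : ℂ)) (x y : Sq) :
    Tendsto (fun n => RsubK (zeta lam) (cov Φ t) (noise W n ω) K x y) atTop
      (𝓝 (F.ker (zeta lam) t (F.field W ω) 1 B x y)) := by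
  simp only [F.RsubK_eq (F.isUnit_res hδ hz ht _) hK, ker_one]
  exact ((F.elt x y).continuous.tendsto _).comp
    (((F.tendsto_res hδ hz hω ht).sub_const 1).mul_const B)

omit hδ hz hω ht in
theorem inner_lineOp {p n : ℕ} (G : ResolventGraph p n) {e : Fin p → ℕ} (he : ∀ i, e i ≤ Φ.jmax)
    (t : ℕ → ℝ) (l : Fin n × Bool) (x y : Sq) :
    inner ℂ (F.feat x) (F.lineOp G e t l (F.feat y)) =
      ((G.lineCov (cov Φ t) (fun i => sliceCov Φ (e i)) l (x, y) : ℝ) : ℂ) := by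
  change _ = ((G.lineVal (cov Φ t) (fun i => sliceCov Φ (e i)) l (x, y) : ℝ) : ℂ)
  by_cases h : ∃ i, G.mark i = l
  · obtain ⟨i, rfl⟩ := h
    rw [lineOp, G.lineVal_mark, G.lineVal_mark, F.inner_feat_proj (he i)]
  · push Not at h
    rw [lineOp, G.lineVal_of_notMem _ _ h, G.lineVal_of_notMem _ _ h, inner_feat_interp]

theorem renAmplitude_eq {J : Finset ℕ} (hJ : J ⊆ Finset.range (Φ.jmax + 1)) {n : ℕ}
    (G : ResolventGraph J.card n) : renAmplitude Φ lam W J G t ω =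
      (-lam) ^ n * ∫ x, F.graphVal (zeta lam) G (J.orderEmbOfFin rfl) t x (F.field W ω) := by
  rw [renAmplitude, ResolventGraph.integrate]
  congr 2
  funext x
  refine Finset.prod_congr rfl fun l _ => ?_
  have hK := F.inner_lineOp G (e := J.orderEmbOfFin rfl) (fun i => Nat.lt_succ_iff.1
    (Finset.mem_range.1 (hJ (Finset.orderEmbOfFin_mem J rfl i)))) t l
  simp only
  by_cases h : G.IsTadpole l
  · rw [if_pos h, ResolventGraph.tau, if_pos h]
    exact (F.tendsto_RsubK hδ hz hω ht hK _ _).limUnder_eq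
  · rw [if_neg h, ResolventGraph.tau, if_neg h]
    exact (F.tendsto_RK hδ hz hω ht hK _ _).limUnder_eq

end Limits

/-- Only finitely many parameters matter. The telescoped sum ends at the indicator of the slices,
whereas the partition function is taken at the constant parameter 1. -/
theorem pot_congr {z : ℂ} {s t : ℕ → ℝ} (h : ∀ j ≤ Φ.jmax, s j = t j) (X : TraceSpace H) :
    F.pot z s X = F.pot z t X := by
  have h1 : F.interp s = F.interp t := Finset.sum_congr rfl fun j hj => by
    rw [h j (Nat.lt_succ_iff.1 (Finset.mem_range.1 hj))]
  have h2 : tad Φ s = tad Φ t := Finset.sum_congr rfl fun j hj => by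
    rw [h j (Nat.lt_succ_iff.1 (Finset.mem_range.1 hj))]
  rw [pot, pot, h1, h2]

end Features

theorem Dominated.integral {T S E : Type*} [TopologicalSpace T] [FirstCountableTopology T]
    [TopologicalSpace S] [MeasurableSpace S] [BorelSpace S] [SecondCountableTopology S]
    [TopologicalSpace.PseudoMetrizableSpace S] {μ : Measure S}
    [IsProbabilityMeasure μ] [NormedAddCommGroup E] {f : (T × S) × E → ℂ} (hf : Dominated f) :
    Dominated fun q : T × E => ∫ x, f ((q.1, x), q.2) ∂μ := by
  obtain ⟨hc, C, hC, hb⟩ := hf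
  refine ⟨?_, C, hC, fun q => ?_⟩
  · rw [continuous_iff_continuousAt]
    intro q₀
    refine continuousAt_of_dominated (bound := fun _ => C * Real.exp (C * (‖q₀.2‖ + 1)))
      (Eventually.of_forall fun q =>
        (hc.comp (by fun_prop : Continuous fun x => ((q.1, x), q.2))).aestronglyMeasurable)
      ?_ (integrable_const _) (Eventually.of_forall fun x =>
        (hc.comp (by fun_prop : Continuous fun q : T × E => ((q.1, x), q.2))).continuousAt)
    have h1 : ∀ᶠ q : T × E in 𝓝 q₀, ‖q.2‖ < ‖q₀.2‖ + 1 :=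
      (continuous_snd.norm.continuousAt (x := q₀)).eventually_lt continuousAt_const (by simp)
    filter_upwards [h1] with q hq
    refine Eventually.of_forall fun x => (hb _).trans ?_
    simp only
    gcongr
  · refine (norm_integral_le_of_norm_le (integrable_const (C * Real.exp (C * ‖q.2‖)))
      (Eventually.of_forall fun x => hb _)).trans ?_
    simp

/-! ### Assembling the expansion -/

namespace Features

open TraceSpace

variable {Φ : Model} {H : Type*} [NormedAddCommGroup H] [InnerProductSpace ℂ H] [CompleteSpace H]
  (F : Features Φ H)

theorem tower_expSum {Ω : Type*} [MeasurableSpace Ω] {P : Measure Ω} {W : L2 → Ω → ℝ}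
    (hW : IsWhiteNoise P W) {z : ℂ} {δ : ℝ} (hδ : 0 < δ)
    (hz : ∀ r : ℝ, δ ≤ ‖1 + z * (r : ℂ)‖) {p : ℕ} (e : Fin p → ℕ) (he : ∀ i, e i ≤ Φ.jmax) :
    Tower (F.expSum P W z Fin.elim0) p e (F.expSum P W z e) := by
  have hc : ∀ {p : ℕ} (e : Fin p → ℕ), ContinuousOn (F.expSum P W z e) unitCube := fun e =>
    continuousOn_iff_continuous_restrict.2 (F.continuous_expSum hδ hz hW e)
  induction p with
  | zero =>
    rw [Subsingleton.elim e Fin.elim0]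
    exact Tower.zero _ (hc _)
  | succ p ih =>
    rw [← Fin.cons_self_tail e]
    exact (ih (Fin.tail e) fun i => he i.succ).succ
      (fun t ht htj => F.hasDerivAt_expSum hδ hz hW ht (he 0) htj _) (hc _)

theorem ofFn_orderEmbOfFin (J : Finset ℕ) :
    List.ofFn (J.orderEmbOfFin rfl) = J.sort (· ≤ ·) := by
  rw [List.ofFn_eq_map]
  exact J.listMap_orderEmbOfFin_finRange rfl

theorem zero_mem_unitCube : (0 : ℕ → ℝ) ∈ unitCube := fun _ => by simp

theorem one_mem_unitCube : (1 : ℕ → ℝ) ∈ unitCube := fun _ => by simp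

theorem dominated_integral_graphVal {z : ℂ} {δ : ℝ} (hδ : 0 < δ)
    (hz : ∀ r : ℝ, δ ≤ ‖1 + z * (r : ℂ)‖) {T : Type*} [TopologicalSpace T]
    [FirstCountableTopology T] {s : T → ℕ → ℝ} (hs : Continuous s) (hs' : ∀ q, s q ∈ unitCube)
    {p n : ℕ} (G : ResolventGraph p n) (e : Fin p → ℕ) (c : ℂ) :
    Dominated (fun q : T × TraceSpace H => Complex.exp (F.pot z (s q.1) q.2) *
      (c * ∫ x, F.graphVal z G e (s q.1) x q.2)) := by
  have d1 : Dominated (fun q : (T × (Fin n → Sq)) × TraceSpace H =>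
      F.graphVal z G e (s q.1.1) q.1.2 q.2) :=
    F.dominated_graphVal G e hδ hz (s := fun q : T × (Fin n → Sq) => s q.1)
      (hs.comp continuous_fst) (fun q => hs' q.1) (x := fun q => q.2) continuous_snd
  exact (F.dominated_exp_pot hδ hz hs hs').mul ((Dominated.const c).mul
    (Dominated.integral (μ := (volume : Measure (Fin n → Sq))) d1))

section Expansion

variable {lam : ℂ} {δ : ℝ} (hδ : 0 < δ) (hz : ∀ r : ℝ, δ ≤ ‖1 + zeta lam * (r : ℂ)‖)
  {Ω : Type*} [MeasurableSpace Ω] {P : Measure Ω} {W : L2 → Ω → ℝ} (hW : IsWhiteNoise P W)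

include F hδ hz hW

/-- The only probabilistic input is convergence of the states; continuity in the field then settles
all parameters, slices and points on the same event. -/
theorem limitsExist : LimitsExist Φ lam W P := by
  filter_upwards [F.ae_tendsto_state_noise hW] with ω hω t ht
  exact ⟨⟨_, F.tendsto_action hδ hz hω ht⟩, fun j hj x y =>
    ⟨_, F.tendsto_RK hδ hz hω ht (fun x y => F.inner_feat_proj hj x y) x y⟩⟩

theorem ae_V_eq : ∀ᵐ ω ∂P, ∀ t ∈ unitCube, V Φ lam W t ω = F.pot (zeta lam) t (F.field W ω) := by
  filter_upwards [F.ae_tendsto_state_noise hW] with ω hω t ht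
  exact F.V_eq hδ hz hω ht

theorem integrable_exp_pot {t : ℕ → ℝ} (ht : t ∈ unitCube) :
    Integrable (fun ω => Complex.exp (F.pot (zeta lam) t (F.field W ω))) P :=
  F.integrable_tame hW (F.tameC1_exp_pot hδ hz ht)

theorem integrable_exp_V {t : ℕ → ℝ} (ht : t ∈ unitCube) :
    Integrable (fun ω => Complex.exp (V Φ lam W t ω)) P := by
  refine (F.integrable_exp_pot hδ hz hW ht).congr ?_
  filter_upwards [F.ae_V_eq hδ hz hW] with ω h
  rw [h t ht]

theorem Zsigma_eq : Zsigma Φ lam W P =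
    ∫ ω, Complex.exp (F.pot (zeta lam) 1 (F.field W ω)) ∂P := by
  refine integral_congr_ae ?_
  filter_upwards [F.ae_V_eq hδ hz hW] with ω h
  rw [h 1 one_mem_unitCube]

section Subset

variable {J : Finset ℕ} (hJ : J ⊆ Finset.range (Φ.jmax + 1))

include hJ

omit F hδ hz hW in
theorem orderEmb_le (i : Fin J.card) : J.orderEmbOfFin rfl i ≤ Φ.jmax :=
  Nat.lt_succ_iff.1 (Finset.mem_range.1 (hJ (Finset.orderEmbOfFin_mem J rfl i)))

theorem ae_graphIntegrand_eq {n : ℕ} (G : ResolventGraph J.card n) :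
    ∀ᵐ ω ∂P, ∀ b ∈ cube J, graphIntegrand Φ lam W J ⟨n, G⟩ ω b =
      Complex.exp (F.pot (zeta lam) (onlyIn J b) (F.field W ω)) * ((-lam) ^ n *
        ∫ x, F.graphVal (zeta lam) G (J.orderEmbOfFin rfl) (onlyIn J b) x (F.field W ω)) := by
  filter_upwards [F.ae_tendsto_state_noise hW] with ω hω b hb
  have ht : onlyIn J b ∈ unitCube :=
    extend_mem_unitCube (J.orderEmbOfFin rfl).injective zero_mem_unitCube hb
  rw [graphIntegrand, F.V_eq hδ hz hω ht, F.renAmplitude_eq hδ hz hω ht hJ]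

theorem integrable_graphIntegrand {n : ℕ} (G : ResolventGraph J.card n) :
    Integrable (fun q : Ω × (Fin J.card → ℝ) => graphIntegrand Φ lam W J ⟨n, G⟩ q.1 q.2)
      (P.prod (volume.restrict (cube J))) := by
  have hP := (IsCentredGaussian.gaussian hW).isProbabilityMeasure
  -- `Dominated` asks for bounds at all parameters. Clamping to [0,1] extends the family
  -- continuously without changing it on the cube.
  set clamp : (Fin J.card → ℝ) → Fin J.card → ℝ := fun b i => max 0 (min 1 (b i)) with hcl
  have hclc : Continuous clamp := by rw [hcl]; fun_prop
  have hclm : ∀ b, clamp b ∈ Set.Icc (0 : Fin J.card → ℝ) 1 := fun b =>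
    ⟨fun i => le_max_left _ _, fun i => max_le zero_le_one (min_le_left _ _)⟩
  have hcl1 : ∀ b ∈ cube J, clamp b = b := fun b hb => by
    funext i
    simp only [hcl]
    exact (congrArg (max 0) (min_eq_right (hb.2 i))).trans (max_eq_right (hb.1 i))
  have hinj := (J.orderEmbOfFin rfl).injective
  have hsc : Continuous fun b => onlyIn J (clamp b) := (continuous_extend hinj 0).comp hclc
  have hs' : ∀ b, onlyIn J (clamp b) ∈ unitCube := fun b =>
    extend_mem_unitCube hinj zero_mem_unitCube (hclm b)
  have d3 := F.dominated_integral_graphVal hδ hz hsc hs' G (J.orderEmbOfFin rfl) ((-lam) ^ n)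
  have hfin : IsFiniteMeasure ((volume : Measure (Fin J.card → ℝ)).restrict (cube J)) :=
    ⟨by rw [Measure.restrict_apply_univ]; exact isCompact_Icc.measure_lt_top⟩
  have i3 := F.integrable_dominated hW ((volume : Measure (Fin J.card → ℝ)).restrict (cube J)) d3
  refine i3.congr ?_
  have a1 := Measure.quasiMeasurePreserving_fst (ν := (volume : Measure (Fin J.card → ℝ)).restrict
    (cube J)) |>.ae (F.ae_graphIntegrand_eq hδ hz hW hJ G)
  have a2 := Measure.quasiMeasurePreserving_snd (μ := P) |>.ae
    (ae_restrict_mem (μ := (volume : Measure (Fin J.card → ℝ))) (s := cube J) measurableSet_Icc)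
  filter_upwards [a1, a2] with q h1 h2
  rw [h1 _ h2]
  simp only [hcl1 _ h2]

theorem graphTerm_eq (g : Σ n, ResolventGraph J.card n) : graphTerm Φ lam W P J g =
    ∫ b in cube J, F.graphInt P W (zeta lam) g.2 (J.orderEmbOfFin rfl) (onlyIn J b) := by
  have hP := (IsCentredGaussian.gaussian hW).isProbabilityMeasure
  obtain ⟨n, G⟩ := g
  rw [graphTerm, integral_integral_swap (F.integrable_graphIntegrand hδ hz hW hJ G)]
  refine setIntegral_congr_fun measurableSet_Icc fun b hb => ?_
  have ht : onlyIn J b ∈ unitCube :=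
    extend_mem_unitCube (J.orderEmbOfFin rfl).injective zero_mem_unitCube hb
  simp only [graphInt]
  rw [integral_prod _ (F.integrable_graphInt hδ hz hW ht G _), ← integral_const_mul]
  refine integral_congr_ae ?_
  filter_upwards [F.ae_graphIntegrand_eq hδ hz hW hJ G] with ω hω
  rw [hω b hb, integral_const_mul, zeta_sq]
  ring

/-- Here the derivatives act on the averaged quantity: `expSum` is the tower of derivatives of E
e^V, and its integral over the cube is an alternating sum. -/
theorem sum_graphTerm : ∑ g ∈ minimalGraphs J.card, (ResolventGraph.weight J.card g : ℂ) *
      graphTerm Φ lam W P J g =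
    testList (J.sort (· ≤ ·))
      (fun t => ∫ ω, Complex.exp (F.pot (zeta lam) t (F.field W ω)) ∂P) 0 := by
  have hinj := (J.orderEmbOfFin rfl).injective
  have h1 := (F.tower_expSum hW hδ hz (J.orderEmbOfFin rfl) (orderEmb_le hJ)).integral_eq
    hinj zero_mem_unitCube
  rw [ofFn_orderEmbOfFin] at h1
  have h2 : F.expSum P W (zeta lam) Fin.elim0 =
      fun t => ∫ ω, Complex.exp (F.pot (zeta lam) t (F.field W ω)) ∂P :=
    funext fun t => F.expSum_zero hδ hz hW _ t
  rw [h2] at h1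
  rw [← h1]
  simp only [expSum, ResolventGraph.sum_graphs, F.graphTerm_eq hδ hz hW hJ]
  rw [integral_finset_sum]
  · refine Finset.sum_congr rfl fun g _ => ?_
    rw [integral_const_mul]
    rfl
  · intro g _
    have hc : ContinuousOn (F.graphInt P W (zeta lam) g.2 (J.orderEmbOfFin rfl)) unitCube :=
      continuousOn_iff_continuous_restrict.2 (F.continuous_graphInt hδ hz hW g.2 _)
    exact (integrableOn_extend hinj zero_mem_unitCube hc).const_mul _

/-- Here the derivatives act for fixed noise, before averaging. The fundamental theorem of calculus
is applied path by path, and only the finite alternating sum has to be exchanged with the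
expectation. -/
theorem testingTerm_eq : testingTerm Φ lam W P J =
    testList (J.sort (· ≤ ·))
      (fun t => ∫ ω, Complex.exp (F.pot (zeta lam) t (F.field W ω)) ∂P) 0 := by
  have hinj := (J.orderEmbOfFin rfl).injective
  obtain ⟨-, h1⟩ := integral_testList
    (f := fun ω t => Complex.exp (F.pot (zeta lam) t (F.field W ω)))
    (fun t ht => F.integrable_exp_pot hδ hz hW ht) (J.sort (· ≤ ·)) zero_mem_unitCube
  rw [← h1, testingTerm]
  refine integral_congr_ae ?_
  filter_upwards [F.ae_V_eq hδ hz hW] with ω hω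
  -- The value of `deriv` is controlled only in the open cube; its boundary is a null set.
  have hae : Set.univ.pi (fun _ : Fin J.card => Set.Ioo (0 : ℝ) 1) =ᵐ[volume] Set.Icc 0 1 :=
    Measure.univ_pi_Ioo_ae_eq_Icc (μ := fun _ => volume) (f := (0 : Fin J.card → ℝ)) (g := 1)
  obtain ⟨g, -, hT, hg⟩ := CubeSmooth.exists_tower (n := 0) (J.orderEmbOfFin rfl) (orderEmb_le hJ)
    ((F.cubeSmooth_pot hδ hz (F.field W ω) _).cexp)
  rw [← ofFn_orderEmbOfFin, ← hT.integral_eq hinj zero_mem_unitCube, cube,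
    ← setIntegral_congr_set hae, ← setIntegral_congr_set hae]
  refine setIntegral_congr_fun (MeasurableSet.univ_pi fun _ => measurableSet_Ioo) fun b hb => ?_
  have hb' : ∀ i, b i ∈ Set.Ioo (0 : ℝ) 1 := fun i => hb i (Set.mem_univ i)
  have hmem : onlyIn J b ∈ unitCube := extend_mem_unitCube hinj zero_mem_unitCube
    ⟨fun i => (hb' i).1.le, fun i => (hb' i).2.le⟩
  have := hg (fun t' => Complex.exp (V Φ lam W t' ω)) (fun t ht => by rw [hω t ht]) _ hmem
    fun i => by rw [onlyIn, hinj.extend_apply]; exact hb' i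
  rw [ofFn_orderEmbOfFin] at this
  exact this

theorem testingTerm_eq_sum : testingTerm Φ lam W P J =
    ∑ g ∈ minimalGraphs J.card, (ResolventGraph.weight J.card g : ℂ) *
      graphTerm Φ lam W P J g := by
  rw [F.sum_graphTerm hδ hz hW hJ, F.testingTerm_eq hδ hz hW hJ]

end Subset

theorem Zsigma_eq_sum : Zsigma Φ lam W P =
    ∑ J ∈ (Finset.range (Φ.jmax + 1)).powerset, ∑ g ∈ minimalGraphs J.card,
      (ResolventGraph.weight J.card g : ℂ) * graphTerm Φ lam W P J g := by
  rw [Finset.sum_congr rfl fun J hJ => F.sum_graphTerm hδ hz hW (Finset.mem_powerset.1 hJ),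
    sum_testList _ _ (0 : ℕ → ℝ) fun _ _ => rfl, F.Zsigma_eq hδ hz hW]
  congr 1
  funext ω
  rw [F.pot_congr fun j hj => ?_]
  simp [Nat.lt_succ_of_le hj]

end Expansion

end Features

/-! ### Gaussian integrals of imaginary quadratic exponentials -/

namespace TameC1

variable {E F : Type*} [NormedAddCommGroup E] [NormedSpace ℝ E] [NormedAddCommGroup F]
  [NormedSpace ℝ F]

theorem clm (L : E →L[ℝ] F) : TameC1 (fun x => L x) := by
  refine of_bounds (A := ‖L‖) (a := 1) (B := ‖L‖) (b := 0) L.contDiff (fun x => ?_) fun x => ?_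
  · refine (L.le_opNorm x).trans ?_
    gcongr
    linarith [Real.add_one_le_exp (1 * ‖x‖)]
  · rw [L.fderiv]; simp

theorem cexp_of_re_nonpos {f : E → ℂ} (hf : TameC1 f) (h0 : ∀ x, (f x).re ≤ 0) :
    TameC1 (fun x => Complex.exp (f x)) := by
  obtain ⟨f1, C, hC, hfb⟩ := hf
  have hexp : ∀ x, ‖Complex.exp (f x)‖ ≤ 1 := fun x => by
    rw [Complex.norm_exp]
    exact Real.exp_le_one_iff.2 (h0 x)
  refine of_bounds (A := 1) (a := 0) (B := C) (b := C) f1.cexp (fun x => by simpa using hexp x)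
    fun x => ?_
  rw [((f1.differentiable one_ne_zero x).hasFDerivAt.cexp).fderiv, norm_smul]
  calc _ ≤ 1 * (C * Real.exp (C * ‖x‖)) :=
        mul_le_mul (hexp x) (hfb x).2 (norm_nonneg _) zero_le_one
    _ = _ := one_mul _

end TameC1

namespace IsCentredGaussian

variable {κ Ω : Type*} [Fintype κ] [MeasurableSpace Ω] {P : Measure Ω} {X : κ → Ω → ℝ}
  {K : κ → κ → ℝ} (hX : IsCentredGaussian P X K) (s : κ → ℝ) {w : ℂ} (hw : w.re = 0)

include hX hw

/-- Integration by parts against an imaginary quadratic exponential. -/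
theorem integral_mul_mul_exp_quadratic (a b : κ) :
    ∫ ω, (X a ω : ℂ) * ((X b ω : ℂ) *
        Complex.exp (-(w / 2) * ((∑ k, s k * X k ω ^ 2 : ℝ) : ℂ))) ∂P =
      (K a b : ℂ) * ∫ ω, Complex.exp (-(w / 2) * ((∑ k, s k * X k ω ^ 2 : ℝ) : ℂ)) ∂P -
      w * ∑ k, (K a k : ℂ) * s k * ∫ ω, (X k ω : ℂ) * ((X b ω : ℂ) *
        Complex.exp (-(w / 2) * ((∑ k, s k * X k ω ^ 2 : ℝ) : ℂ))) ∂P := by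
  classical
  have := hX.gaussian.isProbabilityMeasure
  have hm : ∀ i, AEMeasurable (X i) P := hX.gaussian.aemeasurable
  have hcoord : ∀ k, TameC1 (fun y : κ → ℝ => ((y k : ℝ) : ℂ)) := fun k =>
    TameC1.clm (Complex.ofRealCLM.comp
      (ContinuousLinearMap.proj (R := ℝ) (φ := fun _ : κ => ℝ) k))
  have hre : ∀ r : ℝ, (-(w / 2) * (r : ℂ)).re = 0 := fun r => by
    simp [Complex.mul_re, hw]
  have hnorm : ∀ r : ℝ, ‖Complex.exp (-(w / 2) * (r : ℂ))‖ = 1 := fun r => by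
    rw [Complex.norm_exp, hre, Real.exp_zero]
  have hquad : TameC1 (fun y : κ → ℝ => -(w / 2) * ((∑ k, s k * y k ^ 2 : ℝ) : ℂ)) := by
    have h := (TameC1.const (E := κ → ℝ) (-(w / 2))).mul (TameC1.sum Finset.univ fun k =>
      (TameC1.const (E := κ → ℝ) (s k : ℂ)).mul ((hcoord k).mul (hcoord k)))
    convert h using 3 with y
    push_cast
    exact Finset.sum_congr rfl fun k _ => by ring
  have hf : TameC1 (fun y : κ → ℝ => ((y b : ℝ) : ℂ) *
      Complex.exp (-(w / 2) * ((∑ k, s k * y k ^ 2 : ℝ) : ℂ))) :=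
    (hcoord b).mul (hquad.cexp_of_re_nonpos fun y => (hre _).le)
  have hder : ∀ y v : κ → ℝ, fderiv ℝ (fun y : κ → ℝ => ((y b : ℝ) : ℂ) *
      Complex.exp (-(w / 2) * ((∑ k, s k * y k ^ 2 : ℝ) : ℂ))) y v =
      (v b : ℂ) * Complex.exp (-(w / 2) * ((∑ k, s k * y k ^ 2 : ℝ) : ℂ)) -
        w * ∑ k, (v k : ℂ) * s k * ((y k : ℂ) * ((y b : ℂ) *
          Complex.exp (-(w / 2) * ((∑ k, s k * y k ^ 2 : ℝ) : ℂ)))) := by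
    intro y v
    have hl : HasDerivAt (fun ε : ℝ => y + ε • v) v 0 := by
      simpa using ((hasDerivAt_id (0 : ℝ)).smul_const v).const_add y
    have e0 : y + (0 : ℝ) • v = y := by simp
    have h1 := ((hf.contDiff.differentiable one_ne_zero) (y + (0 : ℝ) • v)).hasFDerivAt.comp_hasDerivAt
      (0 : ℝ) hl
    have hc : ∀ k, HasDerivAt (fun ε : ℝ => (((y + ε • v) k : ℝ) : ℂ)) (v k : ℂ) 0 := fun k => by
      simpa using (hasDerivAt_pi.1 hl k).ofReal_comp
    have hq : HasDerivAt (fun ε : ℝ => -(w / 2) * ((∑ k, s k * (y + ε • v) k ^ 2 : ℝ) : ℂ))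
        (-w * ∑ k, (v k : ℂ) * s k * y k) 0 := by
      have h := (HasDerivAt.fun_sum fun k (_ : k ∈ Finset.univ) =>
        (((hc k).fun_mul (hc k)).const_mul (s k : ℂ))).const_mul (-(w / 2))
      refine (h.congr_deriv ?_).congr_of_eventuallyEq (Eventually.of_forall fun ε => ?_)
      · simp only [e0, Finset.mul_sum]
        exact Finset.sum_congr rfl fun k _ => by ring
      · push_cast
        simp only [Finset.mul_sum]
        exact Finset.sum_congr rfl fun k _ => by ring
    have h2 := (hc b).fun_mul hq.cexp
    have h3 := h1.unique h2
    rw [e0] at h3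
    rw [h3]
    rw [sub_eq_add_neg]
    congr 1
    simp only [Finset.mul_sum]
    rw [← Finset.sum_neg_distrib]
    exact Finset.sum_congr rfl fun k _ => by ring
  have hsum : ∀ v : κ → ℝ, ∑ i, v i • (Pi.single i 1 : κ → ℝ) = v := fun v => by
    ext i
    simp [Finset.sum_apply, Pi.single_apply]
  have hibp := hX.integral_mul_finset hf a Finset.univ fun i => (Pi.single i 1 : κ → ℝ)
  simp only [hsum, hder] at hibp
  have hi : ∀ k, Integrable (fun ω => (X k ω : ℂ) * ((X b ω : ℂ) *
      Complex.exp (-(w / 2) * ((∑ k, s k * X k ω ^ 2 : ℝ) : ℂ)))) P := fun k => by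
    have h := (hX.integrable_mul k b).norm
    refine h.mono' (by fun_prop) (Eventually.of_forall fun ω => ?_)
    rw [norm_mul, norm_mul, hnorm, mul_one, Complex.norm_real, Complex.norm_real, ← norm_mul]
  have hi0 : Integrable (fun ω => Complex.exp (-(w / 2) * ((∑ k, s k * X k ω ^ 2 : ℝ) : ℂ))) P :=
    (integrable_const (1 : ℝ)).mono' (by fun_prop) (Eventually.of_forall fun ω => (hnorm _).le)
  rw [hibp, integral_sub (hi0.const_mul _)
    ((integrable_finset_sum _ fun k _ => (hi k).const_mul _).const_mul _), integral_const_mul,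
    integral_const_mul, integral_finset_sum _ fun k _ => (hi k).const_mul _]
  simp only [integral_const_mul]

end IsCentredGaussian

namespace Features

open TraceSpace

variable {Φ : Model} {H : Type*} [NormedAddCommGroup H] [InnerProductSpace ℂ H] [CompleteSpace H]
  (F : Features Φ H) {κ : Type*} [Fintype κ] (x : κ → Sq) (s : κ → ℝ)

theorem op_sum_dirac_apply (v : H) : op H (∑ k, s k • F.dirac (x k)) v =
    ∑ k, ((s k : ℂ) * inner ℂ (F.feat (x k)) v) • F.feat (x k) := by
  simp only [map_sum, map_smul, ContinuousLinearMap.sum_apply, smul_apply, op_dirac]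
  exact Finset.sum_congr rfl fun k _ => by rw [mul_smul]; rfl

theorem tr_sum_dirac (B : H →L[ℂ] H) : tr H (∑ k, s k • F.dirac (x k)) B =
    ∑ k, (s k : ℂ) * inner ℂ (F.feat (x k)) (B (F.feat (x k))) := by
  simp only [map_sum, map_smul, ContinuousLinearMap.sum_apply, smul_apply, tr_dirac]
  rfl

variable {w : ℂ} {δ : ℝ} (hδ : 0 < δ) (hw : ∀ r : ℝ, δ ≤ ‖1 + w * (r : ℂ)‖)

include F hδ hw

/-- The system `(1 + w C s) v = 0` has only the trivial solution. -/
theorem eq_zero_of_covariance_system {v : κ → ℂ}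
    (hv : ∀ k, v k + w * ∑ l, (cov Φ 1 (x k, x l) : ℂ) * s l * v l = 0) (k : κ) : v k = 0 := by
  set f : H := ∑ l, ((s l : ℂ) * v l) • F.feat (x l) with hf
  have hin : ∀ k, inner ℂ (F.feat (x k)) (F.interp 1 f) =
      ∑ l, (cov Φ 1 (x k, x l) : ℂ) * s l * v l := fun k => by
    rw [hf, map_sum, inner_sum]
    refine Finset.sum_congr rfl fun l _ => ?_
    rw [map_smul, inner_smul_right, inner_feat_interp]
    ring
  -- The system says that `F.interp 1 f` is annihilated by 1 + wDS, with D = `F.interp 1` and S the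
  -- operator of the Dirac masses. This operator is invertible, and `v` is recovered from `F.interp
  -- 1 f`.
  have h0 : (1 + (w • F.interp 1) * op H (∑ k, s k • F.dirac (x k))) (F.interp 1 f) = 0 := by
    simp only [add_apply, one_apply_eq_self, mul_apply_eq_comp, smul_apply,
      F.op_sum_dirac_apply x s, hin]
    rw [← map_smul, ← map_add, Finset.smul_sum, hf, ← Finset.sum_add_distrib]
    convert map_zero (F.interp 1)
    refine Finset.sum_eq_zero fun l _ => ?_
    rw [smul_smul, ← add_smul]
    convert zero_smul ℂ _
    linear_combination (s l : ℂ) * hv l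
  obtain ⟨u, hu⟩ := F.isUnit_res hδ hw one_mem_unitCube (∑ k, s k • F.dirac (x k))
  have h1 : F.interp 1 f = 0 := by
    have h2 := congrArg (fun B : H →L[ℂ] H => B (F.interp 1 f)) u.inv_mul
    simp only [mul_apply_eq_comp, hu, h0, map_zero, one_apply_eq_self] at h2
    exact h2.symm
  have h3 := hv k
  rw [← hin, h1, inner_zero_right, mul_zero, add_zero] at h3
  exact h3

/-- The resolvent equation RD + wDSRD = D between feature vectors; the Dirac masses turn S into a
finite sum. -/
theorem ker_sum_dirac (a b : κ) :
    F.ker w 1 (∑ k, s k • F.dirac (x k)) 0 (F.interp 1) (x a) (x b) +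
      w * ∑ l, (cov Φ 1 (x a, x l) : ℂ) * s l *
        F.ker w 1 (∑ k, s k • F.dirac (x k)) 0 (F.interp 1) (x l) (x b) =
      (cov Φ 1 (x a, x b) : ℂ) := by
  have hu := F.isUnit_res hδ hw one_mem_unitCube (∑ k, s k • F.dirac (x k))
  have h : F.res w 1 (∑ k, s k • F.dirac (x k)) * F.interp 1 +
      (w • F.interp 1) * op H (∑ k, s k • F.dirac (x k)) *
        (F.res w 1 (∑ k, s k • F.dirac (x k)) * F.interp 1) = F.interp 1 := by
    have h1 := Ring.mul_inverse_cancel _ hu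
    calc _ = (1 + (w • F.interp 1) * op H (∑ k, s k • F.dirac (x k))) *
          F.res w 1 (∑ k, s k • F.dirac (x k)) * F.interp 1 := by noncomm_ring
      _ = _ := by rw [res, invOneAdd, h1, one_mul]
  have h2 := congrArg (fun B : H →L[ℂ] H => inner ℂ (F.feat (x a)) (B (F.feat (x b)))) h
  simp only [inner_feat_interp, add_apply, inner_add_right] at h2
  rw [← h2, ker_zero]
  congr 1
  simp only [mul_apply_eq_comp, smul_apply, F.op_sum_dirac_apply x s]
  simp only [map_sum, map_smul, inner_smul_right, inner_sum, inner_feat_interp, ker_zero]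
  congr 1
  exact Finset.sum_congr rfl fun l _ => by rw [mul_apply_eq_comp]; ring

end Features

/-! ### Gaussian integrals as the interaction at Dirac masses -/

namespace Features

open TraceSpace

variable {Φ : Model} {H : Type*} [NormedAddCommGroup H] [InnerProductSpace ℂ H] [CompleteSpace H]
  (F : Features Φ H) {κ : Type*} [Fintype κ] (x : κ → Sq) (s : κ → ℝ)

theorem coercive_of_re_eq_zero {w : ℂ} (hw : w.re = 0) (r : ℝ) : 1 ≤ ‖1 + w * (r : ℂ)‖ := by
  refine le_trans ?_ (Complex.re_le_norm _)
  simp [Complex.mul_re, hw]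

theorem pot_coupling_zero (t : ℕ → ℝ) (X : TraceSpace H) : F.pot 0 t X = 0 := by
  simp [pot, avgRes]

variable {Ω : Type*} [MeasurableSpace Ω] {P : Measure Ω} {φ : Sq → Ω → ℝ}
  (hφ : IsCentredGaussian P φ fun x y => cov Φ 1 (x, y)) {w : ℂ} (hw : w.re = 0)

include hφ hw

/-- The two point function of a Gaussian field with an imaginary quadratic weight is the kernel
of the resolvent. -/
theorem integral_mul_mul_exp_quadratic_eq_ker (a b : κ) :
    ∫ ω, (φ (x a) ω : ℂ) * ((φ (x b) ω : ℂ) *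
        Complex.exp (-(w / 2) * ((∑ k, s k * φ (x k) ω ^ 2 : ℝ) : ℂ))) ∂P =
      F.ker w 1 (∑ k, s k • F.dirac (x k)) 0 (F.interp 1) (x a) (x b) *
        ∫ ω, Complex.exp (-(w / 2) * ((∑ k, s k * φ (x k) ω ^ 2 : ℝ) : ℂ)) ∂P := by
  have h1 := fun a => (hφ.comp x).integral_mul_mul_exp_quadratic s hw a b
  have h2 := fun a => F.ker_sum_dirac x s one_pos (coercive_of_re_eq_zero hw) a b
  set h := ∫ ω, Complex.exp (-(w / 2) * ((∑ k, s k * φ (x k) ω ^ 2 : ℝ) : ℂ)) ∂P with hh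
  set G : κ → ℂ := fun a => ∫ ω, (φ (x a) ω : ℂ) * ((φ (x b) ω : ℂ) *
    Complex.exp (-(w / 2) * ((∑ k, s k * φ (x k) ω ^ 2 : ℝ) : ℂ))) ∂P with hG
  -- For fixed `b`, the moments and the kernel times `h` both solve (1 + wCs)v = C(·,b)h. The
  -- homogeneous system has only the zero solution.
  have h3 := F.eq_zero_of_covariance_system x s one_pos (coercive_of_re_eq_zero hw)
    (v := fun a => G a - F.ker w 1 (∑ k, s k • F.dirac (x k)) 0 (F.interp 1) (x a) (x b) * h)
    (fun k => by
      have e1 : G k = _ := h1 k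
      have e : ∑ l, (cov Φ 1 (x k, x l) : ℂ) * s l * (G l -
          F.ker w 1 (∑ k, s k • F.dirac (x k)) 0 (F.interp 1) (x l) (x b) * h) =
          ∑ l, (cov Φ 1 (x k, x l) : ℂ) * s l * G l - (∑ l, (cov Φ 1 (x k, x l) : ℂ) * s l *
            F.ker w 1 (∑ k, s k • F.dirac (x k)) 0 (F.interp 1) (x l) (x b)) * h := by
        rw [Finset.sum_mul, ← Finset.sum_sub_distrib]
        exact Finset.sum_congr rfl fun l _ => by ring
      simp only [e]
      linear_combination e1 - h * h2 k) a
  exact sub_eq_zero.1 h3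

/-- A Gaussian integral with an imaginary quadratic exponent is the exponential of the
interaction at a finite combination of Dirac masses. -/
theorem integral_exp_quadratic :
    ∫ ω, Complex.exp (-(w / 2) * ((∑ k, s k * φ (x k) ω ^ 2 : ℝ) : ℂ)) ∂P =
      Complex.exp (F.pot w 1 (∑ k, s k • F.dirac (x k)) + 3 / 4 * w ^ 2 * (tad Φ 1 : ℂ) ^ 2
        - 3 / 2 * w * tad Φ 1 * ∑ k, (s k : ℂ)) := by
  have := hφ.gaussian.isProbabilityMeasure
  have hm : ∀ i, AEMeasurable (φ i) P := hφ.gaussian.aemeasurable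
  set X := ∑ k, s k • F.dirac (x k) with hX
  set S : Ω → ℝ := fun ω => ∑ k, s k * φ (x k) ω ^ 2 with hS
  have hSm : AEMeasurable S P := by fun_prop
  have hSi : Integrable S P := integrable_finset_sum _ fun k _ => by
    simpa only [sq] using (hφ.integrable_mul (x k) (x k)).const_mul (s k)
  have huw : ∀ u : ℝ, ((u : ℂ) * w).re = 0 := fun u => by simp [Complex.mul_re, hw]
  have hnorm : ∀ (u : ℝ) (r : ℝ), ‖Complex.exp (-((u : ℂ) * w / 2) * (r : ℂ))‖ = 1 := fun u r => by
    rw [Complex.norm_exp]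
    simp [Complex.mul_re, hw]
  set K : ℝ → κ → ℂ := fun u k => F.ker (u * w) 1 X 0 (F.interp 1) (x k) (x k) with hK
  set h : ℝ → ℂ := fun u => ∫ ω, Complex.exp (-((u : ℂ) * w / 2) * (S ω : ℂ)) ∂P with hh
  set g : ℝ → ℂ := fun u => F.pot (u * w) 1 X + 3 / 4 * (u * w) ^ 2 * (tad Φ 1 : ℂ) ^ 2
        - 3 / 2 * (u * w) * tad Φ 1 * ∑ k, (s k : ℂ) with hg
  -- `h` and exp `g` have the same logarithmic derivative in the scale `u` of the coupling and the
  -- same value 1 at `u = 0`.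
  have hh' : ∀ u, HasDerivAt h (-(w / 2) * (∑ k, (s k : ℂ) * K u k) * h u) u := by
    intro u
    have hd := hasDerivAt_integral_of_dominated_loc_of_deriv_le (μ := P) (𝕜 := ℝ) (x₀ := u)
      (s := Set.univ) (F := fun u ω => Complex.exp (-((u : ℂ) * w / 2) * (S ω : ℂ)))
      (F' := fun u ω => Complex.exp (-((u : ℂ) * w / 2) * (S ω : ℂ)) * (-(w / 2) * (S ω : ℂ)))
      (bound := fun ω => ‖w / 2‖ * |S ω|) univ_mem (Eventually.of_forall fun u => by fun_prop)
      ((integrable_const (1 : ℝ)).mono' (by fun_prop) (Eventually.of_forall fun ω => (hnorm _ _).le))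
      (by fun_prop)
      (Eventually.of_forall fun ω u _ => by
        rw [norm_mul, hnorm, one_mul, norm_mul, norm_neg, Complex.norm_real, Real.norm_eq_abs])
      (hSi.abs.const_mul _)
      (Eventually.of_forall fun ω u _ => by
        refine HasDerivAt.cexp ?_
        have h1 := ((((hasDerivAt_id u).ofReal_comp.mul_const w).div_const 2).neg).mul_const
          (S ω : ℂ)
        refine h1.congr_deriv ?_
        push_cast
        ring)
    refine hd.2.congr_deriv ?_
    have e : ∀ ω, Complex.exp (-((u : ℂ) * w / 2) * (S ω : ℂ)) * (-(w / 2) * (S ω : ℂ)) =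
        ∑ k, -(w / 2) * s k * ((φ (x k) ω : ℂ) * ((φ (x k) ω : ℂ) *
          Complex.exp (-((u : ℂ) * w / 2) * (S ω : ℂ)))) := fun ω => by
      have : (S ω : ℂ) = ∑ k, (s k : ℂ) * (φ (x k) ω : ℂ) ^ 2 := by simp [hS]
      generalize Complex.exp (-((u : ℂ) * w / 2) * (S ω : ℂ)) = E
      rw [this]
      simp only [Finset.mul_sum]
      exact Finset.sum_congr rfl fun k _ => by ring
    simp only [e]
    rw [integral_finset_sum]
    · simp only [integral_const_mul]
      rw [Finset.mul_sum, Finset.sum_mul]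
      refine Finset.sum_congr rfl fun k _ => ?_
      rw [F.integral_mul_mul_exp_quadratic_eq_ker x s hφ (huw u) k k]
      ring
    · intro k _
      refine Integrable.const_mul ?_ _
      refine (hφ.integrable_mul (x k) (x k)).norm.mono' (by fun_prop)
        (Eventually.of_forall fun ω => ?_)
      rw [norm_mul, norm_mul, hnorm, mul_one, Complex.norm_real, ← norm_mul]
  have hg' : ∀ u, HasDerivAt g (-(w / 2) * ∑ k, (s k : ℂ) * K u k) u := by
    intro u
    have h1 : HasDerivAt (fun u : ℝ => (u : ℂ) * w) w u := by
      simpa using (hasDerivAt_id u).ofReal_comp.mul_const w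
    have h2 := (F.hasDerivAt_pot_coupling one_pos (coercive_of_re_eq_zero (huw u))
      one_mem_unitCube X).comp u h1
    have h3 := (h2.add (((h1.pow 2).const_mul (3 / 4)).mul_const ((tad Φ 1 : ℂ) ^ 2))).sub
      (((h1.const_mul (3 / 2)).mul_const (tad Φ 1 : ℂ)).mul_const (∑ k, (s k : ℂ)))
    refine h3.congr_deriv ?_
    have e1 : tr H X (F.interp 1) = tad Φ 1 * ∑ k, (s k : ℂ) := by
      rw [hX, F.tr_sum_dirac x s, Finset.mul_sum]
      exact Finset.sum_congr rfl fun k _ => by rw [inner_feat_interp_self, mul_comm]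
    have e2 : tr H X ((F.res (u * w) 1 X - 1) * F.interp 1) =
        ∑ k, (s k : ℂ) * K u k - tad Φ 1 * ∑ k, (s k : ℂ) := by
      rw [Finset.mul_sum, ← Finset.sum_sub_distrib]
      conv_lhs => rw [hX, F.tr_sum_dirac x s]
      refine Finset.sum_congr rfl fun k _ => ?_
      simp only [hK]
      rw [ker_zero_eq_add, inner_feat_interp_self, ker_one]
      ring
    rw [e1, e2]
    push_cast
    ring
  have hconst : ∀ u, HasDerivAt (fun u => h u * Complex.exp (-g u)) 0 u := fun u => by
    refine ((hh' u).mul (hg' u).neg.cexp).congr_deriv ?_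
    simp only [Pi.neg_apply]
    ring
  have h01 := is_const_of_deriv_eq_zero (fun u => (hconst u).differentiableAt)
    (fun u => (hconst u).deriv) 1 0
  have h0 : h 0 = 1 := by simp [hh]
  have g0 : g 0 = 0 := by simp [hg, pot_coupling_zero]
  simp only [h0, g0, neg_zero, Complex.exp_zero, mul_one, Complex.exp_neg] at h01
  have h1 := (mul_inv_eq_one₀ (Complex.exp_ne_zero _)).1 h01
  simpa only [hh, hg, Complex.ofReal_one, one_mul] using h1

end Features

/-! ### The intermediate field -/

/-- The Wick ordered fourth power `a⁴ - 6 T a² + 3 T²`. -/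
def wickFour (T a : ℝ) : ℝ := a ^ 4 - 6 * T * a ^ 2 + 3 * T ^ 2

theorem wickFour_eq (T a : ℝ) : wickFour T a = (a ^ 2 - 3 * T) ^ 2 - 6 * T ^ 2 := by
  unfold wickFour; ring

theorem le_wickFour (T a : ℝ) : -(6 * T ^ 2) ≤ wickFour T a := by
  rw [wickFour_eq]
  nlinarith [sq_nonneg (a ^ 2 - 3 * T)]

theorem inner_cellInd (n : ℕ) (k l : Fin (2 ^ n) × Fin (2 ^ n)) :
    inner ℝ (cellInd n k) (cellInd n l) = if k = l then (1 / 4 : ℝ) ^ n else 0 := by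
  rw [cellInd, cellInd, L2.inner_indicatorConstLp_indicatorConstLp]
  split_ifs with h
  · rw [h, Set.inter_self, volume_real_cell]
    simp
  · have : cell n k ∩ cell n l = ∅ :=
      Set.eq_empty_of_forall_notMem fun x hx => h (cell_unique hx.1 hx.2)
    simp [this]

theorem sum_cells (n : ℕ) : ∑ _k : Fin (2 ^ n) × Fin (2 ^ n), (1 / 4 : ℝ) ^ n = 1 := by
  rw [Finset.sum_const, Finset.card_univ, Fintype.card_prod, Fintype.card_fin, nsmul_eq_mul,
    ← mul_pow]
  push_cast
  rw [← mul_pow]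
  norm_num

/-! ### The intermediate field at the corners of the dyadic squares -/

namespace Features

open TraceSpace

variable {Φ : Model} {H : Type*} [NormedAddCommGroup H] [InnerProductSpace ℂ H] [CompleteSpace H]
  (F : Features Φ H) {Ω Ω' : Type*} [MeasurableSpace Ω] {P : Measure Ω} [MeasurableSpace Ω']
  {P' : Measure Ω'} {φ : Sq → Ω' → ℝ} (hφ : IsCentredGaussian P' φ fun x y => cov Φ 1 (x, y))
  {w : ℂ} (hw : w.re = 0)

section Shift

variable {κ : Type*} [Fintype κ] (x : κ → Sq) (s : κ → ℝ)

include hφ hw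

/-- The exponential of the interaction at a finite combination of Dirac masses. -/
theorem exp_pot_eq : Complex.exp (F.pot w 1 (∑ k, s k • F.dirac (x k))) =
    Complex.exp (-(3 / 4) * w ^ 2 * (tad Φ 1 : ℂ) ^ 2) *
      ∫ ω, Complex.exp (-(w / 2) * ((∑ k, s k * (φ (x k) ω ^ 2 - 3 * tad Φ 1) : ℝ) : ℂ)) ∂P' := by
  have h := F.integral_exp_quadratic x s hφ hw
  have e : ∀ ω, Complex.exp (-(w / 2) * ((∑ k, s k * (φ (x k) ω ^ 2 - 3 * tad Φ 1) : ℝ) : ℂ)) =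
      Complex.exp (3 / 2 * w * tad Φ 1 * ∑ k, (s k : ℂ)) *
        Complex.exp (-(w / 2) * ((∑ k, s k * φ (x k) ω ^ 2 : ℝ) : ℂ)) := fun ω => by
    rw [← Complex.exp_add]
    congr 1
    push_cast
    simp only [mul_sub, Finset.sum_sub_distrib, ← Finset.sum_mul]
    ring
  simp only [e]
  rw [integral_const_mul, h, ← Complex.exp_add, ← Complex.exp_add]
  congr 1
  ring

/-- Up to an explicit factor the exponential is an average of phases. The resulting bound does not
depend on the nodes or on the masses, and dominates the limit of fine grids. -/
theorem norm_exp_pot_le : ‖Complex.exp (F.pot w 1 (∑ k, s k • F.dirac (x k)))‖ ≤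
    Real.exp (‖w‖ ^ 2 * tad Φ 1 ^ 2) := by
  have := hφ.gaussian.isProbabilityMeasure
  rw [F.exp_pot_eq hφ hw, norm_mul, ← mul_one (Real.exp _)]
  gcongr
  · rw [Complex.norm_exp]
    refine Real.exp_le_exp.2 ((Complex.re_le_norm _).trans ?_)
    rw [norm_mul, norm_mul, norm_pow, norm_pow, Complex.norm_real, Real.norm_eq_abs, sq_abs]
    norm_num
    nlinarith [mul_nonneg (sq_nonneg ‖w‖) (sq_nonneg (tad Φ 1))]
  · refine (norm_integral_le_integral_norm _).trans (le_of_eq ?_)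
    have : ∀ r : ℝ, ‖Complex.exp (-(w / 2) * (r : ℂ))‖ = 1 := fun r => by
      rw [Complex.norm_exp]
      simp [Complex.mul_re, hw]
    simp only [this]
    simp

end Shift

variable {W : L2 → Ω → ℝ} (hW : IsWhiteNoise P W)

include hφ hw hW

/-- Introduction of the intermediate field at the corners of the dyadic squares. -/
theorem integral_exp_wickFour_corners (n : ℕ) :
    ∫ ω, Complex.exp (w ^ 2 / 8 *
        ((∑ k, (1 / 4) ^ n * wickFour (tad Φ 1) (φ (corner n k) ω) : ℝ) : ℂ)) ∂P' =
      ∫ ω, Complex.exp (F.pot w 1 (∑ k, W (cellInd n k) ω • F.dirac (corner n k))) ∂P := by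
  have := hφ.gaussian.isProbabilityMeasure
  have := (IsCentredGaussian.gaussian hW).isProbabilityMeasure
  have hm : ∀ i, AEMeasurable (φ i) P' := hφ.gaussian.aemeasurable
  have hmW : ∀ i, AEMeasurable (W i) P := (IsCentredGaussian.gaussian hW).aemeasurable
  obtain ⟨y, rfl⟩ : ∃ y : ℝ, w = Complex.I * y := ⟨w.im, by
    rw [mul_comm]; exact Complex.ext (by simp [hw]) (by simp)⟩
  set T := tad Φ 1
  set g : (Fin (2 ^ n) × Fin (2 ^ n)) → Ω' → ℝ := fun k ω => φ (corner n k) ω ^ 2 - 3 * T with hg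
  have hgm : ∀ k, AEMeasurable (g k) P' := fun k => by fun_prop
  have hfub : Integrable (fun q : Ω × Ω' => Complex.exp (-(Complex.I * y / 2) *
      ((∑ k, W (cellInd n k) q.1 * g k q.2 : ℝ) : ℂ))) (P.prod P') := by
    have h1 : AEMeasurable (fun q : Ω × Ω' => ∑ k, W (cellInd n k) q.1 * g k q.2) (P.prod P') :=
      Finset.aemeasurable_fun_sum _ fun k _ =>
        ((hmW _).comp_quasiMeasurePreserving Measure.quasiMeasurePreserving_fst).mul
          ((hgm k).comp_quasiMeasurePreserving Measure.quasiMeasurePreserving_snd)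
    refine (integrable_const (1 : ℝ)).mono' (by fun_prop) (Eventually.of_forall fun q => ?_)
    rw [Complex.norm_exp]
    refine le_of_eq ?_
    simp [Complex.mul_re]
  have hpot := fun ω => F.exp_pot_eq hφ hw (corner n) fun k => W (cellInd n k) ω
  simp only [hpot]
  rw [integral_const_mul, integral_integral_swap hfub, ← integral_const_mul]
  congr 1
  ext ω
  -- The indicators are orthogonal of squared norm 4⁻ⁿ, so averaging the noise produces the square
  -- of φ² - 3T on each cell. This square is the Wick power plus 6T², and the constant is absorbed
  -- by the prefactor of `exp_pot_eq`.
  have h := (IsCentredGaussian.comp hW (cellInd n)).integral_exp_I_mul_sum Finset.univ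
    fun k => -(y / 2) * g k ω
  simp only [inner_cellInd, mul_ite, mul_zero, Finset.sum_ite_eq, Finset.mem_univ, if_true] at h
  have e : ∀ ω', -(Complex.I * y / 2) * ((∑ k, W (cellInd n k) ω' * g k ω : ℝ) : ℂ) =
      Complex.I * ((∑ k, -(y / 2) * g k ω * W (cellInd n k) ω' : ℝ) : ℂ) := fun ω' => by
    have : ∑ k, -(y / 2) * g k ω * W (cellInd n k) ω' =
        -(y / 2) * ∑ k, W (cellInd n k) ω' * g k ω := by
      rw [Finset.mul_sum]
      exact Finset.sum_congr rfl fun k _ => by ring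
    rw [this]
    push_cast
    ring
  change _ = _ * ∫ ω', Complex.exp (-(Complex.I * y / 2) *
    ((∑ k, W (cellInd n k) ω' * g k ω : ℝ) : ℂ)) ∂P
  simp only [e]
  rw [h, ← Complex.exp_add]
  have e1 : ∑ k, (1 / 4 : ℝ) ^ n * wickFour T (φ (corner n k) ω) =
      ∑ k, (1 / 4 : ℝ) ^ n * g k ω ^ 2 - 6 * T ^ 2 := by
    have : ∀ k, (1 / 4 : ℝ) ^ n * wickFour T (φ (corner n k) ω) =
        (1 / 4 : ℝ) ^ n * g k ω ^ 2 - (1 / 4) ^ n * (6 * T ^ 2) := fun k => by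
      rw [wickFour_eq]; ring
    simp only [this, Finset.sum_sub_distrib]
    rw [← Finset.sum_mul, sum_cells, one_mul]
  have e2 : ∑ k, -(y / 2) * g k ω * (-(y / 2) * g k ω) * (1 / 4) ^ n =
      y ^ 2 / 4 * ∑ k, (1 / 4 : ℝ) ^ n * g k ω ^ 2 := by
    rw [Finset.mul_sum]
    exact Finset.sum_congr rfl fun k _ => by ring
  rw [e1, e2]
  congr 1
  push_cast
  rw [mul_pow, Complex.I_sq]
  ring

include F in
theorem tendsto_integral_exp_wickFour_corners :
    Tendsto (fun n => ∫ ω, Complex.exp (w ^ 2 / 8 *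
        ((∑ k, (1 / 4) ^ n * wickFour (tad Φ 1) (φ (corner n k) ω) : ℝ) : ℂ)) ∂P') atTop
      (𝓝 (∫ ω, Complex.exp (F.pot w 1 (F.field W ω)) ∂P)) := by
  have := (IsCentredGaussian.gaussian hW).isProbabilityMeasure
  have hmW : ∀ i, AEMeasurable (W i) P := (IsCentredGaussian.gaussian hW).aemeasurable
  have hc : Continuous (F.pot w 1) := continuous_iff_continuousAt.2 fun X =>
    F.continuousAt_pot one_pos (z := fun _ => w) (t := fun _ => 1) (X := fun X => X)
      (coercive_of_re_eq_zero hw) one_mem_unitCube continuousAt_const continuousAt_const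
      continuousAt_id
  simp only [F.integral_exp_wickFour_corners hφ hw hW]
  refine tendsto_integral_of_dominated_convergence
    (fun _ => Real.exp (‖w‖ ^ 2 * tad Φ 1 ^ 2)) (fun n => ?_) (integrable_const _)
    (fun n => Eventually.of_forall fun ω => F.norm_exp_pot_le hφ hw _ _) ?_
  · refine (Complex.continuous_exp.comp hc).comp_aestronglyMeasurable ?_
    exact Finset.aestronglyMeasurable_fun_sum _ fun k _ =>
      (hmW _).aestronglyMeasurable.smul_const _
  · filter_upwards [F.ae_tendsto_corners hW] with ω h
    exact ((Complex.continuous_exp.comp hc).tendsto _).comp h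

end Features

/-! ### Riemann sums of the Wick ordered fourth power -/

theorem measurable_wickFour (T : ℝ) : Measurable (wickFour T) := by unfold wickFour; fun_prop

theorem abs_wickFour_le {T : ℝ} (hT : 0 ≤ T) (a : ℝ) :
    |wickFour T a| ≤ (24 + 12 * T + 3 * T ^ 2) * Real.exp |a| := by
  have h4 : |a| ^ 4 ≤ 24 * Real.exp |a| := by
    have := Real.pow_div_factorial_le_exp |a| (abs_nonneg a) 4
    norm_num [Nat.factorial] at this
    linarith
  have h2 : |a| ^ 2 ≤ 2 * Real.exp |a| := by
    have := Real.pow_div_factorial_le_exp |a| (abs_nonneg a) 2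
    norm_num [Nat.factorial] at this
    simp only [sq_abs]
    linarith
  have h0 : 1 ≤ Real.exp |a| := Real.one_le_exp (abs_nonneg a)
  have e4 : a ^ 4 = |a| ^ 4 := by rw [← abs_pow, abs_of_nonneg (by positivity)]
  have e2 : a ^ 2 = |a| ^ 2 := (sq_abs a).symm
  have h5 : T * |a| ^ 2 ≤ T * (2 * Real.exp |a|) := mul_le_mul_of_nonneg_left h2 hT
  have h6 : T ^ 2 * 1 ≤ T ^ 2 * Real.exp |a| := mul_le_mul_of_nonneg_left h0 (sq_nonneg T)
  have p4 : 0 ≤ |a| ^ 4 := by positivity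
  have p2 : 0 ≤ T * |a| ^ 2 := by positivity
  have p1 : 0 ≤ T ^ 2 := sq_nonneg T
  unfold wickFour
  rw [e4, e2, abs_le]
  constructor <;> nlinarith

/-- The difference factors through a - b, and Young's inequality separates (a - b)² from the other
factor. The latter has a large expectation, but carries the small parameter ε. -/
theorem abs_wickFour_sub_le {T : ℝ} (hT : 0 ≤ T) (a b : ℝ) {ε : ℝ} (hε : 0 < ε) :
    |wickFour T a - wickFour T b| ≤ (2 * ε)⁻¹ * (a - b) ^ 2 +
      ε / 4 * (6 + 6 * T) ^ 2 * (Real.exp (4 * |a|) + Real.exp (4 * |b|)) := by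
  set s := |a| + |b| with hs
  have hs0 : 0 ≤ s := by positivity
  have h3 : s ^ 3 ≤ 6 * Real.exp s := by
    have := Real.pow_div_factorial_le_exp s hs0 3
    norm_num [Nat.factorial] at this
    linarith
  have h1 : s ≤ Real.exp s := by linarith [Real.add_one_le_exp s]
  have hsum : |a + b| ≤ s := abs_add_le a b
  have hsq : |a ^ 2 + b ^ 2 - 6 * T| ≤ s ^ 2 + 6 * T := by
    have : a ^ 2 + b ^ 2 ≤ s ^ 2 := by
      rw [hs, ← sq_abs a, ← sq_abs b]
      nlinarith [mul_nonneg (abs_nonneg a) (abs_nonneg b)]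
    rw [abs_le]
    constructor <;> nlinarith [sq_nonneg a, sq_nonneg b, sq_nonneg s]
  set p := |a + b| * |a ^ 2 + b ^ 2 - 6 * T| with hp
  have hp0 : 0 ≤ p := by positivity
  have hpe : p ≤ (6 + 6 * T) * Real.exp s := by
    calc p ≤ s * (s ^ 2 + 6 * T) := mul_le_mul hsum hsq (abs_nonneg _) hs0
      _ = s ^ 3 + 6 * T * s := by ring
      _ ≤ _ := by nlinarith [mul_le_mul_of_nonneg_left h1 hT]
  have hp2 : p ^ 2 ≤ (6 + 6 * T) ^ 2 * ((Real.exp (4 * |a|) + Real.exp (4 * |b|)) / 2) := by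
    calc p ^ 2 ≤ ((6 + 6 * T) * Real.exp s) ^ 2 := pow_le_pow_left₀ hp0 hpe 2
      _ = (6 + 6 * T) ^ 2 * (Real.exp (2 * |a|) * Real.exp (2 * |b|)) := by
          rw [mul_pow, ← Real.exp_nat_mul, ← Real.exp_add]
          congr 2
          push_cast
          ring
      _ ≤ _ := by
          gcongr
          have e1 : Real.exp (4 * |a|) = Real.exp (2 * |a|) ^ 2 := by
            rw [← Real.exp_nat_mul]; push_cast; ring_nf
          have e2 : Real.exp (4 * |b|) = Real.exp (2 * |b|) ^ 2 := by
            rw [← Real.exp_nat_mul]; push_cast; ring_nf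
          rw [e1, e2]
          nlinarith [sq_nonneg (Real.exp (2 * |a|) - Real.exp (2 * |b|))]
  have e : wickFour T a - wickFour T b = (a - b) * ((a + b) * (a ^ 2 + b ^ 2 - 6 * T)) := by
    unfold wickFour; ring
  rw [e, abs_mul, abs_mul]
  have hy : |a - b| * p ≤ (2 * ε)⁻¹ * (a - b) ^ 2 + ε / 2 * p ^ 2 := by
    have h := sq_nonneg (|a - b| - ε * p)
    rw [sub_sq, sq_abs] at h
    have : |a - b| * p = (2 * ε)⁻¹ * (2 * |a - b| * (ε * p)) := by field_simp
    rw [this]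
    have h' : ε / 2 * p ^ 2 = (2 * ε)⁻¹ * (ε * p) ^ 2 := by field_simp
    rw [h', ← mul_add]
    gcongr
    linarith
  refine hy.trans ?_
  have := mul_le_mul_of_nonneg_left hp2 (half_pos hε).le
  linarith

/-! ### First moment estimates for the Wick power -/

namespace IsCentredGaussian

variable {T Ω : Type*} [MeasurableSpace Ω] {P : Measure Ω} {X : T → Ω → ℝ} {K : T → T → ℝ}
  (hX : IsCentredGaussian P X K) {τ : ℝ}

include hX

theorem lintegral_wickFour_le {a : T} (ha : K a a = τ) :
    ∫⁻ ω, ‖wickFour τ (X a ω)‖ₑ ∂P ≤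
      ENNReal.ofReal ((24 + 12 * τ + 3 * τ ^ 2) * (2 * Real.exp (τ / 2))) := by
  have hτ : 0 ≤ τ := ha ▸ hX.cov_self_nonneg a
  have h := hX.lintegral_exp_mul_abs_le a zero_le_one
  simp only [one_mul, one_pow, ha] at h
  rw [ENNReal.ofReal_mul (by positivity)]
  refine le_trans ?_ (mul_le_mul_right h _)
  rw [← lintegral_const_mul' _ _ ENNReal.ofReal_ne_top]
  refine lintegral_mono fun ω => ?_
  rw [← ENNReal.ofReal_mul (by positivity), Real.enorm_eq_ofReal_abs]
  exact ENNReal.ofReal_le_ofReal (abs_wickFour_le hτ _)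

/-- The squared increment has expectation 2(τ - K a b); the exponential moments of the two variables
of variance τ give the constant in front of ε. -/
theorem lintegral_wickFour_sub_le {a b : T} (ha : K a a = τ) (hb : K b b = τ) {ε : ℝ}
    (hε : 0 < ε) : ∫⁻ ω, ‖wickFour τ (X a ω) - wickFour τ (X b ω)‖ₑ ∂P ≤
      ENNReal.ofReal ((τ - K a b) / ε + ε * ((6 + 6 * τ) ^ 2 * Real.exp (8 * τ))) := by
  have hτ : 0 ≤ τ := ha ▸ hX.cov_self_nonneg a
  have hm : ∀ i, AEMeasurable (X i) P := hX.gaussian.aemeasurable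
  have hi : Integrable (fun ω => (X a ω - X b ω) ^ 2) P := by
    refine (((hX.integrable_mul a a).add (hX.integrable_mul b b)).sub
      ((hX.integrable_mul a b).const_mul 2)).congr (Eventually.of_forall fun ω => ?_)
    simp only [Pi.add_apply, Pi.sub_apply]
    ring
  have hd : ∫ ω, (X a ω - X b ω) ^ 2 ∂P = 2 * (τ - K a b) := by
    have e : ∀ ω, (X a ω - X b ω) ^ 2 = X a ω * X a ω + X b ω * X b ω - 2 * (X a ω * X b ω) :=
      fun ω => by ring
    simp only [e]
    have hs : Integrable (fun ω => X a ω * X a ω + X b ω * X b ω) P :=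
      (hX.integrable_mul a a).add (hX.integrable_mul b b)
    rw [integral_sub hs ((hX.integrable_mul a b).const_mul 2), integral_add (hX.integrable_mul a a)
      (hX.integrable_mul b b), integral_const_mul, hX.covariance, hX.covariance, hX.covariance,
      ha, hb]
    ring
  have hd0 : 0 ≤ τ - K a b := by
    have := integral_nonneg (μ := P) (f := fun ω => (X a ω - X b ω) ^ 2)
      fun ω => sq_nonneg (X a ω - X b ω)
    linarith
  have h1 := hX.lintegral_exp_mul_abs_le a (c := 4) (by norm_num)
  have h2 := hX.lintegral_exp_mul_abs_le b (c := 4) (by norm_num)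
  have e8 : (4 : ℝ) ^ 2 * τ / 2 = 8 * τ := by ring
  rw [ha, e8] at h1
  rw [hb, e8] at h2
  have hc : 0 ≤ ε / 4 * (6 + 6 * τ) ^ 2 := by positivity
  calc _ ≤ ∫⁻ ω, (ENNReal.ofReal (2 * ε)⁻¹ * ENNReal.ofReal ((X a ω - X b ω) ^ 2) +
        ENNReal.ofReal (ε / 4 * (6 + 6 * τ) ^ 2) * (ENNReal.ofReal (Real.exp (4 * |X a ω|)) +
          ENNReal.ofReal (Real.exp (4 * |X b ω|)))) ∂P := by
        refine lintegral_mono fun ω => ?_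
        rw [← ENNReal.ofReal_mul (by positivity), ← ENNReal.ofReal_add (by positivity)
          (by positivity), ← ENNReal.ofReal_mul hc, ← ENNReal.ofReal_add (by positivity)
          (by positivity), Real.enorm_eq_ofReal_abs]
        exact ENNReal.ofReal_le_ofReal (abs_wickFour_sub_le hτ _ _ hε)
    _ = ENNReal.ofReal (2 * ε)⁻¹ * ENNReal.ofReal (2 * (τ - K a b)) +
        ENNReal.ofReal (ε / 4 * (6 + 6 * τ) ^ 2) *
          (∫⁻ ω, ENNReal.ofReal (Real.exp (4 * |X a ω|)) ∂P +
            ∫⁻ ω, ENNReal.ofReal (Real.exp (4 * |X b ω|)) ∂P) := by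
        rw [lintegral_add_left' (by fun_prop), lintegral_const_mul' _ _ ENNReal.ofReal_ne_top,
          lintegral_const_mul' _ _ ENNReal.ofReal_ne_top, lintegral_add_left' (by fun_prop),
          ← hd, ofReal_integral_eq_lintegral_ofReal hi
            (Eventually.of_forall fun ω => sq_nonneg _)]
    _ ≤ ENNReal.ofReal (2 * ε)⁻¹ * ENNReal.ofReal (2 * (τ - K a b)) +
        ENNReal.ofReal (ε / 4 * (6 + 6 * τ) ^ 2) *
          (ENNReal.ofReal (2 * Real.exp (8 * τ)) + ENNReal.ofReal (2 * Real.exp (8 * τ))) := by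
        gcongr
    _ = _ := by
        rw [← ENNReal.ofReal_mul (by positivity), ← ENNReal.ofReal_add (by positivity)
          (by positivity), ← ENNReal.ofReal_mul hc, ← ENNReal.ofReal_add (by positivity)
          (by positivity)]
        congr 1
        field_simp
        ring

end IsCentredGaussian

theorem dist_lt_of_mem_cell {d : ℝ} (hd : 0 < d) : ∃ N : ℕ, ∀ n ≥ N,
    ∀ (k : Fin (2 ^ n) × Fin (2 ^ n)) (x y : Sq), x ∈ cell n k → y ∈ cell n k → dist x y < d := by
  obtain ⟨N, hN⟩ := exists_pow_lt_of_lt_one (half_pos hd) (by norm_num : (1 / 2 : ℝ) < 1)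
  refine ⟨N, fun n hn k x y hx hy => ?_⟩
  have h1 := l1dist_le_of_mem_cell hx hy
  have h2 : (1 / 2 : ℝ) ^ n ≤ (1 / 2) ^ N := pow_le_pow_of_le_one (by norm_num) (by norm_num) hn
  have h3 : dist x y ≤ l1dist x y := by
    rw [Prod.dist_eq, Subtype.dist_eq, Subtype.dist_eq, Real.dist_eq, Real.dist_eq, l1dist]
    exact max_le (by linarith [abs_nonneg ((x.2 : ℝ) - y.2)])
      (by linarith [abs_nonneg ((x.1 : ℝ) - y.1)])
  linarith

/-- The Riemann sum of a function over the corners of the dyadic squares. -/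
def cornerSum (n : ℕ) (g : Sq → ℝ) : ℝ := ∑ k, (1 / 4) ^ n * g (corner n k)

theorem measurable_cornerSum {Ω : Type*} [MeasurableSpace Ω] {g : Sq → Ω → ℝ}
    (hg : ∀ x, Measurable (g x)) (n : ℕ) : Measurable fun ω => cornerSum n fun x => g x ω :=
  Finset.measurable_fun_sum _ fun k _ => (hg _).const_mul _

theorem le_cornerSum (n : ℕ) {g : Sq → ℝ} {c : ℝ} (hg : ∀ x, c ≤ g x) : c ≤ cornerSum n g := by
  calc c = ∑ k : Fin (2 ^ n) × Fin (2 ^ n), (1 / 4) ^ n * c := by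
        rw [← Finset.sum_mul, sum_cells, one_mul]
    _ ≤ _ := Finset.sum_le_sum fun k _ => mul_le_mul_of_nonneg_left (hg _) (by positivity)

/-- The function constant on the dyadic squares with the values of `g` at the corners. -/
def cornerStep (n : ℕ) (g : Sq → ℝ) (x : Sq) : ℝ :=
  ∑ k, (cell n k).indicator (fun _ => g (corner n k)) x

theorem measurable_cornerStep {Ω : Type*} [MeasurableSpace Ω] {g : Sq → Ω → ℝ}
    (hg : ∀ x, Measurable (g x)) (n : ℕ) :
    Measurable fun q : Ω × Sq => cornerStep n (fun x => g x q.1) q.2 :=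
  Finset.measurable_fun_sum _ fun k _ => Measurable.ite
    (p := fun q : Ω × Sq => q.2 ∈ cell n k) (measurable_snd (measurableSet_cell n k))
    ((hg _).comp measurable_fst) measurable_const

theorem integrable_cornerStep (n : ℕ) (g : Sq → ℝ) : Integrable (cornerStep n g) :=
  integrable_finsetSum _ fun k _ => (integrable_const _).indicator (measurableSet_cell n k)

theorem integral_cornerStep (n : ℕ) (g : Sq → ℝ) : ∫ x, cornerStep n g x = cornerSum n g := by
  unfold cornerStep
  rw [integral_finsetSum _ fun k _ => (integrable_const _).indicator (measurableSet_cell n k)]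
  refine Finset.sum_congr rfl fun k _ => ?_
  rw [integral_indicator_const _ (measurableSet_cell n k), volume_real_cell, smul_eq_mul]

theorem cornerStep_of_mem {n : ℕ} (g : Sq → ℝ) {x : Sq} {k : Fin (2 ^ n) × Fin (2 ^ n)}
    (hx : x ∈ cell n k) : cornerStep n g x = g (corner n k) := by
  unfold cornerStep
  rw [Finset.sum_eq_single k]
  · rw [Set.indicator_of_mem hx]
  · exact fun l _ hl => Set.indicator_of_notMem (fun h => hl (cell_unique h hx)) _
  · simp

namespace IsCentredGaussian

variable {Ω : Type*} [MeasurableSpace Ω] {P : Measure Ω} {φ : Sq → Ω → ℝ} {K : C(Sq × Sq, ℝ)}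
  {τ : ℝ} (hφ : IsCentredGaussian P φ fun x y => K (x, y)) (hK : ∀ x, K (x, x) = τ)

include hφ hK

theorem eventually_lintegral_wickFour_sub_le {η : ℝ} (hη : 0 < η) : ∃ N : ℕ, ∀ n ≥ N,
    ∀ (k : Fin (2 ^ n) × Fin (2 ^ n)) (x y : Sq), x ∈ cell n k → y ∈ cell n k →
      ∫⁻ ω, ‖wickFour τ (φ x ω) - wickFour τ (φ y ω)‖ₑ ∂P ≤ ENNReal.ofReal η := by
  set M := (6 + 6 * τ) ^ 2 * Real.exp (8 * τ) with hM
  have hM0 : 0 ≤ M := by positivity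
  obtain ⟨ε, hε, hεM⟩ : ∃ ε : ℝ, 0 < ε ∧ ε * M ≤ η / 2 := by
    refine ⟨η / 2 / (M + 1), by positivity, ?_⟩
    rw [div_mul_eq_mul_div, div_le_iff₀ (by positivity)]
    nlinarith
  obtain ⟨d, hd, hdK⟩ := Metric.uniformContinuous_iff.1
    (CompactSpace.uniformContinuous_of_continuous K.continuous) (ε * (η / 2)) (by positivity)
  obtain ⟨N, hN⟩ := dist_lt_of_mem_cell hd
  refine ⟨N, fun n hn k x y hx hy => ?_⟩
  refine (hφ.lintegral_wickFour_sub_le (hK x) (hK y) hε).trans (ENNReal.ofReal_le_ofReal ?_)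
  have h1 := @hdK (x, x) (x, y) (by
    rw [Prod.dist_eq, dist_self]
    exact max_lt hd (hN n hn k x y hx hy))
  rw [Real.dist_eq, hK] at h1
  have h2 : (τ - K (x, y)) / ε ≤ η / 2 := by
    rw [div_le_iff₀ hε]
    linarith [le_abs_self (τ - K (x, y))]
  linarith

variable (hm : Measurable fun q : Sq × Ω => φ q.1 q.2)

include hm

theorem integrable_wickFour : Integrable (fun q : Sq × Ω => wickFour τ (φ q.1 q.2))
    ((volume : Measure Sq).prod P) := by
  have := hφ.gaussian.isProbabilityMeasure
  have hqm : Measurable fun q : Sq × Ω => wickFour τ (φ q.1 q.2) := (measurable_wickFour τ).comp hm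
  refine ⟨hqm.aestronglyMeasurable, ?_⟩
  rw [hasFiniteIntegral_iff_enorm, lintegral_prod _ hqm.enorm.aemeasurable]
  refine (lintegral_mono fun x => hφ.lintegral_wickFour_le (hK x)).trans_lt ?_
  rw [lintegral_const, measure_univ, mul_one]
  exact ENNReal.ofReal_lt_top

/-- By Tonelli the first moment is estimated point by point on the square. Only continuity of the
covariance is used, with no regularity of the paths of φ. -/
theorem tendsto_lintegral_corners_sub :
    Tendsto (fun n => ∫⁻ ω, ‖cornerSum n (fun x => wickFour τ (φ x ω)) -
      ∫ x, wickFour τ (φ x ω)‖ₑ ∂P) atTop (𝓝 0) := by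
  have := hφ.gaussian.isProbabilityMeasure
  have hqm : Measurable fun q : Sq × Ω => wickFour τ (φ q.1 q.2) := (measurable_wickFour τ).comp hm
  have hqx : ∀ x, Measurable fun ω => wickFour τ (φ x ω) := fun x =>
    (measurable_wickFour τ).comp hm.of_uncurry_left
  rw [ENNReal.tendsto_nhds_zero]
  intro e he
  obtain ⟨η, hη, hηe⟩ : ∃ η : ℝ, 0 < η ∧ ENNReal.ofReal η ≤ e := by
    rcases eq_or_ne e ⊤ with rfl | h
    · exact ⟨1, one_pos, le_top⟩
    · exact ⟨e.toReal, ENNReal.toReal_pos he.ne' h, ENNReal.ofReal_toReal_le⟩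
  obtain ⟨N, hN⟩ := hφ.eventually_lintegral_wickFour_sub_le hK hη
  filter_upwards [eventually_ge_atTop N] with n hn
  refine le_trans ?_ hηe
  calc _ ≤ ∫⁻ ω, (∫⁻ x, ‖cornerStep n (fun x => wickFour τ (φ x ω)) x -
          wickFour τ (φ x ω)‖ₑ) ∂P := by
        refine lintegral_mono_ae ?_
        filter_upwards [(hφ.integrable_wickFour hK hm).prod_left_ae] with ω hω
        rw [← integral_cornerStep, ← integral_sub (integrable_cornerStep n _) hω]
        exact enorm_integral_le_lintegral_enorm _
    _ = ∫⁻ x, (∫⁻ ω, ‖cornerStep n (fun x => wickFour τ (φ x ω)) x -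
          wickFour τ (φ x ω)‖ₑ ∂P) := by
        refine lintegral_lintegral_swap (f := fun ω x =>
          ‖cornerStep n (fun x => wickFour τ (φ x ω)) x - wickFour τ (φ x ω)‖ₑ) ?_
        exact ((measurable_cornerStep hqx n).sub (hqm.comp measurable_swap)).enorm.aemeasurable
    _ ≤ ∫⁻ _x : Sq, ENNReal.ofReal η := by
        refine lintegral_mono_ae ?_
        filter_upwards [ae_mem_cell n] with x ⟨k, hx⟩
        simp only [cornerStep_of_mem _ hx]
        exact hN n hn k _ x (corner_mem_cell n k) hx
    _ = _ := by rw [lintegral_const, measure_univ, mul_one]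

/-- A subsequence is enough, because the integrals are already known to converge along the full
sequence on the intermediate field side. -/
theorem exists_subseq_ae_tendsto_corners : ∃ ns : ℕ → ℕ, StrictMono ns ∧ ∀ᵐ ω ∂P,
    Tendsto (fun i => cornerSum (ns i) fun x => wickFour τ (φ x ω)) atTop
      (𝓝 (∫ x, wickFour τ (φ x ω))) := by
  have := hφ.gaussian.isProbabilityMeasure
  have hqx : ∀ x, Measurable fun ω => wickFour τ (φ x ω) := fun x =>
    (measurable_wickFour τ).comp hm.of_uncurry_left
  have h : TendstoInMeasure P (fun n ω => cornerSum n fun x => wickFour τ (φ x ω)) atTop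
      (fun ω => ∫ x, wickFour τ (φ x ω)) := by
    refine tendstoInMeasure_of_tendsto_eLpNorm one_ne_zero
      (fun n => (measurable_cornerSum hqx n).aestronglyMeasurable)
      (hφ.integrable_wickFour hK hm).integral_prod_right.aestronglyMeasurable ?_
    simp only [eLpNorm_one_eq_lintegral_enorm]
    exact hφ.tendsto_lintegral_corners_sub hK hm
  exact h.exists_seq_tendsto_ae

end IsCentredGaussian

namespace Features

variable {Φ : Model} {H : Type*} [NormedAddCommGroup H] [InnerProductSpace ℂ H] [CompleteSpace H]
  (F : Features Φ H) {Ω Ω' : Type*} [MeasurableSpace Ω] {P : Measure Ω} [MeasurableSpace Ω']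
  {P' : Measure Ω'} {φ : Sq → Ω' → ℝ} (hφ : IsCentredGaussian P' φ fun x y => cov Φ 1 (x, y))
  (hm : Measurable fun q : Sq × Ω' => φ q.1 q.2) {w : ℂ} (hw : w.re = 0)
  {W : L2 → Ω → ℝ} (hW : IsWhiteNoise P W)

include hφ hm hw hW

/-- The intermediate field representation for an imaginary coupling `w`. -/
theorem integral_exp_wickFour_of_re_eq_zero :
    ∫ ω, Complex.exp (w ^ 2 / 8 * ((∫ x, wickFour (tad Φ 1) (φ x ω) : ℝ) : ℂ)) ∂P' =
      ∫ ω, Complex.exp (F.pot w 1 (F.field W ω)) ∂P := by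
  have := hφ.gaussian.isProbabilityMeasure
  have hqx : ∀ x, Measurable fun ω => wickFour (tad Φ 1) (φ x ω) := fun x =>
    (measurable_wickFour _).comp hm.of_uncurry_left
  obtain ⟨ns, hns, hlim⟩ := hφ.exists_subseq_ae_tendsto_corners (cov_diag Φ 1) hm
  have hσ : Tendsto (fun n => ∫ ω, Complex.exp (w ^ 2 / 8 *
      ((cornerSum n fun x => wickFour (tad Φ 1) (φ x ω) : ℝ) : ℂ)) ∂P') atTop
      (𝓝 (∫ ω, Complex.exp (F.pot w 1 (F.field W ω)) ∂P)) :=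
    F.tendsto_integral_exp_wickFour_corners hφ hw hW
  refine tendsto_nhds_unique ?_ (hσ.comp hns.tendsto_atTop)
  obtain ⟨y, rfl⟩ : ∃ y : ℝ, w = Complex.I * y := ⟨w.im, by
    rw [mul_comm]; exact Complex.ext (by simp [hw]) (by simp)⟩
  have e : ((Complex.I * y) ^ 2 / 8 : ℂ) = ((-(y ^ 2 / 8) : ℝ) : ℂ) := by
    rw [mul_pow, Complex.I_sq]; push_cast; ring
  rw [e]
  refine tendsto_integral_of_dominated_convergence
    (fun _ => Real.exp (y ^ 2 / 8 * (6 * tad Φ 1 ^ 2))) (fun i => ?_) (integrable_const _)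
    (fun i => Eventually.of_forall fun ω => ?_) ?_
  · have h := measurable_cornerSum hqx (ns i)
    exact Measurable.aestronglyMeasurable (by fun_prop)
  · rw [← Complex.ofReal_mul, Complex.norm_exp_ofReal]
    refine Real.exp_le_exp.2 ?_
    have h := mul_le_mul_of_nonneg_left (le_cornerSum (ns i) fun x =>
      le_wickFour (tad Φ 1) (φ x ω)) (by positivity : 0 ≤ y ^ 2 / 8)
    linarith
  · filter_upwards [hlim] with ω h
    have hc : Continuous fun r : ℝ => Complex.exp (((-(y ^ 2 / 8) : ℝ) : ℂ) * (r : ℂ)) := by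
      fun_prop
    exact (hc.tendsto _).comp h

end Features

/-! ### Analytic continuation in the coupling -/

/-- The open cone `|Re z| < Im z`. -/
def openCone : Set ℂ := {z | |z.re| < z.im}

/-- The closed cone `|Re z| ≤ Im z`. -/
def closedCone : Set ℂ := {z | |z.re| ≤ z.im}

theorem isOpen_openCone : IsOpen openCone :=
  isOpen_lt (continuous_abs.comp Complex.continuous_re) Complex.continuous_im

theorem openCone_subset : openCone ⊆ closedCone := fun z (h : |z.re| < z.im) => h.le

theorem convex_openCone : Convex ℝ openCone := by
  intro z hz w hw a b ha hb hab
  simp only [openCone, Set.mem_setOf_eq, abs_lt] at hz hw ⊢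
  simp only [Complex.add_re, Complex.add_im, Complex.real_smul, Complex.mul_re, Complex.mul_im,
    Complex.ofReal_re, Complex.ofReal_im, zero_mul, sub_zero, add_zero]
  rcases ha.eq_or_lt with rfl | ha
  · rw [zero_add] at hab
    subst hab
    constructor <;> linarith [hw.1, hw.2]
  · have h1 := mul_pos ha (by linarith [hz.1] : 0 < z.re + z.im)
    have h2 := mul_pos ha (by linarith [hz.2] : 0 < z.im - z.re)
    have h3 := mul_nonneg hb (by linarith [hw.1] : 0 ≤ w.re + w.im)
    have h4 := mul_nonneg hb (by linarith [hw.2] : 0 ≤ w.im - w.re)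
    constructor <;> nlinarith

theorem add_I_mul_mem_openCone {z : ℂ} (hz : z ∈ closedCone) {ε : ℝ} (hε : 0 < ε) :
    z + Complex.I * ε ∈ openCone := by
  simp only [openCone, closedCone, Set.mem_setOf_eq] at hz ⊢
  simp
  linarith

theorem closedCone_subset_closure : closedCone ⊆ closure openCone := fun z hz => by
  have h : Tendsto (fun ε : ℝ => z + Complex.I * ε) (𝓝[>] 0) (𝓝 z) := by
    have : Continuous fun ε : ℝ => z + Complex.I * ε := by fun_prop
    simpa using (this.tendsto 0).mono_left nhdsWithin_le_nhds
  exact mem_closure_of_tendsto h (eventually_nhdsWithin_of_forall fun ε hε =>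
    add_I_mul_mem_openCone hz hε)

/-- As |Im z| ≥ |Re z|, the squared modulus is at least (1 + s)² + s² with s = r Re z, and this is
at least 1/2. The constant is uniform on the cone, as needed to vary `z`. -/
theorem coercive_of_mem_closedCone {z : ℂ} (hz : z ∈ closedCone) (r : ℝ) :
    1 / 2 ≤ ‖1 + z * (r : ℂ)‖ := by
  have h0 : z.re ^ 2 ≤ z.im ^ 2 := sq_le_sq.2 (hz.trans (le_abs_self _))
  have h1 : ‖1 + z * (r : ℂ)‖ ^ 2 = (1 + z.re * r) ^ 2 + (z.im * r) ^ 2 := by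
    rw [← Complex.normSq_eq_norm_sq, Complex.normSq_apply]
    simp
    ring
  have h2 := mul_le_mul_of_nonneg_right h0 (sq_nonneg r)
  refine le_of_sq_le_sq ?_ (norm_nonneg _)
  rw [h1]
  nlinarith [sq_nonneg (1 + 2 * (z.re * r))]

theorem re_sq_div (z : ℂ) : (z ^ 2 / 8).re = (z.re ^ 2 - z.im ^ 2) / 8 := by
  rw [show (z ^ 2 / 8 : ℂ) = z ^ 2 / ((8 : ℝ) : ℂ) by norm_num, Complex.div_ofReal_re, sq,
    Complex.mul_re]
  ring

theorem re_sq_nonpos {z : ℂ} (hz : z ∈ closedCone) : (z ^ 2 / 8).re ≤ 0 := by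
  have h0 : z.re ^ 2 ≤ z.im ^ 2 := sq_le_sq.2 (hz.trans (le_abs_self _))
  rw [re_sq_div]
  linarith

theorem re_sq_neg {z : ℂ} (hz : z ∈ openCone) : (z ^ 2 / 8).re < 0 := by
  have h0 : z.re ^ 2 < z.im ^ 2 := sq_lt_sq.2 (lt_of_lt_of_le hz (le_abs_self _))
  rw [re_sq_div]
  linarith

/-- Agreement on the imaginary axis accumulates at i, so the identity theorem applies in the
connected open cone; continuity and density give the boundary. -/
theorem eqOn_closedCone {f g : ℂ → ℂ} (hf : DifferentiableOn ℂ f openCone)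
    (hg : DifferentiableOn ℂ g openCone) (hfc : ContinuousOn f closedCone)
    (hgc : ContinuousOn g closedCone) (h : ∀ z ∈ openCone, z.re = 0 → f z = g z) :
    Set.EqOn f g closedCone := by
  have hI : Complex.I ∈ openCone := by simp [openCone]
  have ht : Tendsto (fun y : ℝ => Complex.I * y) (𝓝[≠] 1) (𝓝[≠] Complex.I) := by
    refine tendsto_nhdsWithin_iff.2 ⟨?_, eventually_nhdsWithin_of_forall fun y hy h => hy ?_⟩
    · have : Continuous fun y : ℝ => Complex.I * y := by fun_prop
      simpa using (this.tendsto 1).mono_left nhdsWithin_le_nhds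
    · simpa using congrArg Complex.im h
  have hev : ∀ᶠ y : ℝ in 𝓝[≠] 1, f (Complex.I * y) = g (Complex.I * y) := by
    filter_upwards [mem_nhdsWithin_of_mem_nhds (Ioi_mem_nhds (one_pos : (0 : ℝ) < 1))] with y hy
    exact h _ (by simpa [openCone] using hy) (by simp)
  exact Set.EqOn.of_subset_closure
    ((hf.analyticOnNhd isOpen_openCone).eqOn_of_preconnected_of_frequently_eq
      (hg.analyticOnNhd isOpen_openCone) convex_openCone.isPreconnected hI
      (ht.frequently hev.frequently)) hfc hgc openCone_subset closedCone_subset_closure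

section LowerBounded

variable {Ω : Type*} [MeasurableSpace Ω] {P : Measure Ω} [IsProbabilityMeasure P] {Q : Ω → ℝ}
  (hQ : AEMeasurable Q P) {b : ℝ} (hb : ∀ ω, -b ≤ Q ω)

include hb

theorem norm_exp_mul_le {c : ℂ} (hc : c.re ≤ 0) (ω : Ω) :
    ‖Complex.exp (c * (Q ω : ℂ))‖ ≤ Real.exp (‖c‖ * |b|) := by
  rw [Complex.norm_exp, Complex.re_mul_ofReal]
  refine Real.exp_le_exp.2 ?_
  have h1 := mul_nonneg (neg_nonneg.2 hc) (by linarith [hb ω] : 0 ≤ Q ω + b)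
  have h2 : -c.re ≤ ‖c‖ := by
    have := Complex.abs_re_le_norm c
    linarith [neg_abs_le c.re]
  have h3 : -c.re * b ≤ ‖c‖ * |b| :=
    (mul_le_mul_of_nonneg_left (le_abs_self b) (neg_nonneg.2 hc)).trans
      (mul_le_mul_of_nonneg_right h2 (abs_nonneg b))
  linarith

include hQ

/-- This is the complex moment generating function of `Q` at z²/8. Since `Q` is bounded below, it is
analytic on the open left half-plane, where z²/8 lies for `z` in the open cone. -/
theorem differentiableOn_integral_exp_sq :
    DifferentiableOn ℂ (fun z : ℂ => ∫ ω, Complex.exp (z ^ 2 / 8 * (Q ω : ℂ)) ∂P) openCone := by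
  have hs : Set.Iic (0 : ℝ) ⊆ integrableExpSet Q P := fun t ht => by
    refine (integrable_const (Real.exp (-t * b))).mono' (by fun_prop)
      (Eventually.of_forall fun ω => ?_)
    rw [Real.norm_of_nonneg (Real.exp_pos _).le]
    refine Real.exp_le_exp.2 ?_
    have ht' : t ≤ 0 := ht
    nlinarith [hb ω]
  have hi : Set.Iio (0 : ℝ) ⊆ interior (integrableExpSet Q P) := by
    rw [← interior_Iic]
    exact interior_mono hs
  refine (differentiableOn_complexMGF (X := Q) (μ := P)).comp (t := {z | z.re ∈ interior (integrableExpSet Q P)})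
    (f := fun z : ℂ => z ^ 2 / 8) (by fun_prop) fun z hz => hi (re_sq_neg hz)

theorem continuousOn_integral_exp_sq :
    ContinuousOn (fun z : ℂ => ∫ ω, Complex.exp (z ^ 2 / 8 * (Q ω : ℂ)) ∂P) closedCone := by
  intro z hz
  have hbd : ∀ᶠ w in 𝓝[closedCone] z, ‖w ^ 2 / 8‖ ≤ ‖z ^ 2 / 8‖ + 1 := by
    have : Continuous fun w : ℂ => ‖w ^ 2 / 8‖ := by fun_prop
    filter_upwards [mem_nhdsWithin_of_mem_nhds (this.continuousAt.eventually_lt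
      continuousAt_const (lt_add_one ‖z ^ 2 / 8‖))] with w hw using le_of_lt hw
  refine continuousWithinAt_of_dominated
    (bound := fun _ => Real.exp ((‖z ^ 2 / 8‖ + 1) * |b|)) (Eventually.of_forall fun w => ?_) ?_
    (integrable_const _) (Eventually.of_forall fun ω => ?_)
  · have h : AEMeasurable (fun ω => (Q ω : ℂ)) P := by fun_prop
    exact AEMeasurable.aestronglyMeasurable (by fun_prop)
  · filter_upwards [hbd, self_mem_nhdsWithin] with w hw hwc
    refine Eventually.of_forall fun ω => (norm_exp_mul_le hb (re_sq_nonpos hwc) ω).trans ?_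
    gcongr
  · have : Continuous fun w : ℂ => Complex.exp (w ^ 2 / 8 * (Q ω : ℂ)) := by fun_prop
    exact this.continuousWithinAt

end LowerBounded

namespace Features

open TraceSpace

variable {Φ : Model} {H : Type*} [NormedAddCommGroup H] [InnerProductSpace ℂ H] [CompleteSpace H]
  (F : Features Φ H) {Ω : Type*} [MeasurableSpace Ω] {P : Measure Ω} {W : L2 → Ω → ℝ}
  (hW : IsWhiteNoise P W)

/-- The derivative of the interaction in the coupling. -/
def potSlopeCoupling (z : ℂ) (X : TraceSpace H) : ℂ :=
  -(3 / 2) * z * (tad Φ 1 : ℂ) ^ 2 + tr H X (F.interp 1)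
    - 1 / 2 * tr H X ((F.res z 1 X - 1) * F.interp 1)

section Bounds

variable {z : ℂ} (hz : z ∈ closedCone)

include hz

theorem norm_pot_le_of_mem_closedCone : ∀ X : TraceSpace H, ‖F.pot z 1 X‖ ≤
    ‖z‖ ^ 2 * |tad Φ 1| ^ 2 + ‖z‖ * (2 * F.projBound ^ 2 + 2 * F.projBound) * ‖X‖ := fun X => by
  refine (F.norm_pot_le one_half_pos (coercive_of_mem_closedCone hz) one_mem_unitCube X).trans_eq ?_
  ring

theorem norm_potSlopeCoupling_le (X : TraceSpace H) : ‖F.potSlopeCoupling z X‖ ≤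
    3 / 2 * ‖z‖ * |tad Φ 1| ^ 2 + (F.projBound ^ 2 + 2 * F.projBound) * ‖X‖ := by
  have h1 := norm_tr_apply_le X (F.interp 1)
  have h2 := norm_tr_apply_le X ((F.res z 1 X - 1) * F.interp 1)
  have h3 := F.norm_interp_le one_mem_unitCube
  have h4 := F.norm_res_mul_interp_le one_half_pos (coercive_of_mem_closedCone hz)
    one_mem_unitCube X
  have h5 : ‖(F.res z 1 X - 1) * F.interp 1‖ ≤ F.projBound ^ 2 * (1 / 2)⁻¹ + F.projBound := by
    rw [sub_mul, one_mul]
    exact (norm_sub_le _ _).trans (add_le_add h4 h3)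
  have h6 := F.projBound_nonneg
  calc ‖F.potSlopeCoupling z X‖ ≤ ‖-(3 / 2) * z * (tad Φ 1 : ℂ) ^ 2‖ + ‖tr H X (F.interp 1)‖ +
        ‖1 / 2 * tr H X ((F.res z 1 X - 1) * F.interp 1)‖ :=
        (norm_sub_le _ _).trans (by gcongr; exact norm_add_le _ _)
    _ ≤ 3 / 2 * ‖z‖ * |tad Φ 1| ^ 2 + ‖X‖ * F.projBound +
        1 / 2 * (‖X‖ * (F.projBound ^ 2 * (1 / 2)⁻¹ + F.projBound)) := by
        gcongr
        · rw [norm_mul, norm_mul, norm_pow, Complex.norm_real]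
          norm_num
        · exact h1.trans (by gcongr)
        · rw [norm_mul]
          norm_num
          exact h2.trans (by gcongr; simpa using h5)
    _ ≤ _ := by nlinarith [mul_nonneg (norm_nonneg X) h6]

theorem continuous_pot_of_mem_closedCone : Continuous (F.pot z 1) :=
  continuous_iff_continuousAt.2 fun X =>
    F.continuousAt_pot one_half_pos (z := fun _ => z) (t := fun _ => 1) (X := fun X => X)
      (coercive_of_mem_closedCone hz) one_mem_unitCube continuousAt_const continuousAt_const
      continuousAt_id

theorem continuous_potSlopeCoupling : Continuous (F.potSlopeCoupling z) := by
  have h : Continuous (F.res z 1) := continuous_iff_continuousAt.2 fun X =>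
    F.continuousAt_res one_half_pos (z := fun _ => z) (t := fun _ => 1) (X := fun X => X)
      (coercive_of_mem_closedCone hz) one_mem_unitCube continuousAt_const continuousAt_const
      continuousAt_id
  unfold potSlopeCoupling
  fun_prop

theorem norm_exp_pot_le_of_norm_le {r : ℝ} (hr : ‖z‖ ≤ r) (X : TraceSpace H) :
    ‖Complex.exp (F.pot z 1 X)‖ ≤ Real.exp (r ^ 2 * |tad Φ 1| ^ 2) *
      Real.exp (r * (2 * F.projBound ^ 2 + 2 * F.projBound) * ‖X‖) := by
  have h6 := F.projBound_nonneg
  rw [Complex.norm_exp, ← Real.exp_add]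
  refine Real.exp_le_exp.2 ((Complex.re_le_norm _).trans
    ((F.norm_pot_le_of_mem_closedCone hz X).trans ?_))
  gcongr

end Bounds

include hW

theorem continuousOn_integral_exp_pot :
    ContinuousOn (fun z => ∫ ω, Complex.exp (F.pot z 1 (F.field W ω)) ∂P) closedCone := by
  intro z hz
  have hm := F.aestronglyMeasurable_field hW
  have hbd : ∀ᶠ w in 𝓝[closedCone] z, ‖w‖ ≤ ‖z‖ + 1 := by
    filter_upwards [mem_nhdsWithin_of_mem_nhds (continuous_norm.continuousAt.eventually_lt
      continuousAt_const (lt_add_one ‖z‖))] with w hw using le_of_lt hw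
  refine continuousWithinAt_of_dominated (bound := fun ω =>
    Real.exp ((‖z‖ + 1) ^ 2 * |tad Φ 1| ^ 2) * Real.exp ((‖z‖ + 1) *
      (2 * F.projBound ^ 2 + 2 * F.projBound) * ‖F.field W ω‖)) ?_ ?_
    ((F.integrable_exp_norm_field hW _).const_mul _) (Eventually.of_forall fun ω => ?_)
  · filter_upwards [self_mem_nhdsWithin] with w hw
    exact (Complex.continuous_exp.comp
      (F.continuous_pot_of_mem_closedCone hw)).comp_aestronglyMeasurable hm
  · filter_upwards [hbd, self_mem_nhdsWithin] with w hw hwc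
    exact Eventually.of_forall fun ω => F.norm_exp_pot_le_of_norm_le hwc hw _
  · refine ContinuousAt.continuousWithinAt (ContinuousAt.cexp ?_)
    exact F.continuousAt_pot one_half_pos (z := fun w => w) (t := fun _ => 1)
      (X := fun _ => F.field W ω) (coercive_of_mem_closedCone hz) one_mem_unitCube continuousAt_id
      continuousAt_const continuousAt_const

/-- On a bounded piece of the cone the coercivity constant is fixed and the derivative in the
coupling grows linearly in the field, so one exponential of the norm dominates. -/
theorem differentiableOn_integral_exp_pot :
    DifferentiableOn ℂ (fun z => ∫ ω, Complex.exp (F.pot z 1 (F.field W ω)) ∂P) openCone := by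
  intro z hz
  have hm := F.aestronglyMeasurable_field hW
  have hexp : ∀ w ∈ closedCone, AEStronglyMeasurable
      (fun ω => Complex.exp (F.pot w 1 (F.field W ω))) P := fun w hw =>
    (Complex.continuous_exp.comp
      (F.continuous_pot_of_mem_closedCone hw)).comp_aestronglyMeasurable hm
  set r := ‖z‖ + 1 with hr
  set A := Real.exp (r ^ 2 * |tad Φ 1| ^ 2)
  set B := r * (2 * F.projBound ^ 2 + 2 * F.projBound)
  set C := 3 / 2 * r * |tad Φ 1| ^ 2 + (F.projBound ^ 2 + 2 * F.projBound) with hC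
  have h6 := F.projBound_nonneg
  have hs : {w | w ∈ openCone ∧ ‖w‖ ≤ r} ∈ 𝓝 z := by
    filter_upwards [isOpen_openCone.mem_nhds hz, continuous_norm.continuousAt.eventually_lt
      continuousAt_const (lt_add_one ‖z‖)] with w h1 h2 using ⟨h1, le_of_lt h2⟩
  refine (hasDerivAt_integral_of_dominated_loc_of_deriv_le (μ := P) (𝕜 := ℂ) (x₀ := z)
    (F := fun z ω => Complex.exp (F.pot z 1 (F.field W ω)))
    (F' := fun z ω => Complex.exp (F.pot z 1 (F.field W ω)) *
      F.potSlopeCoupling z (F.field W ω))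
    (bound := fun ω => A * C * Real.exp ((B + 1) * ‖F.field W ω‖)) hs ?_ ?_ ?_ ?_ ?_
    ?_).2.differentiableAt.differentiableWithinAt
  · filter_upwards [hs] with w hw using hexp w (openCone_subset hw.1)
  · refine ((F.integrable_exp_norm_field hW B).const_mul A).mono' (hexp z (openCone_subset hz))
      (Eventually.of_forall fun ω => ?_)
    exact F.norm_exp_pot_le_of_norm_le (openCone_subset hz) (by linarith) _
  · exact (hexp z (openCone_subset hz)).mul
      ((F.continuous_potSlopeCoupling (openCone_subset hz)).comp_aestronglyMeasurable hm)
  · refine Eventually.of_forall fun ω w hw => ?_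
    have h1 := F.norm_exp_pot_le_of_norm_le (openCone_subset hw.1) hw.2 (F.field W ω)
    have h2 := F.norm_potSlopeCoupling_le (openCone_subset hw.1) (F.field W ω)
    set X := F.field W ω
    have h3 : ‖F.potSlopeCoupling w X‖ ≤ C * Real.exp ‖X‖ := by
      refine h2.trans ?_
      have e1 : 1 ≤ Real.exp ‖X‖ := Real.one_le_exp (norm_nonneg _)
      have e2 : ‖X‖ ≤ Real.exp ‖X‖ := by linarith [Real.add_one_le_exp ‖X‖]
      have h7 : 3 / 2 * ‖w‖ * |tad Φ 1| ^ 2 ≤ 3 / 2 * r * |tad Φ 1| ^ 2 := by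
        gcongr
        exact hw.2
      have h8 : 0 ≤ 3 / 2 * r * |tad Φ 1| ^ 2 := by positivity
      calc _ ≤ 3 / 2 * r * |tad Φ 1| ^ 2 * Real.exp ‖X‖ +
            (F.projBound ^ 2 + 2 * F.projBound) * Real.exp ‖X‖ :=
            add_le_add (h7.trans (le_mul_of_one_le_right h8 e1)) (by gcongr)
        _ = _ := by rw [hC]; ring
    rw [norm_mul]
    calc _ ≤ (A * Real.exp (B * ‖X‖)) * (C * Real.exp ‖X‖) :=
          mul_le_mul h1 h3 (norm_nonneg _) (by positivity)
      _ = A * C * (Real.exp (B * ‖X‖) * Real.exp ‖X‖) := by ring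
      _ = _ := by rw [← Real.exp_add, add_mul B, one_mul]
  · exact (F.integrable_exp_norm_field hW _).const_mul _
  · exact Eventually.of_forall fun ω w hw => (F.hasDerivAt_pot_coupling one_half_pos
      (coercive_of_mem_closedCone (openCone_subset hw.1)) one_mem_unitCube _).cexp

/-- The intermediate field representation for couplings in the closed cone. -/
theorem integral_exp_wickFour {Ω' : Type*} [MeasurableSpace Ω'] {P' : Measure Ω'}
    {φ : Sq → Ω' → ℝ} (hφ : IsCentredGaussian P' φ fun x y => cov Φ 1 (x, y))
    (hm : Measurable fun q : Sq × Ω' => φ q.1 q.2) {z : ℂ} (hz : z ∈ closedCone) :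
    ∫ ω, Complex.exp (z ^ 2 / 8 * ((∫ x, wickFour (tad Φ 1) (φ x ω) : ℝ) : ℂ)) ∂P' =
      ∫ ω, Complex.exp (F.pot z 1 (F.field W ω)) ∂P := by
  have := hφ.gaussian.isProbabilityMeasure
  have hQ : AEMeasurable (fun ω => ∫ x, wickFour (tad Φ 1) (φ x ω)) P' :=
    (hφ.integrable_wickFour (cov_diag Φ 1) hm).integral_prod_right.aemeasurable
  have hb : ∀ ω, -(6 * tad Φ 1 ^ 2) ≤ ∫ x, wickFour (tad Φ 1) (φ x ω) := fun ω => by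
    by_cases hi : Integrable (fun x => wickFour (tad Φ 1) (φ x ω))
    · have h := integral_mono (integrable_const (-(6 * tad Φ 1 ^ 2))) hi fun x =>
        le_wickFour (tad Φ 1) (φ x ω)
      rwa [integral_const, probReal_univ, one_smul] at h
    -- A non-integrable path has integral 0 by convention, and 0 also satisfies the lower bound,
    -- which is therefore valid everywhere.
    · rw [integral_undef hi]
      nlinarith [sq_nonneg (tad Φ 1)]
  exact eqOn_closedCone (differentiableOn_integral_exp_sq hQ hb)
    (F.differentiableOn_integral_exp_pot hW) (continuousOn_integral_exp_sq hQ hb)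
    (F.continuousOn_integral_exp_pot hW)
    (fun w _ hw => F.integral_exp_wickFour_of_re_eq_zero hφ hm hw hW) hz

end Features

/-- The square of 2i√λ has real part -4 Re λ ≤ 0, and its imaginary part is nonnegative for the
principal root. -/
theorem zeta_mem_closedCone {lam : ℂ} (h : 0 ≤ lam.re) : zeta lam ∈ closedCone := by
  have h2 : 0 ≤ (zeta lam).im := by
    rcases eq_or_ne lam 0 with rfl | h0
    · simp [zeta]
    rw [zeta_im h0]
    have h2 := Complex.neg_pi_lt_arg lam
    have h3 := Complex.arg_le_pi lam
    have h4 : 0 ≤ Real.cos (lam.arg / 2) :=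
      Real.cos_nonneg_of_mem_Icc ⟨by linarith, by linarith⟩
    positivity
  have h3 : (zeta lam).re ^ 2 - (zeta lam).im ^ 2 = -4 * lam.re := by
    have := congrArg Complex.re (zeta_sq lam)
    rw [sq, Complex.mul_re] at this
    simp at this
    linarith
  refine abs_le_of_sq_le_sq ?_ h2
  linarith

/-- The functional integral over the field `φ` equals the one over the intermediate field. -/
theorem Zphi_eq {Φ : Model} {H : Type*} [NormedAddCommGroup H] [InnerProductSpace ℂ H]
    [CompleteSpace H] (F : Features Φ H) {lam : ℂ} (hre : 0 ≤ lam.re) {Ω Ω' : Type*}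
    [MeasurableSpace Ω] {P : Measure Ω} {W : L2 → Ω → ℝ} (hW : IsWhiteNoise P W)
    [MeasurableSpace Ω'] {P' : Measure Ω'} {φ : Sq → Ω' → ℝ}
    (hφ : IsCentredGaussian P' φ fun x y => cov Φ 1 (x, y))
    (hm : Measurable fun q : Sq × Ω' => φ q.1 q.2) :
    Zphi Φ lam P' φ = ∫ ω, Complex.exp (F.pot (zeta lam) 1 (F.field W ω)) ∂P := by
  rw [← F.integral_exp_wickFour hW hφ hm (zeta_mem_closedCone hre), zeta_sq,
    show (-4 * lam / 8 : ℂ) = -(lam / 2) by ring]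
  rfl

end

end Phi42

theorem lemma1 :
    ∃ c : (p : ℕ) → (Σ n : ℕ, Phi42.ResolventGraph p n) → ℕ,
      ∀ (Φ : Phi42.Model) (lam : ℂ), lam.arg ≠ Real.pi →
      ∀ (Ω : Type*) [MeasurableSpace Ω] (P : Measure Ω) [IsProbabilityMeasure P]
        (W : Phi42.L2 → Ω → ℝ), Phi42.IsWhiteNoise P W →
        -- the random variables and the integrals in the expansion are well defined
        Phi42.LimitsExist Φ lam W P ∧
        Integrable (fun ω => Complex.exp (Phi42.V Φ lam W 1 ω)) P ∧
        (∀ J ∈ (Finset.range (Φ.jmax + 1)).powerset, ∀ G ∈ Phi42.minimalGraphs J.card,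
          Integrable (fun q : Ω × (Fin J.card → ℝ) => Phi42.graphIntegrand Φ lam W J G q.1 q.2)
            (P.prod (volume.restrict (Phi42.cube J)))) ∧
        -- the general term of the expansion
        (∀ J ∈ (Finset.range (Φ.jmax + 1)).powerset,
          Phi42.testingTerm Φ lam W P J =
            ∑ G ∈ Phi42.minimalGraphs J.card, (c J.card G : ℂ) * Phi42.graphTerm Φ lam W P J G) ∧
        -- the partition function, in the intermediate field representation
        Phi42.Zsigma Φ lam W P =
          ∑ J ∈ (Finset.range (Φ.jmax + 1)).powerset, ∑ G ∈ Phi42.minimalGraphs J.card,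
            (c J.card G : ℂ) * Phi42.graphTerm Φ lam W P J G ∧
        -- the partition function, as a functional integral over the field `φ`
        (0 ≤ lam.re →
          ∀ (Ω' : Type*) [MeasurableSpace Ω'] (P' : Measure Ω') [IsProbabilityMeasure P']
            (φ : Phi42.Sq → Ω' → ℝ), Measurable (fun q : Phi42.Sq × Ω' => φ q.1 q.2) →
            Phi42.IsCentredGaussian P' φ (fun x y => Phi42.cov Φ 1 (x, y)) →
            Phi42.Zphi Φ lam P' φ =
              ∑ J ∈ (Finset.range (Φ.jmax + 1)).powerset, ∑ G ∈ Phi42.minimalGraphs J.card,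
                (c J.card G : ℂ) * Phi42.graphTerm Φ lam W P J G) := by
  -- The weights are multiplicities in a purely combinatorial recursion and are fixed before the
  -- model, the coupling and the noise.
  refine ⟨Phi42.ResolventGraph.weight, fun Φ lam harg Ω _ P _ W hW => ?_⟩
  obtain ⟨δ, hδ, hz⟩ := Phi42.exists_coercive harg
  -- Only the properties recorded in `Features` are used from here on; which Hilbert space realises
  -- them is irrelevant.
  have F := Phi42.features Φ
  refine ⟨F.limitsExist hδ hz hW, F.integrable_exp_V hδ hz hW Phi42.Features.one_mem_unitCube,
    fun J hJ G _ => F.integrable_graphIntegrand hδ hz hW (Finset.mem_powerset.1 hJ) G.2,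
    fun J hJ => F.testingTerm_eq_sum hδ hz hW (Finset.mem_powerset.1 hJ),
    F.Zsigma_eq_sum hδ hz hW, fun hre Ω' _ P' _ φ hφm hφ => ?_⟩
  rw [← F.Zsigma_eq_sum hδ hz hW, F.Zsigma_eq hδ hz hW, Phi42.Zphi_eq F hre hW hφ hφm]
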